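/- Let $SU(2,1)=\{g\in SL(3,\mathbb C): g^*Jg=J\}$ with $J=\begin{pmatrix}0&0&-1\\0&1&0\\-1&0&0\end{pmatrix}$, acting by fractional linear maps $$g(Z)=\Big(\tfrac{a_1z_1+a_2z_2+a_3}{j(g,Z)},\tfrac{b_1z_1+b_2z_2+b_3}{j(g,Z)}\Big),\qquad j(g,Z)=c_1z_1+c_2z_2+c_3$$ ($a,b,c$ being the rows of $g$) on $\mathfrak S_2=\{Z=(z_1,z_2)\in\mathbb C^2:\rho(Z)>0\}$, where $\rho(Z,W)=\overline{z_1}+w_1-\overline{z_2}w_2$ and $\rho(Z)=\rho(Z,Z)$. Put $J(g,Z)=j(g,Z)/|j(g,Z)|$ and let $dm(Z)=4\rho(Z)^{-3}\,dx_1dy_1dx_2dy_2$ $(z_j=x_j+iy_j)$ be the invariant measure. Let $2k\in\mathbb Z$ and $$\Delta_k=\rho(Z)\Big[(z_1+\overline{z_1})\tfrac{\partial^2}{\partial z_1\partial\overline{z_1}}+\tfrac{\partial^2}{\partial z_2\partial\overline{z_2}}+z_2\tfrac{\partial^2}{\partial\overline{z_1}\partial z_2}+\overline{z_2}\tfrac{\partial^2}{\partial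 z_1\partial\overline{z_2}}-k\Big(\tfrac{\partial}{\partial z_1}-\tfrac{\partial}{\partial\overline{z_1}}\Big)\Big].$$ Let $\Gamma\subset SU(2,1)$ be a discrete subgroup acting properly discontinuously and freely (only the identity has fixed points) on $\mathfrak S_2$ with compact quotient, and let $\mathcal F$ be a fundamental domain of $\Gamma$. Let $L^2(\Gamma\backslash\mathfrak S_2,k)$ be the space of functions $f$ on $\mathfrak S_2$ (modulo equality almost everywhere) with $f(\gamma Z)=J(\gamma,Z)^{2k}f(Z)$ for all $\gamma\in\Gamma$ and $f\in L^2(\mathcal F,dm)$, with inner product $(f,g)=\int_{\mathcal F}f\overline g\,dm$. Let $s\in\mathbb C$ with $\operatorname{Re}s>2$ and $s\notin\{|k|,|k|-1,|k|-2,\dots\}$. For $\sigma>1$ put $$\phi_{s,k}(\sigma)=\frac{\Gamma(s-|k|)\Gamma(s+|k|)}{\Gamma(2s-1)}\,\sigma^{-|k|}(\sigma-1)^{|k|-s}F\Big(s-|k|,s-1-|k|;2s-1;-\frac1{\sigma-1}\Big),$$ $F$ being Gauss's hypergeometric function (continued analytically to $\mathbb C\setminus[1,\infty)$), so that $(\sigma-1)\phi_{s,k}(\sigma)\to1$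 as $\sigma\to1^+$. For $Z\ne W$ put $$\varphi_{s,k}(Z,W)=\frac{\rho(Z,W)^{2k}}{|\rho(Z,W)|^{2k}}\,\phi_{s,k}\Big(\frac{|\rho(Z,W)|^2}{\rho(Z)\rho(W)}\Big),\qquad G_{s,k}(Z,W)=\sum_{\gamma\in\Gamma}\varphi_{s,k}(Z,\gamma(W))\,J(\gamma,W)^{2k}\quad(Z\notin\Gamma W).$$ Theorem. The series defining $G_{s,k}(Z,W)$ converges absolutely for $Z\notin\Gamma W$. For every $\mu\in\mathbb C$, the equations $$\Delta_kf=\mu f\qquad\text{and}\qquad f(Z)=\frac1{4\pi^2}\,[s(s-2)-\mu]\int_{\mathcal F}G_{s,k}(Z,\xi)f(\xi)\,dm(\xi)\ \text{ for almost every } Z$$ have the same eigenfunctions in $L^2(\Gamma\backslash\mathfrak S_2,k)$: a nonzero $f\in L^2(\Gamma\backslash\mathfrak S_2,k)$ has a representative in $C^2(\mathfrak S_2)$ that transforms by $f(\gamma Z)=J(\gamma,Z)^{2k}f(Z)$ everywhere and satisfies the first equation if and only if, for almost every $Z$, the integrand on the right is integrable over $\mathcal F$ and the second equation holds. These eigenfunctions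 are complete in $L^2(\Gamma\backslash\mathfrak S_2,k)$: there is an orthonormal sequence $(\phi_i)_{i\ge0}$ of such eigenfunctions, with eigenvalues $\mu_i\in\mathbb C$, such that $f=\sum_i(f,\phi_i)\phi_i$, with convergence in $L^2(\mathcal F,dm)$, for every $f\in L^2(\Gamma\backslash\mathfrak S_2,k)$. -/

import Mathlib

open MeasureTheory Matrix Filter Topology

noncomputable section

namespace PicardSU21

/-- The function `ρ(Z, W) = conj z₁ + w₁ - conj z₂ * w₂` on `ℂ²`. -/
def rho (Z W : ℂ × ℂ) : ℂ :=
  (starRingEnd ℂ) Z.1 + W.1 - (starRingEnd ℂ) Z.2 * W.2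

/-- The real number `ρ(Z) = z₁ + conj z₁ - z₂ * conj z₂`. -/
def rhoDiag (Z : ℂ × ℂ) : ℝ := 2 * Z.1.re - Complex.normSq Z.2

theorem rho_self (Z : ℂ × ℂ) : rho Z Z = (rhoDiag Z : ℂ) := by
  apply Complex.ext <;>
    simp [rho, rhoDiag, Complex.normSq_apply] <;> ring

/-- The Siegel domain `{(z₁, z₂) ∈ ℂ² : z₁ + conj z₁ - z₂ * conj z₂ > 0}`. -/
def siegelSet : Set (ℂ × ℂ) := {Z | 0 < rhoDiag Z}

/-- The Siegel domain as a type, with the topology and measurable structure of a subset of `ℂ²`. -/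
abbrev Siegel : Type := siegelSet

/-- The matrix `J` of the Hermitian form of signature `(2, 1)`. -/
def formJ : Matrix (Fin 3) (Fin 3) ℂ := !![0, 0, -1; 0, 1, 0; -1, 0, 0]

/-- The matrix of an element of `SL(3, ℂ)`. -/
def slMat (a : Matrix.SpecialLinearGroup (Fin 3) ℂ) : Matrix (Fin 3) (Fin 3) ℂ := a

theorem slMat_mul (a b : Matrix.SpecialLinearGroup (Fin 3) ℂ) :
    slMat (a * b) = slMat a * slMat b := rfl

theorem slMat_one : slMat 1 = 1 := rfl

/-- `SU(2, 1) = {g ∈ SL(3, ℂ) : g* J g = J}`. -/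
def SU21 : Subgroup (Matrix.SpecialLinearGroup (Fin 3) ℂ) where
  carrier := {g | (slMat g)ᴴ * formJ * slMat g = formJ}
  one_mem' := by simp [slMat_one]
  mul_mem' := by
    intro a b ha hb
    rw [Set.mem_ofPred_eq] at *
    rw [slMat_mul, conjTranspose_mul]
    calc (slMat b)ᴴ * (slMat a)ᴴ * formJ * (slMat a * slMat b)
        = (slMat b)ᴴ * ((slMat a)ᴴ * formJ * slMat a) * slMat b := by
          simp only [Matrix.mul_assoc]
      _ = formJ := by rw [ha, hb]
  inv_mem' := by
    intro a ha
    rw [Set.mem_ofPred_eq] at *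
    have h1 : slMat a * slMat a⁻¹ = 1 := by
      rw [← slMat_mul, mul_inv_cancel, slMat_one]
    have h2 : (slMat a⁻¹)ᴴ * (slMat a)ᴴ = 1 := by
      rw [← conjTranspose_mul, h1, conjTranspose_one]
    calc (slMat a⁻¹)ᴴ * formJ * slMat a⁻¹
        = (slMat a⁻¹)ᴴ * ((slMat a)ᴴ * formJ * slMat a) * slMat a⁻¹ := by rw [ha]
      _ = ((slMat a⁻¹)ᴴ * (slMat a)ᴴ) * formJ * (slMat a * slMat a⁻¹) := by
          simp only [Matrix.mul_assoc]
      _ = formJ := by rw [h1, h2]; simp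

/-- The matrix of an element of `SU(2, 1)`. -/
def mat (g : SU21) : Matrix (Fin 3) (Fin 3) ℂ := slMat g.1

theorem mat_mul (g h : SU21) : mat (g * h) = mat g * mat h := rfl

theorem mat_one : mat 1 = 1 := rfl

/-- The homogeneous coordinates `(z₁, z₂, 1)` of a point of `ℂ²`. -/
def homog (Z : ℂ × ℂ) : Fin 3 → ℂ := ![Z.1, Z.2, 1]

/-- The factor `j(g, Z) = c₁ z₁ + c₂ z₂ + c₃`, where `(c₁, c₂, c₃)` is the last row of `g`. -/
def jFactor (g : SU21) (Z : ℂ × ℂ) : ℂ :=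
  mat g 2 0 * Z.1 + mat g 2 1 * Z.2 + mat g 2 2

/-- The fractional linear map of `ℂ²` given by `g`. -/
def fracLin (g : SU21) (Z : ℂ × ℂ) : ℂ × ℂ :=
  ((mat g 0 0 * Z.1 + mat g 0 1 * Z.2 + mat g 0 2) / jFactor g Z,
   (mat g 1 0 * Z.1 + mat g 1 1 * Z.2 + mat g 1 2) / jFactor g Z)

theorem rho_eq_form (Z W : ℂ × ℂ) :
    rho Z W = -(star (homog Z) ⬝ᵥ (formJ *ᵥ homog W)) := by
  simp [rho, homog, formJ, dotProduct, mulVec, Fin.sum_univ_three]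
  ring

theorem form_invariant (g : SU21) (v w : Fin 3 → ℂ) :
    star (mat g *ᵥ v) ⬝ᵥ (formJ *ᵥ (mat g *ᵥ w)) = star v ⬝ᵥ (formJ *ᵥ w) := by
  have hg : (mat g)ᴴ * formJ * mat g = formJ := g.2
  rw [star_mulVec, ← dotProduct_mulVec, mulVec_mulVec, mulVec_mulVec, hg]

theorem mulVec_homog (g : SU21) (Z : ℂ × ℂ) : mat g *ᵥ homog Z =
    ![mat g 0 0 * Z.1 + mat g 0 1 * Z.2 + mat g 0 2,
      mat g 1 0 * Z.1 + mat g 1 1 * Z.2 + mat g 1 2, jFactor g Z] := by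
  ext i
  fin_cases i <;> simp [homog, jFactor, mulVec, dotProduct, Fin.sum_univ_three]

theorem mulVec_homog_eq_smul (g : SU21) (Z : ℂ × ℂ) (h : jFactor g Z ≠ 0) :
    mat g *ᵥ homog Z = jFactor g Z • homog (fracLin g Z) := by
  rw [mulVec_homog]
  ext i
  fin_cases i <;> simp [homog, fracLin] <;> field_simp

theorem jFactor_ne_zero (g : SU21) {Z : ℂ × ℂ} (hZ : Z ∈ siegelSet) : jFactor g Z ≠ 0 := by
  intro h0
  have h1 := form_invariant g (homog Z) (homog Z)
  have h2 : (rhoDiag Z : ℂ) = -(star (homog Z) ⬝ᵥ (formJ *ᵥ homog Z)) := by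
    rw [← rho_eq_form, rho_self]
  rw [← h1, mulVec_homog, h0] at h2
  set b := mat g 1 0 * Z.1 + mat g 1 1 * Z.2 + mat g 1 2
  have h3 : (rhoDiag Z : ℂ) = -((starRingEnd ℂ) b * b) := by
    rw [h2]
    simp [formJ, dotProduct, mulVec, Fin.sum_univ_three]
  rw [← Complex.normSq_eq_conj_mul_self] at h3
  have h4 : rhoDiag Z = -Complex.normSq b := by exact_mod_cast h3
  have h5 : 0 < rhoDiag Z := hZ
  have h6 := Complex.normSq_nonneg b
  linarith

theorem rhoDiag_fracLin (g : SU21) {Z : ℂ × ℂ} (hZ : Z ∈ siegelSet) :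
    rhoDiag Z = Complex.normSq (jFactor g Z) * rhoDiag (fracLin g Z) := by
  have hj := jFactor_ne_zero g hZ
  have h1 := form_invariant g (homog Z) (homog Z)
  rw [mulVec_homog_eq_smul g Z hj, star_smul, mulVec_smul, smul_dotProduct, dotProduct_smul] at h1
  have h2 : rho Z Z = (star (jFactor g Z) * jFactor g Z) * rho (fracLin g Z) (fracLin g Z) := by
    rw [rho_eq_form, rho_eq_form, ← h1]
    simp only [smul_eq_mul]
    ring
  rw [rho_self, rho_self, ← starRingEnd_apply, ← Complex.normSq_eq_conj_mul_self] at h2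
  exact_mod_cast h2

theorem fracLin_mem (g : SU21) {Z : ℂ × ℂ} (hZ : Z ∈ siegelSet) : fracLin g Z ∈ siegelSet := by
  have h := rhoDiag_fracLin g hZ
  have h1 : 0 < rhoDiag Z := hZ
  rw [h] at h1
  exact pos_of_mul_pos_right h1 (Complex.normSq_nonneg _)

theorem jFactor_mul (g h : SU21) {Z : ℂ × ℂ} (hZ : Z ∈ siegelSet) :
    jFactor (g * h) Z = jFactor g (fracLin h Z) * jFactor h Z := by
  have hj := jFactor_ne_zero h hZ
  have e : ∀ (a : SU21) (W : ℂ × ℂ), (mat a *ᵥ homog W) 2 = jFactor a W := by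
    intro a W; rw [mulVec_homog]; simp
  have e1 : mat (g * h) *ᵥ homog Z = jFactor h Z • (mat g *ᵥ homog (fracLin h Z)) := by
    rw [← mulVec_smul, ← mulVec_homog_eq_smul h Z hj, mulVec_mulVec, mat_mul]
  rw [← e, e1, Pi.smul_apply, e, smul_eq_mul, mul_comm]

theorem fracLin_mul (g h : SU21) {Z : ℂ × ℂ} (hZ : Z ∈ siegelSet) :
    fracLin (g * h) Z = fracLin g (fracLin h Z) := by
  have hj := jFactor_ne_zero h hZ
  have hj2 := jFactor_ne_zero g (fracLin_mem h hZ)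
  have hj3 := jFactor_ne_zero (g * h) hZ
  have e1 : mat (g * h) *ᵥ homog Z = jFactor h Z • (mat g *ᵥ homog (fracLin h Z)) := by
    rw [← mulVec_smul, ← mulVec_homog_eq_smul h Z hj, mulVec_mulVec, mat_mul]
  rw [mulVec_homog_eq_smul _ _ hj3, mulVec_homog_eq_smul _ _ hj2, smul_smul, jFactor_mul g h hZ,
    mul_comm] at e1
  have e2 := smul_right_injective (Fin 3 → ℂ) (mul_ne_zero hj hj2) e1
  have a0 := congrFun e2 0
  have a1 := congrFun e2 1
  simp only [homog, Matrix.cons_val_zero, Matrix.cons_val_one] at a0 a1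
  exact Prod.ext a0 a1

/-- The action of `SU(2, 1)` on the Siegel domain by fractional linear maps. -/
instance instMulActionSiegel : MulAction SU21 Siegel where
  smul g Z := ⟨fracLin g Z.1, fracLin_mem g Z.2⟩
  one_smul Z := by
    apply Subtype.ext
    change fracLin 1 Z.1 = Z.1
    simp [fracLin, jFactor, mat_one]
  mul_smul g h Z := by
    apply Subtype.ext
    exact fracLin_mul g h Z.2

/-- `J(g, Z) = j(g, Z) / |j(g, Z)|`. -/
def unitFactor (g : SU21) (Z : Siegel) : ℂ := jFactor g Z.1 / (‖jFactor g Z.1‖ : ℂ)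

/-- The invariant measure `dm(Z) = ρ(Z)⁻³ |dz₁ ∧ d conj z₁ ∧ dz₂ ∧ d conj z₂|`; in terms of Lebesgue
measure `dx₁ dy₁ dx₂ dy₂` this is `4 ρ(Z)⁻³ dx₁ dy₁ dx₂ dy₂`, because
`|dz ∧ d conj z| = 2 dx dy`. -/
def dm : Measure Siegel :=
  (Measure.comap (Subtype.val : Siegel → ℂ × ℂ) volume).withDensity
    (fun Z => ENNReal.ofReal (4 / rhoDiag Z.1 ^ 3))

/-- Extension by zero of a function on the Siegel domain; only its germs at points of the (open)
Siegel domain are used. -/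
def extendZero (f : Siegel → ℂ) : ℂ × ℂ → ℂ := Function.extend Subtype.val f 0

/-- The Wirtinger derivative `(∂_x - i ∂_y)/2` in the complex direction `e`. -/
def dWirt (e : ℂ × ℂ) (f : ℂ × ℂ → ℂ) (p : ℂ × ℂ) : ℂ :=
  (fderiv ℝ f p e - Complex.I * fderiv ℝ f p (Complex.I • e)) / 2

/-- The conjugate Wirtinger derivative `(∂_x + i ∂_y)/2` in the complex direction `e`. -/
def dWirtBar (e : ℂ × ℂ) (f : ℂ × ℂ → ℂ) (p : ℂ × ℂ) : ℂ :=
  (fderiv ℝ f p e + Complex.I * fderiv ℝ f p (Complex.I • e)) / 2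

/-- The first coordinate direction of `ℂ²`. -/
def e1 : ℂ × ℂ := (1, 0)

/-- The second coordinate direction of `ℂ²`. -/
def e2 : ℂ × ℂ := (0, 1)

/-- The operator `Δ_k`, `k = n / 2`:
`ρ [(z₁ + conj z₁) ∂₁∂̄₁ + ∂₂∂̄₂ + z₂ ∂̄₁∂₂ + conj z₂ ∂₁∂̄₂ - k (∂₁ - ∂̄₁)]`. -/
def lapl (n : ℤ) (f : Siegel → ℂ) (Z : Siegel) : ℂ :=
  let F := extendZero f
  let p : ℂ × ℂ := Z.1
  (rhoDiag p : ℂ) *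
    ((p.1 + (starRingEnd ℂ) p.1) * dWirt e1 (dWirtBar e1 F) p
      + dWirt e2 (dWirtBar e2 F) p
      + p.2 * dWirtBar e1 (dWirt e2 F) p
      + (starRingEnd ℂ) p.2 * dWirt e1 (dWirtBar e2 F) p
      - ((n : ℂ) / 2) * (dWirt e1 F p - dWirtBar e1 F p))

/-- Gauss's hypergeometric function `F(a, b; c; z)` on the half plane `Re z < 1/2`: there the analytic
continuation of Gauss's series is given by Pfaff's transformation
`F(a, b; c; z) = (1 - z)⁻ᵃ F(a, c - b; c; z / (z - 1))`, whose right-hand side is a convergent series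
because `|z / (z - 1)| < 1`. It is used below only for negative real `z`. -/
def gaussF (a b c z : ℂ) : ℂ :=
  (1 - z) ^ (-a) * ₂F₁ a (c - b) c (z / (z - 1))

/-- `σ(Z, W) = |ρ(Z, W)|² / (ρ(Z) ρ(W))`. -/
def sigma (Z W : Siegel) : ℝ := ‖rho Z.1 W.1‖ ^ 2 / (rhoDiag Z.1 * rhoDiag W.1)

/-- `H_k(Z, W) = ρ(Z, W)^{2k} / |ρ(Z, W)|^{2k}`, with `2k = n`. -/
def Hfactor (n : ℤ) (Z W : Siegel) : ℂ := rho Z.1 W.1 ^ n / (‖rho Z.1 W.1‖ : ℂ) ^ n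

/-- `|k| = |n| / 2`, as a complex number. -/
def absWeight (n : ℤ) : ℂ := ((|(n : ℝ)| / 2 : ℝ) : ℂ)

/-- The normalizing constant `Γ(s - |k|) Γ(s + |k|) / Γ(2s - 1)`. With it the radial function `phi`
below satisfies `(σ - 1) * phi s n σ → 1` as `σ → 1⁺`. -/
def normConst (s : ℂ) (n : ℤ) : ℂ :=
  Complex.Gamma (s - absWeight n) * Complex.Gamma (s + absWeight n) / Complex.Gamma (2 * s - 1)

/-- The normalized radial function
`σ^{-|k|} (σ - 1)^{|k| - s} F(s - |k|, s - 1 - |k|; 2s - 1; -1/(σ - 1))`, for `σ > 1`. -/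
def phi (s : ℂ) (n : ℤ) (σ : ℝ) : ℂ :=
  normConst s n * (σ : ℂ) ^ (-absWeight n) * ((σ - 1 : ℝ) : ℂ) ^ (absWeight n - s) *
    gaussF (s - absWeight n) (s - 1 - absWeight n) (2 * s - 1) ((-1 / (σ - 1) : ℝ) : ℂ)

/-- The point-pair function `φ_{s,k}(Z, W) = H_k(Z, W) φ_{s,k}(σ(Z, W))` (for `Z ≠ W`). -/
def freeGreen (s : ℂ) (n : ℤ) (Z W : Siegel) : ℂ := Hfactor n Z W * phi s n (sigma Z W)

/-- The term of index `γ` of the automorphic Green function. -/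
def greenTerm (s : ℂ) (n : ℤ) (Γ : Subgroup SU21) (Z W : Siegel) (γ : Γ) : ℂ :=
  freeGreen s n Z (γ • W) * unitFactor γ.1 W ^ n

/-- `G_{s,k}(Z, W) = ∑_{γ ∈ Γ} φ_{s,k}(Z, γ W) J(γ, W)^{2k}` (for `Z ∉ Γ W`). -/
def green (s : ℂ) (n : ℤ) (Γ : Subgroup SU21) (Z W : Siegel) : ℂ :=
  ∑' γ : Γ, greenTerm s n Γ Z W γ

/-- `f` represents an element of `L²(Γ \ 𝔖₂, k)`, `2k = n`: it is square-integrable on the fundamental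
domain `D` and transforms by `f(γ Z) = J(γ, Z)^{2k} f(Z)`. As usual elements of `L²` are functions up
to equality almost everywhere. -/
structure IsL2Form (n : ℤ) (Γ : Subgroup SU21) (D : Set Siegel) (f : Siegel → ℂ) : Prop where
  memLp : MemLp f 2 (dm.restrict D)
  automorphic : ∀ γ : Γ, ∀ᵐ Z ∂dm, f (γ • Z) = unitFactor γ.1 Z ^ n * f Z

/-- `f ∈ C²(Γ \ 𝔖₂, k)`, `2k = n`. -/
structure IsC2Form (n : ℤ) (Γ : Subgroup SU21) (f : Siegel → ℂ) : Prop where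
  contDiffOn : ContDiffOn ℝ 2 (extendZero f) siegelSet
  automorphic : ∀ (γ : Γ) (Z : Siegel), f (γ • Z) = unitFactor γ.1 Z ^ n * f Z

/-- `f` represents an eigenfunction of `Δ_k` in `L²(Γ \ 𝔖₂, k)` with eigenvalue `μ`: a nonzero element
of this space that has a `C²` representative `u` with `Δ_k u = μ u`. -/
structure IsDeltaEigen (n : ℤ) (Γ : Subgroup SU21) (D : Set Siegel) (μ : ℂ) (f : Siegel → ℂ) :
    Prop where
  isL2Form : IsL2Form n Γ D f
  ne_zero : ¬ f =ᵐ[dm] 0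
  eigen : ∃ u : Siegel → ℂ, u =ᵐ[dm] f ∧ IsC2Form n Γ u ∧ ∀ Z, lapl n u Z = μ * u Z

/-- `f` represents an eigenfunction in `L²(Γ \ 𝔖₂, k)` of the integral equation
`f(Z) = (1/4π²) [s(s-2) - μ] ∫_D G_{s,k}(Z, ξ) f(ξ) dm(ξ)`. -/
structure IsGreenEigen (s : ℂ) (n : ℤ) (Γ : Subgroup SU21) (D : Set Siegel) (μ : ℂ)
    (f : Siegel → ℂ) : Prop where
  isL2Form : IsL2Form n Γ D f
  ne_zero : ¬ f =ᵐ[dm] 0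
  integrable : ∀ᵐ Z ∂dm, Integrable (fun ξ => green s n Γ Z ξ * f ξ) (dm.restrict D)
  eigen : ∀ᵐ Z ∂dm, f Z = 1 / (4 * (Real.pi : ℂ) ^ 2) * (s * (s - 2) - μ) *
    ∫ ξ in D, green s n Γ Z ξ * f ξ ∂dm

/-- The inner product of `L²(Γ \ 𝔖₂, k)`. -/
def l2Inner (D : Set Siegel) (f g : Siegel → ℂ) : ℂ :=
  ∫ Z in D, f Z * (starRingEnd ℂ) (g Z) ∂dm

/-- `(φ_j)` is a complete orthonormal family in `L²(Γ \ 𝔖₂, k)`: it is orthonormal, and every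
element is the limit in `L²` of its Fourier expansion. -/
structure IsCompleteOrthonormal (n : ℤ) (Γ : Subgroup SU21) (D : Set Siegel)
    (φ : ℕ → Siegel → ℂ) : Prop where
  mem : ∀ i, IsL2Form n Γ D (φ i)
  orthonormal : ∀ i j, l2Inner D (φ i) (φ j) = if i = j then 1 else 0
  complete : ∀ f, IsL2Form n Γ D f →
    Tendsto (fun N => eLpNorm
      (fun Z => f Z - ∑ i ∈ Finset.range N, l2Inner D f (φ i) * φ i Z) 2 (dm.restrict D))
      atTop (𝓝 0)

end PicardSU21

end

open PicardSU21 MeasureTheory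

/-!
# Eigenfunctions of `Δ_k` and of the automorphic Green function

*Point-pair kernels.* For a radial profile `h` put `ker n h Z W = H_k(Z, W) h(σ(Z, W))`, where
`σ(Z, W) = |ρ(Z, W)|² / (ρ(Z) ρ(W))` and `H_k` is the unitary factor `(ρ / |ρ|)^{2k}`, `2k = n`. These
kernels are automorphic in both variables (`ker_smul`). For fixed `Z` the function `σ(Z, ·)` pushes
the invariant measure forward to `4π² (σ - 1) dσ` on `(1, ∞)` (`map_sigma`), so norms of kernels are
one-dimensional integrals. In each variable `Δ_k` acts on a point-pair kernel through an ordinary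
differential operator on the profile (`lapC_kerC`). The function `φ_{s,k}` is an eigenfunction of
that operator with eigenvalue `s (s - 2)` (`phi_ode`), has the singularity `1 / (σ - 1)` at `σ = 1`,
and decays like `σ^{-Re s}`. It is thus a fundamental solution: by Green's identity
(`setIntegral_green`), after capping the singularity,
`∫ φ_{s,k}(Z, ξ) (s (s - 2) u - Δ_k u)(ξ) dm(ξ) = 4π² u(Z)` for bounded `u` of class `C²` with
`Δ_k u` bounded (`kint_phi0_sub_lapl`).

*From `Δ_k` to the Green function.* As `Re s > 2`, the sum over `Γ` converges absolutely, by
comparison with the integral of `σ^{-Re s}`. Unfolding (`integral_eq_integral_tsum`) identifies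
integration against `φ_{s,k}` over the Siegel domain with integration against `G_{s,k}` over `D`. A
`C²` automorphic form is bounded, since the quotient is compact, so the previous formula gives one
half of the equivalence.

*From the Green function to `Δ_k`.* Averages over `Γ` of integrable kernels define bounded operators
on `L²(D)`, with norm at most the `L¹`-norm of the profile, by Schur's test (`norm_autoOp_le`). The
Green operator is compact, being a limit in norm of operators with bounded kernels, which are
Hilbert–Schmidt because `D` has finite measure. A solution `f` of the integral equation satisfies
`Δ_k f = μ f` weakly (`integral_kint_phi0_mul`). Hence the convolution of `f` with a smooth profile
of bounded support is a smooth eigenfunction of `Δ_k` with eigenvalue `μ`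
(`lapl_kint_of_kint_phi0_eq`). By the first half these convolutions lie in an eigenspace of the
compact Green operator for a nonzero eigenvalue; it is finite-dimensional, hence closed
(`smoothEigenspace_le`). When the profiles tend to `φ_{s,k}` in `L¹`, the convolutions tend to a
nonzero multiple of `f` by the integral equation, so `f` itself is a smooth eigenfunction.

*Completeness.* The operator `Δ_k` does not depend on `s`, so a real parameter `s₀ = |k| + 3` may be
used. Then the Green operator is compact, symmetric and, by the weak equation, injective, and
`L²(D)` is separable and infinite-dimensional. The spectral theorem gives a Hilbert basis of
eigenfunctions with nonzero eigenvalues, which the equivalence for `s₀` turns into eigenfunctions of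
`Δ_k`, and the equivalence for `s` into eigenfunctions of the integral equation. -/

noncomputable section

namespace PicardSU21

section

/-! ### Power series at the radius of convergence and hypergeometric coefficients -/

/-- The power series `∑ cₘ xᵐ` with complex coefficients, as a function of a real variable. -/
def powSum (c : ℕ → ℂ) (x : ℝ) : ℂ := ∑' m, c m * (x : ℂ) ^ m

/-- The coefficients of the derivative of a power series. -/
def derivCoeff (c : ℕ → ℂ) (m : ℕ) : ℂ := (m + 1) * c (m + 1)

/-- Polynomially bounded coefficient sequences; the power series then converges for `|x| < 1`. -/
def PolyBdd (c : ℕ → ℂ) : Prop := ∃ (K : ℝ) (r : ℕ), ∀ m, ‖c m‖ ≤ K * ((m : ℝ) + 1) ^ r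

theorem PolyBdd.derivCoeff {c : ℕ → ℂ} (h : PolyBdd c) : PolyBdd (derivCoeff c) := by
  obtain ⟨K, r, h⟩ := h
  have hK : 0 ≤ K := by
    have := (norm_nonneg _).trans (h 0)
    simpa using this
  refine ⟨K * 2 ^ r, r + 1, fun m => ?_⟩
  have e : ‖((m : ℂ) + 1)‖ = (m : ℝ) + 1 := by
    rw [← Nat.cast_succ, Complex.norm_natCast]; push_cast; ring
  rw [PicardSU21.derivCoeff, norm_mul, e]
  have h2 : ((m + 1 : ℕ) : ℝ) + 1 ≤ 2 * ((m : ℝ) + 1) := by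
    push_cast
    have : (0 : ℝ) ≤ m := m.cast_nonneg
    linarith
  calc ((m : ℝ) + 1) * ‖c (m + 1)‖ ≤ ((m : ℝ) + 1) * (K * (2 * ((m : ℝ) + 1)) ^ r) := by
        gcongr
        exact (h _).trans (by gcongr)
    _ = K * 2 ^ r * ((m : ℝ) + 1) ^ (r + 1) := by rw [mul_pow]; ring

theorem summable_add_one_pow_mul_geometric (r : ℕ) {x : ℝ} (hx0 : 0 ≤ x) (hx : x < 1) :
    Summable fun m : ℕ => ((m : ℝ) + 1) ^ r * x ^ m := by
  rcases hx0.eq_or_lt with rfl | hx0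
  · refine summable_of_ne_finset_zero (s := {0}) fun m hm => ?_
    rw [zero_pow (by simpa using hm), mul_zero]
  have h := (summable_nat_add_iff 1).2
    (summable_pow_mul_geometric_of_norm_lt_one (R := ℝ) r (r := x)
      (by rwa [Real.norm_of_nonneg hx0.le]))
  refine (h.mul_right x⁻¹).congr fun m => ?_
  push_cast
  field_simp
  ring

theorem PolyBdd.summable_norm {c : ℕ → ℂ} (h : PolyBdd c) {x : ℝ} (hx : |x| < 1) :
    Summable fun m => ‖c m * (x : ℂ) ^ m‖ := by
  obtain ⟨K, r, h⟩ := h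
  refine Summable.of_nonneg_of_le (fun _ => norm_nonneg _) (fun m => ?_)
    ((summable_add_one_pow_mul_geometric r (abs_nonneg x) hx).mul_left K)
  rw [norm_mul, norm_pow, Complex.norm_real, Real.norm_eq_abs, ← mul_assoc]
  exact mul_le_mul_of_nonneg_right (h m) (by positivity)

theorem PolyBdd.summable {c : ℕ → ℂ} (h : PolyBdd c) {x : ℝ} (hx : |x| < 1) :
    Summable fun m => c m * (x : ℂ) ^ m := (h.summable_norm hx).of_norm

/-- Termwise differentiation inside the unit disc. -/
theorem PolyBdd.hasDerivAt_powSum {c : ℕ → ℂ} (h : PolyBdd c) {x : ℝ} (hx : |x| < 1) :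
    HasDerivAt (powSum c) (powSum (PicardSU21.derivCoeff c) x) x := by
  obtain ⟨r, hxr, hr⟩ := exists_between hx
  have hr0 : 0 ≤ r := (abs_nonneg x).trans hxr.le
  have hs := (h.derivCoeff.summable_norm (x := r) (by rwa [abs_of_nonneg hr0]))
  have hd : ∀ (m : ℕ) (y : ℝ), HasDerivAt (fun y : ℝ => c m * (y : ℂ) ^ m)
      (c m * (m * (y : ℂ) ^ (m - 1))) y := fun m y => by
    have := ((hasDerivAt_id (y : ℂ)).comp_ofReal.pow m).const_mul (c m)
    simpa using this
  have hu : Summable fun m : ℕ => ‖c m * (m * (r : ℂ) ^ (m - 1))‖ := by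
    rw [← summable_nat_add_iff 1]
    refine hs.congr fun m => ?_
    congr 1
    rw [PicardSU21.derivCoeff]
    push_cast
    ring_nf
  have key := hasDerivAt_tsum_of_isPreconnected (t := Metric.ball (0 : ℝ) r) hu Metric.isOpen_ball
    (convex_ball (0 : ℝ) r).isPreconnected (fun m y _ => hd m y) (y₀ := x) (y := x) ?_
    (by simpa using hxr) (h.summable hx) (by simpa using hxr)
  · have e : (∑' m : ℕ, c m * (m * (x : ℂ) ^ (m - 1))) = powSum (PicardSU21.derivCoeff c) x := by
      rw [Summable.tsum_eq_zero_add]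
      · simp only [powSum, PicardSU21.derivCoeff, Nat.cast_zero, zero_mul, mul_zero, zero_add]
        refine tsum_congr fun m => ?_
        push_cast
        ring
      · refine Summable.of_norm_bounded hu fun m => ?_
        simp only [norm_mul, norm_pow, Complex.norm_real, Real.norm_eq_abs]
        rw [abs_of_nonneg hr0]
        gcongr
    rw [e] at key
    exact key
  · intro m y hy
    simp only [norm_mul, norm_pow, Complex.norm_real, Real.norm_eq_abs]
    rw [abs_of_nonneg hr0]
    have : |y| ≤ r := by simpa using (Metric.mem_ball.1 hy).le
    gcongr

/-- An Abelian comparison: weighting a null sequence gives `o` of the sum of the weights. -/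
theorem tendsto_abel_zero {w : ℕ → ℝ} (hw : ∀ m, 0 ≤ w m) {W : ℝ → ℝ}
    (hW : ∀ x : ℝ, 0 < x → x < 1 → HasSum (fun m => w m * x ^ m) (W x))
    (hWtop : Tendsto W (𝓝[<] 1) atTop) {b : ℕ → ℂ} (hb : Tendsto b atTop (𝓝 0)) :
    Tendsto (fun x : ℝ => (∑' m, (w m * b m : ℂ) * (x : ℂ) ^ m) / W x) (𝓝[<] 1) (𝓝 0) := by
  rw [Metric.tendsto_nhds]
  intro ε hε
  obtain ⟨N, hN⟩ := Metric.tendsto_atTop.1 hb (ε / 2) (by positivity)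
  set C : ℝ := ∑ m ∈ Finset.range N, w m * ‖b m‖
  -- the tail is at most `ε / 2 * W x`; the finite head, at most `C`, is swamped by `W x → ∞`
  have h1 : ∀ᶠ x in 𝓝[<] (1 : ℝ), max 1 (4 * C / ε) < W x := hWtop.eventually_gt_atTop _
  have h2 : ∀ᶠ x in 𝓝[<] (1 : ℝ), x ∈ Set.Ioo (0 : ℝ) 1 := Ioo_mem_nhdsLT one_pos
  filter_upwards [h1, h2] with x hx1 hx
  have hx0 := hx.1
  have hWpos : 0 < W x := one_pos.trans ((le_max_left _ _).trans_lt hx1)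
  have hsum := hW x hx.1 hx.2
  have hfin : HasSum (fun m => if m ∈ Finset.range N then w m * ‖b m‖ else 0) C := by
    have : HasSum (fun m => if m ∈ Finset.range N then w m * ‖b m‖ else 0)
        (∑ m ∈ Finset.range N, if m ∈ Finset.range N then w m * ‖b m‖ else 0) :=
      hasSum_sum_of_ne_finset_zero fun m hm => if_neg hm
    rwa [Finset.sum_congr rfl fun m hm => if_pos hm] at this
  have hbd := (hsum.mul_left (ε / 2)).add hfin
  have hle : ‖∑' m, (w m * b m : ℂ) * (x : ℂ) ^ m‖ ≤ ε / 2 * W x + C := by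
    refine tsum_of_norm_bounded hbd fun m => ?_
    rw [norm_mul, norm_mul, norm_pow, Complex.norm_real, Complex.norm_real,
      Real.norm_of_nonneg (hw m), Real.norm_of_nonneg hx0.le]
    have hxm : x ^ m ≤ 1 := pow_le_one₀ hx0.le hx.2.le
    have hxm0 : 0 ≤ x ^ m := by positivity
    by_cases hm : m ∈ Finset.range N
    · rw [if_pos hm]
      have : w m * ‖b m‖ * x ^ m ≤ w m * ‖b m‖ :=
        mul_le_of_le_one_right (mul_nonneg (hw m) (norm_nonneg _)) hxm
      have : 0 ≤ ε / 2 * (w m * x ^ m) := by have := hw m; positivity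
      linarith
    · rw [if_neg hm, add_zero]
      have h3 : ‖b m‖ ≤ ε / 2 := by
        simpa using (hN m (by simpa using hm)).le
      calc w m * ‖b m‖ * x ^ m ≤ w m * (ε / 2) * x ^ m := by have := hw m; gcongr
        _ = ε / 2 * (w m * x ^ m) := by ring
  rw [dist_zero_right, norm_div, Complex.norm_real, Real.norm_of_nonneg hWpos.le,
    div_lt_iff₀ hWpos]
  have h4 : 4 * C / ε < W x := (le_max_right _ _).trans_lt hx1
  have h5 : 4 * C < W x * ε := by rwa [div_lt_iff₀ hε] at h4
  nlinarith

theorem tendsto_one_sub_nhdsLT : Tendsto (fun x : ℝ => 1 - x) (𝓝[<] 1) (𝓝[>] 0) := by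
  refine tendsto_nhdsWithin_iff.2 ⟨?_, ?_⟩
  · have : Tendsto (fun x : ℝ => 1 - x) (𝓝 1) (𝓝 (1 - 1)) := by
      exact (continuous_const.sub continuous_id).tendsto 1
    rw [sub_self] at this
    exact this.mono_left nhdsWithin_le_nhds
  · filter_upwards [self_mem_nhdsWithin] with x hx
    simpa using hx

theorem PolyBdd.of_tendsto {c : ℕ → ℂ} {l : ℂ} (hc : Tendsto c atTop (𝓝 l)) : PolyBdd c := by
  obtain ⟨K, hK⟩ := (hc.norm.bddAbove_range)
  exact ⟨K, 0, fun m => by simpa using hK ⟨m, rfl⟩⟩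

/-- If `cₘ → l`, then `∑ cₘ xᵐ ~ l / (1 - x)` as `x → 1⁻`. -/
theorem tendsto_one_sub_mul_powSum {c : ℕ → ℂ} {l : ℂ} (hc : Tendsto c atTop (𝓝 l)) :
    Tendsto (fun x : ℝ => ((1 - x : ℝ) : ℂ) * powSum c x) (𝓝[<] 1) (𝓝 l) := by
  have hb : Tendsto (fun m => c m - l) atTop (𝓝 0) := by simpa using hc.sub_const l
  have h := tendsto_abel_zero (w := fun _ => 1) (fun _ => zero_le_one) (W := fun x => (1 - x)⁻¹)
    (fun x h0 h1 => by simpa using hasSum_geometric_of_lt_one h0.le h1)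
    (tendsto_inv_nhdsGT_zero.comp tendsto_one_sub_nhdsLT) hb
  have h' := h.add_const l
  rw [zero_add] at h'
  refine h'.congr' ?_
  have h2 : ∀ᶠ x in 𝓝[<] (1 : ℝ), x ∈ Set.Ioo (0 : ℝ) 1 := Ioo_mem_nhdsLT one_pos
  filter_upwards [h2] with x hx
  have hx1 : |x| < 1 := by rw [abs_of_pos hx.1]; exact hx.2
  have hcs := (PolyBdd.of_tendsto hc).summable hx1
  have hls := (PolyBdd.of_tendsto (tendsto_const_nhds (x := l))).summable hx1
  have hg : ∑' m : ℕ, (x : ℂ) ^ m = (1 - (x : ℂ))⁻¹ := tsum_geometric_of_norm_lt_one (by simpa using hx1)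
  have hne : (1 - (x : ℂ)) ≠ 0 := by
    have : (1 - x : ℝ) ≠ 0 := by linarith [hx.2]
    exact_mod_cast this
  have e : (∑' m, (((1 : ℝ) : ℂ) * (c m - l)) * (x : ℂ) ^ m) = powSum c x - l * (1 - (x : ℂ))⁻¹ := by
    rw [powSum, ← hg, ← tsum_mul_left, ← Summable.tsum_sub hcs hls]
    exact tsum_congr fun m => by push_cast; ring
  rw [e]
  push_cast
  field_simp
  ring

theorem hasSum_add_one_mul_geometric {x : ℝ} (hx : |x| < 1) :
    HasSum (fun m : ℕ => ((m : ℝ) + 1) * x ^ m) (((1 - x) ^ 2)⁻¹) := by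
  have := hasSum_choose_mul_geometric_of_norm_lt_one (𝕜 := ℝ) 1 (r := x) (by simpa using hx)
  simpa using this

/-- If `cₘ → l`, then the derivative of `∑ cₘ xᵐ` is asymptotic to `l / (1 - x)²` as `x → 1⁻`. -/
theorem tendsto_one_sub_sq_mul_powSum_derivCoeff {c : ℕ → ℂ} {l : ℂ} (hc : Tendsto c atTop (𝓝 l)) :
    Tendsto (fun x : ℝ => ((1 - x : ℝ) : ℂ) ^ 2 * powSum (derivCoeff c) x) (𝓝[<] 1) (𝓝 l) := by
  have hc1 : Tendsto (fun m => c (m + 1)) atTop (𝓝 l) := (tendsto_add_atTop_iff_nat 1).2 hc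
  have hb : Tendsto (fun m => c (m + 1) - l) atTop (𝓝 0) := by simpa using hc1.sub_const l
  have h := tendsto_abel_zero (w := fun m => (m : ℝ) + 1) (fun m => by positivity)
    (W := fun x => ((1 - x) ^ 2)⁻¹)
    (fun x h0 h1 => hasSum_add_one_mul_geometric (by rwa [abs_of_pos h0]))
    (by
      have h1 := tendsto_inv_nhdsGT_zero.comp tendsto_one_sub_nhdsLT
      have h2 := h1.atTop_mul_atTop₀ h1
      refine h2.congr fun x => ?_
      simp only [Function.comp_apply]
      rw [← mul_inv, sq]) hb
  have h' := h.add_const l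
  rw [zero_add] at h'
  refine h'.congr' ?_
  have h2 : ∀ᶠ x in 𝓝[<] (1 : ℝ), x ∈ Set.Ioo (0 : ℝ) 1 := Ioo_mem_nhdsLT one_pos
  filter_upwards [h2] with x hx
  have hx1 : |x| < 1 := by rw [abs_of_pos hx.1]; exact hx.2
  have hcs := (PolyBdd.of_tendsto hc).derivCoeff.summable hx1
  have hls := (PolyBdd.of_tendsto (tendsto_const_nhds (x := l))).derivCoeff.summable hx1
  have hg : ∑' m : ℕ, ((m : ℂ) + 1) * (x : ℂ) ^ m = ((1 - (x : ℂ)) ^ 2)⁻¹ := by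
    have := (Complex.hasSum_ofReal.2 (hasSum_add_one_mul_geometric hx1)).tsum_eq
    push_cast at this
    exact this
  have hne : (1 - (x : ℂ)) ≠ 0 := by
    have : (1 - x : ℝ) ≠ 0 := by linarith [hx.2]
    exact_mod_cast this
  have e : (∑' m : ℕ, ((((m : ℝ) + 1 : ℝ) : ℂ) * (c (m + 1) - l)) * (x : ℂ) ^ m)
      = powSum (derivCoeff c) x - l * ((1 - (x : ℂ)) ^ 2)⁻¹ := by
    rw [powSum, ← hg, ← tsum_mul_left]
    have hls' : Summable fun m : ℕ => l * (((m : ℂ) + 1) * (x : ℂ) ^ m) :=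
      hls.congr fun m => by rw [derivCoeff]; ring
    rw [← Summable.tsum_sub hcs hls']
    exact tsum_congr fun m => by rw [derivCoeff]; push_cast; ring
  rw [e]
  push_cast
  field_simp
  ring

/-- The coefficients of Gauss's hypergeometric series. -/
def hypCoeff (a b c : ℂ) (m : ℕ) : ℂ := ordinaryHypergeometricCoefficient a b c m

theorem ordinaryHypergeometric_eq_powSum (a b c : ℂ) (x : ℝ) :
    ₂F₁ a b c (x : ℂ) = powSum (hypCoeff a b c) x := by
  rw [ordinaryHypergeometric_eq_tsum]
  rfl

theorem hypCoeff_succ (a b c : ℂ) (hc : ∀ j : ℕ, c + j ≠ 0) (m : ℕ) :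
    (m + 1) * (c + m) * hypCoeff a b c (m + 1) = (a + m) * (b + m) * hypCoeff a b c m := by
  have h1 : ((m : ℂ) + 1) ≠ 0 := by exact_mod_cast Nat.succ_ne_zero m
  have h2 : (m.factorial : ℂ) ≠ 0 := by exact_mod_cast m.factorial_ne_zero
  have h3 := hc m
  simp only [hypCoeff, ordinaryHypergeometricCoefficient, ascPochhammer_succ_eval,
    Nat.factorial_succ, Nat.cast_mul, mul_inv]
  push_cast
  field_simp

theorem ascPochhammer_eval_eq_prod (a : ℂ) (m : ℕ) :
    (ascPochhammer ℂ m).eval a = ∏ j ∈ Finset.range m, (a + j) := by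
  induction m with
  | zero => simp
  | succ m ih => rw [ascPochhammer_succ_eval, ih, Finset.prod_range_succ]

/-- The rising factorials in terms of Euler's sequence for `Γ`. -/
theorem ascPochhammer_eval_succ_eq (a : ℂ) (ha : ∀ j : ℕ, a + j ≠ 0) (m : ℕ) (hm : 0 < m) :
    (ascPochhammer ℂ (m + 1)).eval a = (m : ℂ) ^ a * m.factorial / Complex.GammaSeq a m := by
  have hp : ∏ j ∈ Finset.range (m + 1), (a + j) ≠ 0 := Finset.prod_ne_zero_iff.2 fun j _ => ha j
  have hf : (m.factorial : ℂ) ≠ 0 := by exact_mod_cast m.factorial_ne_zero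
  have hq : (m : ℂ) ^ a ≠ 0 := by
    rw [Complex.cpow_def_of_ne_zero (by exact_mod_cast hm.ne')]; exact Complex.exp_ne_zero _
  rw [ascPochhammer_eval_eq_prod, Complex.GammaSeq]
  field_simp

/-- If `a + b = c + 1`, the hypergeometric coefficients converge (Euler's product for `Γ`). -/
theorem tendsto_hypCoeff {a b c : ℂ} (ha : ∀ j : ℕ, a + j ≠ 0) (hb : ∀ j : ℕ, b + j ≠ 0)
    (hc : ∀ j : ℕ, c + j ≠ 0) (habc : a + b = c + 1) :
    Tendsto (hypCoeff a b c) atTop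
      (𝓝 (Complex.Gamma c / (Complex.Gamma a * Complex.Gamma b))) := by
  have hΓa : Complex.Gamma a ≠ 0 :=
    Complex.Gamma_ne_zero fun m hm => ha m (by rw [hm]; ring)
  have hΓb : Complex.Gamma b ≠ 0 :=
    Complex.Gamma_ne_zero fun m hm => hb m (by rw [hm]; ring)
  rw [← tendsto_add_atTop_iff_nat 1]
  have h1 : Tendsto (fun m : ℕ => (m : ℂ) / ((m : ℂ) + 1)) atTop (𝓝 1) := by
    have := tendsto_natCast_div_add_atTop (𝕜 := ℂ) (1 : ℂ)
    exact this
  have h := h1.mul ((Complex.GammaSeq_tendsto_Gamma c).div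
    ((Complex.GammaSeq_tendsto_Gamma a).mul (Complex.GammaSeq_tendsto_Gamma b))
    (mul_ne_zero hΓa hΓb))
  rw [one_mul] at h
  refine h.congr' ?_
  filter_upwards [eventually_gt_atTop 0] with m hm
  have hm0 : (m : ℂ) ≠ 0 := by exact_mod_cast hm.ne'
  have hm1 : ((m : ℂ) + 1) ≠ 0 := by exact_mod_cast Nat.succ_ne_zero m
  have hf : (m.factorial : ℂ) ≠ 0 := by exact_mod_cast m.factorial_ne_zero
  have hq : ∀ z : ℂ, (m : ℂ) ^ z ≠ 0 := fun z => by
    rw [Complex.cpow_def_of_ne_zero hm0]; exact Complex.exp_ne_zero _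
  have hG : ∀ z : ℂ, (∀ j : ℕ, z + j ≠ 0) → Complex.GammaSeq z m ≠ 0 := fun z hz => by
    rw [Complex.GammaSeq]
    exact div_ne_zero (mul_ne_zero (hq z) hf) (Finset.prod_ne_zero_iff.2 fun j _ => hz j)
  have e : (m : ℂ) ^ a * (m : ℂ) ^ b = (m : ℂ) ^ c * m := by
    rw [← Complex.cpow_add _ _ hm0, habc, Complex.cpow_add _ _ hm0, Complex.cpow_one]
  rw [hypCoeff, ordinaryHypergeometricCoefficient, ascPochhammer_eval_succ_eq a ha m hm,
    ascPochhammer_eval_succ_eq b hb m hm, ascPochhammer_eval_succ_eq c hc m hm]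
  have ga := hG a ha
  have gb := hG b hb
  have gc := hG c hc
  have qc := hq c
  rw [Nat.factorial_succ]
  simp only [Pi.div_apply]
  push_cast
  field_simp
  linear_combination (-1 : ℂ) * e

end

section

/-! ### The radial function `φ_{s,k}` -/

theorem hasSum_of_shift {f : ℕ → ℂ} {S : ℂ} (h0 : f 0 = 0) (h : HasSum (fun m => f (m + 1)) S) :
    HasSum f S := by
  have := (hasSum_nat_add_iff (f := f) 1).1 h
  simpa [h0] using this

/-- The hypergeometric differential equation. -/
theorem hypergeometric_ode {a b c : ℂ} (hc : ∀ j : ℕ, c + j ≠ 0)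
    (hbd : PolyBdd (hypCoeff a b c)) {x : ℝ} (hx : |x| < 1) :
    (x : ℂ) * (1 - x) * powSum (derivCoeff (derivCoeff (hypCoeff a b c))) x
      + (c - (a + b + 1) * x) * powSum (derivCoeff (hypCoeff a b c)) x
      - a * b * powSum (hypCoeff a b c) x = 0 := by
  set p := hypCoeff a b c with hp
  have S0 : HasSum (fun m => p m * (x : ℂ) ^ m) (powSum p x) := (hbd.summable hx).hasSum
  have S1 : HasSum (fun m => derivCoeff p m * (x : ℂ) ^ m) (powSum (derivCoeff p) x) :=
    (hbd.derivCoeff.summable hx).hasSum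
  have S2 : HasSum (fun m => derivCoeff (derivCoeff p) m * (x : ℂ) ^ m)
      (powSum (derivCoeff (derivCoeff p)) x) := (hbd.derivCoeff.derivCoeff.summable hx).hasSum
  have T1 : HasSum (fun m : ℕ => (m : ℂ) * p m * (x : ℂ) ^ m) (x * powSum (derivCoeff p) x) := by
    refine hasSum_of_shift (by simp) ((S1.mul_left (x : ℂ)).congr_fun fun m => ?_)
    rw [derivCoeff]; push_cast; ring
  have T2 : HasSum (fun m : ℕ => (m : ℂ) * (m + 1) * p (m + 1) * (x : ℂ) ^ m)
      (x * powSum (derivCoeff (derivCoeff p)) x) := by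
    refine hasSum_of_shift (by simp) ((S2.mul_left (x : ℂ)).congr_fun fun m => ?_)
    rw [derivCoeff, derivCoeff]; push_cast; ring
  have T3 : HasSum (fun m : ℕ => (m : ℂ) * (m - 1) * p m * (x : ℂ) ^ m)
      (x * (x * powSum (derivCoeff (derivCoeff p)) x)) := by
    refine hasSum_of_shift (by simp) ((T2.mul_left (x : ℂ)).congr_fun fun m => ?_)
    push_cast; ring
  have H := ((((T2.sub T3).add (S1.mul_left c)).sub (T1.mul_left (a + b + 1))).sub
    (S0.mul_left (a * b)))
  have Z : HasSum (fun _ : ℕ => (0 : ℂ)) (x * powSum (derivCoeff (derivCoeff p)) x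
      - x * (x * powSum (derivCoeff (derivCoeff p)) x) + c * powSum (derivCoeff p) x
      - (a + b + 1) * (x * powSum (derivCoeff p) x) - a * b * powSum p x) := by
    refine H.congr_fun fun m => ?_
    have := hypCoeff_succ a b c hc m
    rw [← hp] at this
    rw [derivCoeff]
    linear_combination (-(x : ℂ) ^ m) * this
  have := Z.unique hasSum_zero
  linear_combination this

theorem PolyBdd.norm_powSum_le {c : ℕ → ℂ} (h : PolyBdd c) {r : ℝ} (hr : r < 1) :
    ∃ K : ℝ, 0 ≤ K ∧ ∀ x : ℝ, |x| ≤ r → ‖powSum c x‖ ≤ K := by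
  by_cases hr0 : 0 ≤ r
  · have hs := h.summable_norm (x := r) (by rwa [abs_of_nonneg hr0])
    refine ⟨∑' m, ‖c m * (r : ℂ) ^ m‖, tsum_nonneg fun _ => norm_nonneg _, fun x hx => ?_⟩
    refine tsum_of_norm_bounded hs.hasSum fun m => ?_
    simp only [norm_mul, norm_pow, Complex.norm_real, Real.norm_eq_abs]
    rw [abs_of_nonneg hr0]
    gcongr
  · exact ⟨0, le_rfl, fun x hx => absurd ((abs_nonneg x).trans hx) hr0⟩

/-- The coefficients of the hypergeometric factor of the radial function, as a power series in
`1 / σ`. -/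
def phiCoeff (s : ℂ) (n : ℤ) : ℕ → ℂ := hypCoeff (s - absWeight n) (s + absWeight n) (2 * s - 1)

theorem absWeight_sq (n : ℤ) : absWeight n ^ 2 = (n : ℂ) ^ 2 / 4 := by
  rw [absWeight, ← Complex.ofReal_pow, div_pow, sq_abs]
  push_cast
  norm_num

theorem absWeight_re_nonneg (n : ℤ) : 0 ≤ (absWeight n).re := by
  rw [absWeight, Complex.ofReal_re]; positivity

/-- Pfaff's transformation turns the radial function into `σ⁻ˢ` times a power series in `1/σ`. -/
theorem phi_eq (s : ℂ) (n : ℤ) {σ : ℝ} (hσ : 1 < σ) :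
    phi s n σ = normConst s n * (σ : ℂ) ^ (-s) * powSum (phiCoeff s n) (1 / σ) := by
  have h0 : (0 : ℝ) < σ := one_pos.trans hσ
  have h1 : (0 : ℝ) < σ - 1 := sub_pos.2 hσ
  have hσ0 : (σ : ℂ) ≠ 0 := by exact_mod_cast h0.ne'
  have hσ1 : (σ : ℂ) - 1 ≠ 0 := by exact_mod_cast h1.ne'
  have e1 : 1 - ((-1 / (σ - 1) : ℝ) : ℂ) = ((σ / (σ - 1) : ℝ) : ℂ) := by
    push_cast; field_simp; ring
  have e2 : ((-1 / (σ - 1) : ℝ) : ℂ) / (((-1 / (σ - 1) : ℝ) : ℂ) - 1) = ((1 / σ : ℝ) : ℂ) := by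
    have : ((-1 / (σ - 1) : ℝ) : ℂ) - 1 = -((σ / (σ - 1) : ℝ) : ℂ) := by rw [← e1]; ring
    rw [this]; push_cast; field_simp
  have e3 : (2 * s - 1 - (s - 1 - absWeight n)) = s + absWeight n := by ring
  have e4 : -(s - absWeight n) = absWeight n - s := by ring
  have e5 : ((σ - 1 : ℝ) : ℂ) ^ (absWeight n - s) * ((σ / (σ - 1) : ℝ) : ℂ) ^ (absWeight n - s)
      = (σ : ℂ) ^ (absWeight n - s) := by
    rw [← Complex.mul_cpow_ofReal_nonneg h1.le (by positivity)]
    congr 1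
    push_cast; field_simp
  have e6 : (σ : ℂ) ^ (-absWeight n) * (σ : ℂ) ^ (absWeight n - s) = (σ : ℂ) ^ (-s) := by
    rw [← Complex.cpow_add _ _ hσ0]; congr 1; ring
  rw [phi, gaussF, e1, e2, e3, e4, ordinaryHypergeometric_eq_powSum, phiCoeff, ← e6, ← e5]
  ring

section Parameters

variable {s : ℂ} {n : ℤ}

theorem s_sub_absWeight_add_ne_zero (hpole : ∀ j : ℕ, s ≠ absWeight n - j) (j : ℕ) :
    s - absWeight n + j ≠ 0 := fun h => hpole j (by linear_combination h)

theorem s_add_absWeight_add_ne_zero (hs : 2 < s.re) (j : ℕ) : s + absWeight n + j ≠ 0 := fun h => by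
  have := congrArg Complex.re h
  simp only [Complex.add_re, Complex.natCast_re, Complex.zero_re] at this
  have h1 := absWeight_re_nonneg n
  have h2 : (0 : ℝ) ≤ j := j.cast_nonneg
  linarith

theorem two_mul_s_sub_one_add_ne_zero (hs : 2 < s.re) (j : ℕ) : 2 * s - 1 + j ≠ 0 := fun h => by
  have := congrArg Complex.re h
  simp at this
  have h2 : (0 : ℝ) ≤ j := j.cast_nonneg
  linarith

theorem tendsto_phiCoeff (hs : 2 < s.re) (hpole : ∀ j : ℕ, s ≠ absWeight n - j) :
    Tendsto (phiCoeff s n) atTop (𝓝 (Complex.Gamma (2 * s - 1) /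
      (Complex.Gamma (s - absWeight n) * Complex.Gamma (s + absWeight n)))) :=
  tendsto_hypCoeff (s_sub_absWeight_add_ne_zero hpole) (s_add_absWeight_add_ne_zero hs)
    (two_mul_s_sub_one_add_ne_zero hs) (by ring)

theorem polyBdd_phiCoeff (hs : 2 < s.re) (hpole : ∀ j : ℕ, s ≠ absWeight n - j) :
    PolyBdd (phiCoeff s n) := .of_tendsto (tendsto_phiCoeff hs hpole)

/-- The normalizing constant cancels the limit of the coefficients `phiCoeff`; this is what makes
`(σ - 1) φ(σ) → 1`. -/
theorem normConst_mul_limit (hs : 2 < s.re) (hpole : ∀ j : ℕ, s ≠ absWeight n - j) :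
    normConst s n * (Complex.Gamma (2 * s - 1) /
      (Complex.Gamma (s - absWeight n) * Complex.Gamma (s + absWeight n))) = 1 := by
  have h1 : Complex.Gamma (s - absWeight n) ≠ 0 := Complex.Gamma_ne_zero fun m hm =>
    s_sub_absWeight_add_ne_zero hpole m (by rw [hm]; ring)
  have h2 : Complex.Gamma (s + absWeight n) ≠ 0 := Complex.Gamma_ne_zero fun m hm =>
    s_add_absWeight_add_ne_zero (n := n) hs m (by rw [hm]; ring)
  have h3 : Complex.Gamma (2 * s - 1) ≠ 0 := Complex.Gamma_ne_zero fun m hm =>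
    two_mul_s_sub_one_add_ne_zero hs m (by rw [hm]; ring)
  rw [normConst, div_mul_div_comm, mul_comm]
  exact div_self (mul_ne_zero h3 (mul_ne_zero h1 h2))

/-- The derivative of the radial function `phi`. -/
def phiDeriv (s : ℂ) (n : ℤ) (σ : ℝ) : ℂ :=
  normConst s n * (σ : ℂ) ^ (-s) * (-s * (σ : ℂ)⁻¹ * powSum (phiCoeff s n) (1 / σ)
    - (σ : ℂ)⁻¹ ^ 2 * powSum (derivCoeff (phiCoeff s n)) (1 / σ))

/-- The second derivative of the radial function `phi`. -/
def phiDeriv2 (s : ℂ) (n : ℤ) (σ : ℝ) : ℂ :=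
  normConst s n * (σ : ℂ) ^ (-s) * (s * (s + 1) * (σ : ℂ)⁻¹ ^ 2 * powSum (phiCoeff s n) (1 / σ)
    + (2 * s + 2) * (σ : ℂ)⁻¹ ^ 3 * powSum (derivCoeff (phiCoeff s n)) (1 / σ)
    + (σ : ℂ)⁻¹ ^ 4 * powSum (derivCoeff (derivCoeff (phiCoeff s n))) (1 / σ))

theorem hasDerivAt_powSum_inv {c : ℕ → ℂ} (h : PolyBdd c) {σ : ℝ} (hσ : 1 < σ) :
    HasDerivAt (fun σ : ℝ => powSum c (1 / σ)) (-(σ : ℂ)⁻¹ ^ 2 * powSum (derivCoeff c) (1 / σ)) σ := by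
  have h0 : (0 : ℝ) < σ := one_pos.trans hσ
  have hx : |1 / σ| < 1 := by rw [abs_of_pos (by positivity), div_lt_one h0]; exact hσ
  have hi : HasDerivAt (fun σ : ℝ => 1 / σ) (-(σ ^ 2)⁻¹) σ := by
    simpa [one_div] using hasDerivAt_inv h0.ne'
  have := (h.hasDerivAt_powSum hx).scomp σ hi
  refine this.congr_deriv ?_
  rw [Complex.real_smul]
  push_cast
  rw [inv_pow]

theorem hasDerivAt_cpow_neg (s : ℂ) {σ : ℝ} (hσ : 0 < σ) :
    HasDerivAt (fun σ : ℝ => (σ : ℂ) ^ (-s)) (-s * (σ : ℂ)⁻¹ * (σ : ℂ) ^ (-s)) σ := by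
  have hσ0 : (σ : ℂ) ≠ 0 := by exact_mod_cast hσ.ne'
  have h := (hasDerivAt_id (σ : ℂ)).cpow_const (c := -s) (by simp [Complex.slitPlane, hσ])
  have h2 := h.comp_ofReal
  refine h2.congr_deriv ?_
  simp only [id]
  rw [Complex.cpow_sub _ _ hσ0, Complex.cpow_one]
  field_simp

theorem hasDerivAt_phi (hs : 2 < s.re) (hpole : ∀ j : ℕ, s ≠ absWeight n - j) {σ : ℝ}
    (hσ : 1 < σ) : HasDerivAt (phi s n) (phiDeriv s n σ) σ := by
  have h0 : (0 : ℝ) < σ := one_pos.trans hσ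
  have hP := hasDerivAt_powSum_inv (polyBdd_phiCoeff hs hpole) hσ
  have h := ((hasDerivAt_cpow_neg s h0).const_mul (normConst s n)).mul hP
  have h' := h.congr_of_eventuallyEq (f₁ := phi s n) (by
    filter_upwards [lt_mem_nhds hσ] with τ hτ
    exact phi_eq s n hτ)
  refine h'.congr_deriv ?_
  rw [phiDeriv]
  ring

theorem hasDerivAt_phiDeriv (hs : 2 < s.re) (hpole : ∀ j : ℕ, s ≠ absWeight n - j) {σ : ℝ}
    (hσ : 1 < σ) : HasDerivAt (phiDeriv s n) (phiDeriv2 s n σ) σ := by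
  have h0 : (0 : ℝ) < σ := one_pos.trans hσ
  have hσ0 : (σ : ℂ) ≠ 0 := by exact_mod_cast h0.ne'
  have hb := polyBdd_phiCoeff hs hpole
  have hP := hasDerivAt_powSum_inv hb hσ
  have hP1 := hasDerivAt_powSum_inv hb.derivCoeff hσ
  have hi : HasDerivAt (fun σ : ℝ => (σ : ℂ)⁻¹) (-((σ : ℂ) ^ 2)⁻¹) σ :=
    (hasDerivAt_inv hσ0).comp_ofReal
  have h := ((hasDerivAt_cpow_neg s h0).const_mul (normConst s n)).mul
    (((hi.const_mul (-s)).mul hP).sub ((hi.pow 2).mul hP1))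
  refine h.congr_deriv ?_
  simp only [Pi.mul_apply, Pi.pow_apply, Pi.sub_apply]
  rw [phiDeriv2]
  push_cast
  field_simp
  ring

theorem continuousOn_phiDeriv2 (hs : 2 < s.re) (hpole : ∀ j : ℕ, s ≠ absWeight n - j) :
    ContinuousOn (phiDeriv2 s n) (Set.Ioi 1) := by
  intro σ hσ
  have h0 : (0 : ℝ) < σ := one_pos.trans hσ
  have hσ0 : (σ : ℂ) ≠ 0 := by exact_mod_cast h0.ne'
  have hb := polyBdd_phiCoeff hs hpole
  have h1 := (hasDerivAt_cpow_neg s h0).continuousAt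
  have hP := (hasDerivAt_powSum_inv hb hσ).continuousAt
  have hP1 := (hasDerivAt_powSum_inv hb.derivCoeff hσ).continuousAt
  have hP2 := (hasDerivAt_powSum_inv hb.derivCoeff.derivCoeff hσ).continuousAt
  have hi : ContinuousAt (fun σ : ℝ => (σ : ℂ)⁻¹) σ := (hasDerivAt_inv hσ0).comp_ofReal.continuousAt
  refine ContinuousAt.continuousWithinAt ?_
  unfold phiDeriv2
  exact (continuousAt_const.mul h1).mul ((((continuousAt_const.mul (hi.pow 2)).mul hP).add
    ((continuousAt_const.mul (hi.pow 3)).mul hP1)).add ((hi.pow 4).mul hP2))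

/-- The radial part of the equation `Δ_k φ = s (s - 2) φ`. -/
theorem phi_ode (hs : 2 < s.re) (hpole : ∀ j : ℕ, s ≠ absWeight n - j) {σ : ℝ} (hσ : 1 < σ) :
    (σ : ℂ) * (σ - 1) * phiDeriv2 s n σ + (3 * σ - 1) * phiDeriv s n σ
      + (n : ℂ) ^ 2 / 4 / σ * phi s n σ = s * (s - 2) * phi s n σ := by
  have h0 : (0 : ℝ) < σ := one_pos.trans hσ
  have hσ0 : (σ : ℂ) ≠ 0 := by exact_mod_cast h0.ne'
  have hx : |1 / σ| < 1 := by rw [abs_of_pos (by positivity), div_lt_one h0]; exact hσ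
  have H := hypergeometric_ode (two_mul_s_sub_one_add_ne_zero hs) (polyBdd_phiCoeff hs hpole) hx
  rw [phi_eq s n hσ, phiDeriv2, phiDeriv, ← absWeight_sq]
  simp only [phiCoeff] at *
  generalize powSum (derivCoeff (derivCoeff _)) _ = P2 at *
  generalize powSum (derivCoeff _) _ = P1 at *
  generalize powSum _ _ = P0 at *
  push_cast at H
  generalize (σ : ℂ) ^ (-s) = q
  generalize normConst s n = C
  -- the hypergeometric equation at `x = 1 / σ`, cleared of denominators
  have H' : (σ - 1) * P2 + ((2 * s - 1) * σ - (2 * s + 1)) * σ * P1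
      - (s - absWeight n) * (s + absWeight n) * σ ^ 2 * P0 = 0 := by
    have h2 := congrArg (fun z => z * (σ : ℂ) ^ 2) H
    simp only [zero_mul] at h2
    rw [← h2]
    field_simp
    ring
  field_simp
  linear_combination C * q * H'

/-- The radial function and `σ` times its derivative are `O(σ^{-Re s})` at infinity. -/
theorem phi_bound_atTop (hs : 2 < s.re) (hpole : ∀ j : ℕ, s ≠ absWeight n - j) :
    ∃ K : ℝ, 0 ≤ K ∧ ∀ σ : ℝ, 2 ≤ σ → ‖phi s n σ‖ ≤ K * σ ^ (-s.re) ∧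
      σ * ‖phiDeriv s n σ‖ ≤ K * σ ^ (-s.re) := by
  have hb := polyBdd_phiCoeff hs hpole
  obtain ⟨K0, hK0, h0⟩ := hb.norm_powSum_le (r := 1 / 2) (by norm_num)
  obtain ⟨K1, hK1, h1⟩ := hb.derivCoeff.norm_powSum_le (r := 1 / 2) (by norm_num)
  refine ⟨‖normConst s n‖ * (K0 + ‖s‖ * K0 + K1), by positivity, fun σ hσ => ?_⟩
  have hp : (0 : ℝ) < σ := by linarith
  have hx : |1 / σ| ≤ 1 / 2 := by
    rw [abs_of_pos (by positivity)]
    exact one_div_le_one_div_of_le two_pos hσ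
  have hn : ‖(σ : ℂ) ^ (-s)‖ = σ ^ (-s.re) := by
    rw [Complex.norm_cpow_eq_rpow_re_of_pos hp, Complex.neg_re]
  have hnn : 0 ≤ σ ^ (-s.re) := Real.rpow_nonneg hp.le _
  have hnσ : ‖(σ : ℂ)⁻¹‖ = σ⁻¹ := by
    rw [norm_inv, Complex.norm_real, Real.norm_of_nonneg hp.le]
  constructor
  · rw [phi_eq s n (by linarith), norm_mul, norm_mul, hn]
    have := h0 _ hx
    calc ‖normConst s n‖ * σ ^ (-s.re) * ‖powSum (phiCoeff s n) (1 / σ)‖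
        ≤ ‖normConst s n‖ * σ ^ (-s.re) * (K0 + ‖s‖ * K0 + K1) := by
          gcongr
          have : 0 ≤ ‖s‖ * K0 := by positivity
          linarith
      _ = _ := by ring
  · rw [phiDeriv, norm_mul, norm_mul, hn]
    have a0 := h0 _ hx
    have a1 := h1 _ hx
    have key : ‖-s * (σ : ℂ)⁻¹ * powSum (phiCoeff s n) (1 / σ)
        - (σ : ℂ)⁻¹ ^ 2 * powSum (derivCoeff (phiCoeff s n)) (1 / σ)‖
        ≤ σ⁻¹ * (‖s‖ * K0 + K1) := by
      refine (norm_sub_le _ _).trans ?_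
      simp only [norm_mul, norm_neg, norm_pow, hnσ]
      have hi : σ⁻¹ ≤ 1 := inv_le_one_of_one_le₀ (by linarith)
      have hi0 : 0 ≤ σ⁻¹ := by positivity
      have : σ⁻¹ ^ 2 ≤ σ⁻¹ := by nlinarith
      calc _ ≤ ‖s‖ * σ⁻¹ * K0 + σ⁻¹ * K1 := by gcongr
        _ = _ := by ring
    calc σ * (‖normConst s n‖ * σ ^ (-s.re) * _)
        ≤ σ * (‖normConst s n‖ * σ ^ (-s.re) * (σ⁻¹ * (‖s‖ * K0 + K1))) := by gcongr
      _ = ‖normConst s n‖ * (‖s‖ * K0 + K1) * σ ^ (-s.re) := by field_simp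
      _ ≤ _ := by gcongr; linarith

theorem tendsto_one_div_nhdsGT : Tendsto (fun σ : ℝ => 1 / σ) (𝓝[>] 1) (𝓝[<] 1) := by
  refine tendsto_nhdsWithin_iff.2 ⟨?_, ?_⟩
  · have : ContinuousAt (fun σ : ℝ => 1 / σ) 1 := by
      simp [one_div]
    have h := this.tendsto
    simp only [div_one] at h
    exact h.mono_left nhdsWithin_le_nhds
  · filter_upwards [self_mem_nhdsWithin] with x hx
    have : (1 : ℝ) < x := hx
    exact (div_lt_one (by linarith)).2 this

theorem tendsto_cpow_neg_nhdsGT (s : ℂ) : Tendsto (fun σ : ℝ => (σ : ℂ) ^ (-s)) (𝓝[>] 1) (𝓝 1) := by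
  have h := (hasDerivAt_cpow_neg s one_pos).continuousAt.tendsto
  simp only [Complex.ofReal_one, Complex.one_cpow] at h
  exact h.mono_left nhdsWithin_le_nhds

theorem tendsto_ofReal_nhdsGT : Tendsto (fun σ : ℝ => (σ : ℂ)) (𝓝[>] 1) (𝓝 1) := by
  have h := Complex.continuous_ofReal.tendsto (1 : ℝ)
  rw [Complex.ofReal_one] at h
  exact h.mono_left nhdsWithin_le_nhds

/-- The singularity of the radial function at `σ = 1`. -/
theorem tendsto_phi (hs : 2 < s.re) (hpole : ∀ j : ℕ, s ≠ absWeight n - j) :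
    Tendsto (fun σ : ℝ => ((σ - 1 : ℝ) : ℂ) * phi s n σ) (𝓝[>] 1) (𝓝 1) := by
  have h := (tendsto_one_sub_mul_powSum (tendsto_phiCoeff hs hpole)).comp tendsto_one_div_nhdsGT
  have h2 := (((tendsto_cpow_neg_nhdsGT s).const_mul (normConst s n)).mul h).mul
    tendsto_ofReal_nhdsGT
  rw [mul_one, mul_one, normConst_mul_limit hs hpole] at h2
  refine h2.congr' ?_
  filter_upwards [self_mem_nhdsWithin] with σ hσ
  have h0 : (0 : ℝ) < σ := one_pos.trans hσ
  have hσ0 : (σ : ℂ) ≠ 0 := by exact_mod_cast h0.ne'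
  rw [phi_eq s n hσ, Function.comp_apply]
  push_cast
  field_simp

theorem tendsto_phiDeriv (hs : 2 < s.re) (hpole : ∀ j : ℕ, s ≠ absWeight n - j) :
    Tendsto (fun σ : ℝ => ((σ - 1 : ℝ) : ℂ) ^ 2 * phiDeriv s n σ) (𝓝[>] 1) (𝓝 (-1)) := by
  have h := (tendsto_one_sub_mul_powSum (tendsto_phiCoeff hs hpole)).comp tendsto_one_div_nhdsGT
  have h' := (tendsto_one_sub_sq_mul_powSum_derivCoeff (tendsto_phiCoeff hs hpole)).comp
    tendsto_one_div_nhdsGT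
  have hz : Tendsto (fun σ : ℝ => -s * ((σ : ℂ) - 1)) (𝓝[>] 1) (𝓝 0) := by
    simpa using (tendsto_ofReal_nhdsGT.sub_const 1).const_mul (-s)
  have h2 := (((tendsto_cpow_neg_nhdsGT s).const_mul (normConst s n)).mul ((hz.mul h).sub h'))
  rw [zero_mul, zero_sub, mul_one, mul_neg, normConst_mul_limit hs hpole] at h2
  refine h2.congr' ?_
  filter_upwards [self_mem_nhdsWithin] with σ hσ
  have h0 : (0 : ℝ) < σ := one_pos.trans hσ
  have hσ0 : (σ : ℂ) ≠ 0 := by exact_mod_cast h0.ne'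
  rw [phiDeriv, Function.comp_apply, Function.comp_apply]
  push_cast
  field_simp

end Parameters

theorem conj_powSum (c : ℕ → ℂ) (hc : ∀ m, (starRingEnd ℂ) (c m) = c m) (x : ℝ) :
    (starRingEnd ℂ) (powSum c x) = powSum c x := by
  rw [powSum, Complex.conj_tsum]
  simp [hc]

theorem conj_hypCoeff (a b c : ℝ) (m : ℕ) :
    (starRingEnd ℂ) (hypCoeff a b c m) = hypCoeff a b c m := by
  simp [hypCoeff, ordinaryHypergeometricCoefficient, ascPochhammer_eval_eq_prod]

/-- For real `s` the radial function is real. -/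
theorem conj_phi (s : ℝ) (n : ℤ) {σ : ℝ} (hσ : 1 < σ) :
    (starRingEnd ℂ) (phi s n σ) = phi s n σ := by
  have h1 : (starRingEnd ℂ) (normConst s n) = normConst s n := by
    simp [normConst, absWeight, ← Complex.Gamma_conj, map_ofNat]
  have h2 : (starRingEnd ℂ) ((σ : ℂ) ^ (-(s : ℂ))) = (σ : ℂ) ^ (-(s : ℂ)) := by
    rw [← Complex.ofReal_neg, ← Complex.ofReal_cpow (by linarith), Complex.conj_ofReal]
  rw [phi_eq _ n hσ, map_mul, map_mul, h1, h2, conj_powSum]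
  intro m
  have := conj_hypCoeff (s - |(n : ℝ)| / 2) (s + |(n : ℝ)| / 2) (2 * s - 1) m
  simp only [phiCoeff, absWeight]
  push_cast at this ⊢
  exact this

end

section

/-! ### The point-pair invariant `σ` -/

open ComplexConjugate

theorem coe_smul (g : SU21) (Z : Siegel) : ((g • Z : Siegel) : ℂ × ℂ) = fracLin g Z.1 := rfl

theorem rhoDiag_pos (Z : Siegel) : 0 < rhoDiag Z.1 := Z.2

/-- `ρ` is a Hermitian form in homogeneous coordinates, hence transforms with the factors `j(g, ·)`.
-/
theorem rho_smul (g : SU21) (Z W : Siegel) :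
    rho Z.1 W.1 = conj (jFactor g Z.1) * jFactor g W.1 * rho (g • Z).1 (g • W).1 := by
  have h1 := form_invariant g (homog Z.1) (homog W.1)
  rw [mulVec_homog_eq_smul g _ (jFactor_ne_zero g Z.2),
    mulVec_homog_eq_smul g _ (jFactor_ne_zero g W.2), star_smul, mulVec_smul, smul_dotProduct,
    dotProduct_smul] at h1
  rw [coe_smul, coe_smul, rho_eq_form, rho_eq_form, ← h1]
  simp only [smul_eq_mul, starRingEnd_apply]
  ring

theorem rho_swap (Z W : ℂ × ℂ) : rho W Z = conj (rho Z W) := by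
  simp [rho]; ring

theorem sigma_comm (Z W : Siegel) : sigma Z W = sigma W Z := by
  rw [sigma, sigma, rho_swap Z.1 W.1, Complex.norm_conj, mul_comm (rhoDiag _)]

theorem sigma_smul (g : SU21) (Z W : Siegel) : sigma (g • Z) (g • W) = sigma Z W := by
  have hZ := rhoDiag_fracLin g Z.2
  have hW := rhoDiag_fracLin g W.2
  have h1 := jFactor_ne_zero g Z.2
  have h2 := jFactor_ne_zero g W.2
  rw [← coe_smul] at hZ hW
  have p1 := rhoDiag_pos (g • Z)
  have p2 := rhoDiag_pos (g • W)
  rw [sigma, sigma, rho_smul g Z W, hZ, hW, norm_mul, norm_mul, Complex.norm_conj, mul_pow, mul_pow]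
  simp only [Complex.sq_norm]
  have n1 : Complex.normSq (jFactor g Z.1) ≠ 0 := by simpa using h1
  have n2 : Complex.normSq (jFactor g W.1) ≠ 0 := by simpa using h2
  field_simp

/-- The base point `(1/2, 0)` of the Siegel domain. -/
def base : Siegel := ⟨(1 / 2, 0), by simp [siegelSet, rhoDiag]⟩

theorem rhoDiag_base : rhoDiag base.1 = 1 := by simp [base, rhoDiag]

theorem rho_base (Z : ℂ × ℂ) : rho Z base.1 = conj (Z.1 + 1 / 2) := by
  simp [rho, base, map_ofNat]

/-- In the coordinates `z₁ + 1/2`, `z₁ - 1/2`, `z₂` the form `ρ` is diagonal. -/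
theorem normSq_add_half (Z : ℂ × ℂ) :
    ‖Z.1 + 1 / 2‖ ^ 2 = rhoDiag Z + (‖Z.1 - 1 / 2‖ ^ 2 + ‖Z.2‖ ^ 2) := by
  simp only [Complex.sq_norm, rhoDiag, Complex.normSq_apply]
  simp
  ring

theorem sigma_base (Z : Siegel) : sigma Z base = ‖Z.1.1 + 1 / 2‖ ^ 2 / rhoDiag Z.1 := by
  rw [sigma, rho_base, rhoDiag_base, Complex.norm_conj, mul_one]

/-- An element of `SU(2, 1)` which moves the base point to `Z`: a dilation followed by a
Heisenberg translation. -/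
def moveMat (Z : Siegel) : Matrix (Fin 3) (Fin 3) ℂ :=
  let t : ℂ := (Real.sqrt (rhoDiag Z.1) : ℂ)
  !![t, conj Z.1.2, (Z.1.1 - rhoDiag Z.1 / 2) / t; 0, 1, Z.1.2 / t; 0, 0, 1 / t]

/-- `SU(2, 1)` acts transitively on the Siegel domain. -/
theorem exists_smul_base (Z : Siegel) : ∃ g : SU21, g • base = Z := by
  have hr := rhoDiag_pos Z
  set t : ℂ := (Real.sqrt (rhoDiag Z.1) : ℂ) with ht
  have ht0 : t ≠ 0 := by
    rw [ht]; exact_mod_cast (Real.sqrt_pos.2 hr).ne'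
  have htt : t * t = (rhoDiag Z.1 : ℂ) := by
    rw [ht]; exact_mod_cast Real.mul_self_sqrt hr.le
  have htc : conj t = t := by rw [ht, Complex.conj_ofReal]
  have hdet : (moveMat Z).det = 1 := by
    rw [moveMat, Matrix.det_fin_three]
    simp [← ht, ht0]
  have hrho : (rhoDiag Z.1 : ℂ) = conj Z.1.1 + Z.1.1 - conj Z.1.2 * Z.1.2 := by
    rw [← rho_self]; rfl
  -- only three entries remain after simplification; the corner entry is the definition of `ρ(Z)`
  have hform : (moveMat Z)ᴴ * formJ * moveMat Z = formJ := by
    ext i j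
    have hb : conj (Z.1.1 - (rhoDiag Z.1 : ℂ) / 2) = conj Z.1.1 - (rhoDiag Z.1 : ℂ) / 2 := by
      simp [map_ofNat]
    fin_cases i <;> fin_cases j <;>
      simp [moveMat, formJ, Matrix.mul_apply, Fin.sum_univ_three, ← ht, htc, ht0,
        map_ofNat]
    · field_simp
      ring
    · field_simp
      ring
    · field_simp
      rw [hrho]
      ring
  refine ⟨⟨⟨moveMat Z, hdet⟩, hform⟩, ?_⟩
  apply Subtype.ext
  rw [coe_smul]
  set g : SU21 := ⟨⟨moveMat Z, hdet⟩, hform⟩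
  have hg : mat g = moveMat Z := rfl
  apply Prod.ext
  · simp only [fracLin, jFactor, hg, base, moveMat, ← ht]
    simp
    field_simp
    rw [← htt]
    ring
  · simp only [fracLin, jFactor, hg, base, moveMat, ← ht]
    simp
    field_simp

theorem one_le_sigma_base (Z : Siegel) : 1 ≤ sigma Z base := by
  rw [sigma_base, le_div_iff₀ (rhoDiag_pos Z), normSq_add_half]
  have : 0 ≤ ‖Z.1.1 - 1 / 2‖ ^ 2 + ‖Z.1.2‖ ^ 2 := by positivity
  linarith

theorem one_le_sigma (Z W : Siegel) : 1 ≤ sigma Z W := by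
  obtain ⟨g, rfl⟩ := exists_smul_base W
  have := one_le_sigma_base (g⁻¹ • Z)
  rwa [← sigma_smul g, smul_inv_smul] at this

theorem sigma_pos (Z W : Siegel) : 0 < sigma Z W := one_pos.trans_le (one_le_sigma Z W)

theorem eq_of_sigma_eq_one {Z W : Siegel} (h : sigma Z W = 1) : Z = W := by
  obtain ⟨g, rfl⟩ := exists_smul_base W
  rw [← sigma_smul g⁻¹, inv_smul_smul, sigma_base, div_eq_one_iff_eq (rhoDiag_pos _).ne',
    normSq_add_half, add_eq_left] at h
  rw [← inv_smul_eq_iff]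
  have h1 : ‖(g⁻¹ • Z).1.1 - 1 / 2‖ ^ 2 = 0 := by nlinarith [sq_nonneg ‖(g⁻¹ • Z).1.2‖, sq_nonneg ‖(g⁻¹ • Z).1.1 - 1 / 2‖]
  have h2 : ‖(g⁻¹ • Z).1.2‖ ^ 2 = 0 := by nlinarith [sq_nonneg ‖(g⁻¹ • Z).1.2‖, sq_nonneg ‖(g⁻¹ • Z).1.1 - 1 / 2‖]
  apply Subtype.ext
  apply Prod.ext
  · exact sub_eq_zero.1 (by simpa [base] using h1)
  · simpa [base] using h2

theorem rho_ne_zero (Z W : Siegel) : rho Z.1 W.1 ≠ 0 := by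
  intro h
  have := one_le_sigma Z W
  rw [sigma, h] at this
  norm_num at this

/-- In the coordinates `z₁ + 1/2`, `z₁ - 1/2`, `z₂`, which diagonalize `ρ`, this is the
Cauchy–Schwarz inequality. -/
theorem norm_rho_le (Z W : Siegel) : ‖rho Z.1 W.1‖ ≤ 2 * (‖Z.1.1 + 1 / 2‖ * ‖W.1.1 + 1 / 2‖) := by
  have e : rho Z.1 W.1 = conj (Z.1.1 + 1 / 2) * (W.1.1 + 1 / 2)
      - (conj (Z.1.1 - 1 / 2) * (W.1.1 - 1 / 2) + conj Z.1.2 * W.1.2) := by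
    simp [rho, map_ofNat]; ring
  have hZ := normSq_add_half Z.1
  have hW := normSq_add_half W.1
  have pZ := rhoDiag_pos Z
  have pW := rhoDiag_pos W
  have h1 : ‖conj (Z.1.1 - 1 / 2) * (W.1.1 - 1 / 2) + conj Z.1.2 * W.1.2‖
      ≤ ‖Z.1.1 - 1 / 2‖ * ‖W.1.1 - 1 / 2‖ + ‖Z.1.2‖ * ‖W.1.2‖ := by
    refine (norm_add_le _ _).trans (le_of_eq ?_)
    rw [norm_mul, norm_mul, Complex.norm_conj, Complex.norm_conj]
  have h2 : ‖Z.1.1 - 1 / 2‖ * ‖W.1.1 - 1 / 2‖ + ‖Z.1.2‖ * ‖W.1.2‖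
      ≤ ‖Z.1.1 + 1 / 2‖ * ‖W.1.1 + 1 / 2‖ := by
    refine abs_le_of_sq_le_sq' ?_ (by positivity) |>.2
    have h3 : (‖Z.1.1 - 1 / 2‖ * ‖W.1.1 - 1 / 2‖ + ‖Z.1.2‖ * ‖W.1.2‖) ^ 2
        ≤ (‖Z.1.1 - 1 / 2‖ ^ 2 + ‖Z.1.2‖ ^ 2) * (‖W.1.1 - 1 / 2‖ ^ 2 + ‖W.1.2‖ ^ 2) := by
      nlinarith [sq_nonneg (‖Z.1.1 - 1 / 2‖ * ‖W.1.2‖ - ‖Z.1.2‖ * ‖W.1.1 - 1 / 2‖)]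
    refine h3.trans ?_
    rw [mul_pow]
    gcongr <;> linarith
  calc ‖rho Z.1 W.1‖ ≤ ‖conj (Z.1.1 + 1 / 2) * (W.1.1 + 1 / 2)‖
        + ‖conj (Z.1.1 - 1 / 2) * (W.1.1 - 1 / 2) + conj Z.1.2 * W.1.2‖ := by
        rw [e]; exact norm_sub_le _ _
    _ ≤ ‖Z.1.1 + 1 / 2‖ * ‖W.1.1 + 1 / 2‖ + ‖Z.1.1 + 1 / 2‖ * ‖W.1.1 + 1 / 2‖ := by
        gcongr
        · rw [norm_mul, Complex.norm_conj]
        · exact h1.trans h2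
    _ = _ := by ring

/-- A multiplicative form of the triangle inequality: `σ = cosh² d`. -/
theorem sigma_le (Z W X : Siegel) : sigma Z X ≤ 4 * sigma Z W * sigma W X := by
  obtain ⟨g, rfl⟩ := exists_smul_base W
  have key : ∀ Z X : Siegel, sigma Z X ≤ 4 * sigma Z base * sigma base X := by
    intro Z X
    rw [sigma_comm base, sigma_base, sigma_base, sigma]
    have h := norm_rho_le Z X
    have pZ := rhoDiag_pos Z
    have pX := rhoDiag_pos X
    have e : 4 * (‖Z.1.1 + 1 / 2‖ ^ 2 / rhoDiag Z.1) * (‖X.1.1 + 1 / 2‖ ^ 2 / rhoDiag X.1)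
        = (2 * (‖Z.1.1 + 1 / 2‖ * ‖X.1.1 + 1 / 2‖)) ^ 2 / (rhoDiag Z.1 * rhoDiag X.1) := by
      field_simp; ring
    rw [e]
    gcongr
  have := key (g⁻¹ • Z) (g⁻¹ • X)
  rwa [sigma_smul, ← sigma_smul g (g⁻¹ • Z) base, ← sigma_smul g base (g⁻¹ • X), smul_inv_smul,
    smul_inv_smul] at this

theorem continuous_rho : Continuous fun p : (ℂ × ℂ) × (ℂ × ℂ) => rho p.1 p.2 := by
  unfold rho
  have := Complex.continuous_conj
  fun_prop

theorem continuous_rhoDiag : Continuous rhoDiag := by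
  unfold rhoDiag
  have := Complex.continuous_re
  have := Complex.continuous_normSq
  fun_prop

theorem isOpen_siegelSet : IsOpen siegelSet := isOpen_lt continuous_const continuous_rhoDiag

theorem continuous_sigma : Continuous fun p : Siegel × Siegel => sigma p.1 p.2 := by
  unfold sigma
  refine Continuous.div ?_ ?_ fun p => (mul_pos (rhoDiag_pos p.1) (rhoDiag_pos p.2)).ne'
  · exact (continuous_rho.comp (((continuous_subtype_val.comp continuous_fst).prodMk
      (continuous_subtype_val.comp continuous_snd)))).norm.pow 2
  · exact (continuous_rhoDiag.comp (continuous_subtype_val.comp continuous_fst)).mul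
      (continuous_rhoDiag.comp (continuous_subtype_val.comp continuous_snd))

theorem continuous_sigma_right (Z : Siegel) : Continuous (sigma Z) :=
  Continuous.comp (g := fun p : Siegel × Siegel => sigma p.1 p.2) (f := fun W => (Z, W))
    continuous_sigma (by fun_prop)

/-- Closed balls are compact: `σ(W, base) ≤ R` bounds `W` and keeps `ρ(W)` away from zero. -/
theorem isCompact_sigma_base_le (R : ℝ) : IsCompact {W : Siegel | sigma W base ≤ R} := by
  rcases lt_or_ge R 1 with hR | hR
  · have : {W : Siegel | sigma W base ≤ R} = ∅ := by
      ext W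
      have := one_le_sigma W base
      simp only [Set.mem_ofPred_eq, Set.mem_empty_iff_false, iff_false, not_le]
      linarith
    rw [this]; exact isCompact_empty
  set K : Set (ℂ × ℂ) := {p | ‖p.1 + 1 / 2‖ ^ 2 ≤ R * rhoDiag p} ∩ {p | 1 / (4 * R) ≤ rhoDiag p}
  have hR0 : 0 < R := by linarith
  have hKS : ∀ p ∈ K, 0 < rhoDiag p := fun p hp => lt_of_lt_of_le (by positivity) hp.2
  have hKc : IsClosed K := by
    refine (isClosed_le ?_ ?_).inter (isClosed_le continuous_const continuous_rhoDiag)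
    · fun_prop
    · exact continuous_const.mul continuous_rhoDiag
  have hKb : K ⊆ Metric.closedBall 0 (4 * R + 4) := by
    intro p hp
    have hpos := hKS p hp
    have h1 := hp.1
    have h2 : rhoDiag p ≤ 2 * p.1.re := by
      have := Complex.normSq_nonneg p.2
      unfold rhoDiag; linarith
    have h3 : p.1.re = (p.1 + 1 / 2).re - 1 / 2 := by simp
    have h4 : (p.1 + 1 / 2).re ≤ ‖p.1 + 1 / 2‖ := Complex.re_le_norm _
    set m := ‖p.1 + 1 / 2‖
    have hm0 : 0 ≤ m := norm_nonneg _
    have h5 : m ^ 2 ≤ R * (2 * m) := h1.trans (by gcongr; linarith)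
    have h6 : m ≤ 2 * R := by
      by_contra hcon
      push Not at hcon
      nlinarith
    have h7 : ‖p.1‖ ≤ 2 * R + 1 := by
      calc ‖p.1‖ = ‖(p.1 + 1 / 2) - 1 / 2‖ := by congr 1; ring
        _ ≤ m + ‖(1 / 2 : ℂ)‖ := norm_sub_le _ _
        _ ≤ 2 * R + 1 := by norm_num; linarith
    have h8 : ‖p.2‖ ^ 2 ≤ 4 * R + 2 := by
      rw [Complex.sq_norm]
      have := Complex.re_le_norm p.1
      unfold rhoDiag at hpos; linarith
    rw [mem_closedBall_zero_iff, Prod.norm_def, max_le_iff]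
    refine ⟨by linarith, ?_⟩
    by_contra hcon
    push Not at hcon
    nlinarith
  have hKcomp : IsCompact K := Metric.isCompact_of_isClosed_isBounded hKc
    (Metric.isBounded_closedBall.subset hKb)
  have := Topology.IsInducing.subtypeVal.isCompact_preimage' hKcomp
    (fun p hp => ⟨⟨p, hKS p hp⟩, rfl⟩ : K ⊆ Set.range (Subtype.val : Siegel → ℂ × ℂ))
  convert! this using 1
  ext W
  have hpos := rhoDiag_pos W
  simp only [Set.mem_ofPred_eq, Set.mem_preimage, K, Set.mem_inter_iff, sigma_base, div_le_iff₀ hpos]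
  refine ⟨fun h => ⟨h, ?_⟩, fun h => h.1⟩
  rw [div_le_iff₀ (by positivity)]
  -- `Re z₁ > 0` on the Siegel domain, so `R ρ(W) ≥ |z₁ + 1/2|² ≥ 1/4`
  have h1 : (1 / 2 : ℝ) ≤ ‖W.1.1 + 1 / 2‖ := by
    have h2 : 0 < W.1.1.re := by
      have := Complex.normSq_nonneg W.1.2
      unfold rhoDiag at hpos; linarith
    have := Complex.re_le_norm (W.1.1 + 1 / 2)
    simp at this
    norm_num
    linarith
  nlinarith

theorem isCompact_sigma_le (Z : Siegel) (R : ℝ) : IsCompact {W : Siegel | sigma Z W ≤ R} := by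
  refine (isCompact_sigma_base_le (4 * sigma base Z * R)).of_isClosed_subset
    (isClosed_le (continuous_sigma_right Z) continuous_const) fun W hW => ?_
  rw [Set.mem_ofPred_eq, sigma_comm]
  refine (sigma_le base Z W).trans ?_
  have := sigma_pos base Z
  have hW' : sigma Z W ≤ R := hW
  gcongr

/-- The sets `σ(Z, W) < 1 + δ` form a neighbourhood basis of `Z`. -/
theorem exists_sigma_lt_imp {Z : Siegel} {U : Set Siegel} (hU : U ∈ 𝓝 Z) :
    ∃ δ : ℝ, 0 < δ ∧ ∀ W, sigma Z W < 1 + δ → W ∈ U := by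
  obtain ⟨V, hVU, hVo, hZV⟩ := mem_nhds_iff.1 hU
  set K := {W : Siegel | sigma Z W ≤ 2} \ V
  have hK : IsCompact K := (isCompact_sigma_le Z 2).diff hVo
  -- off `V`, the function `σ(Z, ·)` attains a minimum greater than `1` on the compact ball
  by_cases hne : K.Nonempty
  · obtain ⟨W0, hW0, hmin⟩ := hK.exists_isMinOn hne (continuous_sigma_right Z).continuousOn
    have h1 : 1 < sigma Z W0 := by
      refine lt_of_le_of_ne (one_le_sigma _ _) fun h => ?_
      exact hW0.2 (eq_of_sigma_eq_one h.symm ▸ hZV)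
    refine ⟨min 1 (sigma Z W0 - 1), lt_min one_pos (by linarith), fun W hW => ?_⟩
    by_contra hWU
    have hW2 : W ∈ K := ⟨by
      have := min_le_left 1 (sigma Z W0 - 1)
      simp only [Set.mem_ofPred_eq]; linarith, fun h => hWU (hVU h)⟩
    have := isMinOn_iff.1 hmin W hW2
    have := min_le_right 1 (sigma Z W0 - 1)
    linarith
  · refine ⟨1, one_pos, fun W hW => ?_⟩
    by_contra hWU
    exact hne ⟨W, by simp only [Set.mem_ofPred_eq]; linarith, fun h => hWU (hVU h)⟩

theorem norm_unitFactor (g : SU21) (Z : Siegel) : ‖unitFactor g Z‖ = 1 := by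
  have := jFactor_ne_zero g Z.2
  rw [unitFactor, norm_div, Complex.norm_real, norm_norm, div_self (norm_ne_zero_iff.2 this)]

theorem unitFactor_ne_zero (g : SU21) (Z : Siegel) : unitFactor g Z ≠ 0 := by
  rw [← norm_ne_zero_iff, norm_unitFactor]; exact one_ne_zero

theorem unitFactor_mul (g h : SU21) (Z : Siegel) :
    unitFactor (g * h) Z = unitFactor g (h • Z) * unitFactor h Z := by
  rw [unitFactor, unitFactor, unitFactor, jFactor_mul g h Z.2, norm_mul, coe_smul]
  push_cast
  rw [mul_div_mul_comm]

theorem unitFactor_one (Z : Siegel) : unitFactor 1 Z = 1 := by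
  simp [unitFactor, jFactor, mat_one]

theorem unitFactor_inv (g : SU21) (Z : Siegel) :
    unitFactor g⁻¹ Z = (unitFactor g (g⁻¹ • Z))⁻¹ := by
  have := unitFactor_mul g g⁻¹ Z
  rw [mul_inv_cancel, unitFactor_one] at this
  exact eq_inv_of_mul_eq_one_right this.symm

theorem conj_unitFactor (g : SU21) (Z : Siegel) : conj (unitFactor g Z) = (unitFactor g Z)⁻¹ := by
  rw [Complex.inv_def, Complex.normSq_eq_norm_sq, norm_unitFactor]; simp

theorem norm_Hfactor (n : ℤ) (Z W : Siegel) : ‖Hfactor n Z W‖ = 1 := by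
  have := norm_ne_zero_iff.2 (rho_ne_zero Z W)
  rw [Hfactor, norm_div, norm_zpow, norm_zpow, Complex.norm_real, norm_norm,
    div_self (zpow_ne_zero _ this)]

theorem Hfactor_eq (n : ℤ) (Z W : Siegel) :
    Hfactor n Z W = (rho Z.1 W.1 / (‖rho Z.1 W.1‖ : ℂ)) ^ n := by
  rw [Hfactor, div_zpow]

theorem Hfactor_self (n : ℤ) (Z : Siegel) : Hfactor n Z Z = 1 := by
  have := rhoDiag_pos Z
  have h : (rhoDiag Z.1 : ℂ) ≠ 0 := by exact_mod_cast this.ne'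
  rw [Hfactor_eq, rho_self, Complex.norm_real, Real.norm_of_nonneg this.le, div_self h, _root_.one_zpow]

theorem conj_unit {z : ℂ} (hz : z ≠ 0) : conj z / (‖z‖ : ℂ) = (z / (‖z‖ : ℂ))⁻¹ := by
  have hn : (‖z‖ : ℂ) ≠ 0 := by exact_mod_cast norm_ne_zero_iff.2 hz
  have : z * conj z = (‖z‖ : ℂ) ^ 2 := by rw [Complex.mul_conj, Complex.normSq_eq_norm_sq]; push_cast; rfl
  rw [inv_div, div_eq_div_iff hn hz]
  linear_combination this

theorem Hfactor_swap (n : ℤ) (Z W : Siegel) : Hfactor n W Z = Hfactor (-n) Z W := by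
  rw [Hfactor_eq, Hfactor_eq, rho_swap Z.1 W.1, Complex.norm_conj, conj_unit (rho_ne_zero Z W),
    _root_.inv_zpow']

theorem conj_Hfactor (n : ℤ) (Z W : Siegel) : conj (Hfactor n Z W) = Hfactor (-n) Z W := by
  rw [Hfactor_eq, Hfactor_eq, map_zpow₀, map_div₀, Complex.conj_ofReal,
    conj_unit (rho_ne_zero Z W), _root_.inv_zpow']

/-- The unitary factor of a point-pair function is automorphic of weight `2k = n` in both variables.
-/
theorem Hfactor_smul (n : ℤ) (g : SU21) (Z W : Siegel) :
    Hfactor n (g • Z) (g • W) * unitFactor g W ^ n = unitFactor g Z ^ n * Hfactor n Z W := by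
  have h1 := jFactor_ne_zero g Z.2
  have h2 := jFactor_ne_zero g W.2
  have h3 := rho_ne_zero (g • Z) (g • W)
  have e := rho_smul g Z W
  have c1 := conj_unit h1
  have n1 : (‖jFactor g Z.1‖ : ℂ) ≠ 0 := by exact_mod_cast norm_ne_zero_iff.2 h1
  have n2 : (‖jFactor g W.1‖ : ℂ) ≠ 0 := by exact_mod_cast norm_ne_zero_iff.2 h2
  have n3 : (‖rho (g • Z).1 (g • W).1‖ : ℂ) ≠ 0 := by exact_mod_cast norm_ne_zero_iff.2 h3
  rw [Hfactor_eq, Hfactor_eq, ← mul_zpow, ← mul_zpow, e, norm_mul, norm_mul, Complex.norm_conj]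
  congr 1
  unfold unitFactor
  have c2 : jFactor g Z.1 * conj (jFactor g Z.1) = (‖jFactor g Z.1‖ : ℂ) ^ 2 := by
    rw [Complex.mul_conj, Complex.normSq_eq_norm_sq]; push_cast; rfl
  push_cast
  field_simp
  linear_combination (-1 : ℂ) * c2

/-- The point-pair function `H_k(Z, W) h(σ(Z, W))` of weight `2k = n` with radial profile `h`. -/
def ker (n : ℤ) (h : ℝ → ℂ) (Z W : Siegel) : ℂ := Hfactor n Z W * h (sigma Z W)

theorem norm_ker (n : ℤ) (h : ℝ → ℂ) (Z W : Siegel) : ‖ker n h Z W‖ = ‖h (sigma Z W)‖ := by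
  rw [ker, norm_mul, norm_Hfactor, one_mul]

theorem freeGreen_eq_ker (s : ℂ) (n : ℤ) : freeGreen s n = ker n (phi s n) := rfl

/-- Point-pair functions are equivariant under `SU(2, 1)`. -/
theorem ker_smul (n : ℤ) (h : ℝ → ℂ) (g : SU21) (Z W : Siegel) :
    ker n h (g • Z) (g • W) * unitFactor g W ^ n = unitFactor g Z ^ n * ker n h Z W := by
  have := Hfactor_smul n g Z W
  rw [ker, ker, sigma_smul]
  linear_combination h (sigma Z W) * this

theorem ker_swap (n : ℤ) (h : ℝ → ℂ) (Z W : Siegel) : ker n h Z W = ker (-n) h W Z := by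
  rw [ker, ker, sigma_comm, Hfactor_swap n W Z]

theorem conj_ker (n : ℤ) (h : ℝ → ℂ) (Z W : Siegel) :
    conj (ker n h Z W) = ker n (fun σ => conj (h σ)) W Z := by
  rw [ker, ker, map_mul, conj_Hfactor, sigma_comm, Hfactor_swap n Z W]

theorem continuous_Hfactor (n : ℤ) : Continuous fun p : Siegel × Siegel => Hfactor n p.1 p.2 := by
  simp only [Hfactor_eq]
  have h : Continuous fun p : Siegel × Siegel => rho p.1.1 p.2.1 :=
    continuous_rho.comp (((continuous_subtype_val.comp continuous_fst).prodMk
      (continuous_subtype_val.comp continuous_snd)))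
  refine Continuous.zpow₀ (h.div (Complex.continuous_ofReal.comp h.norm) fun p => ?_) n
    fun p => Or.inl (div_ne_zero (rho_ne_zero _ _) ?_)
  all_goals
    simp only [Function.comp_apply]
    exact_mod_cast norm_ne_zero_iff.2 (rho_ne_zero p.1 p.2)

theorem measurable_ker (n : ℤ) {h : ℝ → ℂ} (hh : Measurable h) :
    Measurable fun p : Siegel × Siegel => ker n h p.1 p.2 :=
  (continuous_Hfactor n).measurable.mul (hh.comp continuous_sigma.measurable)

theorem continuous_jFactor (g : SU21) : Continuous (jFactor g) := by
  unfold jFactor; fun_prop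

instance : ContinuousConstSMul SU21 Siegel where
  continuous_const_smul g := by
    refine Continuous.subtype_mk (f := fun Z : Siegel => fracLin g Z.1) ?_ _
    have h : Continuous fun Z : Siegel => jFactor g Z.1 :=
      (continuous_jFactor g).comp continuous_subtype_val
    unfold fracLin
    refine Continuous.prodMk (Continuous.div ?_ h fun Z => jFactor_ne_zero g Z.2)
      (Continuous.div ?_ h fun Z => jFactor_ne_zero g Z.2) <;> fun_prop

theorem continuous_unitFactor (g : SU21) : Continuous (unitFactor g) := by
  have h : Continuous fun Z : Siegel => jFactor g Z.1 :=
    (continuous_jFactor g).comp continuous_subtype_val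
  refine h.div (Complex.continuous_ofReal.comp h.norm) fun Z => ?_
  exact_mod_cast norm_ne_zero_iff.2 (jFactor_ne_zero g Z.2)

end

section

/-! ### The invariant measure in polar coordinates -/

open ComplexConjugate ENNReal

/-- The denominator of the fractional linear map of `ℂ²` given by a `3 × 3` matrix. -/
def fracDenom (M : Matrix (Fin 3) (Fin 3) ℂ) (p : ℂ × ℂ) : ℂ := M 2 0 * p.1 + M 2 1 * p.2 + M 2 2

/-- The fractional linear map of `ℂ²` given by a `3 × 3` matrix. -/
def fracMap (M : Matrix (Fin 3) (Fin 3) ℂ) (p : ℂ × ℂ) : ℂ × ℂ :=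
  ((M 0 0 * p.1 + M 0 1 * p.2 + M 0 2) / fracDenom M p,
   (M 1 0 * p.1 + M 1 1 * p.2 + M 1 2) / fracDenom M p)

theorem hasFDerivAt_affine (a b c : ℂ) (p : ℂ × ℂ) :
    HasFDerivAt (fun p : ℂ × ℂ => a * p.1 + b * p.2 + c)
      (a • ContinuousLinearMap.fst ℂ ℂ ℂ + b • ContinuousLinearMap.snd ℂ ℂ ℂ) p :=
  ((hasFDerivAt_fst.const_mul a).add (hasFDerivAt_snd.const_mul b)).add_const c

/-- The real Jacobian determinant of a fractional linear map of `ℂ²`. -/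
theorem exists_hasFDerivAt_fracMap (M : Matrix (Fin 3) (Fin 3) ℂ) {p : ℂ × ℂ}
    (hp : fracDenom M p ≠ 0) :
    ∃ D : ℂ × ℂ →L[ℝ] ℂ × ℂ, HasFDerivAt (fracMap M) D p ∧
      D.det = Complex.normSq M.det / Complex.normSq (fracDenom M p) ^ 3 := by
  set j := fracDenom M p with hj
  set N1 := M 0 0 * p.1 + M 0 1 * p.2 + M 0 2 with hN1
  set N2 := M 1 0 * p.1 + M 1 1 * p.2 + M 1 2 with hN2
  set a := (M 0 0 * j - N1 * M 2 0) / j ^ 2 with ha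
  set b := (M 0 1 * j - N1 * M 2 1) / j ^ 2 with hb
  set c := (M 1 0 * j - N2 * M 2 0) / j ^ 2 with hc
  set d := (M 1 1 * j - N2 * M 2 1) / j ^ 2 with hd
  set L : ℂ × ℂ →ₗ[ℂ] ℂ × ℂ :=
    Matrix.toLin (Module.Basis.finTwoProd ℂ) (Module.Basis.finTwoProd ℂ) !![a, b; c, d] with hL
  have hdiv : ∀ a b c : ℂ, HasFDerivAt (fun p : ℂ × ℂ => (a * p.1 + b * p.2 + c) / fracDenom M p)
      (((a * j - (a * p.1 + b * p.2 + c) * M 2 0) / j ^ 2) • ContinuousLinearMap.fst ℂ ℂ ℂ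
        + ((b * j - (a * p.1 + b * p.2 + c) * M 2 1) / j ^ 2) • ContinuousLinearMap.snd ℂ ℂ ℂ)
      p := by
    intro a b c
    have h := (hasFDerivAt_affine a b c p).mul
      ((hasDerivAt_inv hp).comp_hasFDerivAt p (hasFDerivAt_affine (M 2 0) (M 2 1) (M 2 2) p))
    refine (h.congr_of_eventuallyEq ?_).congr_fderiv ?_
    · exact Eventually.of_forall fun q => div_eq_mul_inv _ _
    · refine ContinuousLinearMap.ext fun v => ?_
      simp only [_root_.add_apply, _root_.smul_apply, smul_eq_mul,
        ContinuousLinearMap.coe_fst', ContinuousLinearMap.coe_snd', Function.comp_apply]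
      have e : M 2 0 * p.1 + M 2 1 * p.2 + M 2 2 = j := rfl
      rw [e]
      field_simp
      ring
  refine ⟨(LinearMap.toContinuousLinearMap L).restrictScalars ℝ, ?_, ?_⟩
  · refine HasFDerivAt.restrictScalars ℝ ?_
    rw [hL, Matrix.toLin_finTwoProd_toContinuousLinearMap]
    exact (hdiv (M 0 0) (M 0 1) (M 0 2)).prodMk (hdiv (M 1 0) (M 1 1) (M 1 2))
  · have e1 : ((LinearMap.toContinuousLinearMap L).restrictScalars ℝ).det
        = LinearMap.det (L.restrictScalars ℝ) := rfl
    have e2 : LinearMap.det L = M.det / j ^ 3 := by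
      rw [hL, LinearMap.det_toLin, Matrix.det_fin_two_of, ha, hb, hc, hd, Matrix.det_fin_three]
      have hjj : j = M 2 0 * p.1 + M 2 1 * p.2 + M 2 2 := rfl
      field_simp
      rw [hN1, hN2, hjj]
      ring
    rw [e1, LinearMap.det_restrictScalars, e2, Algebra.norm_complex_apply]
    simp

theorem measurableSet_siegelSet : MeasurableSet siegelSet := isOpen_siegelSet.measurableSet

instance : (volume : Measure (ℂ × ℂ)).IsAddHaarMeasure :=
  Measure.prod.instIsAddHaarMeasure (volume : Measure ℂ) (volume : Measure ℂ)

theorem measurable_density : Measurable fun p : ℂ × ℂ => ENNReal.ofReal (4 / rhoDiag p ^ 3) :=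
  ENNReal.measurable_ofReal.comp ((continuous_rhoDiag.measurable.pow_const 3).const_div 4)

theorem lintegral_dm (F : ℂ × ℂ → ℝ≥0∞) :
    ∫⁻ Z : Siegel, F Z.1 ∂dm
      = ∫⁻ p in siegelSet, ENNReal.ofReal (4 / rhoDiag p ^ 3) * F p := by
  have hm : Measurable fun Z : Siegel => ENNReal.ofReal (4 / rhoDiag Z.1 ^ 3) :=
    measurable_density.comp measurable_subtype_coe
  rw [dm, lintegral_withDensity_eq_lintegral_mul_non_measurable _ hm
    (Eventually.of_forall fun _ => ENNReal.ofReal_lt_top)]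
  exact lintegral_subtype_comap measurableSet_siegelSet
    (fun p => ENNReal.ofReal (4 / rhoDiag p ^ 3) * F p)

theorem fracLin_eq_fracMap (g : SU21) : fracLin g = fracMap (mat g) := rfl

theorem jFactor_eq_fracDenom (g : SU21) : jFactor g = fracDenom (mat g) := rfl

theorem mat_det (g : SU21) : (mat g).det = 1 := g.1.2

/-- The measure `dm` is invariant under `SU(2, 1)`. -/
theorem lintegral_smul_dm (g : SU21) (f : Siegel → ℝ≥0∞) :
    ∫⁻ Z, f (g • Z) ∂dm = ∫⁻ Z, f Z ∂dm := by
  set F : ℂ × ℂ → ℝ≥0∞ := Function.extend Subtype.val f 0 with hF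
  have hFv : ∀ Z : Siegel, F Z.1 = f Z := fun Z => Subtype.val_injective.extend_apply f 0 Z
  have e1 : ∫⁻ Z, f Z ∂dm = ∫⁻ Z : Siegel, F Z.1 ∂dm := lintegral_congr fun Z => (hFv Z).symm
  have e2 : ∫⁻ Z, f (g • Z) ∂dm = ∫⁻ Z : Siegel, F (fracLin g Z.1) ∂dm :=
    lintegral_congr fun Z => (hFv (g • Z)).symm
  rw [e1, e2, lintegral_dm, lintegral_dm (fun p => F (fracLin g p))]
  have himg : fracLin g '' siegelSet = siegelSet := by
    refine Set.Subset.antisymm ?_ fun p hp => ?_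
    · rintro _ ⟨p, hp, rfl⟩
      exact fracLin_mem g hp
    · refine ⟨fracLin g⁻¹ p, fracLin_mem g⁻¹ hp, ?_⟩
      rw [← fracLin_mul g g⁻¹ hp, mul_inv_cancel]
      exact congrArg Subtype.val (one_smul SU21 (⟨p, hp⟩ : Siegel))
  have hinj : Set.InjOn (fracLin g) siegelSet := by
    intro p hp q hq h
    have h2 : g • (⟨p, hp⟩ : Siegel) = g • (⟨q, hq⟩ : Siegel) := Subtype.ext h
    exact congrArg Subtype.val (MulAction.injective g h2)
  -- the Jacobian determinant `|j(g, p)|⁻⁶` is compensated by `ρ(g p)⁻³ = |j(g, p)|⁶ ρ(p)⁻³`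
  choose! D hD hdet using fun (p : ℂ × ℂ) (hp : p ∈ siegelSet) =>
    exists_hasFDerivAt_fracMap (mat g) (p := p) (jFactor_ne_zero g hp)
  have key := lintegral_image_eq_lintegral_abs_det_fderiv_mul volume measurableSet_siegelSet
    (fun p hp => (hD p hp).hasFDerivWithinAt) hinj
    (fun p => ENNReal.ofReal (4 / rhoDiag p ^ 3) * F p)
  rw [← fracLin_eq_fracMap, himg] at key
  rw [key]
  refine setLIntegral_congr_fun measurableSet_siegelSet fun p hp => ?_
  have hr := rhoDiag_fracLin g hp
  have hj : 0 < Complex.normSq (jFactor g p) := Complex.normSq_pos.2 (jFactor_ne_zero g hp)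
  have hr' : 0 < rhoDiag (fracLin g p) := fracLin_mem g hp
  rw [hdet p hp, mat_det, ← mul_assoc, ← ENNReal.ofReal_mul (abs_nonneg _), ← jFactor_eq_fracDenom,
    map_one, abs_of_nonneg (by positivity), hr]
  congr 2
  field_simp

instance : SMulInvariantMeasure SU21 Siegel dm where
  measure_preimage_smul g s hs := by
    have h := lintegral_smul_dm g (s.indicator 1)
    rw [lintegral_indicator_one hs] at h
    rw [← h, ← lintegral_indicator_one (hs.preimage (continuous_const_smul g).measurable)]
    rfl

/-- The substitution `t = r²`. -/
theorem lintegral_image_sq (q : ℝ → ℝ≥0∞) :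
    ∫⁻ t in Set.Ioi (0 : ℝ), q t = ∫⁻ r in Set.Ioi (0 : ℝ), ENNReal.ofReal (2 * r) * q (r ^ 2) := by
  have himg : (fun r : ℝ => r ^ 2) '' Set.Ioi 0 = Set.Ioi 0 := by
    ext t
    constructor
    · rintro ⟨r, hr, rfl⟩
      have : (0 : ℝ) < r := hr
      exact pow_pos this 2
    · intro ht
      exact ⟨Real.sqrt t, Real.sqrt_pos.2 ht, Real.sq_sqrt (le_of_lt ht)⟩
  have h := lintegral_image_eq_lintegral_abs_deriv_mul (s := Set.Ioi (0 : ℝ))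
    (f := fun r : ℝ => r ^ 2) (f' := fun r => 2 * r) measurableSet_Ioi
    (fun r _ => by simpa using (hasDerivAt_pow 2 r).hasDerivWithinAt)
    (fun a ha b hb hab => by
      have ha' : (0 : ℝ) < a := ha
      have hb' : (0 : ℝ) < b := hb
      exact (pow_left_inj₀ ha'.le hb'.le two_ne_zero).1 hab) q
  rw [himg] at h
  rw [h]
  refine setLIntegral_congr_fun measurableSet_Ioi fun r hr => ?_
  have : (0 : ℝ) < r := hr
  rw [abs_of_pos (by positivity)]

/-- Lebesgue measure on `ℂ` in terms of `|w|²`. -/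
theorem lintegral_normSq {q : ℝ → ℝ≥0∞} (hq : Measurable q) :
    ∫⁻ w : ℂ, q (Complex.normSq w) = ENNReal.ofReal Real.pi * ∫⁻ t in Set.Ioi (0 : ℝ), q t := by
  rw [← Complex.lintegral_comp_polarCoord_symm, lintegral_image_sq q]
  have e : ∀ p : ℝ × ℝ, Complex.normSq (Complex.polarCoord.symm p) = p.1 ^ 2 := fun p => by
    rw [Complex.normSq_eq_norm_sq, Complex.norm_polarCoord_symm, sq_abs]
  simp_rw [e]
  have hm : Measurable fun r : ℝ => ENNReal.ofReal r * q (r ^ 2) :=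
    ENNReal.measurable_ofReal.mul (hq.comp (measurable_id.pow_const 2))
  rw [polarCoord_target, Measure.volume_eq_prod, ← Measure.prod_restrict,
    lintegral_prod _ (by
      simp only [smul_eq_mul]
      exact (hm.comp measurable_fst).aemeasurable)]
  simp only [smul_eq_mul, lintegral_const, Measure.restrict_apply_univ, Real.volume_Ioo]
  rw [lintegral_mul_const _ hm, ← lintegral_const_mul _ (by
    exact (ENNReal.measurable_ofReal.comp (measurable_id.const_mul 2)).mul
      (hq.comp (measurable_id.pow_const 2))), ← lintegral_mul_const _ hm]
  refine setLIntegral_congr_fun measurableSet_Ioi fun r hr => ?_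
  have h0 : (0 : ℝ) < r := hr
  rw [mul_right_comm, ← ENNReal.ofReal_mul h0.le, ← mul_assoc,
    ← ENNReal.ofReal_mul Real.pi_pos.le]
  congr 2
  ring

theorem lintegral_Ioi_add {g : ℝ → ℝ≥0∞} (hg : Measurable g) :
    ∫⁻ a in Set.Ioi (0 : ℝ), ∫⁻ b in Set.Ioi (0 : ℝ), g (a + b)
      = ∫⁻ t in Set.Ioi (0 : ℝ), ENNReal.ofReal t * g t := by
  have h1 : ∀ a : ℝ, ∫⁻ b in Set.Ioi (0 : ℝ), g (a + b)
      = ∫⁻ t, (Set.Ioi a).indicator g t := by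
    intro a
    rw [← lintegral_indicator measurableSet_Ioi,
      ← lintegral_add_left_eq_self ((Set.Ioi a).indicator g) a]
    refine lintegral_congr fun b => ?_
    simp [Set.indicator_apply]
  have hm : Measurable fun p : ℝ × ℝ => (Set.Ioi p.1).indicator g p.2 := by
    have : (fun p : ℝ × ℝ => (Set.Ioi p.1).indicator g p.2)
        = {p : ℝ × ℝ | p.1 < p.2}.indicator (fun p => g p.2) := by
      ext p; simp [Set.indicator_apply]
    rw [this]
    exact (hg.comp measurable_snd).indicator (measurableSet_lt measurable_fst measurable_snd)
  simp_rw [h1]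
  rw [lintegral_lintegral_swap hm.aemeasurable, ← lintegral_indicator measurableSet_Ioi]
  refine lintegral_congr fun t => ?_
  have h2 : ∀ a : ℝ, (Set.Ioi a).indicator g t = (Set.Iio t).indicator (fun _ => g t) a := by
    intro a; simp [Set.indicator_apply]
  simp_rw [h2]
  rw [lintegral_indicator measurableSet_Iio, lintegral_const, Measure.restrict_restrict
    measurableSet_Iio, Measure.restrict_apply_univ, Set.Iio_inter_Ioi, Real.volume_Ioo, sub_zero,
    mul_comm]
  by_cases ht : 0 < t
  · simp [ht]
  · simp [ht, ENNReal.ofReal_of_nonpos (not_lt.1 ht)]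

/-- Lebesgue measure on `ℂ²` in terms of `|w|²`. -/
theorem lintegral_normSq_add {g : ℝ → ℝ≥0∞} (hg : Measurable g) :
    ∫⁻ w : ℂ × ℂ, g (Complex.normSq w.1 + Complex.normSq w.2)
      = ENNReal.ofReal (Real.pi ^ 2) * ∫⁻ t in Set.Ioi (0 : ℝ), ENNReal.ofReal t * g t := by
  have hn := Complex.continuous_normSq.measurable
  have hgm : Measurable fun w : ℂ × ℂ => g (Complex.normSq w.1 + Complex.normSq w.2) :=
    hg.comp ((hn.comp measurable_fst).add (hn.comp measurable_snd))
  rw [Measure.volume_eq_prod, lintegral_prod _ hgm.aemeasurable]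
  have h1 : ∀ a : ℝ, ∫⁻ w : ℂ, g (a + Complex.normSq w)
      = ENNReal.ofReal Real.pi * ∫⁻ b in Set.Ioi (0 : ℝ), g (a + b) := fun a =>
    lintegral_normSq (hg.comp (measurable_const_add a))
  have hm : Measurable fun a : ℝ => ∫⁻ b in Set.Ioi (0 : ℝ), g (a + b) :=
    Measurable.lintegral_prod_right' (f := fun p : ℝ × ℝ => g (p.1 + p.2))
      (hg.comp (measurable_fst.add measurable_snd))
  simp_rw [h1]
  rw [lintegral_const_mul (ENNReal.ofReal Real.pi)
    (f := fun w : ℂ => ∫⁻ b in Set.Ioi (0 : ℝ), g (Complex.normSq w + b)) (hm.comp hn),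
    lintegral_normSq (q := fun a => ∫⁻ b in Set.Ioi (0 : ℝ), g (a + b)) hm, lintegral_Ioi_add hg,
    ← mul_assoc, ← ENNReal.ofReal_mul Real.pi_pos.le, sq]

/-- The matrix of the Cayley transform from the unit ball to the Siegel domain. -/
def cayleyMat : Matrix (Fin 3) (Fin 3) ℂ := !![-1 / 2, 0, 1 / 2; 0, 1, 0; 1, 0, 1]

theorem cayley_denom (w : ℂ × ℂ) : fracDenom cayleyMat w = w.1 + 1 := by
  simp [fracDenom, cayleyMat]

theorem cayley_apply (w : ℂ × ℂ) :
    fracMap cayleyMat w = ((1 - w.1) / 2 / (w.1 + 1), w.2 / (w.1 + 1)) := by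
  rw [fracMap, cayley_denom]
  simp [cayleyMat]
  ring_nf

theorem cayley_det : cayleyMat.det = -1 := by
  rw [Matrix.det_fin_three]
  simp [cayleyMat]
  norm_num

/-- The open unit ball of `ℂ²`. -/
def ball2 : Set (ℂ × ℂ) := {w | Complex.normSq w.1 + Complex.normSq w.2 < 1}

theorem ball2_ne {w : ℂ × ℂ} (hw : w ∈ ball2) : w.1 + 1 ≠ 0 := by
  intro h
  have h1 : w.1 = -1 := eq_neg_of_add_eq_zero_left h
  have h2 : Complex.normSq w.1 + Complex.normSq w.2 < 1 := hw
  rw [h1] at h2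
  have := Complex.normSq_nonneg w.2
  simp at h2
  linarith

theorem rhoDiag_cayley {w : ℂ × ℂ} (hw : w.1 + 1 ≠ 0) :
    rhoDiag (fracMap cayleyMat w) =
      (1 - (Complex.normSq w.1 + Complex.normSq w.2)) / Complex.normSq (w.1 + 1) := by
  have hn : Complex.normSq (w.1 + 1) ≠ 0 := by simpa using hw
  rw [cayley_apply, rhoDiag]
  simp only [map_div₀]
  have e : ((1 - w.1) / 2 / (w.1 + 1)).re = (1 - Complex.normSq w.1) / 2 / Complex.normSq (w.1 + 1) := by
    rw [Complex.div_re]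
    simp only [Complex.normSq_apply, Complex.add_re, Complex.add_im, Complex.one_re, Complex.one_im]
    simp
    ring
  rw [e]
  field_simp
  ring

theorem cayley_add_half {w : ℂ × ℂ} (hw : w.1 + 1 ≠ 0) :
    (fracMap cayleyMat w).1 + 1 / 2 = 1 / (w.1 + 1) := by
  rw [cayley_apply]; field_simp; ring

/-- The Cayley transform maps the unit ball onto the Siegel domain. -/
theorem image_cayley : fracMap cayleyMat '' ball2 = siegelSet := by
  ext p
  constructor
  · rintro ⟨w, hw, rfl⟩
    have hne := ball2_ne hw
    have hw' : Complex.normSq w.1 + Complex.normSq w.2 < 1 := hw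
    change 0 < rhoDiag _
    rw [rhoDiag_cayley hne]
    exact div_pos (by linarith) (Complex.normSq_pos.2 hne)
  · intro hp
    have hp' : 0 < rhoDiag p := hp
    have hz : p.1 + 1 / 2 ≠ 0 := by
      intro h
      have := normSq_add_half p
      rw [h] at this
      have h2 : 0 ≤ ‖p.1 - 1 / 2‖ ^ 2 + ‖p.2‖ ^ 2 := by positivity
      simp only [norm_zero] at this
      linarith
    set w : ℂ × ℂ := ((1 / 2 - p.1) / (p.1 + 1 / 2), p.2 / (p.1 + 1 / 2)) with hw
    have hw1 : w.1 + 1 = 1 / (p.1 + 1 / 2) := by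
      rw [hw, eq_div_iff hz, add_mul, div_mul_cancel₀ _ hz]; ring
    have hne : w.1 + 1 ≠ 0 := by rw [hw1]; exact one_div_ne_zero hz
    have hmap : fracMap cayleyMat w = p := by
      rw [cayley_apply, hw1]
      apply Prod.ext
      · simp only [hw]
        rw [div_div_eq_mul_div, div_one, div_mul_eq_mul_div, sub_mul, div_mul_cancel₀ _ hz]
        ring
      · simp only [hw]
        rw [div_div_eq_mul_div, div_one, div_mul_cancel₀ _ hz]
    refine ⟨w, ?_, hmap⟩
    have h := rhoDiag_cayley hne
    rw [hmap] at h
    have hpos := Complex.normSq_pos.2 hne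
    rw [h] at hp'
    have := (div_pos_iff_of_pos_right hpos).1 hp'
    rw [ball2, Set.mem_ofPred_eq]
    linarith

theorem injOn_cayley : Set.InjOn (fracMap cayleyMat) ball2 := by
  intro w hw v hv h
  have h1 := ball2_ne hw
  have h2 := ball2_ne hv
  have e1 := cayley_add_half h1
  have e2 := cayley_add_half h2
  rw [h, e2] at e1
  have e3 : w.1 + 1 = v.1 + 1 := by
    rw [div_eq_div_iff h2 h1] at e1
    linear_combination e1
  have e4 := congrArg Prod.snd h
  rw [cayley_apply, cayley_apply] at e4
  simp only at e4
  rw [e3, div_left_inj' h2] at e4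
  exact Prod.ext (add_right_cancel e3) e4

/-- The substitution `t = 1 - 1/σ`. -/
theorem lintegral_image_one_sub_inv (q : ℝ → ℝ≥0∞) :
    ∫⁻ t in Set.Ioo (0 : ℝ) 1, q t
      = ∫⁻ σ in Set.Ioi (1 : ℝ), ENNReal.ofReal (σ⁻¹ ^ 2) * q (1 - σ⁻¹) := by
  have himg : (fun σ : ℝ => 1 - σ⁻¹) '' Set.Ioi 1 = Set.Ioo 0 1 := by
    ext t
    constructor
    · rintro ⟨σ, hσ, rfl⟩
      have h1 : (1 : ℝ) < σ := hσ
      have h2 : 0 < σ⁻¹ := by positivity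
      have h3 : σ⁻¹ < 1 := inv_lt_one_of_one_lt₀ h1
      constructor <;> simp only <;> linarith
    · rintro ⟨h0, h1⟩
      have h2 : 0 < 1 - t := by linarith
      refine ⟨(1 - t)⁻¹, (one_lt_inv₀ h2).2 (by linarith), ?_⟩
      simp
  have h := lintegral_image_eq_lintegral_abs_deriv_mul (s := Set.Ioi (1 : ℝ))
    (f := fun σ : ℝ => 1 - σ⁻¹) (f' := fun σ => (σ ^ 2)⁻¹) measurableSet_Ioi
    (fun σ hσ => by
      have h1 : (1 : ℝ) < σ := hσ
      simpa using ((hasDerivAt_inv (by positivity : σ ≠ 0)).const_sub 1).hasDerivWithinAt)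
    (fun a ha b hb hab => by simpa using hab) q
  rw [himg] at h
  rw [h]
  refine setLIntegral_congr_fun measurableSet_Ioi fun r hr => ?_
  have : (1 : ℝ) < r := hr
  rw [abs_of_pos (by positivity), inv_pow]

/-- The invariant measure in polar coordinates about the base point. The Cayley transform carries
`σ(·, base)` to `1 / (1 - |w|²)` on the unit ball, where Lebesgue measure is `π² t dt` in terms of
`t = |w|²`. -/
theorem lintegral_sigma_base {q : ℝ → ℝ≥0∞} (hq : Measurable q) :
    ∫⁻ Z, q (sigma Z base) ∂dm
      = ∫⁻ σ in Set.Ioi (1 : ℝ), ENNReal.ofReal (4 * Real.pi ^ 2 * (σ - 1)) * q σ := by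
  have hb : MeasurableSet ball2 := by
    refine measurableSet_lt ?_ measurable_const
    exact ((Complex.continuous_normSq.measurable.comp measurable_fst).add
      (Complex.continuous_normSq.measurable.comp measurable_snd))
  choose! D hD hdet using fun (w : ℂ × ℂ) (hw : w ∈ ball2) =>
    exists_hasFDerivAt_fracMap cayleyMat (p := w) (by rw [cayley_denom]; exact ball2_ne hw)
  have e1 : ∫⁻ Z, q (sigma Z base) ∂dm
      = ∫⁻ Z : Siegel, (fun p : ℂ × ℂ => q (‖p.1 + 1 / 2‖ ^ 2 / rhoDiag p)) Z.1 ∂dm :=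
    lintegral_congr fun Z => by simp only; rw [sigma_base]
  rw [e1, lintegral_dm (fun p : ℂ × ℂ => q (‖p.1 + 1 / 2‖ ^ 2 / rhoDiag p)), ← image_cayley, lintegral_image_eq_lintegral_abs_det_fderiv_mul volume hb
    (fun p hp => (hD p hp).hasFDerivWithinAt) injOn_cayley]
  -- the pulled-back integrand as a function of `t = |w|²`
  set g : ℝ → ℝ≥0∞ := (Set.Iio 1).indicator fun t =>
    ENNReal.ofReal (4 / (1 - t) ^ 3) * q ((1 - t)⁻¹) with hg
  have hgm : Measurable g := by
    refine Measurable.indicator ?_ measurableSet_Iio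
    have h1 : Measurable fun t : ℝ => 1 - t := measurable_const.sub measurable_id
    exact (ENNReal.measurable_ofReal.comp ((h1.pow_const 3).const_div 4)).mul (hq.comp h1.inv)
  have e2 : ∫⁻ w in ball2, ENNReal.ofReal |(D w).det|
        * (ENNReal.ofReal (4 / rhoDiag (fracMap cayleyMat w) ^ 3)
          * q (‖(fracMap cayleyMat w).1 + 1 / 2‖ ^ 2 / rhoDiag (fracMap cayleyMat w)))
      = ∫⁻ w : ℂ × ℂ, g (Complex.normSq w.1 + Complex.normSq w.2) := by
    rw [← lintegral_indicator hb]
    refine lintegral_congr fun w => ?_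
    by_cases hw : w ∈ ball2
    · have hne := ball2_ne hw
      have hw' : Complex.normSq w.1 + Complex.normSq w.2 < 1 := hw
      have hpos := Complex.normSq_pos.2 hne
      rw [Set.indicator_of_mem hw, hg, Set.indicator_of_mem (by exact hw), rhoDiag_cayley hne,
        cayley_add_half hne, hdet w hw, cayley_det, cayley_denom, ← mul_assoc,
        ← ENNReal.ofReal_mul (abs_nonneg _), Complex.sq_norm, map_div₀, map_one, Complex.normSq_neg,
        map_one]
      have h1 : 0 < 1 - (Complex.normSq w.1 + Complex.normSq w.2) := by linarith
      congr 2
      · rw [abs_of_nonneg (by positivity)]; field_simp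
      · field_simp
    · rw [Set.indicator_of_notMem hw, hg, Set.indicator_of_notMem (by exact hw)]
  rw [e2, lintegral_normSq_add hgm]
  have e3 : ∫⁻ t in Set.Ioi (0 : ℝ), ENNReal.ofReal t * g t
      = ∫⁻ t in Set.Ioo (0 : ℝ) 1, ENNReal.ofReal t *
        (ENNReal.ofReal (4 / (1 - t) ^ 3) * q ((1 - t)⁻¹)) := by
    rw [← lintegral_indicator measurableSet_Ioi, ← lintegral_indicator measurableSet_Ioo]
    refine lintegral_congr fun t => ?_
    by_cases h0 : 0 < t <;> by_cases h1 : t < 1 <;> simp [Set.indicator_apply, hg, h0, h1]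
  rw [e3, lintegral_image_one_sub_inv, ← lintegral_const_mul' _ _ ENNReal.ofReal_ne_top]
  refine setLIntegral_congr_fun measurableSet_Ioi fun σ hσ => ?_
  have h1 : (1 : ℝ) < σ := hσ
  have h3 : σ⁻¹ ≤ 1 := inv_le_one_of_one_le₀ h1.le
  simp only [_root_.sub_sub_cancel, inv_inv]
  rw [← mul_assoc, ← mul_assoc, ← mul_assoc, ← ENNReal.ofReal_mul (by positivity),
    ← ENNReal.ofReal_mul (by positivity),
    ← ENNReal.ofReal_mul (mul_nonneg (by positivity) (by linarith))]
  congr 2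
  field_simp

/-- The invariant measure in polar coordinates about `Z`. -/
theorem lintegral_sigma (Z : Siegel) {q : ℝ → ℝ≥0∞} (hq : Measurable q) :
    ∫⁻ W, q (sigma Z W) ∂dm
      = ∫⁻ σ in Set.Ioi (1 : ℝ), ENNReal.ofReal (4 * Real.pi ^ 2 * (σ - 1)) * q σ := by
  obtain ⟨g, rfl⟩ := exists_smul_base Z
  rw [← lintegral_smul_dm g, ← lintegral_sigma_base hq]
  refine lintegral_congr fun W => ?_
  rw [sigma_smul, sigma_comm]

/-- The distribution of `σ(Z, ·)` under the invariant measure. -/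
def radial : Measure ℝ :=
  (volume.restrict (Set.Ioi (1 : ℝ))).withDensity fun σ => ENNReal.ofReal (4 * Real.pi ^ 2 * (σ - 1))

theorem measurable_radial_density :
    Measurable fun σ : ℝ => ENNReal.ofReal (4 * Real.pi ^ 2 * (σ - 1)) :=
  ENNReal.measurable_ofReal.comp ((measurable_id.sub_const 1).const_mul _)

theorem measurable_sigma (Z : Siegel) : Measurable (sigma Z) := (continuous_sigma_right Z).measurable

theorem map_sigma (Z : Siegel) : Measure.map (sigma Z) dm = radial := by
  ext s hs
  have h := lintegral_sigma Z (q := s.indicator 1) (measurable_one.indicator hs)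
  rw [Measure.map_apply (measurable_sigma Z) hs, radial, withDensity_apply _ hs,
    ← lintegral_indicator hs, ← lintegral_indicator_one ((measurable_sigma Z) hs)]
  refine h.trans (lintegral_congr fun σ => ?_)
  by_cases hσ : σ ∈ s <;> simp [hσ]

theorem measurePreserving_sigma (Z : Siegel) : MeasurePreserving (sigma Z) dm radial :=
  ⟨measurable_sigma Z, map_sigma Z⟩

end

section

/-! ### Wirtinger derivatives of point-pair functions -/

open ComplexConjugate

/-- The Wirtinger derivatives in the complex direction `e` in a uniform notation: `ε = -1` gives
`∂_e` and `ε = 1` gives the conjugate derivative. -/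
def wd (e : ℂ × ℂ) (ε : ℂ) (F : ℂ × ℂ → ℂ) (p : ℂ × ℂ) : ℂ :=
  (fderiv ℝ F p e + ε * Complex.I * fderiv ℝ F p (Complex.I • e)) / 2

theorem dWirt_eq (e : ℂ × ℂ) (F : ℂ × ℂ → ℂ) : dWirt e F = wd e (-1) F := by
  ext p; simp only [dWirt, wd]; ring

theorem dWirtBar_eq (e : ℂ × ℂ) (F : ℂ × ℂ → ℂ) : dWirtBar e F = wd e 1 F := by
  ext p; simp only [dWirtBar, wd]; ring

theorem differentiableAt_div {E 𝕜 : Type*} [NormedAddCommGroup E] [NormedSpace ℝ E]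
    [NormedField 𝕜] [NormedAlgebra ℝ 𝕜] {F G : E → 𝕜} {p : E} (hF : DifferentiableAt ℝ F p)
    (hG : DifferentiableAt ℝ G p) (h0 : G p ≠ 0) : DifferentiableAt ℝ (fun q => F q / G q) p := by
  simp only [div_eq_mul_inv]
  exact hF.fun_mul (hG.fun_inv h0)

section Rules

variable {e : ℂ × ℂ} {ε : ℂ} {F G : ℂ × ℂ → ℂ} {p : ℂ × ℂ}

theorem wd_congr (h : F =ᶠ[𝓝 p] G) : wd e ε F p = wd e ε G p := by
  rw [wd, wd, h.fderiv_eq]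

theorem wd_of_hasFDerivAt {F' : ℂ × ℂ →L[ℝ] ℂ} (h : HasFDerivAt F F' p) :
    wd e ε F p = (F' e + ε * Complex.I * F' (Complex.I • e)) / 2 := by rw [wd, h.fderiv]

theorem wd_const (c : ℂ) : wd e ε (fun _ => c) p = 0 := by
  simp [wd_of_hasFDerivAt (hasFDerivAt_const c p)]

theorem wd_add (hF : DifferentiableAt ℝ F p) (hG : DifferentiableAt ℝ G p) :
    wd e ε (fun q => F q + G q) p = wd e ε F p + wd e ε G p := by
  rw [wd_of_hasFDerivAt (hF.hasFDerivAt.fun_add hG.hasFDerivAt), wd, wd]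
  simp; ring

theorem wd_sub (hF : DifferentiableAt ℝ F p) (hG : DifferentiableAt ℝ G p) :
    wd e ε (fun q => F q - G q) p = wd e ε F p - wd e ε G p := by
  rw [wd_of_hasFDerivAt (hF.hasFDerivAt.fun_sub hG.hasFDerivAt), wd, wd]
  simp; ring

theorem wd_mul (hF : DifferentiableAt ℝ F p) (hG : DifferentiableAt ℝ G p) :
    wd e ε (fun q => F q * G q) p = wd e ε F p * G p + F p * wd e ε G p := by
  rw [wd_of_hasFDerivAt (hF.hasFDerivAt.fun_mul hG.hasFDerivAt), wd, wd]
  simp; ring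

theorem wd_const_mul (c : ℂ) (hF : DifferentiableAt ℝ F p) :
    wd e ε (fun q => c * F q) p = c * wd e ε F p := by
  rw [wd_mul (differentiableAt_const c) hF, wd_const, zero_mul, zero_add]

theorem wd_inv (hF : DifferentiableAt ℝ F p) (h0 : F p ≠ 0) :
    wd e ε (fun q => (F q)⁻¹) p = -wd e ε F p / F p ^ 2 := by
  have h' := (hasFDerivAt_inv' (𝕜 := ℝ) h0).comp p hF.hasFDerivAt
  have e1 : wd e ε (fun q => (F q)⁻¹) p = _ := wd_of_hasFDerivAt h'
  rw [e1, wd]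
  simp
  field_simp
  ring

theorem wd_div (hF : DifferentiableAt ℝ F p) (hG : DifferentiableAt ℝ G p) (h0 : G p ≠ 0) :
    wd e ε (fun q => F q / G q) p = wd e ε F p / G p - F p * wd e ε G p / G p ^ 2 := by
  simp only [div_eq_mul_inv (F _)]
  rw [wd_mul hF (hG.fun_inv h0), wd_inv hG h0]
  ring

theorem wd_zpow (hF : DifferentiableAt ℝ F p) (h0 : F p ≠ 0) (n : ℤ) :
    wd e ε (fun q => F q ^ n) p = n * (F p ^ n / F p) * wd e ε F p := by
  have h1 := ((hasDerivAt_zpow n (F p) (Or.inl h0)).hasFDerivAt.restrictScalars ℝ).comp p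
    hF.hasFDerivAt
  have e1 : wd e ε (fun q => F q ^ n) p = _ := wd_of_hasFDerivAt h1
  rw [e1, wd, zpow_sub_one₀ h0]
  simp
  field_simp

/-- Chain rule for the composition with a function of a real variable. -/
theorem wd_comp_real {u : ℂ × ℂ → ℝ} (hu : DifferentiableAt ℝ u p) {h : ℝ → ℂ} {h' : ℂ}
    (hh : HasDerivAt h h' (u p)) :
    wd e ε (fun q => h (u q)) p = h' * wd e ε (fun q => (u q : ℂ)) p := by
  have h1 := hh.hasFDerivAt.comp p hu.hasFDerivAt
  have h2 := (Complex.ofRealCLM.hasFDerivAt (x := u p)).comp p hu.hasFDerivAt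
  have e1 : wd e ε (fun q => h (u q)) p = _ := wd_of_hasFDerivAt h1
  have e2 : wd e ε (fun q => (u q : ℂ)) p = _ := wd_of_hasFDerivAt h2
  rw [e1, e2]
  simp
  ring

end Rules

/-- The operator `Δ_k` on functions on `ℂ²`; only germs at points of the Siegel domain matter. -/
def lapC (n : ℤ) (F : ℂ × ℂ → ℂ) (p : ℂ × ℂ) : ℂ :=
  (rhoDiag p : ℂ) *
    ((p.1 + conj p.1) * wd e1 (-1) (wd e1 1 F) p
      + wd e2 (-1) (wd e2 1 F) p
      + p.2 * wd e1 1 (wd e2 (-1) F) p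
      + conj p.2 * wd e1 (-1) (wd e2 1 F) p
      - ((n : ℂ) / 2) * (wd e1 (-1) F p - wd e1 1 F p))

theorem lapl_eq_lapC (n : ℤ) (f : Siegel → ℂ) (Z : Siegel) :
    lapl n f Z = lapC n (extendZero f) Z.1 := by
  simp only [lapl, lapC, dWirt_eq, dWirtBar_eq]

theorem wd_eventuallyEq {e : ℂ × ℂ} {ε : ℂ} {F G : ℂ × ℂ → ℂ} {p : ℂ × ℂ} (h : F =ᶠ[𝓝 p] G) :
    wd e ε F =ᶠ[𝓝 p] wd e ε G := by
  filter_upwards [h.eventuallyEq_nhds] with q hq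
  exact wd_congr hq

theorem lapC_congr {n : ℤ} {F G : ℂ × ℂ → ℂ} {p : ℂ × ℂ} (h : F =ᶠ[𝓝 p] G) :
    lapC n F p = lapC n G p := by
  simp only [lapC, wd_congr h, wd_congr (wd_eventuallyEq h)]

theorem extendZero_apply (f : Siegel → ℂ) (Z : Siegel) : extendZero f Z.1 = f Z :=
  Subtype.val_injective.extend_apply f 0 Z

theorem extendZero_eqOn {f : Siegel → ℂ} {F : ℂ × ℂ → ℂ} (h : ∀ Z : Siegel, f Z = F Z.1) :
    Set.EqOn (extendZero f) F siegelSet := fun p hp => by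
  rw [← h ⟨p, hp⟩]; exact extendZero_apply f ⟨p, hp⟩

theorem lapl_eq_of_eq {n : ℤ} {f : Siegel → ℂ} {F : ℂ × ℂ → ℂ} (h : ∀ Z : Siegel, f Z = F Z.1)
    (Z : Siegel) : lapl n f Z = lapC n F Z.1 := by
  rw [lapl_eq_lapC]
  exact lapC_congr ((extendZero_eqOn h).eventuallyEq_of_mem (isOpen_siegelSet.mem_nhds Z.2))

/-- The point-pair function as a function on `ℂ²` in the first variable. -/
def kerC (n : ℤ) (h : ℝ → ℂ) (W p : ℂ × ℂ) : ℂ :=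
  rho p W ^ n / (‖rho p W‖ : ℂ) ^ n * h (‖rho p W‖ ^ 2 / (rhoDiag p * rhoDiag W))

section Derivatives

variable {W : ℂ × ℂ} {p : ℂ × ℂ} {e : ℂ × ℂ} {ε : ℂ}

theorem differentiable_conj_fst : Differentiable ℝ fun p : ℂ × ℂ => conj p.1 :=
  Complex.conjCLE.differentiable.comp differentiable_fst

theorem differentiable_conj_snd : Differentiable ℝ fun p : ℂ × ℂ => conj p.2 :=
  Complex.conjCLE.differentiable.comp differentiable_snd

theorem wd_conj_fst : wd e ε (fun p : ℂ × ℂ => conj p.1) p = (1 + ε) / 2 * conj e.1 := by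
  have h : HasFDerivAt (fun p : ℂ × ℂ => conj p.1) _ p :=
    (Complex.conjCLE.hasFDerivAt (x := p.1)).comp p (hasFDerivAt_fst (𝕜 := ℝ) (p := p))
  rw [wd_of_hasFDerivAt h]
  simp
  linear_combination (-ε * conj e.1 / 2) * Complex.I_mul_I

theorem wd_conj_snd : wd e ε (fun p : ℂ × ℂ => conj p.2) p = (1 + ε) / 2 * conj e.2 := by
  have h : HasFDerivAt (fun p : ℂ × ℂ => conj p.2) _ p :=
    (Complex.conjCLE.hasFDerivAt (x := p.2)).comp p (hasFDerivAt_snd (𝕜 := ℝ) (p := p))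
  rw [wd_of_hasFDerivAt h]
  simp
  linear_combination (-ε * conj e.2 / 2) * Complex.I_mul_I

theorem wd_fst : wd e ε (fun p : ℂ × ℂ => p.1) p = (1 - ε) / 2 * e.1 := by
  rw [wd_of_hasFDerivAt (hasFDerivAt_fst (𝕜 := ℝ) (p := p))]
  simp
  linear_combination (ε * e.1 / 2) * Complex.I_mul_I

theorem wd_snd : wd e ε (fun p : ℂ × ℂ => p.2) p = (1 - ε) / 2 * e.2 := by
  rw [wd_of_hasFDerivAt (hasFDerivAt_snd (𝕜 := ℝ) (p := p))]
  simp
  linear_combination (ε * e.2 / 2) * Complex.I_mul_I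

theorem differentiable_rho : Differentiable ℝ fun p : ℂ × ℂ => rho p W := by
  have h1 := differentiable_conj_fst
  have h2 := differentiable_conj_snd
  unfold rho
  exact (h1.add_const _).fun_sub (h2.mul_const _)

theorem wd_rho : wd e ε (fun p => rho p W) p = (1 + ε) / 2 * (conj e.1 - conj e.2 * W.2) := by
  have h1 := differentiable_conj_fst p
  have h2 := differentiable_conj_snd p
  unfold rho
  rw [wd_sub (h1.add_const _) (h2.mul_const _), wd_add h1 (differentiableAt_const _),
    wd_mul h2 (differentiableAt_const _), wd_const, wd_const, wd_conj_fst, wd_conj_snd]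
  ring

/-- The conjugate of `ρ(·, W)`, a holomorphic polynomial. -/
def rhoBar (W p : ℂ × ℂ) : ℂ := p.1 + conj W.1 - p.2 * conj W.2

theorem rhoBar_eq : rhoBar W p = conj (rho p W) := by
  simp [rhoBar, rho]

theorem differentiable_rhoBar : Differentiable ℝ (rhoBar W) := by
  unfold rhoBar; fun_prop

theorem wd_rhoBar : wd e ε (rhoBar W) p = (1 - ε) / 2 * (e.1 - e.2 * conj W.2) := by
  have h1 : DifferentiableAt ℝ (fun p : ℂ × ℂ => p.1) p := differentiableAt_fst
  have h2 : DifferentiableAt ℝ (fun p : ℂ × ℂ => p.2) p := differentiableAt_snd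
  unfold rhoBar
  rw [wd_sub (h1.add_const _) (h2.mul_const _), wd_add h1 (differentiableAt_const _),
    wd_mul h2 (differentiableAt_const _), wd_const, wd_const, wd_fst, wd_snd]
  ring

theorem rhoDiag_cast : (rhoDiag p : ℂ) = p.1 + conj p.1 - p.2 * conj p.2 := by
  rw [← rho_self, rho]; ring

theorem differentiable_rhoDiag_cast : Differentiable ℝ fun p : ℂ × ℂ => (rhoDiag p : ℂ) := by
  have h1 := differentiable_conj_fst
  have h2 := differentiable_conj_snd
  simp only [rhoDiag_cast]
  fun_prop

theorem differentiable_rhoDiag : Differentiable ℝ rhoDiag := by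
  have : rhoDiag = fun p => Complex.reCLM (rhoDiag p : ℂ) := by ext p; simp
  rw [this]
  exact Complex.reCLM.differentiable.comp differentiable_rhoDiag_cast

theorem wd_rhoDiag : wd e ε (fun p => (rhoDiag p : ℂ)) p
    = (1 - ε) / 2 * (e.1 - e.2 * conj p.2) + (1 + ε) / 2 * (conj e.1 - p.2 * conj e.2) := by
  have h1 : DifferentiableAt ℝ (fun p : ℂ × ℂ => p.1) p := differentiableAt_fst
  have h2 : DifferentiableAt ℝ (fun p : ℂ × ℂ => p.2) p := differentiableAt_snd
  have h3 := differentiable_conj_fst p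
  have h4 := differentiable_conj_snd p
  simp only [rhoDiag_cast]
  rw [wd_sub (h1.fun_add h3) (h2.fun_mul h4), wd_add h1 h3, wd_mul h2 h4, wd_fst, wd_snd, wd_conj_fst,
    wd_conj_snd]
  ring

/-- The logarithmic derivative of `ρ / conj ρ`. -/
def alphaW (W e : ℂ × ℂ) (ε : ℂ) (p : ℂ × ℂ) : ℂ :=
  wd e ε (fun p => rho p W) p / rho p W - wd e ε (rhoBar W) p / rhoBar W p

/-- The logarithmic derivative of `σ(·, W)`. -/
def sigW (W e : ℂ × ℂ) (ε : ℂ) (p : ℂ × ℂ) : ℂ :=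
  wd e ε (fun p => rho p W) p / rho p W + wd e ε (rhoBar W) p / rhoBar W p
    - wd e ε (fun p => (rhoDiag p : ℂ)) p / (rhoDiag p : ℂ)

/-- `σ` as a function on `ℂ²`. -/
def sigmaC (W p : ℂ × ℂ) : ℝ := ‖rho p W‖ ^ 2 / (rhoDiag p * rhoDiag W)

theorem sigmaC_cast : (sigmaC W p : ℂ) = rho p W * rhoBar W p / (rhoDiag p * rhoDiag W) := by
  rw [sigmaC, rhoBar_eq, Complex.mul_conj, Complex.normSq_eq_norm_sq]
  push_cast
  rfl

theorem rho_ne (hp : p ∈ siegelSet) (hW : W ∈ siegelSet) : rho p W ≠ 0 :=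
  rho_ne_zero (⟨p, hp⟩ : Siegel) (⟨W, hW⟩ : Siegel)

theorem rhoBar_ne (hp : p ∈ siegelSet) (hW : W ∈ siegelSet) : rhoBar W p ≠ 0 := by
  rw [rhoBar_eq]; simpa using rho_ne hp hW

theorem rhoDiag_ne (hp : p ∈ siegelSet) : (rhoDiag p : ℂ) ≠ 0 := by
  have : 0 < rhoDiag p := hp
  exact_mod_cast this.ne'

theorem differentiableAt_sigmaC (hp : p ∈ siegelSet) (hW : W ∈ siegelSet) :
    DifferentiableAt ℝ (sigmaC W) p := by
  have h1 : 0 < rhoDiag p := hp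
  have h2 : 0 < rhoDiag W := hW
  unfold sigmaC
  exact differentiableAt_div ((differentiable_rho p).norm_sq ℝ)
    ((differentiable_rhoDiag p).mul_const _) (by positivity)

theorem wd_sigmaC (hp : p ∈ siegelSet) (hW : W ∈ siegelSet) :
    wd e ε (fun p => (sigmaC W p : ℂ)) p = sigmaC W p * sigW W e ε p := by
  have h1 := rho_ne hp hW
  have h2 := rhoBar_ne hp hW
  have h3 := rhoDiag_ne hp
  have h4 := rhoDiag_ne hW
  simp only [sigmaC_cast]
  rw [wd_div ((differentiable_rho p).fun_mul (differentiable_rhoBar p))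
    ((differentiable_rhoDiag_cast p).mul_const _) (mul_ne_zero h3 h4),
    wd_mul (differentiable_rho p) (differentiable_rhoBar p),
    wd_mul (differentiable_rhoDiag_cast p) (differentiableAt_const _), wd_const, sigW]
  field_simp
  ring

/-- The unitary factor of the point-pair function as a function on `ℂ²`. -/
def hfac (n : ℤ) (W p : ℂ × ℂ) : ℂ := rho p W ^ n / (‖rho p W‖ : ℂ) ^ n

theorem differentiableAt_hfac (n : ℤ) (hp : p ∈ siegelSet) (hW : W ∈ siegelSet) :
    DifferentiableAt ℝ (hfac n W) p := by
  have h1 := rho_ne hp hW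
  have h2 : (‖rho p W‖ : ℂ) ≠ 0 := by exact_mod_cast norm_ne_zero_iff.2 h1
  have d1 : DifferentiableAt ℝ (fun p => (‖rho p W‖ : ℂ)) p :=
    Complex.ofRealCLM.differentiableAt.comp p ((differentiable_rho p).norm ℝ h1)
  have z : ∀ x : ℂ, x ≠ 0 → DifferentiableAt ℝ (fun x : ℂ => x ^ n) x := fun x hx =>
    (differentiableAt_zpow.2 (Or.inl hx)).restrictScalars ℝ
  exact differentiableAt_div
    (DifferentiableAt.comp (g := fun x : ℂ => x ^ n) p (z _ h1) (differentiable_rho p))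
    (DifferentiableAt.comp (g := fun x : ℂ => x ^ n) p (z _ h2) d1) (zpow_ne_zero _ h2)

theorem hfac_ne (n : ℤ) (hp : p ∈ siegelSet) (hW : W ∈ siegelSet) : hfac n W p ≠ 0 := by
  have h1 := rho_ne hp hW
  have h2 : (‖rho p W‖ : ℂ) ≠ 0 := by exact_mod_cast norm_ne_zero_iff.2 h1
  exact div_ne_zero (zpow_ne_zero _ h1) (zpow_ne_zero _ h2)

/-- The square of the unitary factor is `(ρ / conj ρ)ⁿ`, a quotient of polynomials in the
coordinates and their conjugates. -/
theorem hfac_sq (n : ℤ) (hp : p ∈ siegelSet) (hW : W ∈ siegelSet) :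
    hfac n W p * hfac n W p * rhoBar W p ^ n = rho p W ^ n := by
  have h1 := rho_ne hp hW
  have h2 : (‖rho p W‖ : ℂ) ≠ 0 := by exact_mod_cast norm_ne_zero_iff.2 h1
  have h3 : rho p W * rhoBar W p = (‖rho p W‖ : ℂ) * (‖rho p W‖ : ℂ) := by
    rw [rhoBar_eq, Complex.mul_conj, Complex.normSq_eq_norm_sq]; push_cast; ring
  have h4 : rho p W ^ n * rhoBar W p ^ n = (‖rho p W‖ : ℂ) ^ n * (‖rho p W‖ : ℂ) ^ n := by
    rw [← mul_zpow, h3, mul_zpow]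
  have h5 : (‖rho p W‖ : ℂ) ^ n ≠ 0 := zpow_ne_zero _ h2
  rw [hfac]
  field_simp
  linear_combination h4

/-- The derivative of the unitary factor, obtained from that of its square. -/
theorem wd_hfac (n : ℤ) (hp : p ∈ siegelSet) (hW : W ∈ siegelSet) :
    wd e ε (hfac n W) p = n / 2 * alphaW W e ε p * hfac n W p := by
  have h1 := rho_ne hp hW
  have h2 := rhoBar_ne hp hW
  have d := differentiableAt_hfac n hp hW
  have dB : DifferentiableAt ℝ (fun q => rhoBar W q ^ n) p :=
    DifferentiableAt.comp (g := fun x : ℂ => x ^ n) p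
      ((differentiableAt_zpow.2 (Or.inl h2)).restrictScalars ℝ) (differentiable_rhoBar p)
  have key : wd e ε (fun q => hfac n W q * hfac n W q * rhoBar W q ^ n) p
      = wd e ε (fun q => rho q W ^ n) p := by
    refine wd_congr ?_
    filter_upwards [isOpen_siegelSet.mem_nhds hp] with q hq
    exact hfac_sq n hq hW
  rw [wd_mul (d.fun_mul d) dB, wd_mul d d, wd_zpow (differentiable_rhoBar p) h2,
    wd_zpow (differentiable_rho p) h1, ← hfac_sq n hp hW] at key
  have h3 := hfac_ne n hp hW
  have h4 : rhoBar W p ^ n ≠ 0 := zpow_ne_zero _ h2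
  rw [alphaW]
  generalize wd e ε (hfac n W) p = x at *
  generalize wd e ε (fun p => rho p W) p = a at *
  generalize wd e ε (rhoBar W) p = b at *
  generalize rhoBar W p ^ n = B at *
  -- the product rule for `hfac² * rhoBarⁿ = rhoⁿ` determines the derivative `x` of `hfac`
  have h5 : 2 * hfac n W p * B * (x - n / 2 * (a / rho p W - b / rhoBar W p) * hfac n W p) = 0 := by
    field_simp
    field_simp at key
    linear_combination (hfac n W p * B) * key
  have h6 := (mul_eq_zero.1 h5).resolve_left (mul_ne_zero (mul_ne_zero two_ne_zero h3) h4)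
  linear_combination h6

theorem kerC_eq (n : ℤ) (h : ℝ → ℂ) : kerC n h W p = hfac n W p * h (sigmaC W p) := rfl

theorem differentiableAt_kerC (n : ℤ) {h : ℝ → ℂ} (hh : Differentiable ℝ h) (hp : p ∈ siegelSet)
    (hW : W ∈ siegelSet) : DifferentiableAt ℝ (kerC n h W) p :=
  (differentiableAt_hfac n hp hW).mul
    (DifferentiableAt.comp (g := h) p (hh _) (differentiableAt_sigmaC hp hW))

/-- Every first derivative of a point-pair function is a combination of two such functions. -/
theorem wd_kerC (n : ℤ) {h h' : ℝ → ℂ} (hh : ∀ x, HasDerivAt h (h' x) x) (hp : p ∈ siegelSet)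
    (hW : W ∈ siegelSet) : wd e ε (kerC n h W) p
      = n / 2 * alphaW W e ε p * kerC n h W p
        + sigW W e ε p * kerC n (fun x => x * h' x) W p := by
  have d1 := differentiableAt_hfac n hp hW
  have d2 := differentiableAt_sigmaC hp hW
  have d3 : DifferentiableAt ℝ (fun q => h (sigmaC W q)) p :=
    DifferentiableAt.comp (g := h) p (hh _).differentiableAt d2
  have e1 : wd e ε (kerC n h W) p = wd e ε (fun q => hfac n W q * h (sigmaC W q)) p := rfl
  rw [e1, wd_mul d1 d3, wd_hfac n hp hW, wd_comp_real d2 (hh _), wd_sigmaC hp hW, kerC_eq, kerC_eq]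
  ring

theorem differentiableAt_alphaW (hp : p ∈ siegelSet) (hW : W ∈ siegelSet) :
    DifferentiableAt ℝ (alphaW W e ε) p := by
  have h1 := rho_ne hp hW
  have h2 := rhoBar_ne hp hW
  unfold alphaW
  simp only [wd_rho, wd_rhoBar]
  exact (differentiableAt_div (differentiableAt_const _) (differentiable_rho p) h1).fun_sub
    (differentiableAt_div (differentiableAt_const _) (differentiable_rhoBar p) h2)

theorem differentiableAt_sigW (hp : p ∈ siegelSet) (hW : W ∈ siegelSet) :
    DifferentiableAt ℝ (sigW W e ε) p := by
  have h1 := rho_ne hp hW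
  have h2 := rhoBar_ne hp hW
  have h3 := rhoDiag_ne hp
  have d2 := differentiable_conj_snd
  unfold sigW
  simp only [wd_rho, wd_rhoBar, wd_rhoDiag]
  refine ((differentiableAt_div (differentiableAt_const _) (differentiable_rho p) h1).fun_add
    (differentiableAt_div (differentiableAt_const _) (differentiable_rhoBar p) h2)).fun_sub
    (differentiableAt_div ?_ (differentiable_rhoDiag_cast p) h3)
  fun_prop

/-- The second derivatives of a point-pair function. -/
theorem wd_wd_kerC (n : ℤ) {h h1 h2 : ℝ → ℂ} (hh : ∀ x, HasDerivAt h (h1 x) x)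
    (hh1 : ∀ x, HasDerivAt h1 (h2 x) x) (hp : p ∈ siegelSet) (hW : W ∈ siegelSet)
    (f : ℂ × ℂ) (η : ℂ) : wd f η (wd e ε (kerC n h W)) p
      = hfac n W p * (n / 2 * wd f η (alphaW W e ε) p * h (sigmaC W p)
        + n / 2 * alphaW W e ε p * (n / 2 * alphaW W f η p * h (sigmaC W p)
          + sigW W f η p * (sigmaC W p * h1 (sigmaC W p)))
        + wd f η (sigW W e ε) p * (sigmaC W p * h1 (sigmaC W p))
        + sigW W e ε p * (n / 2 * alphaW W f η p * (sigmaC W p * h1 (sigmaC W p))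
          + sigW W f η p * (sigmaC W p * (h1 (sigmaC W p) + sigmaC W p * h2 (sigmaC W p))))) := by
  have hθ : ∀ x : ℝ, HasDerivAt (fun x : ℝ => (x : ℂ) * h1 x) (h1 x + x * h2 x) x := fun x => by
    have := (HasDerivAt.ofReal_comp (hasDerivAt_id x)).fun_mul (hh1 x)
    refine this.congr_deriv ?_
    simp
  have dk := differentiableAt_kerC n (h := h) (fun x => (hh x).differentiableAt) hp hW
  have dk1 := differentiableAt_kerC n (h := fun x => x * h1 x) (fun x => (hθ x).differentiableAt)
    hp hW
  have da := differentiableAt_alphaW (e := e) (ε := ε) hp hW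
  have ds := differentiableAt_sigW (e := e) (ε := ε) hp hW
  have e1 : wd f η (wd e ε (kerC n h W)) p = wd f η (fun q => n / 2 * alphaW W e ε q * kerC n h W q
      + sigW W e ε q * kerC n (fun x => x * h1 x) W q) p := by
    refine wd_congr ?_
    filter_upwards [isOpen_siegelSet.mem_nhds hp] with q hq
    exact wd_kerC n hh hq hW
  rw [e1, wd_add ((da.const_mul _).fun_mul dk) (ds.fun_mul dk1), wd_mul (da.const_mul _) dk,
    wd_mul ds dk1, wd_const_mul _ da, wd_kerC n hh hp hW, wd_kerC n hθ hp hW]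
  simp only [kerC_eq]
  ring

end Derivatives

end

section

/-! ### The radial part of `Δ_k` -/

open ComplexConjugate

section Laplacian

variable {W p e f : ℂ × ℂ} {ε η : ℂ}

theorem wd_alphaW (hp : p ∈ siegelSet) (hW : W ∈ siegelSet) :
    wd f η (alphaW W e ε) p =
      -((1 + ε) / 2 * (conj e.1 - conj e.2 * W.2)) * ((1 + η) / 2 * (conj f.1 - conj f.2 * W.2))
        / rho p W ^ 2
      + ((1 - ε) / 2 * (e.1 - e.2 * conj W.2)) * ((1 - η) / 2 * (f.1 - f.2 * conj W.2))
        / rhoBar W p ^ 2 := by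
  have h1 := rho_ne hp hW
  have h2 := rhoBar_ne hp hW
  unfold alphaW
  simp only [wd_rho, wd_rhoBar]
  rw [wd_sub (differentiableAt_div (differentiableAt_const _) (differentiable_rho p) h1)
    (differentiableAt_div (differentiableAt_const _) (differentiable_rhoBar p) h2),
    wd_div (differentiableAt_const _) (differentiable_rho p) h1,
    wd_div (differentiableAt_const _) (differentiable_rhoBar p) h2, wd_const, wd_const, wd_rho,
    wd_rhoBar]
  ring

theorem wd_sigW (hp : p ∈ siegelSet) (hW : W ∈ siegelSet) :
    wd f η (sigW W e ε) p =
      -((1 + ε) / 2 * (conj e.1 - conj e.2 * W.2)) * ((1 + η) / 2 * (conj f.1 - conj f.2 * W.2))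
        / rho p W ^ 2
      - ((1 - ε) / 2 * (e.1 - e.2 * conj W.2)) * ((1 - η) / 2 * (f.1 - f.2 * conj W.2))
        / rhoBar W p ^ 2
      + ((1 - ε) / 2 * (e.2 * ((1 + η) / 2 * conj f.2))
          + (1 + ε) / 2 * ((1 - η) / 2 * f.2 * conj e.2)) / rhoDiag p
      + ((1 - ε) / 2 * (e.1 - e.2 * conj p.2) + (1 + ε) / 2 * (conj e.1 - p.2 * conj e.2))
        * ((1 - η) / 2 * (f.1 - f.2 * conj p.2) + (1 + η) / 2 * (conj f.1 - p.2 * conj f.2))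
        / (rhoDiag p : ℂ) ^ 2 := by
  have h1 := rho_ne hp hW
  have h2 := rhoBar_ne hp hW
  have h3 := rhoDiag_ne hp
  have d1 : DifferentiableAt ℝ (fun p : ℂ × ℂ => p.2) p := differentiableAt_snd
  have d2 := differentiable_conj_snd p
  have c := fun z : ℂ => differentiableAt_const (𝕜 := ℝ) (E := ℂ × ℂ) (x := p) z
  have dr : DifferentiableAt ℝ (fun p : ℂ × ℂ =>
      (1 - ε) / 2 * (e.1 - e.2 * conj p.2) + (1 + ε) / 2 * (conj e.1 - p.2 * conj e.2)) p := by
    fun_prop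
  unfold sigW
  simp only [wd_rho, wd_rhoBar, wd_rhoDiag]
  rw [wd_sub ((differentiableAt_div (c _) (differentiable_rho p) h1).fun_add
    (differentiableAt_div (c _) (differentiable_rhoBar p) h2))
    (differentiableAt_div dr (differentiable_rhoDiag_cast p) h3),
    wd_add (differentiableAt_div (c _) (differentiable_rho p) h1)
      (differentiableAt_div (c _) (differentiable_rhoBar p) h2),
    wd_div (c _) (differentiable_rho p) h1,
    wd_div (c _) (differentiable_rhoBar p) h2,
    wd_div dr (differentiable_rhoDiag_cast p) h3, wd_const, wd_const, wd_rho, wd_rhoBar, wd_rhoDiag,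
    wd_add (by fun_prop) (by fun_prop), wd_const_mul _ (by fun_prop), wd_const_mul _ (by fun_prop),
    wd_sub (by fun_prop) (by fun_prop), wd_sub (by fun_prop) (by fun_prop), wd_const, wd_const,
    wd_const_mul _ d2, wd_mul d1 (c _), wd_const, wd_conj_snd, wd_snd]
  ring

/-- The radial part of `Δ_k`. -/
def radOp (n : ℤ) (h h1 h2 : ℝ → ℂ) (σ : ℝ) : ℂ :=
  σ * (σ - 1) * h2 σ + (3 * σ - 1) * h1 σ + (n : ℂ) ^ 2 / 4 / σ * h σ

/-- `Δ_k` maps point-pair functions to point-pair functions. -/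
theorem lapC_kerC (n : ℤ) {h h1 h2 : ℝ → ℂ} (hh : ∀ x, HasDerivAt h (h1 x) x)
    (hh1 : ∀ x, HasDerivAt h1 (h2 x) x) (hp : p ∈ siegelSet) (hW : W ∈ siegelSet) :
    lapC n (kerC n h W) p = kerC n (radOp n h h1 h2) W p := by
  have n1 := rho_ne hp hW
  have n2 := rhoBar_ne hp hW
  have n3 := rhoDiag_ne hp
  have n4 := rhoDiag_ne hW
  rw [lapC, wd_wd_kerC n hh hh1 hp hW, wd_wd_kerC n hh hh1 hp hW, wd_wd_kerC n hh hh1 hp hW,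
    wd_wd_kerC n hh hh1 hp hW, wd_kerC n hh hp hW, wd_kerC n hh hp hW]
  simp only [wd_alphaW hp hW, wd_sigW hp hW, kerC_eq, alphaW, sigW, wd_rho, wd_rhoBar, wd_rhoDiag,
    radOp, e1, e2, map_zero, map_one]
  have hσ : (sigmaC W p : ℂ) = _ := sigmaC_cast
  have nσ : (sigmaC W p : ℂ) ≠ 0 := by
    rw [hσ]; exact div_ne_zero (mul_ne_zero n1 n2) (mul_ne_zero n3 n4)
  generalize hfac n W p = E
  generalize h (sigmaC W p) = H0
  generalize h1 (sigmaC W p) = H1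
  generalize h2 (sigmaC W p) = H2
  generalize (sigmaC W p : ℂ) = σ at *
  have hA : rho p W = conj p.1 + W.1 - conj p.2 * W.2 := rfl
  have hB : rhoBar W p = p.1 + conj W.1 - p.2 * conj W.2 := rfl
  have hr : (rhoDiag p : ℂ) = p.1 + conj p.1 - p.2 * conj p.2 := rhoDiag_cast
  have hq : (rhoDiag W : ℂ) = W.1 + conj W.1 - W.2 * conj W.2 := rhoDiag_cast
  generalize rho p W = A at *
  generalize rhoBar W p = B at *
  generalize (rhoDiag p : ℂ) = r at *
  generalize (rhoDiag W : ℂ) = q at *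
  generalize p.1 = z1 at *
  generalize p.2 = z2 at *
  generalize conj z1 = Z1 at *
  generalize conj z2 = Z2 at *
  generalize W.1 = w1 at *
  generalize W.2 = w2 at *
  generalize conj w1 = W1 at *
  generalize conj w2 = W2 at *
  generalize (n : ℂ) = N at *
  -- the coefficients of `h''`, `h'` and `h` are separate rational identities
  have X : r * ((z1 + Z1) * (B⁻¹ - r⁻¹) * (A⁻¹ - r⁻¹)
      + (-W2 / B - -Z2 / r) * (-w2 / A - -z2 / r)
      + z2 * (A⁻¹ - r⁻¹) * (-W2 / B - -Z2 / r) + Z2 * (B⁻¹ - r⁻¹) * (-w2 / A - -z2 / r))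
      = 1 - r * q / (A * B) := by
    field_simp
    subst hA hB hr hq
    ring
  have Y : r * ((z1 + Z1) * (r ^ 2)⁻¹ + (r⁻¹ + z2 * Z2 / r ^ 2) - 2 * (z2 * Z2) / r ^ 2) = 2 := by
    field_simp
    subst hr
    ring
  have Y' : (z1 + Z1) * (A⁻¹ * (B⁻¹ - r⁻¹) - B⁻¹ * (A⁻¹ - r⁻¹))
      + (-w2 / A * (-W2 / B - -Z2 / r) - (-w2 / A - -z2 / r) * (-W2 / B))
      + z2 * (-(-W2 / B * (A⁻¹ - r⁻¹)) + (-W2 / B - -Z2 / r) * A⁻¹)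
      + Z2 * (-w2 / A * (B⁻¹ - r⁻¹) - (-w2 / A - -z2 / r) * B⁻¹)
      - ((B⁻¹ - r⁻¹) - (A⁻¹ - r⁻¹)) = 0 := by
    field_simp
    subst hA hB hr
    ring
  have V : (z1 + Z1) * A⁻¹ * B⁻¹ + -w2 / A * (-W2 / B) + z2 * (-W2 / B) * A⁻¹ + Z2 * (-w2 / A) * B⁻¹
      - (B⁻¹ + A⁻¹) = -(q / (A * B)) := by
    field_simp
    subst hA hB hq
    ring
  have hσ1 : r * q / (A * B) = σ⁻¹ := by rw [hσ, inv_div]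
  have hσ2 : q / (A * B) = σ⁻¹ / r := by rw [← hσ1]; field_simp
  rw [hσ1] at X
  rw [hσ2] at V
  clear hσ1 hσ2 hσ
  have V' : r * (-(σ⁻¹ / r)) = -σ⁻¹ := by field_simp
  norm_num
  rw [div_eq_mul_inv (N ^ 2 / 4) σ]
  have s1 : σ⁻¹ * σ = 1 := inv_mul_cancel₀ nσ
  linear_combination (exp := 1) (E * σ * (H1 + σ * H2)) * X + (E * σ * H1) * Y
    + (r * N / 2 * E * σ * H1) * Y' - (r * N ^ 2 / 4 * E * H0) * V - (N ^ 2 / 4 * E * H0) * V'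
    - (E * (H1 + σ * H2)) * s1

end Laplacian

end

section

/-! ### Green's identity -/

open ComplexConjugate

section GreenIdentity

variable {e f p : ℂ × ℂ} {ε η : ℂ} {F G : ℂ × ℂ → ℂ} {S : Set (ℂ × ℂ)}

theorem contDiffOn_wd {m n : WithTop ℕ∞} (hF : ContDiffOn ℝ n F S) (hS : IsOpen S) (hmn : m + 1 ≤ n) :
    ContDiffOn ℝ m (wd e ε F) S := by
  have h := hF.fderiv_of_isOpen hS hmn
  unfold wd
  exact ((h.clm_apply contDiffOn_const).add
    (contDiffOn_const.mul (h.clm_apply contDiffOn_const))).div_const 2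

/-- Wirtinger derivatives commute, by the symmetry of the second derivative. -/
theorem wd_comm (hF : ContDiffAt ℝ 2 F p) : wd f η (wd e ε F) p = wd e ε (wd f η F) p := by
  have hd : DifferentiableAt ℝ (fderiv ℝ F) p :=
    (hF.fderiv_right (m := 1) (by norm_num)).differentiableAt one_ne_zero
  have hs : ∀ v w, fderiv ℝ (fderiv ℝ F) p v w = fderiv ℝ (fderiv ℝ F) p w v :=
    hF.isSymmSndFDerivAt (by simp)
  have key : ∀ (e : ℂ × ℂ) (ε : ℂ) v, fderiv ℝ (wd e ε F) p v
      = (fderiv ℝ (fderiv ℝ F) p v e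
        + ε * Complex.I * fderiv ℝ (fderiv ℝ F) p v (Complex.I • e)) / 2 := by
    intro e ε v
    have h1 : ∀ w, HasFDerivAt (fun q => fderiv ℝ F q w) ((fderiv ℝ (fderiv ℝ F) p).flip w) p :=
      fun w => by
        simpa using hd.hasFDerivAt.clm_apply (hasFDerivAt_const w p)
    have h2 : HasFDerivAt (wd e ε F) _ p :=
      (((h1 e).fun_add ((h1 (Complex.I • e)).const_mul (ε * Complex.I))).mul_const (2 : ℂ)⁻¹)
    rw [h2.fderiv]
    simp
    ring
  rw [wd, wd, key, key, key, key, hs e f, hs (Complex.I • e) f, hs e (Complex.I • f),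
    hs (Complex.I • e) (Complex.I • f)]
  ring

theorem integral_wd_eq_zero (hF : ContDiff ℝ 1 F) (hc : HasCompactSupport F) :
    Integrable (wd e ε F) ∧ ∫ q, wd e ε F q = 0 := by
  have hi : ∀ v, Integrable fun q => fderiv ℝ F q v := fun v =>
    ((hF.continuous_fderiv one_ne_zero).clm_apply continuous_const).integrable_of_hasCompactSupport
      (hc.fderiv_apply ℝ v)
  have h0 : ∀ v, ∫ q, fderiv ℝ F q v = 0 := by
    intro v
    have := integral_mul_fderiv_eq_neg_fderiv_mul_of_integrable (μ := volume)
      (f := fun _ : ℂ × ℂ => (1 : ℂ)) (g := F) (v := v) (by simp) (by simpa using hi v)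
      (by simpa using hF.continuous.integrable_of_hasCompactSupport hc)
      (fun _ _ => differentiableAt_const _) (fun x _ => hF.differentiable one_ne_zero x)
    simpa using this
  refine ⟨((hi e).add ((hi (Complex.I • e)).const_mul (ε * Complex.I))).div_const 2, ?_⟩
  unfold wd
  rw [integral_div, integral_add (hi e) ((hi _).const_mul _), integral_const_mul, h0, h0]
  simp

/-- The integral of a Wirtinger derivative of a function with compact support in an open set
vanishes. -/
theorem setIntegral_wd_eq_zero (hS : IsOpen S) {K : Set (ℂ × ℂ)} (hK : IsCompact K) (hKS : K ⊆ S)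
    (hF : ContDiffOn ℝ 1 F S) (h0 : ∀ q ∈ S, q ∉ K → F q = 0) :
    IntegrableOn (wd e ε F) S ∧ ∫ q in S, wd e ε F q = 0 := by
  set V := S.indicator F
  have hV0 : ∀ q, q ∉ K → V q = 0 := fun q hq => by
    by_cases hqS : q ∈ S
    · simp [V, hqS, h0 q hqS hq]
    · simp [V, hqS]
  have hVF : ∀ q ∈ S, V =ᶠ[𝓝 q] F := fun q hq => by
    filter_upwards [hS.mem_nhds hq] with x hx
    simp [V, hx]
  have hV0' : ∀ q, q ∉ K → V =ᶠ[𝓝 q] fun _ => 0 := fun q hq => by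
    filter_upwards [hK.isClosed.isOpen_compl.mem_nhds hq] with x hx
    exact hV0 x hx
  have hc : HasCompactSupport V := HasCompactSupport.intro hK hV0
  have hV : ContDiff ℝ 1 V := contDiff_iff_contDiffAt.2 fun q => by
    by_cases hq : q ∈ K
    · exact (hF.contDiffAt (hS.mem_nhds (hKS hq))).congr_of_eventuallyEq (hVF q (hKS hq))
    · exact contDiffAt_const.congr_of_eventuallyEq (hV0' q hq)
  obtain ⟨hi, hz⟩ := integral_wd_eq_zero (e := e) (ε := ε) hV hc
  have hS' : ∀ q ∈ S, wd e ε F q = wd e ε V q := fun q hq => (wd_congr (hVF q hq)).symm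
  constructor
  · exact (hi.integrableOn (s := S)).congr_fun (fun q hq => (hS' q hq).symm) hS.measurableSet
  · rw [setIntegral_congr_fun hS.measurableSet hS', setIntegral_eq_integral_of_forall_compl_eq_zero,
      hz]
    intro q hq
    rw [wd_congr (hV0' q fun h => hq (hKS h)), wd_const]

theorem wd_mul₃ {A B C : ℂ × ℂ → ℂ} (hA : DifferentiableAt ℝ A p) (hB : DifferentiableAt ℝ B p)
    (hC : DifferentiableAt ℝ C p) : wd e ε (fun q => A q * B q * C q) p
      = wd e ε A p * B p * C p + A p * wd e ε B p * C p + A p * B p * wd e ε C p := by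
  rw [wd_mul (hA.fun_mul hB) hC, wd_mul hA hB]
  ring

/-- The first component of the vector field `X u` with `div (ρ⁻² X u) = ρ⁻³ Δ_0 u`. -/
def fieldA (u : ℂ × ℂ → ℂ) (q : ℂ × ℂ) : ℂ :=
  (q.1 + conj q.1) * wd e1 1 u q + conj q.2 * wd e2 1 u q

/-- The second component of the vector field `X u`. -/
def fieldB (u : ℂ × ℂ → ℂ) (q : ℂ × ℂ) : ℂ := q.2 * wd e1 1 u q + wd e2 1 u q

/-- The first component of the conjugate vector field. -/
def fieldA' (u : ℂ × ℂ → ℂ) (q : ℂ × ℂ) : ℂ :=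
  (q.1 + conj q.1) * wd e1 (-1) u q + q.2 * wd e2 (-1) u q

/-- The second component of the conjugate vector field. -/
def fieldB' (u : ℂ × ℂ → ℂ) (q : ℂ × ℂ) : ℂ := conj q.2 * wd e1 (-1) u q + wd e2 (-1) u q

/-- The density `ρ⁻²`. -/
def rhoInvSq (q : ℂ × ℂ) : ℂ := ((rhoDiag q : ℂ))⁻¹ * ((rhoDiag q : ℂ))⁻¹

theorem contDiff_conj {E : Type*} [NormedAddCommGroup E] [NormedSpace ℝ E] {n : WithTop ℕ∞} {f : E → ℂ}
    {s : Set E} (hf : ContDiffOn ℝ n f s) : ContDiffOn ℝ n (fun x => conj (f x)) s :=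
  Complex.conjCLE.contDiff.comp_contDiffOn hf

theorem contDiff_rhoDiag_cast {n : WithTop ℕ∞} : ContDiff ℝ n fun q : ℂ × ℂ => (rhoDiag q : ℂ) := by
  simp only [rhoDiag_cast]
  have h1 : ContDiff ℝ n fun q : ℂ × ℂ => conj q.1 := Complex.conjCLE.contDiff.comp contDiff_fst
  have h2 : ContDiff ℝ n fun q : ℂ × ℂ => conj q.2 := Complex.conjCLE.contDiff.comp contDiff_snd
  exact (contDiff_fst.add h1).sub (contDiff_snd.mul h2)

theorem contDiffOn_rhoInvSq {n : WithTop ℕ∞} : ContDiffOn ℝ n rhoInvSq siegelSet := by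
  have : ContDiffOn ℝ n (fun q : ℂ × ℂ => (rhoDiag q : ℂ)⁻¹) siegelSet :=
    contDiff_rhoDiag_cast.contDiffOn.inv fun q hq => rhoDiag_ne hq
  exact this.mul this

theorem contDiffOn_fields {u : ℂ × ℂ → ℂ} (hu : ContDiffOn ℝ 2 u siegelSet) :
    ContDiffOn ℝ 1 (fieldA u) siegelSet ∧ ContDiffOn ℝ 1 (fieldB u) siegelSet ∧
    ContDiffOn ℝ 1 (fieldA' u) siegelSet ∧ ContDiffOn ℝ 1 (fieldB' u) siegelSet := by
  have h1 : ∀ e ε, ContDiffOn ℝ 1 (wd e ε u) siegelSet := fun e ε =>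
    contDiffOn_wd hu isOpen_siegelSet (by norm_num)
  have f1 : ContDiffOn ℝ 1 (fun q : ℂ × ℂ => q.1) siegelSet := contDiff_fst.contDiffOn
  have f2 : ContDiffOn ℝ 1 (fun q : ℂ × ℂ => q.2) siegelSet := contDiff_snd.contDiffOn
  refine ⟨?_, ?_, ?_, ?_⟩
  · exact ((f1.add (contDiff_conj f1)).mul (h1 _ _)).add ((contDiff_conj f2).mul (h1 _ _))
  · exact (f2.mul (h1 _ _)).add (h1 _ _)
  · exact ((f1.add (contDiff_conj f1)).mul (h1 _ _)).add (f2.mul (h1 _ _))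
  · exact ((contDiff_conj f2).mul (h1 _ _)).add (h1 _ _)

theorem wd_rhoInvSq (hp : p ∈ siegelSet) : wd e ε rhoInvSq p
    = -2 * wd e ε (fun q => (rhoDiag q : ℂ)) p / (rhoDiag p : ℂ) ^ 3 := by
  have h := rhoDiag_ne hp
  have d : DifferentiableAt ℝ (fun q : ℂ × ℂ => ((rhoDiag q : ℂ))⁻¹) p :=
    (differentiable_rhoDiag_cast p).fun_inv h
  unfold rhoInvSq
  rw [wd_mul d d, wd_inv (differentiable_rhoDiag_cast p) h]
  field_simp
  ring

/-- The pointwise form of Green's identity: `ρ⁻³ (g Δ_k u - u Δ_{-k} g)` is a divergence. -/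
theorem lapC_mul_sub_mul_lapC (n : ℤ) {u g : ℂ × ℂ → ℂ} (hu : ContDiffOn ℝ 2 u siegelSet)
    (hg : ContDiffOn ℝ 2 g siegelSet) (hp : p ∈ siegelSet) :
    (lapC n u p * g p - u p * lapC (-n) g p) / (rhoDiag p : ℂ) ^ 3
      = wd e1 (-1) (fun q => rhoInvSq q * g q * fieldA u q) p
        + wd e2 (-1) (fun q => rhoInvSq q * g q * fieldB u q) p
        - wd e1 1 (fun q => rhoInvSq q * u q * fieldA' g q) p
        - wd e2 1 (fun q => rhoInvSq q * u q * fieldB' g q) p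
        - n / 2 * (wd e1 (-1) (fun q => rhoInvSq q * u q * g q) p
          - wd e1 1 (fun q => rhoInvSq q * u q * g q) p) := by
  have hn := isOpen_siegelSet.mem_nhds hp
  have du : DifferentiableAt ℝ u p := (hu.contDiffAt hn).differentiableAt two_ne_zero
  have dg : DifferentiableAt ℝ g p := (hg.contDiffAt hn).differentiableAt two_ne_zero
  have db : DifferentiableAt ℝ rhoInvSq p :=
    (contDiffOn_rhoInvSq.contDiffAt hn).differentiableAt one_ne_zero
  obtain ⟨a1, a2, -, -⟩ := contDiffOn_fields hu
  obtain ⟨-, -, a3, a4⟩ := contDiffOn_fields hg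
  have b1 := (a1.contDiffAt hn).differentiableAt one_ne_zero
  have b2 := (a2.contDiffAt hn).differentiableAt one_ne_zero
  have b3 := (a3.contDiffAt hn).differentiableAt one_ne_zero
  have b4 := (a4.contDiffAt hn).differentiableAt one_ne_zero
  have dw : ∀ {v : ℂ × ℂ → ℂ}, ContDiffOn ℝ 2 v siegelSet → ∀ e ε,
      DifferentiableAt ℝ (wd e ε v) p := fun {v} hv e ε =>
    ((contDiffOn_wd hv isOpen_siegelSet (m := 1) (by norm_num)).contDiffAt hn).differentiableAt
      one_ne_zero
  have d1 : DifferentiableAt ℝ (fun p : ℂ × ℂ => p.1) p := differentiableAt_fst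
  have d2 : DifferentiableAt ℝ (fun p : ℂ × ℂ => p.2) p := differentiableAt_snd
  have d3 := differentiable_conj_fst p
  have d4 := differentiable_conj_snd p
  have c1 : ∀ e ε, wd e ε (fieldA u) p = ((1 - ε) / 2 * e.1 + (1 + ε) / 2 * conj e.1) * wd e1 1 u p
      + (p.1 + conj p.1) * wd e ε (wd e1 1 u) p
      + ((1 + ε) / 2 * conj e.2 * wd e2 1 u p + conj p.2 * wd e ε (wd e2 1 u) p) := fun e ε => by
    unfold fieldA
    rw [wd_add ((d1.fun_add d3).fun_mul (dw hu _ _)) (d4.fun_mul (dw hu _ _)),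
      wd_mul (d1.fun_add d3) (dw hu _ _), wd_mul d4 (dw hu _ _), wd_add d1 d3, wd_fst, wd_conj_fst,
      wd_conj_snd]
  have c2 : ∀ e ε, wd e ε (fieldB u) p = ((1 - ε) / 2 * e.2 * wd e1 1 u p
      + p.2 * wd e ε (wd e1 1 u) p) + wd e ε (wd e2 1 u) p := fun e ε => by
    unfold fieldB
    rw [wd_add (d2.fun_mul (dw hu _ _)) (dw hu _ _), wd_mul d2 (dw hu _ _), wd_snd]
  have c3 : ∀ e ε, wd e ε (fieldA' g) p
      = ((1 - ε) / 2 * e.1 + (1 + ε) / 2 * conj e.1) * wd e1 (-1) g p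
      + (p.1 + conj p.1) * wd e ε (wd e1 (-1) g) p
      + ((1 - ε) / 2 * e.2 * wd e2 (-1) g p + p.2 * wd e ε (wd e2 (-1) g) p) := fun e ε => by
    unfold fieldA'
    rw [wd_add ((d1.fun_add d3).fun_mul (dw hg _ _)) (d2.fun_mul (dw hg _ _)),
      wd_mul (d1.fun_add d3) (dw hg _ _), wd_mul d2 (dw hg _ _), wd_add d1 d3, wd_fst, wd_conj_fst,
      wd_snd]
  have c4 : ∀ e ε, wd e ε (fieldB' g) p = ((1 + ε) / 2 * conj e.2 * wd e1 (-1) g p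
      + conj p.2 * wd e ε (wd e1 (-1) g) p) + wd e ε (wd e2 (-1) g) p := fun e ε => by
    unfold fieldB'
    rw [wd_add (d4.fun_mul (dw hg _ _)) (dw hg _ _), wd_mul d4 (dw hg _ _), wd_conj_snd]
  rw [wd_mul₃ db dg b1, wd_mul₃ db dg b2, wd_mul₃ db du b3, wd_mul₃ db du b4, wd_mul₃ db du dg,
    wd_mul₃ db du dg, c1, c2, c3, c4]
  -- bring the mixed second derivatives on both sides to the same order
  simp only [wd_rhoInvSq hp, wd_rhoDiag, lapC, fieldA, fieldB, fieldA', fieldB', rhoInvSq]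
  rw [wd_comm (e := e1) (ε := 1) (f := e2) (η := -1) (hu.contDiffAt hn),
    wd_comm (e := e1) (ε := -1) (f := e1) (η := 1) (hg.contDiffAt hn),
    wd_comm (e := e2) (ε := -1) (f := e2) (η := 1) (hg.contDiffAt hn),
    wd_comm (e := e1) (ε := -1) (f := e2) (η := 1) (hg.contDiffAt hn)]
  have hr : (rhoDiag p : ℂ) = _ := rhoDiag_cast
  have hr0 := rhoDiag_ne hp
  generalize wd e1 (-1) (wd e1 1 u) p = x1
  generalize wd e2 (-1) (wd e2 1 u) p = x2
  generalize wd e1 1 (wd e2 (-1) u) p = x3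
  generalize wd e1 (-1) (wd e2 1 u) p = x4
  generalize wd e1 (-1) (wd e1 1 g) p = y1
  generalize wd e2 (-1) (wd e2 1 g) p = y2
  generalize wd e1 1 (wd e2 (-1) g) p = y3
  generalize wd e1 (-1) (wd e2 1 g) p = y4
  generalize (rhoDiag p : ℂ) = r at *
  simp only [e1, e2, map_one, map_zero, Int.cast_neg]
  norm_num
  field_simp
  linear_combination (-4 * (wd (1, 0) 1 u p * g p - u p * wd (1, 0) (-1) g p)) * hr

/-- Green's identity for a function with compact support. -/
theorem setIntegral_green (n : ℤ) {u g : ℂ × ℂ → ℂ} (hu : ContDiffOn ℝ 2 u siegelSet)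
    (hg : ContDiffOn ℝ 2 g siegelSet) {K : Set (ℂ × ℂ)} (hK : IsCompact K) (hKS : K ⊆ siegelSet)
    (h0 : ∀ q ∈ siegelSet, q ∉ K → g q = 0) :
    ∫ p in siegelSet, (lapC n u p * g p - u p * lapC (-n) g p) / (rhoDiag p : ℂ) ^ 3 = 0 := by
  have hS := isOpen_siegelSet
  obtain ⟨a1, a2, -, -⟩ := contDiffOn_fields hu
  obtain ⟨-, -, a3, a4⟩ := contDiffOn_fields hg
  have hb : ContDiffOn ℝ 1 rhoInvSq siegelSet := contDiffOn_rhoInvSq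
  have u1 := hu.of_le (m := 1) (by norm_num)
  have g1 := hg.of_le (m := 1) (by norm_num)
  have hw : ∀ e ε, ∀ q ∈ siegelSet, q ∉ K → wd e ε g q = 0 := fun e ε q hq hqK => by
    have : g =ᶠ[𝓝 q] fun _ => 0 := by
      filter_upwards [hS.mem_nhds hq, hK.isClosed.isOpen_compl.mem_nhds hqK] with x hx hxK
      exact h0 x hx hxK
    rw [wd_congr this, wd_const]
  have i1 := setIntegral_wd_eq_zero (e := e1) (ε := -1) hS hK hKS ((hb.mul g1).mul a1)
    (fun q hq hqK => by simp [h0 q hq hqK])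
  have i2 := setIntegral_wd_eq_zero (e := e2) (ε := -1) hS hK hKS ((hb.mul g1).mul a2)
    (fun q hq hqK => by simp [h0 q hq hqK])
  have i3 := setIntegral_wd_eq_zero (e := e1) (ε := 1) hS hK hKS ((hb.mul u1).mul a3)
    (fun q hq hqK => by simp [fieldA', hw _ _ q hq hqK])
  have i4 := setIntegral_wd_eq_zero (e := e2) (ε := 1) hS hK hKS ((hb.mul u1).mul a4)
    (fun q hq hqK => by simp [fieldB', hw _ _ q hq hqK])
  have i5 := fun ε => setIntegral_wd_eq_zero (e := e1) (ε := ε) hS hK hKS ((hb.mul u1).mul g1)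
    (fun q hq hqK => by simp [h0 q hq hqK])
  rw [setIntegral_congr_fun hS.measurableSet fun p hp => lapC_mul_sub_mul_lapC n hu hg hp]
  have j1 := i1.1.add i2.1
  have j2 := j1.sub i3.1
  have j3 := j2.sub i4.1
  have j4 := ((i5 (-1)).1.sub (i5 1).1).const_mul (n / 2 : ℂ)
  refine (integral_sub j3 j4).trans ?_
  rw [integral_sub' j2 i4.1, integral_sub' j1 i3.1, integral_add' i1.1 i2.1, integral_const_mul,
    integral_sub' (i5 (-1)).1 (i5 1).1]
  rw [i1.2, i2.2, i3.2, i4.2, (i5 (-1)).2, (i5 1).2]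
  simp

end GreenIdentity

end

section

/-! ### Integral operators with point-pair kernels of compact support -/

open ComplexConjugate ENNReal

instance : LocallyCompactSpace Siegel := isOpen_siegelSet.locallyCompactSpace

/-- The ball `σ(Z, ·) ≤ R` has measure `O((R - 1)²)`. -/
theorem dm_sigma_le_le (Z : Siegel) {R : ℝ} (hR : 1 ≤ R) :
    dm {W | sigma Z W ≤ R} ≤ ENNReal.ofReal (4 * Real.pi ^ 2 * (R - 1) ^ 2) := by
  have h1 : dm {W | sigma Z W ≤ R} = ∫⁻ W, (Set.Iic R).indicator 1 (sigma Z W) ∂dm := by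
    exact (lintegral_indicator_one ((measurable_sigma Z) measurableSet_Iic)).symm
  rw [h1, lintegral_sigma Z (measurable_one.indicator measurableSet_Iic)]
  calc ∫⁻ σ in Set.Ioi 1, ENNReal.ofReal (4 * Real.pi ^ 2 * (σ - 1)) * (Set.Iic R).indicator 1 σ
      = ∫⁻ σ in Set.Ioi 1, (Set.Iic R).indicator
          (fun σ => ENNReal.ofReal (4 * Real.pi ^ 2 * (σ - 1))) σ := by
        congr 1; ext σ; by_cases h : σ ∈ Set.Iic R <;> simp [h]
    _ = ∫⁻ σ in Set.Iic R ∩ Set.Ioi 1, ENNReal.ofReal (4 * Real.pi ^ 2 * (σ - 1)) := by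
        rw [lintegral_indicator measurableSet_Iic, Measure.restrict_restrict measurableSet_Iic]
    _ ≤ ∫⁻ _ in Set.Iic R ∩ Set.Ioi 1, ENNReal.ofReal (4 * Real.pi ^ 2 * (R - 1)) := by
        refine setLIntegral_mono measurable_const fun σ hσ => ENNReal.ofReal_le_ofReal ?_
        have : σ ≤ R := hσ.1
        gcongr
    _ ≤ ENNReal.ofReal (4 * Real.pi ^ 2 * (R - 1)) * ENNReal.ofReal (R - 1) := by
        rw [setLIntegral_const]
        have : Set.Iic R ∩ Set.Ioi 1 ⊆ Set.Icc 1 R := fun σ hσ => ⟨le_of_lt hσ.2, hσ.1⟩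
        exact mul_le_mul_right ((measure_mono this).trans_eq Real.volume_Icc) _
    _ = ENNReal.ofReal (4 * Real.pi ^ 2 * (R - 1) ^ 2) := by
        have : 0 ≤ R - 1 := by linarith
        rw [← ENNReal.ofReal_mul (by positivity)]
        ring_nf

theorem dm_sigma_le_lt_top (Z : Siegel) (R : ℝ) : dm {W | sigma Z W ≤ R} < ∞ :=
  have h : {W | sigma Z W ≤ R} ⊆ {W | sigma Z W ≤ max R 1} := fun W (h : sigma Z W ≤ R) =>
    show sigma Z W ≤ max R 1 from le_max_of_le_left h
  (measure_mono h).trans_lt ((dm_sigma_le_le Z (le_max_right R 1)).trans_lt ENNReal.ofReal_lt_top)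

theorem exists_subset_sigma_le (Z : Siegel) {K : Set Siegel} (hK : IsCompact K) :
    ∃ R, ∀ W ∈ K, sigma Z W ≤ R := by
  obtain ⟨R, hR⟩ := hK.bddAbove_image (continuous_sigma_right Z).continuousOn
  exact ⟨R, fun W hW => hR ⟨W, hW, rfl⟩⟩

instance : IsFiniteMeasureOnCompacts dm where
  lt_top_of_isCompact K hK := by
    obtain ⟨R, hR⟩ := exists_subset_sigma_le base hK
    exact (measure_mono hR).trans_lt (dm_sigma_le_lt_top base R)

theorem integral_dm (F : ℂ × ℂ → ℂ) :
    ∫ Z : Siegel, F Z.1 ∂dm = ∫ p in siegelSet, (4 / rhoDiag p ^ 3 : ℝ) • F p := by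
  rw [dm, integral_withDensity_eq_integral_toReal_smul
    (f := fun Z : Siegel => ENNReal.ofReal (4 / rhoDiag Z.1 ^ 3))
    (measurable_density.comp measurable_subtype_coe) (by simp)]
  have : ∀ Z : Siegel, (ENNReal.ofReal (4 / rhoDiag Z.1 ^ 3)).toReal = 4 / rhoDiag Z.1 ^ 3 :=
    fun Z => ENNReal.toReal_ofReal (by have := rhoDiag_pos Z; positivity)
  have e : (fun Z : Siegel => (ENNReal.ofReal (4 / rhoDiag Z.1 ^ 3)).toReal • F Z.1)
      = fun Z : Siegel => (fun p => (4 / rhoDiag p ^ 3 : ℝ) • F p) Z.1 := by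
    ext Z; rw [this]
  exact (congrArg (fun φ => ∫ Z, φ Z ∂(Measure.comap Subtype.val volume)) e).trans
    (integral_subtype_comap (μ := volume) measurableSet_siegelSet
      fun p => (4 / rhoDiag p ^ 3 : ℝ) • F p)

section Parametric

set_option linter.unusedSectionVars false

variable {F : Type*} [NormedAddCommGroup F] [NormedSpace ℝ F] [NormedSpace ℂ F]
  [IsScalarTower ℝ ℂ F] [SMulCommClass ℝ ℂ F]

/-- The support of `G(p, ·)` is locally uniformly compact in `p`. -/
def LocSupp (G : (ℂ × ℂ) × (ℂ × ℂ) → F) : Prop :=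
  ∀ p ∈ siegelSet, ∃ V ∈ 𝓝 p, ∃ K : Set Siegel, IsCompact K ∧ ∀ q ∈ V, ∀ ξ : Siegel, ξ ∉ K →
    G (q, ξ.1) = 0

/-- The derivative in the first variable. -/
def dFst (G : (ℂ × ℂ) × (ℂ × ℂ) → F) (q : (ℂ × ℂ) × (ℂ × ℂ)) : ℂ × ℂ →L[ℝ] F :=
  (fderiv ℝ G q).comp (ContinuousLinearMap.inl ℝ (ℂ × ℂ) (ℂ × ℂ))

variable {G : (ℂ × ℂ) × (ℂ × ℂ) → F} {f : Siegel → ℂ}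

theorem isOpen_siegelSet_prod : IsOpen (siegelSet ×ˢ siegelSet) :=
  isOpen_siegelSet.prod isOpen_siegelSet

theorem hasFDerivAt_dFst (hG : ContDiffOn ℝ 1 G (siegelSet ×ˢ siegelSet)) {p : ℂ × ℂ}
    (hp : p ∈ siegelSet) (ξ : Siegel) :
    HasFDerivAt (fun q => G (q, ξ.1)) (dFst G (p, ξ.1)) p := by
  have h1 : HasFDerivAt G (fderiv ℝ G (p, ξ.1)) (p, ξ.1) :=
    ((hG.contDiffAt (isOpen_siegelSet_prod.mem_nhds ⟨hp, ξ.2⟩)).differentiableAt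
      one_ne_zero).hasFDerivAt
  exact h1.comp p (hasFDerivAt_prodMk_left p ξ.1)

theorem contDiffOn_dFst {m n : WithTop ℕ∞} (hG : ContDiffOn ℝ n G (siegelSet ×ˢ siegelSet))
    (hmn : m + 1 ≤ n) : ContDiffOn ℝ m (dFst G) (siegelSet ×ˢ siegelSet) :=
  (hG.fderiv_of_isOpen isOpen_siegelSet_prod hmn).clm_comp contDiffOn_const

theorem LocSupp.dFst (hs : LocSupp G) (hG : ContDiffOn ℝ 1 G (siegelSet ×ˢ siegelSet)) :
    LocSupp (dFst G) := by
  intro p hp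
  obtain ⟨V, hV, K, hK, h0⟩ := hs p hp
  refine ⟨interior V ∩ siegelSet, inter_mem (interior_mem_nhds.2 hV)
    (isOpen_siegelSet.mem_nhds hp), K, hK, fun q hq ξ hξ => ?_⟩
  rw [← (hasFDerivAt_dFst hG hq.2 ξ).fderiv]
  have : (fun q => G (q, ξ.1)) =ᶠ[𝓝 q] fun _ => 0 := by
    filter_upwards [isOpen_interior.mem_nhds hq.1] with x hx
    exact h0 x (interior_subset hx) ξ hξ
  rw [this.fderiv_eq, fderiv_const_apply]

theorem continuous_section (hG : ContinuousOn G (siegelSet ×ˢ siegelSet)) {p : ℂ × ℂ}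
    (hp : p ∈ siegelSet) : Continuous fun ξ : Siegel => G (p, ξ.1) :=
  hG.comp_continuous (by fun_prop) fun ξ => ⟨hp, ξ.2⟩

/-- Local domination of the integrand by an integrable function. -/
theorem exists_bound (hs : LocSupp G) (hG : ContinuousOn G (siegelSet ×ˢ siegelSet))
    (hf : LocallyIntegrable f dm) {p : ℂ × ℂ} (hp : p ∈ siegelSet) :
    ∃ V ∈ 𝓝 p, V ⊆ siegelSet ∧ ∃ b : Siegel → ℝ, Integrable b dm ∧
      ∀ q ∈ V, ∀ ξ : Siegel, ‖f ξ • G (q, ξ.1)‖ ≤ b ξ := by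
  obtain ⟨V, hV, K, hK, h0⟩ := hs p hp
  obtain ⟨V', hV', hV'V, hV'c⟩ := local_compact_nhds
    (inter_mem hV (isOpen_siegelSet.mem_nhds hp))
  have hKc : IsCompact (Subtype.val '' K) := hK.image continuous_subtype_val
  have hcont : ContinuousOn G (V' ×ˢ (Subtype.val '' K)) := hG.mono (by
    rintro ⟨q, w⟩ ⟨hq, ξ, -, rfl⟩
    exact ⟨(hV'V hq).2, ξ.2⟩)
  obtain ⟨C, hC⟩ := (hV'c.prod hKc).exists_bound_of_continuousOn hcont
  refine ⟨V', hV', fun q hq => (hV'V hq).2, K.indicator fun ξ => C * ‖f ξ‖, ?_, fun q hq ξ => ?_⟩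
  · rw [integrable_indicator_iff hK.measurableSet]
    exact ((hf.integrableOn_isCompact hK).norm).const_mul C
  · by_cases hξ : ξ ∈ K
    · rw [Set.indicator_of_mem hξ, norm_smul, mul_comm]
      exact mul_le_mul_of_nonneg_right (hC (q, ξ.1) ⟨hq, ξ, hξ, rfl⟩) (norm_nonneg _)
    · rw [Set.indicator_of_notMem hξ, h0 q (hV'V hq).1 ξ hξ]
      simp

theorem aestronglyMeasurable_smul_section (hG : ContinuousOn G (siegelSet ×ˢ siegelSet))
    (hf : LocallyIntegrable f dm) {p : ℂ × ℂ} (hp : p ∈ siegelSet) :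
    AEStronglyMeasurable (fun ξ : Siegel => f ξ • G (p, ξ.1)) dm :=
  hf.aestronglyMeasurable.smul (continuous_section hG hp).aestronglyMeasurable

theorem integrable_smul_section (hs : LocSupp G) (hG : ContinuousOn G (siegelSet ×ˢ siegelSet))
    (hf : LocallyIntegrable f dm) {p : ℂ × ℂ} (hp : p ∈ siegelSet) :
    Integrable (fun ξ : Siegel => f ξ • G (p, ξ.1)) dm := by
  obtain ⟨V, hV, -, b, hb, hle⟩ := exists_bound hs hG hf hp
  exact hb.mono' (aestronglyMeasurable_smul_section hG hf hp)
    (Eventually.of_forall fun ξ => hle p (mem_of_mem_nhds hV) ξ)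

theorem continuousOn_integral_param (hs : LocSupp G)
    (hG : ContinuousOn G (siegelSet ×ˢ siegelSet)) (hf : LocallyIntegrable f dm) :
    ContinuousOn (fun p => ∫ ξ : Siegel, f ξ • G (p, ξ.1) ∂dm) siegelSet := by
  intro p hp
  obtain ⟨V, hV, hVS, b, hb, hle⟩ := exists_bound hs hG hf hp
  refine ContinuousAt.continuousWithinAt (continuousAt_of_dominated (bound := b) ?_ ?_ hb ?_)
  · filter_upwards [hV] with q hq using aestronglyMeasurable_smul_section hG hf (hVS hq)
  · filter_upwards [hV] with q hq using Eventually.of_forall fun ξ => hle q hq ξ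
  · refine Eventually.of_forall fun ξ => ContinuousAt.const_smul ?_ _
    have : ContinuousAt G (p, ξ.1) := hG.continuousAt (isOpen_siegelSet_prod.mem_nhds ⟨hp, ξ.2⟩)
    exact ContinuousAt.comp (f := fun q => (q, ξ.1)) this (by fun_prop)

/-- Differentiation under the integral sign. -/
theorem hasFDerivAt_integral_param (hs : LocSupp G)
    (hG : ContDiffOn ℝ 1 G (siegelSet ×ˢ siegelSet)) (hf : LocallyIntegrable f dm) {p : ℂ × ℂ}
    (hp : p ∈ siegelSet) : HasFDerivAt (fun p => ∫ ξ : Siegel, f ξ • G (p, ξ.1) ∂dm)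
      (∫ ξ : Siegel, f ξ • dFst G (p, ξ.1) ∂dm) p := by
  have hc' : ContinuousOn (dFst G) (siegelSet ×ˢ siegelSet) :=
    (contDiffOn_dFst (m := 0) hG (by norm_num)).continuousOn
  obtain ⟨V, hV, hVS, b, hb, hle⟩ := exists_bound (hs.dFst hG) hc' hf hp
  refine hasFDerivAt_integral_of_dominated_of_fderiv_le (𝕜 := ℝ) (bound := b)
    (F := fun p (ξ : Siegel) => f ξ • G (p, ξ.1)) (F' := fun p ξ => f ξ • dFst G (p, ξ.1)) hV ?_
    (integrable_smul_section hs hG.continuousOn hf hp)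
    (aestronglyMeasurable_smul_section hc' hf hp) ?_ hb ?_
  · filter_upwards [hV] with q hq
    exact aestronglyMeasurable_smul_section hG.continuousOn hf (hVS hq)
  · exact Eventually.of_forall fun ξ q hq => hle q hq ξ
  · exact Eventually.of_forall fun ξ q hq => (hasFDerivAt_dFst hG (hVS hq) ξ).const_smul (f ξ)

end Parametric

/-- The radial part of `Δ_k` applied to a function of one variable. -/
def radL (n : ℤ) (h : ℝ → ℂ) : ℝ → ℂ := radOp n h (deriv h) (deriv (deriv h))

/-- The point-pair function of both variables on `ℂ² × ℂ²`. -/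
def kerP (n : ℤ) (h : ℝ → ℂ) (q : (ℂ × ℂ) × (ℂ × ℂ)) : ℂ := kerC n h q.2 q.1

/-- The integral operator with a point-pair kernel. -/
def kint (n : ℤ) (h : ℝ → ℂ) (f : Siegel → ℂ) (Z : Siegel) : ℂ := ∫ ξ, ker n h Z ξ * f ξ ∂dm

section Kernels

variable {n : ℤ} {h : ℝ → ℂ} {R : ℝ} {f u : Siegel → ℂ}

theorem contDiff_rho {m : WithTop ℕ∞} :
    ContDiff ℝ m fun q : (ℂ × ℂ) × (ℂ × ℂ) => rho q.1 q.2 := by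
  have h1 : ContDiff ℝ m fun q : (ℂ × ℂ) × (ℂ × ℂ) => conj q.1.1 :=
    Complex.conjCLE.contDiff.comp (contDiff_fst.comp contDiff_fst)
  have h2 : ContDiff ℝ m fun q : (ℂ × ℂ) × (ℂ × ℂ) => conj q.1.2 :=
    Complex.conjCLE.contDiff.comp (contDiff_snd.comp contDiff_fst)
  exact (h1.add (contDiff_fst.comp contDiff_snd)).sub (h2.mul (contDiff_snd.comp contDiff_snd))

theorem contDiff_rhoDiag {m : WithTop ℕ∞} : ContDiff ℝ m rhoDiag := by
  have : rhoDiag = fun p => Complex.reCLM (rhoDiag p : ℂ) := by ext p; simp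
  rw [this]
  exact Complex.reCLM.contDiff.comp contDiff_rhoDiag_cast

theorem contDiffAt_zpow {m : WithTop ℕ∞} (n : ℤ) {z : ℂ} (hz : z ≠ 0) :
    ContDiffAt ℝ m (fun z : ℂ => z ^ n) z :=
  ((AnalyticAt.fun_zpow (𝕜 := ℂ) (f := fun z : ℂ => z) analyticAt_id hz).contDiffAt).restrict_scalars ℝ

theorem contDiffOn_hfacP {m : WithTop ℕ∞} : ContDiffOn ℝ m
    (fun q : (ℂ × ℂ) × (ℂ × ℂ) => rho q.1 q.2 ^ n / (‖rho q.1 q.2‖ : ℂ) ^ n)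
    (siegelSet ×ˢ siegelSet) := by
  intro q hq
  have h1 := rho_ne hq.1 hq.2
  have h2 : (‖rho q.1 q.2‖ : ℂ) ≠ 0 := by exact_mod_cast norm_ne_zero_iff.2 h1
  have h3 : ContDiffAt ℝ m (fun q : (ℂ × ℂ) × (ℂ × ℂ) => (‖rho q.1 q.2‖ : ℂ)) q :=
    Complex.ofRealCLM.contDiff.contDiffAt.comp q (contDiff_rho.contDiffAt.norm ℝ h1)
  have h4 : ContDiffAt ℝ m (fun q : (ℂ × ℂ) × (ℂ × ℂ) => rho q.1 q.2 ^ n) q :=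
    ContDiffAt.comp (g := fun z : ℂ => z ^ n) q (contDiffAt_zpow n h1) contDiff_rho.contDiffAt
  have h5 : ContDiffAt ℝ m (fun q : (ℂ × ℂ) × (ℂ × ℂ) => (‖rho q.1 q.2‖ : ℂ) ^ n) q :=
    ContDiffAt.comp (g := fun z : ℂ => z ^ n) q (contDiffAt_zpow n h2) h3
  simp only [div_eq_mul_inv]
  exact (h4.mul (h5.inv (zpow_ne_zero _ h2))).contDiffWithinAt

theorem contDiffOn_sigmaP {m : WithTop ℕ∞} : ContDiffOn ℝ m
    (fun q : (ℂ × ℂ) × (ℂ × ℂ) => ‖rho q.1 q.2‖ ^ 2 / (rhoDiag q.1 * rhoDiag q.2))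
    (siegelSet ×ˢ siegelSet) := by
  refine ContDiffOn.div (contDiff_rho.norm_sq ℝ).contDiffOn
    ((contDiff_rhoDiag.comp contDiff_fst).mul (contDiff_rhoDiag.comp contDiff_snd)).contDiffOn ?_
  rintro q ⟨h1, h2⟩
  have h1 : 0 < rhoDiag q.1 := h1
  have h2 : 0 < rhoDiag q.2 := h2
  exact (mul_pos h1 h2).ne'

theorem contDiffOn_kerP {m : WithTop ℕ∞} (hh : ContDiff ℝ m h) :
    ContDiffOn ℝ m (kerP n h) (siegelSet ×ˢ siegelSet) :=
  contDiffOn_hfacP.mul (hh.comp_contDiffOn contDiffOn_sigmaP)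

theorem continuousOn_kerP (hh : ContinuousOn h (Set.Ioi 0)) :
    ContinuousOn (kerP n h) (siegelSet ×ˢ siegelSet) := by
  refine (contDiffOn_hfacP (m := 0)).continuousOn.mul
    (hh.comp (contDiffOn_sigmaP (m := 0)).continuousOn fun q hq => ?_)
  exact sigma_pos ⟨q.1, hq.1⟩ ⟨q.2, hq.2⟩

/-- A point-pair function with a profile of bounded support has locally uniformly compact support,
by the triangle inequality `sigma_le`. -/
theorem locSupp_kerP (hR : ∀ σ > R, h σ = 0) : LocSupp (kerP n h) := by
  intro p hp
  set M := sigma base ⟨p, hp⟩ + 1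
  have hV : {q : ℂ × ℂ | sigmaC q base.1 < M} ∈ 𝓝 p := by
    have hc : ContinuousAt (fun q : ℂ × ℂ => sigmaC q base.1) p := by
      have := (contDiffOn_sigmaP (m := 0)).continuousOn.continuousAt
        (isOpen_siegelSet_prod.mem_nhds ⟨base.2, hp⟩ : _ ∈ 𝓝 (base.1, p))
      exact ContinuousAt.comp (f := fun q => (base.1, q)) this (by fun_prop)
    exact hc.eventually_lt_const (show sigma base ⟨p, hp⟩ < M by simp [M])
  refine ⟨_, inter_mem hV (isOpen_siegelSet.mem_nhds hp), _,
    isCompact_sigma_le base (4 * M * max R 0), ?_⟩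
  rintro q ⟨hq, hqS⟩ ξ hξ
  have h1 := sigma_le base ⟨q, hqS⟩ ξ
  have h2 : sigma base ⟨q, hqS⟩ < M := hq
  have h3 : 4 * M * max R 0 < sigma base ξ := not_le.1 hξ
  have h4 := sigma_pos ⟨q, hqS⟩ ξ
  have h5 : 4 * sigma base ⟨q, hqS⟩ * sigma ⟨q, hqS⟩ ξ ≤ 4 * M * sigma ⟨q, hqS⟩ ξ := by gcongr
  have h6 : max R 0 < sigma ⟨q, hqS⟩ ξ := by
    by_contra! hcon
    have hM : 0 ≤ M := by have := sigma_pos base ⟨q, hqS⟩; linarith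
    have : 4 * M * sigma ⟨q, hqS⟩ ξ ≤ 4 * M * max R 0 := by gcongr
    linarith
  have h7 : ker n h ⟨q, hqS⟩ ξ = 0 := by
    rw [ker, hR _ ((le_max_left _ _).trans_lt h6), mul_zero]
  exact h7

theorem deriv_eq_zero_of_gt (hR : ∀ σ > R, h σ = 0) : ∀ σ > R, deriv h σ = 0 := by
  intro σ hσ
  have : h =ᶠ[𝓝 σ] fun _ => 0 := by
    filter_upwards [lt_mem_nhds hσ] with x hx using hR x hx
  rw [this.deriv_eq, deriv_const]

theorem radL_eq_zero_of_gt (hR : ∀ σ > R, h σ = 0) : ∀ σ > R, radL n h σ = 0 := by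
  intro σ hσ
  rw [radL, radOp, hR σ hσ, deriv_eq_zero_of_gt hR σ hσ,
    deriv_eq_zero_of_gt (deriv_eq_zero_of_gt hR) σ hσ]
  simp

theorem contDiff_deriv (hh : ContDiff ℝ 2 h) : ContDiff ℝ 1 (deriv h) :=
  (contDiff_succ_iff_deriv.1 (hh : ContDiff ℝ (1 + 1) h)).2.2

theorem hasDerivAt_of_contDiff (hh : ContDiff ℝ 2 h) :
    (∀ x, HasDerivAt h (deriv h x) x) ∧ ∀ x, HasDerivAt (deriv h) (deriv (deriv h) x) x :=
  ⟨fun x => (hh.differentiable two_ne_zero x).hasDerivAt,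
    fun x => ((contDiff_deriv hh).differentiable one_ne_zero x).hasDerivAt⟩

theorem continuousOn_radL (hh : ContDiff ℝ 2 h) : ContinuousOn (radL n h) (Set.Ioi 0) := by
  have h1 := hh.continuous
  have h2 := (contDiff_deriv hh).continuous
  have h3 : Continuous (deriv (deriv h)) := (contDiff_deriv hh).continuous_deriv le_rfl
  unfold radL radOp
  have h4 : ContinuousOn (fun σ : ℝ => (n : ℂ) ^ 2 / 4 / (σ : ℂ)) (Set.Ioi 0) := by
    refine ContinuousOn.div (by fun_prop) (by fun_prop) fun σ hσ => ?_
    have : (0 : ℝ) < σ := hσ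
    exact_mod_cast this.ne'
  exact (by fun_prop : Continuous fun σ : ℝ => (σ : ℂ) * (σ - 1) * deriv (deriv h) σ
    + (3 * σ - 1) * deriv h σ).continuousOn.add (h4.mul h1.continuousOn)

theorem contDiffOn_of_eq {m : WithTop ℕ∞} {F : ℂ × ℂ → ℂ} (hF : ContDiffOn ℝ m F siegelSet)
    (h : ∀ Z : Siegel, f Z = F Z.1) : ContDiffOn ℝ m (extendZero f) siegelSet :=
  hF.congr (extendZero_eqOn h)

theorem continuous_of_contDiffOn {m : WithTop ℕ∞} (hu : ContDiffOn ℝ m (extendZero u) siegelSet) :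
    Continuous u := by
  have : u = fun Z : Siegel => extendZero u Z.1 := by ext Z; rw [extendZero_apply]
  rw [this]
  exact hu.continuousOn.comp_continuous continuous_subtype_val fun Z => Z.2

theorem continuous_lapl (hu : ContDiffOn ℝ 2 (extendZero u) siegelSet) :
    Continuous (lapl n u) := by
  have h1 : ∀ e ε, ContDiffOn ℝ 1 (wd e ε (extendZero u)) siegelSet := fun e ε =>
    contDiffOn_wd hu isOpen_siegelSet (by norm_num)
  have h2 : ∀ e ε f η, Continuous fun Z : Siegel => wd f η (wd e ε (extendZero u)) Z.1 :=
    fun e ε f η => (contDiffOn_wd (m := 0) (h1 e ε) isOpen_siegelSet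
      (by norm_num)).continuousOn.comp_continuous continuous_subtype_val fun Z => Z.2
  have h3 : ∀ e ε, Continuous fun Z : Siegel => wd e ε (extendZero u) Z.1 :=
    fun e ε => (h1 e ε).continuousOn.comp_continuous continuous_subtype_val Subtype.property
  have h4 : Continuous fun Z : Siegel => (rhoDiag Z.1 : ℂ) :=
    Complex.continuous_ofReal.comp (continuous_rhoDiag.comp continuous_subtype_val)
  have h5 : Continuous fun Z : Siegel => Z.1.1 := continuous_fst.comp continuous_subtype_val
  have h6 : Continuous fun Z : Siegel => Z.1.2 := continuous_snd.comp continuous_subtype_val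
  have : lapl n u = fun Z : Siegel => lapC n (extendZero u) Z.1 := by
    ext Z; rw [lapl_eq_lapC]
  rw [this]
  unfold lapC
  exact h4.mul ((((((h5.add (Complex.continuous_conj.comp h5)).mul (h2 _ _ _ _)).add
    (h2 _ _ _ _)).add (h6.mul (h2 _ _ _ _))).add
    ((Complex.continuous_conj.comp h6).mul (h2 _ _ _ _))).sub
    (continuous_const.mul ((h3 _ _).sub (h3 _ _))))

/-- The integral operator as a function on `ℂ²`. -/
def kintC (n : ℤ) (h : ℝ → ℂ) (f : Siegel → ℂ) (p : ℂ × ℂ) : ℂ :=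
  ∫ ξ : Siegel, f ξ • kerP n h (p, ξ.1) ∂dm

theorem kint_eq_kintC (Z : Siegel) : kint n h f Z = kintC n h f Z.1 :=
  integral_congr_ae (Eventually.of_forall fun _ => mul_comm _ _)

theorem integrable_ker_mul (hh : ContinuousOn h (Set.Ioi 0)) (hR : ∀ σ > R, h σ = 0)
    (hf : LocallyIntegrable f dm) (Z : Siegel) : Integrable (fun ξ => ker n h Z ξ * f ξ) dm :=
  (integrable_smul_section (locSupp_kerP hR) (continuousOn_kerP (n := n) hh) hf Z.2).congr
    (Eventually.of_forall fun _ => mul_comm _ _)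

/-- Point-pair operators of compact support are smoothing. -/
theorem contDiffOn_kint (hh : ContDiff ℝ 2 h) (hR : ∀ σ > R, h σ = 0)
    (hf : LocallyIntegrable f dm) : ContDiffOn ℝ 2 (extendZero (kint n h f)) siegelSet := by
  have hG : ContDiffOn ℝ 2 (kerP n h) (siegelSet ×ˢ siegelSet) := contDiffOn_kerP hh
  have hs : LocSupp (kerP n h) := locSupp_kerP hR
  have hG' : ContDiffOn ℝ 1 (dFst (kerP n h)) (siegelSet ×ˢ siegelSet) :=
    contDiffOn_dFst hG (by norm_num)
  have hs' := hs.dFst (hG.of_le (by norm_num))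
  have hG'' : ContDiffOn ℝ 0 (dFst (dFst (kerP n h))) (siegelSet ×ˢ siegelSet) :=
    contDiffOn_dFst hG' (by norm_num)
  have hs'' := hs'.dFst hG'
  have hS := isOpen_siegelSet
  refine contDiffOn_of_eq ?_ kint_eq_kintC
  have d1 := fun p hp => hasFDerivAt_integral_param hs (hG.of_le (by norm_num)) hf (p := p) hp
  have d2 := fun p hp => hasFDerivAt_integral_param hs' hG' hf (p := p) hp
  have c2 := continuousOn_integral_param hs'' hG''.continuousOn hf
  -- the integral is differentiated twice, and the second derivative is continuous
  have step : ContDiffOn ℝ (0 + 1) (fun p => ∫ ξ : Siegel, f ξ • dFst (kerP n h) (p, ξ.1) ∂dm)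
      siegelSet := by
    rw [contDiffOn_succ_iff_fderiv_of_isOpen hS]
    refine ⟨fun p hp => (d2 p hp).differentiableAt.differentiableWithinAt, by simp, ?_⟩
    exact contDiffOn_zero.2 (c2.congr fun p hp => (d2 p hp).fderiv)
  have : ContDiffOn ℝ (1 + 1) (kintC n h f) siegelSet := by
    rw [contDiffOn_succ_iff_fderiv_of_isOpen hS]
    refine ⟨fun p hp => (d1 p hp).differentiableAt.differentiableWithinAt, by simp, ?_⟩
    exact (by simpa using step : ContDiffOn ℝ 1 _ siegelSet).congr fun p hp => (d1 p hp).fderiv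
  exact this

/-- The Wirtinger derivative in the first variable. -/
def wdP (e : ℂ × ℂ) (ε : ℂ) (G : (ℂ × ℂ) × (ℂ × ℂ) → ℂ) (q : (ℂ × ℂ) × (ℂ × ℂ)) : ℂ :=
  wd e ε (fun p => G (p, q.2)) q.1

theorem wdP_eqOn {G : (ℂ × ℂ) × (ℂ × ℂ) → ℂ} (hG : ContDiffOn ℝ 1 G (siegelSet ×ˢ siegelSet))
    (e : ℂ × ℂ) (ε : ℂ) : Set.EqOn (wdP e ε G)
      (fun q => (dFst G q e + ε * Complex.I * dFst G q (Complex.I • e)) / 2)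
      (siegelSet ×ˢ siegelSet) := by
  rintro ⟨p, w⟩ ⟨hp, hw⟩
  exact wd_of_hasFDerivAt (hasFDerivAt_dFst hG hp ⟨w, hw⟩)

theorem contDiffOn_wdP {m : WithTop ℕ∞} {G : (ℂ × ℂ) × (ℂ × ℂ) → ℂ}
    (hG : ContDiffOn ℝ (m + 1) G (siegelSet ×ˢ siegelSet)) (e : ℂ × ℂ) (ε : ℂ) :
    ContDiffOn ℝ m (wdP e ε G) (siegelSet ×ˢ siegelSet) := by
  have h := contDiffOn_dFst hG le_rfl
  refine ContDiffOn.congr ?_ (wdP_eqOn (hG.of_le le_add_self) e ε)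
  exact ((h.clm_apply contDiffOn_const).add
    (contDiffOn_const.mul (h.clm_apply contDiffOn_const))).div_const 2

theorem LocSupp.wdP {G : (ℂ × ℂ) × (ℂ × ℂ) → ℂ} (hs : LocSupp G) (e : ℂ × ℂ) (ε : ℂ) :
    LocSupp (wdP e ε G) := by
  intro p hp
  obtain ⟨V, hV, K, hK, h0⟩ := hs p hp
  refine ⟨interior V, interior_mem_nhds.2 hV, K, hK, fun q hq ξ hξ => ?_⟩
  have : (fun q => G (q, ξ.1)) =ᶠ[𝓝 q] fun _ => 0 := by
    filter_upwards [isOpen_interior.mem_nhds hq] with x hx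
    exact h0 x (interior_subset hx) ξ hξ
  exact (wd_congr this).trans (wd_const 0)

/-- Wirtinger derivatives pass under the integral sign. -/
theorem wd_integral_param {G : (ℂ × ℂ) × (ℂ × ℂ) → ℂ} (hs : LocSupp G)
    (hG : ContDiffOn ℝ 1 G (siegelSet ×ˢ siegelSet)) (hf : LocallyIntegrable f dm) {p : ℂ × ℂ}
    (hp : p ∈ siegelSet) (e : ℂ × ℂ) (ε : ℂ) :
    wd e ε (fun p => ∫ ξ : Siegel, f ξ • G (p, ξ.1) ∂dm) p
      = ∫ ξ : Siegel, f ξ • wdP e ε G (p, ξ.1) ∂dm := by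
  have hi := integrable_smul_section (hs.dFst hG)
    (contDiffOn_dFst (m := 0) hG (by norm_num)).continuousOn hf hp
  rw [wd_of_hasFDerivAt (hasFDerivAt_integral_param hs hG hf hp),
    ContinuousLinearMap.integral_apply hi, ContinuousLinearMap.integral_apply hi,
    ← integral_const_mul, ← integral_add, ← integral_div]
  · refine integral_congr_ae (Eventually.of_forall fun ξ => ?_)
    simp only [wdP_eqOn hG e ε (⟨hp, ξ.2⟩ : (p, ξ.1) ∈ siegelSet ×ˢ siegelSet),
      _root_.smul_apply, smul_eq_mul]
    ring
  · exact hi.apply_continuousLinearMap _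
  · exact (hi.apply_continuousLinearMap _).const_mul _

/-- `Δ_k` of a point-pair integral is the integral with the kernel `Δ_k` applied to it. -/
theorem lapl_kint (hh : ContDiff ℝ 2 h) (hR : ∀ σ > R, h σ = 0) (hf : LocallyIntegrable f dm)
    (Z : Siegel) : lapl n (kint n h f) Z = kint n (radL n h) f Z := by
  rw [lapl_eq_of_eq kint_eq_kintC, kint_eq_kintC]
  have hG : ContDiffOn ℝ 2 (kerP n h) (siegelSet ×ˢ siegelSet) := contDiffOn_kerP hh
  have hs : LocSupp (kerP n h) := locSupp_kerP hR
  have hp := Z.2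
  have hS := isOpen_siegelSet
  generalize Z.1 = p at hp ⊢
  have g1 : ∀ e ε, ContDiffOn ℝ 1 (wdP e ε (kerP n h)) (siegelSet ×ˢ siegelSet) := fun e ε =>
    contDiffOn_wdP (m := 1) hG e ε
  have w1 : ∀ e ε, ∀ q ∈ siegelSet, wd e ε (kintC n h f) q
      = ∫ ξ : Siegel, f ξ • wdP e ε (kerP n h) (q, ξ.1) ∂dm := fun e ε q hq =>
    wd_integral_param hs (hG.of_le (by norm_num)) hf hq e ε
  have w2 : ∀ e ε e' ε', wd e' ε' (wd e ε (kintC n h f)) p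
      = ∫ ξ : Siegel, f ξ • wdP e' ε' (wdP e ε (kerP n h)) (p, ξ.1) ∂dm := fun e ε e' ε' => by
    have : wd e ε (kintC n h f) =ᶠ[𝓝 p]
        fun q => ∫ ξ : Siegel, f ξ • wdP e ε (kerP n h) (q, ξ.1) ∂dm := by
      filter_upwards [hS.mem_nhds hp] with q hq using w1 e ε q hq
    rw [wd_congr this]
    exact wd_integral_param (hs.wdP e ε) (g1 e ε) hf hp e' ε'
  have i1 : ∀ e ε, Integrable (fun ξ : Siegel => f ξ • wdP e ε (kerP n h) (p, ξ.1)) dm :=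
    fun e ε => integrable_smul_section (hs.wdP e ε) (g1 e ε).continuousOn hf hp
  have i2 : ∀ e ε e' ε',
      Integrable (fun ξ : Siegel => f ξ • wdP e' ε' (wdP e ε (kerP n h)) (p, ξ.1)) dm :=
    fun e ε e' ε' => integrable_smul_section ((hs.wdP e ε).wdP e' ε')
      (contDiffOn_wdP (m := 0) (by simpa using g1 e ε) e' ε').continuousOn hf hp
  obtain ⟨hd1, hd2⟩ := hasDerivAt_of_contDiff hh
  rw [lapC, w2, w2, w2, w2, w1 _ _ p hp, w1 _ _ p hp, kintC]
  simp only [← integral_const_mul]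
  rw [← integral_add ((i2 _ _ _ _).const_mul _) (i2 _ _ _ _),
    ← integral_add _ ((i2 _ _ _ _).const_mul _),
    ← integral_add _ ((i2 _ _ _ _).const_mul _), ← integral_sub (i1 _ _) (i1 _ _),
    ← integral_const_mul, ← integral_sub _ (((i1 _ _).sub' (i1 _ _)).const_mul _),
    ← integral_const_mul]
  · refine integral_congr_ae (Eventually.of_forall fun ξ => ?_)
    have := lapC_kerC n hd1 hd2 hp ξ.2
    simp only [lapC] at this
    simp only [smul_eq_mul]
    have e1 : kerP n (radL n h) (p, ξ.1) = kerC n (radOp n h (deriv h) (deriv (deriv h))) ξ.1 p :=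
      rfl
    rw [e1, ← this]
    simp only [wdP]
    have e2 : (fun p => kerP n h (p, ξ.1)) = kerC n h ξ.1 := rfl
    have e3 : ∀ e ε, (fun p => wd e ε (fun p => kerP n h (p, ξ.1)) p) = wd e ε (kerC n h ξ.1) :=
      fun _ _ => rfl
    rw [e2]
    ring
  · exact ((((i2 _ _ _ _).const_mul _).add (i2 _ _ _ _)).add ((i2 _ _ _ _).const_mul _)).add
      ((i2 _ _ _ _).const_mul _)
  · exact (((i2 _ _ _ _).const_mul _).add (i2 _ _ _ _)).add ((i2 _ _ _ _).const_mul _)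
  · exact ((i2 _ _ _ _).const_mul _).add (i2 _ _ _ _)

theorem _root_.Continuous.locallyIntegrable_dm (hu : Continuous u) : LocallyIntegrable u dm :=
  hu.locallyIntegrable

theorem radL_neg : radL (-n) h = radL n h := by
  ext σ; simp [radL, radOp]

/-- Point-pair operators commute with `Δ_k`. -/
theorem kint_lapl (hh : ContDiff ℝ 2 h) (hR : ∀ σ > R, h σ = 0)
    (hu : ContDiffOn ℝ 2 (extendZero u) siegelSet) (Z : Siegel) :
    kint n h (lapl n u) Z = kint n (radL n h) u Z := by
  have c1 := (continuous_lapl (n := n) hu).locallyIntegrable_dm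
  have c2 := (continuous_of_contDiffOn hu).locallyIntegrable_dm
  have i1 := integrable_ker_mul (n := n) hh.continuous.continuousOn hR c1 Z
  have i2 := integrable_ker_mul (n := n) (continuousOn_radL (n := n) hh)
    (radL_eq_zero_of_gt hR) c2 Z
  -- as a function of the second variable the kernel has weight `-n`; apply Green's identity to it
  rw [kint, kint, ← sub_eq_zero, ← integral_sub i1 i2]
  set g : ℂ × ℂ → ℂ := kerC (-n) h Z.1
  have hg : ContDiffOn ℝ 2 g siegelSet := by
    have : ContDiffOn ℝ 2 (kerP (-n) h) (siegelSet ×ˢ siegelSet) := contDiffOn_kerP hh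
    exact this.comp (f := fun q : ℂ × ℂ => (q, Z.1)) (contDiff_id.prodMk contDiff_const).contDiffOn
      fun q hq => ⟨hq, Z.2⟩
  obtain ⟨hd1, hd2⟩ := hasDerivAt_of_contDiff hh
  have key := setIntegral_green n hu hg ((isCompact_sigma_le Z R).image continuous_subtype_val)
    (by rintro _ ⟨ξ, -, rfl⟩; exact ξ.2) (fun q hq hqK => by
      have h1 : ¬ sigma Z ⟨q, hq⟩ ≤ R := fun hle => hqK ⟨⟨q, hq⟩, hle, rfl⟩
      have h2 : ker (-n) h ⟨q, hq⟩ Z = 0 := by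
        rw [ker, sigma_comm, hR _ (not_le.1 h1), mul_zero]
      exact h2)
  have e1 : ∀ ξ : Siegel, ker n h Z ξ * lapl n u ξ - ker n (radL n h) Z ξ * u ξ
      = (fun p => lapC n (extendZero u) p * g p - extendZero u p * lapC (-n) g p) ξ.1 := by
    intro ξ
    have h3 : lapC (-n) g ξ.1 = ker (-n) (radL (-n) h) ξ Z := lapC_kerC (-n) hd1 hd2 ξ.2 Z.2
    have h4 : g ξ.1 = ker (-n) h ξ Z := rfl
    simp only [h3, h4, extendZero_apply, lapl_eq_lapC, radL_neg]
    rw [ker_swap n h, ker_swap n (radL n h)]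
    ring
  simp only [e1]
  refine (integral_dm fun p =>
    lapC n (extendZero u) p * g p - extendZero u p * lapC (-n) g p).trans ?_
  have e2 : ∀ p ∈ siegelSet, (4 / rhoDiag p ^ 3 : ℝ) •
      (lapC n (extendZero u) p * g p - extendZero u p * lapC (-n) g p)
      = 4 * ((lapC n (extendZero u) p * g p - extendZero u p * lapC (-n) g p)
        / (rhoDiag p : ℂ) ^ 3) := fun p _ => by
    rw [Complex.real_smul]; push_cast; ring
  rw [setIntegral_congr_fun measurableSet_siegelSet e2, integral_const_mul, key, mul_zero]

end Kernels

end

section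

/-! ### Integration of radial functions and cutoff at infinity -/

open ComplexConjugate ENNReal

/-- A majorant of the radial Green function, integrable for the radial measure if `2 < a`. -/
def decay (a σ : ℝ) : ℝ := (σ - 1)⁻¹ * σ ^ (1 - a)

section Radial

variable {a K : ℝ} {q : ℝ → ℂ}

theorem integrable_radial_iff {E : Type*} [NormedAddCommGroup E] [NormedSpace ℝ E] {q : ℝ → E} :
    Integrable q radial ↔ IntegrableOn (fun σ => (4 * Real.pi ^ 2 * (σ - 1)) • q σ) (Set.Ioi 1) := by
  rw [radial, integrable_withDensity_iff_integrable_smul' measurable_radial_density (by simp)]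
  refine integrableOn_congr_fun (fun σ hσ => ?_) measurableSet_Ioi
  have : (1 : ℝ) < σ := hσ
  rw [ENNReal.toReal_ofReal (mul_nonneg (by positivity) (by linarith))]

theorem integral_radial {E : Type*} [NormedAddCommGroup E] [NormedSpace ℝ E] (q : ℝ → E) :
    ∫ σ, q σ ∂radial = ∫ σ in Set.Ioi 1, (4 * Real.pi ^ 2 * (σ - 1)) • q σ := by
  rw [radial, integral_withDensity_eq_integral_toReal_smul measurable_radial_density (by simp)]
  refine setIntegral_congr_fun measurableSet_Ioi fun σ hσ => ?_
  have : (1 : ℝ) < σ := hσ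
  rw [ENNReal.toReal_ofReal (mul_nonneg (by positivity) (by linarith))]

theorem decay_nonneg {σ : ℝ} (hσ : 1 < σ) : 0 ≤ decay a σ := by
  have : 0 < σ - 1 := by linarith
  unfold decay; positivity

theorem rpow_neg_le_decay {σ : ℝ} (hσ : 1 < σ) : σ ^ (-a) ≤ decay a σ := by
  have h0 : 0 < σ - 1 := by linarith
  have h1 : 0 < σ := by linarith
  rw [decay, show 1 - a = -a + 1 by ring, Real.rpow_add_one h1.ne', inv_mul_eq_div, le_div_iff₀ h0]
  gcongr
  linarith

/-- Near the singularity `decay a` controls `1 / (σ - 1)`. -/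
theorem inv_le_decay {σ : ℝ} (ha : 1 ≤ a) (hσ : 1 < σ) (hσ2 : σ ≤ 2) :
    (σ - 1)⁻¹ ≤ 2 ^ (a - 1) * decay a σ := by
  have h0 : 0 < σ - 1 := by linarith
  have h2 : (2 : ℝ) ^ (1 - a) ≤ σ ^ (1 - a) :=
    Real.rpow_le_rpow_of_nonpos (by linarith) hσ2 (by linarith)
  have h3 : (2 : ℝ) ^ (a - 1) * 2 ^ (1 - a) = 1 := by
    rw [← Real.rpow_add two_pos]; simp
  calc (σ - 1)⁻¹ = 2 ^ (a - 1) * ((σ - 1)⁻¹ * 2 ^ (1 - a)) := by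
        rw [mul_left_comm, h3, mul_one]
    _ ≤ _ := by unfold decay; gcongr

theorem ae_radial : ∀ᵐ σ ∂radial, 1 < σ :=
  (withDensity_absolutelyContinuous _ _).ae_le (ae_restrict_mem measurableSet_Ioi)

/-- The zero of the density `4π² (σ - 1)` compensates the pole of `decay a`. -/
theorem integrable_decay (ha : 2 < a) : Integrable (decay a) radial := by
  rw [integrable_radial_iff]
  have h : IntegrableOn (fun σ : ℝ => 4 * Real.pi ^ 2 * σ ^ (1 - a)) (Set.Ioi 1) :=
    (integrableOn_Ioi_rpow_of_lt (show 1 - a < -1 by linarith) one_pos).const_mul (4 * Real.pi ^ 2)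
  refine h.congr_fun (fun σ hσ => ?_) measurableSet_Ioi
  have h0 : σ - 1 ≠ 0 := by
    have : (1 : ℝ) < σ := hσ
    linarith
  simp only [decay, smul_eq_mul]
  field_simp

theorem integrable_radial_of_le (ha : 2 < a) (hq : AEStronglyMeasurable q radial)
    (hle : ∀ σ, 1 < σ → ‖q σ‖ ≤ K * decay a σ) : Integrable q radial :=
  ((integrable_decay ha).const_mul K).mono' hq (by
    filter_upwards [ae_radial] with σ hσ using hle σ hσ)

theorem integrable_comp_sigma {E : Type*} [NormedAddCommGroup E] {q : ℝ → E}
    (hq : Integrable q radial) (Z : Siegel) : Integrable (fun W => q (sigma Z W)) dm :=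
  (measurePreserving_sigma Z).integrable_comp_of_integrable hq

theorem integral_comp_sigma {E : Type*} [NormedAddCommGroup E] [NormedSpace ℝ E] {q : ℝ → E}
    (hq : AEStronglyMeasurable q radial) (Z : Siegel) :
    ∫ W, q (sigma Z W) ∂dm = ∫ σ, q σ ∂radial := by
  rw [← map_sigma Z, integral_map (measurable_sigma Z).aemeasurable (by rwa [map_sigma])]

theorem ae_one_lt_sigma (Z : Siegel) : ∀ᵐ W ∂dm, 1 < sigma Z W :=
  (measurePreserving_sigma Z).quasiMeasurePreserving.ae ae_radial

theorem aestronglyMeasurable_ker (n : ℤ) (hq : AEStronglyMeasurable q radial) (Z : Siegel) :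
    AEStronglyMeasurable (ker n q Z) dm := by
  have h1 : Continuous fun W : Siegel => Hfactor n Z W :=
    Continuous.comp (g := fun p : Siegel × Siegel => Hfactor n p.1 p.2) (f := fun W => (Z, W))
      (continuous_Hfactor n) (continuous_const.prodMk continuous_id)
  have h2 : AEStronglyMeasurable (fun W => q (sigma Z W)) dm :=
    hq.comp_quasiMeasurePreserving (measurePreserving_sigma Z).quasiMeasurePreserving
  exact h1.aestronglyMeasurable.mul h2

theorem aestronglyMeasurable_radial_of_continuousOn (hq : ContinuousOn q (Set.Ioi 1)) :
    AEStronglyMeasurable q radial :=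
  (hq.aestronglyMeasurable measurableSet_Ioi).mono_ac (withDensity_absolutelyContinuous _ _)

end Radial

section FarCutoff

/-- A smooth cutoff function, equal to `1` for `σ ≤ c` and to `0` for `σ ≥ 2c`. -/
def cutoff (c σ : ℝ) : ℝ := Real.smoothTransition (2 - σ / c)

theorem cutoff_contDiff {c : ℝ} {m : ℕ∞} : ContDiff ℝ m (cutoff c) :=
  Real.smoothTransition.contDiff.comp (by fun_prop)

theorem cutoff_eq_one {c σ : ℝ} (hc : 0 < c) (h : σ ≤ c) : cutoff c σ = 1 := by
  refine Real.smoothTransition.one_of_one_le ?_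
  have : σ / c ≤ 1 := (div_le_one hc).2 h
  linarith

theorem cutoff_eq_zero {c σ : ℝ} (hc : 0 < c) (h : 2 * c ≤ σ) : cutoff c σ = 0 := by
  refine Real.smoothTransition.zero_of_nonpos ?_
  have : 2 ≤ σ / c := (le_div_iff₀ hc).2 h
  linarith

theorem abs_cutoff_le (c σ : ℝ) : |cutoff c σ| ≤ 1 := by
  rw [cutoff, abs_of_nonneg (Real.smoothTransition.nonneg _)]
  exact Real.smoothTransition.le_one _

theorem hasDerivAt_cutoff (c σ : ℝ) :
    HasDerivAt (cutoff c) (deriv Real.smoothTransition (2 - σ / c) * (-1 / c)) σ := by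
  have h1 : HasDerivAt (fun σ : ℝ => 2 - σ / c) (-1 / c) σ := by
    simpa [neg_div] using ((hasDerivAt_id σ).div_const c).const_sub 2
  exact ((Real.smoothTransition.contDiff (n := 1)).differentiable (by norm_num) _).hasDerivAt.comp
    σ h1

theorem hasDerivAt_deriv_cutoff (c σ : ℝ) :
    HasDerivAt (fun σ => deriv Real.smoothTransition (2 - σ / c) * (-1 / c))
      (deriv (deriv Real.smoothTransition) (2 - σ / c) * (-1 / c) * (-1 / c)) σ := by
  have h1 : HasDerivAt (fun σ : ℝ => 2 - σ / c) (-1 / c) σ := by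
    simpa [neg_div] using ((hasDerivAt_id σ).div_const c).const_sub 2
  have h2 : ContDiff ℝ 1 (deriv Real.smoothTransition) :=
    (contDiff_succ_iff_deriv.1 (Real.smoothTransition.contDiff (n := 1 + 1))).2.2
  exact ((h2.differentiable (by norm_num) _).hasDerivAt.comp σ h1).mul_const _

/-- The first two derivatives of the smooth transition function are bounded, as it is constant
outside `[0, 1]`. -/
theorem exists_deriv_smoothTransition_le : ∃ M : ℝ, 0 ≤ M ∧
    ∀ x, |deriv Real.smoothTransition x| ≤ M ∧ |deriv (deriv Real.smoothTransition) x| ≤ M := by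
  have h2 : ContDiff ℝ 1 (deriv Real.smoothTransition) :=
    (contDiff_succ_iff_deriv.1 (Real.smoothTransition.contDiff (n := 1 + 1))).2.2
  have c1 := h2.continuous
  have c2 : Continuous (deriv (deriv Real.smoothTransition)) := h2.continuous_deriv le_rfl
  obtain ⟨M1, hM1⟩ := isCompact_Icc.exists_bound_of_continuousOn (c1.continuousOn (s := Set.Icc 0 1))
  obtain ⟨M2, hM2⟩ := isCompact_Icc.exists_bound_of_continuousOn (c2.continuousOn (s := Set.Icc 0 1))
  have hz : ∀ x ∉ Set.Icc (0 : ℝ) 1, ∃ v, Real.smoothTransition =ᶠ[𝓝 x] fun _ => v := by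
    intro x hx
    rcases lt_or_ge x 0 with h | h
    · exact ⟨0, by
        filter_upwards [gt_mem_nhds h] with y hy using Real.smoothTransition.zero_of_nonpos hy.le⟩
    · have h1 : 1 < x := by by_contra hc; exact hx ⟨h, not_lt.1 hc⟩
      exact ⟨1, by
        filter_upwards [lt_mem_nhds h1] with y hy using Real.smoothTransition.one_of_one_le hy.le⟩
  refine ⟨max (max M1 M2) 0, le_max_right _ _, fun x => ?_⟩
  by_cases hx : x ∈ Set.Icc (0 : ℝ) 1
  · exact ⟨(hM1 x hx).trans (le_max_of_le_left (le_max_left _ _)),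
      (hM2 x hx).trans (le_max_of_le_left (le_max_right _ _))⟩
  · obtain ⟨v, hv⟩ := hz x hx
    have e1 := hv.deriv
    rw [deriv_const'] at e1
    rw [e1.eq_of_nhds, e1.deriv_eq, deriv_const]
    simp

/-- The product with the cutoff function. -/
def cutMul (h : ℝ → ℂ) (c σ : ℝ) : ℂ := h σ * cutoff c σ

variable {h : ℝ → ℂ} {n : ℤ} {c : ℝ}

theorem contDiff_cutMul (hh : ContDiff ℝ 2 h) : ContDiff ℝ 2 (cutMul h c) :=
  hh.mul (Complex.ofRealCLM.contDiff.comp (cutoff_contDiff (m := 2)))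

theorem cutMul_eq_zero (hc : 0 < c) : ∀ σ > 2 * c, cutMul h c σ = 0 := fun σ hσ => by
  rw [cutMul, cutoff_eq_zero hc (le_of_lt hσ)]; simp

theorem cutMul_eq {σ : ℝ} (hc : 0 < c) (h' : σ ≤ c) : cutMul h c σ = h σ := by
  rw [cutMul, cutoff_eq_one hc h']; simp

theorem norm_cutMul_le (σ : ℝ) : ‖cutMul h c σ‖ ≤ ‖h σ‖ := by
  rw [cutMul, norm_mul, Complex.norm_real]
  exact mul_le_of_le_one_right (norm_nonneg _) (abs_cutoff_le c σ)

theorem radL_congr {h g : ℝ → ℂ} {σ : ℝ} (hg : h =ᶠ[𝓝 σ] g) : radL n h σ = radL n g σ := by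
  rw [radL, radL, radOp, radOp, hg.eq_of_nhds, hg.deriv_eq, hg.deriv.deriv_eq]

theorem radL_cutMul_eq {σ : ℝ} (hc : 0 < c) (h' : σ < c) : radL n (cutMul h c) σ = radL n h σ :=
  radL_congr (by filter_upwards [gt_mem_nhds h'] with x hx using cutMul_eq hc hx.le)

theorem radL_cutMul (hh : ContDiff ℝ 2 h) (σ : ℝ) : radL n (cutMul h c) σ
    = cutoff c σ * radL n h σ + 2 * σ * (σ - 1) * deriv h σ *
        (deriv Real.smoothTransition (2 - σ / c) * (-1 / c) : ℝ)
      + h σ * (σ * (σ - 1) * (deriv (deriv Real.smoothTransition) (2 - σ / c) * (-1 / c) * (-1 / c)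
          : ℝ) + (3 * σ - 1) * (deriv Real.smoothTransition (2 - σ / c) * (-1 / c) : ℝ)) := by
  obtain ⟨h1, h2⟩ := hasDerivAt_of_contDiff hh
  have d1 : ∀ x, HasDerivAt (cutMul h c) (deriv h x * cutoff c x
      + h x * (deriv Real.smoothTransition (2 - x / c) * (-1 / c) : ℝ)) x := fun x =>
    (h1 x).mul (hasDerivAt_cutoff c x).ofReal_comp
  have e1 : deriv (cutMul h c) = fun x => deriv h x * cutoff c x
      + h x * (deriv Real.smoothTransition (2 - x / c) * (-1 / c) : ℝ) := funext fun x => (d1 x).deriv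
  have d2 := ((h2 σ).fun_mul (hasDerivAt_cutoff c σ).ofReal_comp).fun_add
    ((h1 σ).fun_mul (hasDerivAt_deriv_cutoff c σ).ofReal_comp)
  have e2 := d2.deriv
  rw [← e1] at e2
  rw [radL, radL, radOp, radOp, e2, e1]
  simp only [cutMul]
  ring

/-- The cutoff changes the radial operator by a uniformly controlled amount. -/
theorem exists_norm_radL_cutMul_le (hh : ContDiff ℝ 2 h) {K a : ℝ}
    (b0 : ∀ σ, 1 ≤ σ → ‖h σ‖ ≤ K * σ ^ (-a)) (b1 : ∀ σ, 1 ≤ σ → σ * ‖deriv h σ‖ ≤ K * σ ^ (-a))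
    (b2 : ∀ σ, 1 ≤ σ → ‖radL n h σ‖ ≤ K * σ ^ (-a)) :
    ∃ K', ∀ c, 0 < c → ∀ σ, 1 ≤ σ → ‖radL n (cutMul h c) σ‖ ≤ K' * σ ^ (-a) := by
  obtain ⟨M, hM0, hM⟩ := exists_deriv_smoothTransition_le
  refine ⟨(1 + 14 * M) * K, fun c hc σ hσ => ?_⟩
  have hσ0 : 0 < σ := by linarith
  rw [radL_cutMul hh]
  -- on the support of the derivatives of the cutoff function one has `σ ≤ 2c`
  have k : |deriv Real.smoothTransition (2 - σ / c)| * (σ / c) ≤ 2 * M ∧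
      |deriv (deriv Real.smoothTransition) (2 - σ / c)| * (σ / c) ^ 2 ≤ 4 * M := by
    rcases le_or_gt (σ / c) 2 with h2 | h2
    · have h3 : 0 ≤ σ / c := by positivity
      obtain ⟨m1, m2⟩ := hM (2 - σ / c)
      constructor
      · nlinarith [mul_le_mul m1 h2 h3 hM0]
      · have : (σ / c) ^ 2 ≤ 4 := by nlinarith
        nlinarith [mul_le_mul m2 this (by positivity) hM0]
    · have hz : Real.smoothTransition =ᶠ[𝓝 (2 - σ / c)] fun _ => 0 := by
        filter_upwards [gt_mem_nhds (show 2 - σ / c < 0 by linarith)] with y hy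
        exact Real.smoothTransition.zero_of_nonpos hy.le
      have e1 := hz.deriv
      rw [deriv_const'] at e1
      rw [e1.eq_of_nhds, e1.deriv_eq, deriv_const]
      simp [hM0]
  set A := deriv Real.smoothTransition (2 - σ / c)
  set B := deriv (deriv Real.smoothTransition) (2 - σ / c)
  have t1 : ‖(cutoff c σ : ℂ) * radL n h σ‖ ≤ K * σ ^ (-a) := by
    rw [norm_mul, Complex.norm_real]
    exact (mul_le_of_le_one_left (norm_nonneg _) (abs_cutoff_le c σ)).trans (b2 σ hσ)
  have n1 : ‖((σ : ℂ) - 1)‖ ≤ σ := by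
    rw [← Complex.ofReal_one, ← Complex.ofReal_sub, Complex.norm_real, Real.norm_eq_abs,
      abs_of_nonneg (by linarith)]
    linarith
  have n2 : ‖(3 * (σ : ℂ) - 1)‖ ≤ 3 * σ := by
    have : (3 * (σ : ℂ) - 1) = ((3 * σ - 1 : ℝ) : ℂ) := by push_cast; ring
    rw [this, Complex.norm_real, Real.norm_eq_abs, abs_of_nonneg (by linarith)]
    linarith
  have n3 : ‖(σ : ℂ)‖ = σ := by rw [Complex.norm_real, Real.norm_eq_abs, abs_of_pos hσ0]
  have n4 : ‖((A * (-1 / c) : ℝ) : ℂ)‖ = |A| / c := by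
    rw [Complex.norm_real, Real.norm_eq_abs, abs_mul, abs_div, abs_neg, abs_one, abs_of_pos hc]
    ring
  have n5 : ‖((B * (-1 / c) * (-1 / c) : ℝ) : ℂ)‖ = |B| / c ^ 2 := by
    rw [Complex.norm_real, Real.norm_eq_abs, abs_mul, abs_mul, abs_div, abs_neg, abs_one,
      abs_of_pos hc]
    ring
  have hK : 0 ≤ K * σ ^ (-a) := (norm_nonneg _).trans (b0 σ hσ)
  have t2 : ‖2 * (σ : ℂ) * (σ - 1) * deriv h σ * (A * (-1 / c) : ℝ)‖ ≤ 4 * M * (K * σ ^ (-a)) := by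
    rw [norm_mul, norm_mul, norm_mul, norm_mul, n3, n4, Complex.norm_ofNat]
    calc 2 * σ * ‖(σ : ℂ) - 1‖ * ‖deriv h σ‖ * (|A| / c)
        ≤ 2 * σ * σ * ‖deriv h σ‖ * (|A| / c) := by gcongr
      _ = 2 * (|A| * (σ / c)) * (σ * ‖deriv h σ‖) := by ring
      _ ≤ 2 * (2 * M) * (K * σ ^ (-a)) :=
          mul_le_mul (mul_le_mul_of_nonneg_left k.1 zero_le_two) (b1 σ hσ) (by positivity)
            (by positivity)
      _ = _ := by ring
  have t3 : ‖h σ * ((σ : ℂ) * (σ - 1) * (B * (-1 / c) * (-1 / c) : ℝ)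
      + (3 * σ - 1) * (A * (-1 / c) : ℝ))‖ ≤ 10 * M * (K * σ ^ (-a)) := by
    rw [norm_mul]
    have : ‖(σ : ℂ) * (σ - 1) * (B * (-1 / c) * (-1 / c) : ℝ) + (3 * σ - 1) * (A * (-1 / c) : ℝ)‖
        ≤ 10 * M := by
      refine (norm_add_le _ _).trans ?_
      rw [norm_mul, norm_mul, norm_mul, n3, n4, n5]
      calc σ * ‖(σ : ℂ) - 1‖ * (|B| / c ^ 2) + ‖3 * (σ : ℂ) - 1‖ * (|A| / c)
          ≤ σ * σ * (|B| / c ^ 2) + 3 * σ * (|A| / c) := by gcongr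
        _ = |B| * (σ / c) ^ 2 + 3 * (|A| * (σ / c)) := by field_simp
        _ ≤ 10 * M := by linarith [k.1, k.2]
    calc _ ≤ (K * σ ^ (-a)) * (10 * M) :=
          mul_le_mul (b0 σ hσ) this (norm_nonneg _) hK
      _ = _ := by ring
  calc _ ≤ K * σ ^ (-a) + 4 * M * (K * σ ^ (-a)) + 10 * M * (K * σ ^ (-a)) :=
        (norm_add_le _ _).trans (add_le_add ((norm_add_le _ _).trans (add_le_add t1 t2)) t3)
    _ = _ := by ring

end FarCutoff

end

section

/-! ### Capping the singularity of the radial function -/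

open ComplexConjugate ENNReal

section Commute

variable {h : ℝ → ℂ} {n : ℤ} {u : Siegel → ℂ} {a K B : ℝ}

theorem integrable_rpow_neg (ha : 2 < a) : Integrable (fun σ : ℝ => σ ^ (-a)) radial := by
  refine (integrable_decay ha).mono' (Measurable.aestronglyMeasurable (by fun_prop)) ?_
  filter_upwards [ae_radial] with σ hσ
  rw [Real.norm_eq_abs, abs_of_nonneg (by positivity)]
  exact rpow_neg_le_decay hσ

theorem aesm_radial_of_continuousOn {q : ℝ → ℂ} (hq : ContinuousOn q (Set.Ioi 0)) :
    AEStronglyMeasurable q radial :=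
  aestronglyMeasurable_radial_of_continuousOn
    (hq.mono fun _ h => one_pos.trans (show (1 : ℝ) < _ from h))

/-- Point-pair operators with rapidly decaying kernels commute with `Δ_k` on bounded functions. -/
theorem kint_lapl_of_decay (ha : 2 < a) (hh : ContDiff ℝ 2 h)
    (b0 : ∀ σ, 1 ≤ σ → ‖h σ‖ ≤ K * σ ^ (-a)) (b1 : ∀ σ, 1 ≤ σ → σ * ‖deriv h σ‖ ≤ K * σ ^ (-a))
    (b2 : ∀ σ, 1 ≤ σ → ‖radL n h σ‖ ≤ K * σ ^ (-a))
    (hu : ContDiffOn ℝ 2 (extendZero u) siegelSet) (hB : ∀ ξ, ‖u ξ‖ ≤ B)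
    (hB' : ∀ ξ, ‖lapl n u ξ‖ ≤ B) (Z : Siegel) :
    kint n h (lapl n u) Z = kint n (radL n h) u Z := by
  obtain ⟨K', hK'⟩ := exists_norm_radL_cutMul_le hh b0 b1 b2
  have hc : ∀ j : ℕ, (0 : ℝ) < j + 1 := fun j => by positivity
  have cu := continuous_of_contDiffOn hu
  have cl := continuous_lapl (n := n) hu
  have hB0 : 0 ≤ B := (norm_nonneg _).trans (hB base)
  -- the far cutoff at `j + 1` reduces this to compact support; both sides converge by domination
  have large : ∀ x : ℝ, ∀ᶠ j : ℕ in atTop, x < (j : ℝ) + 1 := fun x => by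
    obtain ⟨N, hN⟩ := exists_nat_gt x
    filter_upwards [eventually_ge_atTop N] with j hj
    have : (N : ℝ) ≤ j := by exact_mod_cast hj
    linarith
  have lim : ∀ (q : ℕ → ℝ → ℂ) (q' : ℝ → ℂ) (v : Siegel → ℂ) (C : ℝ), Continuous v →
      (∀ ξ, ‖v ξ‖ ≤ B) → (∀ j, ContinuousOn (q j) (Set.Ioi 0)) →
      (∀ j σ, 1 ≤ σ → ‖q j σ‖ ≤ C * σ ^ (-a)) → (∀ σ, ∀ᶠ j in atTop, q j σ = q' σ) →
      Tendsto (fun j => kint n (q j) v Z) atTop (𝓝 (kint n q' v Z)) := by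
    intro q q' v C hv hvB hq hqC hlim
    refine tendsto_integral_of_dominated_convergence (fun ξ => C * sigma Z ξ ^ (-a) * B) ?_ ?_ ?_ ?_
    · exact fun j => (aestronglyMeasurable_ker n (aesm_radial_of_continuousOn (hq j)) Z).mul
        hv.aestronglyMeasurable
    · exact ((integrable_comp_sigma (integrable_rpow_neg ha) Z).const_mul C).mul_const B
    · refine fun j => Eventually.of_forall fun ξ => ?_
      rw [norm_mul, norm_ker]
      have := hqC j _ (one_le_sigma Z ξ)
      exact mul_le_mul this (hvB ξ) (norm_nonneg _) ((norm_nonneg _).trans this)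
    · refine Eventually.of_forall fun ξ => tendsto_const_nhds.congr' ?_
      filter_upwards [hlim (sigma Z ξ)] with j hj
      rw [ker, ker, hj]
  have l1 := lim (fun j => cutMul h (j + 1)) h (lapl n u) K cl hB'
    (fun j => (contDiff_cutMul hh).continuous.continuousOn)
    (fun j σ hσ => (norm_cutMul_le σ).trans (b0 σ hσ))
    (fun σ => by filter_upwards [large σ] with j hj using cutMul_eq (hc j) hj.le)
  have l2 := lim (fun j => radL n (cutMul h (j + 1))) (radL n h) u K' cu hB
    (fun j => continuousOn_radL (contDiff_cutMul hh))
    (fun j σ hσ => hK' _ (hc j) σ hσ)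
    (fun σ => by filter_upwards [large σ] with j hj using radL_cutMul_eq (hc j) hj)
  refine tendsto_nhds_unique l1 (l2.congr fun j => ?_)
  exact (kint_lapl (contDiff_cutMul hh) (cutMul_eq_zero (hc j)) hu Z).symm

end Commute

section Cap

variable {s : ℂ} {n : ℤ} {a : ℝ}

/-- The second derivative of the `C²` function `capPhi`. -/
def capD2 (s : ℂ) (n : ℤ) (a x : ℝ) : ℂ := phiDeriv2 s n (max x a)

/-- The derivative of `capPhi`. -/
def capD (s : ℂ) (n : ℤ) (a x : ℝ) : ℂ := phiDeriv s n a + ∫ t in a..x, capD2 s n a t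

/-- The function equal to `phi` on `[a, ∞)` and to its second Taylor polynomial at `a` on
`(-∞, a]`. -/
def capPhi (s : ℂ) (n : ℤ) (a x : ℝ) : ℂ := phi s n a + ∫ t in a..x, capD s n a t

variable (hs : 2 < s.re) (hpole : ∀ j : ℕ, s ≠ absWeight n - j)
include hs hpole

theorem continuous_capD2 (ha : 1 < a) : Continuous (capD2 s n a) :=
  (continuousOn_phiDeriv2 hs hpole).comp_continuous (by fun_prop)
    fun x => ha.trans_le (le_max_right x a)

theorem hasDerivAt_capD (ha : 1 < a) (x : ℝ) : HasDerivAt (capD s n a) (capD2 s n a x) x := by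
  have hc := continuous_capD2 hs hpole ha
  exact (intervalIntegral.integral_hasDerivAt_right (hc.intervalIntegrable _ _)
    hc.aestronglyMeasurable.stronglyMeasurableAtFilter hc.continuousAt).const_add _

theorem continuous_capD (ha : 1 < a) : Continuous (capD s n a) :=
  continuous_iff_continuousAt.2 fun x => (hasDerivAt_capD hs hpole ha x).continuousAt

theorem hasDerivAt_capPhi (ha : 1 < a) (x : ℝ) : HasDerivAt (capPhi s n a) (capD s n a x) x := by
  have hc := continuous_capD hs hpole ha
  exact (intervalIntegral.integral_hasDerivAt_right (hc.intervalIntegrable _ _)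
    hc.aestronglyMeasurable.stronglyMeasurableAtFilter hc.continuousAt).const_add _

theorem deriv_capPhi (ha : 1 < a) : deriv (capPhi s n a) = capD s n a :=
  funext fun x => (hasDerivAt_capPhi hs hpole ha x).deriv

theorem deriv_capD (ha : 1 < a) : deriv (capD s n a) = capD2 s n a :=
  funext fun x => (hasDerivAt_capD hs hpole ha x).deriv

theorem contDiff_capPhi (ha : 1 < a) : ContDiff ℝ 2 (capPhi s n a) := by
  have h1 : ContDiff ℝ 1 (capD s n a) := contDiff_one_iff_deriv.2
    ⟨fun x => (hasDerivAt_capD hs hpole ha x).differentiableAt, by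
      rw [deriv_capD hs hpole ha]; exact continuous_capD2 hs hpole ha⟩
  have h2 : ContDiff ℝ (1 + 1) (capPhi s n a) := contDiff_succ_iff_deriv.2
    ⟨fun x => (hasDerivAt_capPhi hs hpole ha x).differentiableAt, by simp, by
      rw [deriv_capPhi hs hpole ha]; exact h1⟩
  exact h2

theorem capD_eq (ha : 1 < a) {x : ℝ} (hx : a ≤ x) : capD s n a x = phiDeriv s n x := by
  have h : ∫ t in a..x, capD2 s n a t = phiDeriv s n x - phiDeriv s n a := by
    refine intervalIntegral.integral_eq_sub_of_hasDerivAt (fun t ht => ?_)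
      ((continuous_capD2 hs hpole ha).intervalIntegrable _ _)
    rw [Set.uIcc_of_le hx] at ht
    rw [capD2, max_eq_left ht.1]
    exact hasDerivAt_phiDeriv hs hpole (ha.trans_le ht.1)
  rw [capD, h]; ring

theorem capPhi_eq (ha : 1 < a) {x : ℝ} (hx : a ≤ x) : capPhi s n a x = phi s n x := by
  have h : ∫ t in a..x, capD s n a t = phi s n x - phi s n a := by
    refine intervalIntegral.integral_eq_sub_of_hasDerivAt (fun t ht => ?_)
      ((continuous_capD hs hpole ha).intervalIntegrable _ _)
    rw [Set.uIcc_of_le hx] at ht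
    rw [capD_eq hs hpole ha ht.1]
    exact hasDerivAt_phi hs hpole (ha.trans_le ht.1)
  rw [capPhi, h]; ring

theorem radL_capPhi_eq (ha : 1 < a) (x : ℝ) : radL n (capPhi s n a) x
    = x * (x - 1) * capD2 s n a x + (3 * x - 1) * capD s n a x
      + (n : ℂ) ^ 2 / 4 / x * capPhi s n a x := by
  rw [radL, radOp, deriv_capPhi hs hpole ha, deriv_capD hs hpole ha]

/-- On `[a, ∞)` the capped function still solves the radial equation. -/
theorem radL_capPhi (ha : 1 < a) {x : ℝ} (hx : a ≤ x) :
    radL n (capPhi s n a) x = s * (s - 2) * phi s n x := by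
  rw [radL_capPhi_eq hs hpole ha, capPhi_eq hs hpole ha hx, capD_eq hs hpole ha hx, capD2,
    max_eq_left hx, phi_ode hs hpole (ha.trans_le hx)]

/-- The radial function is dominated by `decay (Re s)`, hence integrable for the radial measure. -/
theorem exists_phi_le_decay : ∃ K : ℝ, 0 ≤ K ∧ ∀ σ : ℝ, 1 < σ → ‖phi s n σ‖ ≤ K * decay s.re σ := by
  obtain ⟨K0, hK0, h0⟩ := phi_bound_atTop hs hpole
  have h1 : ∀ᶠ σ : ℝ in 𝓝[>] 1, ‖((σ - 1 : ℝ) : ℂ) * phi s n σ‖ < 2 :=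
    (tendsto_phi hs hpole).norm.eventually_lt_const (by simp)
  obtain ⟨δ, hδ, h1⟩ := mem_nhdsGT_iff_exists_Ioo_subset.1 h1
  have hδ : 1 < δ := hδ
  have hc : ContinuousOn (phi s n) (Set.Icc δ 2) := fun σ hσ =>
    (hasDerivAt_phi hs hpole (hδ.trans_le hσ.1)).continuousAt.continuousWithinAt
  obtain ⟨M, hM⟩ := isCompact_Icc.exists_bound_of_continuousOn hc
  set L := max M 2 * 2 ^ (s.re - 1)
  have hL : 0 ≤ L := mul_nonneg (le_max_of_le_right two_pos.le) (by positivity)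
  refine ⟨K0 + L, by positivity, fun σ hσ => ?_⟩
  have hd := decay_nonneg (a := s.re) hσ
  rw [add_mul]
  -- large `σ`: decay at infinity; `1 < σ < δ`: the singularity; `δ ≤ σ < 2`: compactness
  rcases le_or_gt 2 σ with h2 | h2
  · calc ‖phi s n σ‖ ≤ K0 * σ ^ (-s.re) := (h0 σ h2).1
      _ ≤ K0 * decay s.re σ := by gcongr; exact rpow_neg_le_decay hσ
      _ ≤ _ := le_add_of_nonneg_right (by positivity)
  · have h3 := inv_le_decay (a := s.re) (by linarith) hσ h2.le
    have hσ' : 0 < σ - 1 := by linarith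
    have h4 : ‖phi s n σ‖ ≤ max M 2 * (σ - 1)⁻¹ := by
      rcases lt_or_ge σ δ with h5 | h5
      · have h6 : ‖((σ - 1 : ℝ) : ℂ) * phi s n σ‖ < 2 := h1 ⟨hσ, h5⟩
        rw [norm_mul, Complex.norm_real, Real.norm_eq_abs, abs_of_pos hσ'] at h6
        rw [← div_eq_mul_inv, le_div_iff₀ hσ', mul_comm]
        exact h6.le.trans (le_max_right _ _)
      · have h6 := hM σ ⟨h5, h2.le⟩
        have h7 : 1 ≤ (σ - 1)⁻¹ := (one_le_inv₀ hσ').2 (by linarith)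
        have h8 : 0 ≤ max M 2 := le_max_of_le_right two_pos.le
        exact (h6.trans (le_max_left _ _)).trans (le_mul_of_one_le_right h8 h7)
    calc ‖phi s n σ‖ ≤ max M 2 * (2 ^ (s.re - 1) * decay s.re σ) := by
          refine h4.trans ?_
          have h8 : 0 ≤ max M 2 := le_max_of_le_right two_pos.le
          gcongr
      _ = L * decay s.re σ := by simp only [L]; ring
      _ ≤ _ := le_add_of_nonneg_left (by positivity)

/-- On `[1, a]` the capped function is `O(1 / (a - 1))` and fails the radial equation by
`O(1 / (a - 1)²)`, uniformly as `a → 1`. The ball `σ ≤ a` has measure `O((a - 1)²)`, so the defect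
has bounded mass. -/
theorem exists_capPhi_le : ∃ C : ℝ, 0 ≤ C ∧ ∀ᶠ a : ℝ in 𝓝[>] 1, ∀ x ∈ Set.Icc 1 a,
    ‖capPhi s n a x‖ ≤ C / (a - 1) ∧
      ‖s * (s - 2) * capPhi s n a x - radL n (capPhi s n a) x‖ ≤ C / (a - 1) ^ 2 := by
  have e1 : ∀ᶠ a : ℝ in 𝓝[>] 1, ‖((a - 1 : ℝ) : ℂ) * phi s n a‖ < 2 :=
    (tendsto_phi hs hpole).norm.eventually_lt_const (by simp)
  have e2 : ∀ᶠ a : ℝ in 𝓝[>] 1, ‖((a - 1 : ℝ) : ℂ) ^ 2 * phiDeriv s n a‖ < 2 :=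
    (tendsto_phiDeriv hs hpole).norm.eventually_lt_const (by simp)
  have e3 : ∀ᶠ a : ℝ in 𝓝[>] 1, a < 2 :=
    mem_nhdsWithin_of_mem_nhds (gt_mem_nhds (by norm_num))
  set L := ‖s * (s - 2)‖
  set N := ‖(n : ℂ) ^ 2 / 4‖
  have hL : 0 ≤ L := norm_nonneg _
  have hN : 0 ≤ N := norm_nonneg _
  set D := 2 * L + 10 + 2 * N
  have hD : 0 ≤ D := by positivity
  -- `D`, `2 + D` and `4 + D` bound the scaled second and first derivative and the value
  refine ⟨(L + N) * (4 + D) + 2 * D + 5 * (2 + D) + (4 + D), by positivity, ?_⟩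
  filter_upwards [e1, e2, e3, self_mem_nhdsWithin] with a h1 h2 h3 ha x hx
  have ha : 1 < a := ha
  have hd : 0 < a - 1 := by linarith
  have hd1 : a - 1 ≤ 1 := by linarith
  have ha0 : 0 < a := by linarith
  rw [norm_mul, Complex.norm_real, Real.norm_eq_abs, abs_of_pos hd] at h1
  rw [norm_mul, norm_pow, Complex.norm_real, Real.norm_eq_abs, abs_of_pos hd] at h2
  have n0 : ‖phi s n a‖ ≤ 2 / (a - 1) := by rw [le_div_iff₀ hd]; linarith
  have n1 : ‖phiDeriv s n a‖ ≤ 2 / (a - 1) ^ 2 := by rw [le_div_iff₀ (by positivity)]; linarith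
  have i1 : 1 / (a - 1) ≤ 1 / (a - 1) ^ 2 :=
    one_div_le_one_div_of_le (by positivity) (by nlinarith)
  have nr : ∀ y : ℝ, 0 ≤ y → ‖(y : ℂ)‖ = y := fun y hy => by
    rw [Complex.norm_real, Real.norm_eq_abs, abs_of_nonneg hy]
  have nN : ∀ y : ℝ, 1 ≤ y → ‖(n : ℂ) ^ 2 / 4 / y‖ ≤ N := fun y hy => by
    rw [norm_div _ (y : ℂ), nr y (by linarith)]
    exact div_le_self hN hy
  have n3 : ∀ y : ℝ, 1 ≤ y → y ≤ a → ‖(3 * (y : ℂ) - 1)‖ ≤ 5 := fun y hy hya => by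
    have : (3 * (y : ℂ) - 1) = ((3 * y - 1 : ℝ) : ℂ) := by push_cast; ring
    rw [this, nr _ (by linarith)]; linarith
  -- the differential equation bounds the second derivative by the value and the first derivative
  have n2 : ‖phiDeriv2 s n a‖ ≤ D / (a - 1) ^ 3 := by
    have ode := phi_ode hs hpole ha
    have e : ((a * (a - 1) : ℝ) : ℂ) * phiDeriv2 s n a = s * (s - 2) * phi s n a
        - (3 * a - 1) * phiDeriv s n a - (n : ℂ) ^ 2 / 4 / a * phi s n a := by
      rw [← ode]; push_cast; ring
    have e' : a * (a - 1) * ‖phiDeriv2 s n a‖ ≤ L * (2 / (a - 1)) + 5 * (2 / (a - 1) ^ 2)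
        + N * (2 / (a - 1)) := by
      rw [← nr (a * (a - 1)) (by positivity), ← norm_mul, e]
      refine (norm_sub_le _ _).trans (add_le_add ((norm_sub_le _ _).trans (add_le_add ?_ ?_)) ?_)
      · rw [norm_mul]; gcongr
      · rw [norm_mul]; gcongr; exact n3 a ha.le le_rfl
      · rw [norm_mul]; gcongr; exact nN a ha.le
    have e'' : (a - 1) * ‖phiDeriv2 s n a‖ ≤ D * (1 / (a - 1) ^ 2) := by
      calc (a - 1) * ‖phiDeriv2 s n a‖ ≤ a * ((a - 1) * ‖phiDeriv2 s n a‖) :=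
            le_mul_of_one_le_left (by positivity) ha.le
        _ = a * (a - 1) * ‖phiDeriv2 s n a‖ := by ring
        _ ≤ _ := e'
        _ = 2 * L * (1 / (a - 1)) + 10 * (1 / (a - 1) ^ 2) + 2 * N * (1 / (a - 1)) := by ring
        _ ≤ 2 * L * (1 / (a - 1) ^ 2) + 10 * (1 / (a - 1) ^ 2) + 2 * N * (1 / (a - 1) ^ 2) := by
          gcongr
        _ = _ := by simp only [D]; ring
    rw [le_div_iff₀ (by positivity)]
    rw [mul_one_div, le_div_iff₀ (by positivity)] at e''
    linarith
  have c2 : ∀ y ∈ Set.Icc 1 a, ‖capD2 s n a y‖ ≤ D / (a - 1) ^ 3 := fun y hy => by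
    rw [capD2, max_eq_right hy.2]; exact n2
  have c1 : ∀ y ∈ Set.Icc 1 a, ‖capD s n a y‖ ≤ (2 + D) / (a - 1) ^ 2 := fun y hy => by
    have hi : ‖∫ t in a..y, capD2 s n a t‖ ≤ D / (a - 1) ^ 3 * |y - a| :=
      intervalIntegral.norm_integral_le_of_norm_le_const fun t ht => by
        rw [Set.uIoc_of_ge hy.2] at ht
        exact c2 t ⟨hy.1.trans ht.1.le, ht.2⟩
    have hy' : |y - a| ≤ a - 1 := by rw [abs_le]; constructor <;> linarith [hy.1, hy.2]
    calc ‖capD s n a y‖ ≤ 2 / (a - 1) ^ 2 + D / (a - 1) ^ 3 * (a - 1) :=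
          (norm_add_le _ _).trans (add_le_add n1 (hi.trans (by gcongr)))
      _ = _ := by field_simp
  have c0 : ∀ y ∈ Set.Icc 1 a, ‖capPhi s n a y‖ ≤ (4 + D) / (a - 1) := fun y hy => by
    have hi : ‖∫ t in a..y, capD s n a t‖ ≤ (2 + D) / (a - 1) ^ 2 * |y - a| :=
      intervalIntegral.norm_integral_le_of_norm_le_const fun t ht => by
        rw [Set.uIoc_of_ge hy.2] at ht
        exact c1 t ⟨hy.1.trans ht.1.le, ht.2⟩
    have hy' : |y - a| ≤ a - 1 := by rw [abs_le]; constructor <;> linarith [hy.1, hy.2]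
    calc ‖capPhi s n a y‖ ≤ 2 / (a - 1) + (2 + D) / (a - 1) ^ 2 * (a - 1) :=
          (norm_add_le _ _).trans (add_le_add n0 (hi.trans (by gcongr)))
      _ = _ := by field_simp; ring
  constructor
  · refine (c0 x hx).trans ?_
    have : 0 ≤ (L + N) * (4 + D) + 2 * D + 5 * (2 + D) := by positivity
    exact div_le_div_of_nonneg_right (by linarith) hd.le
  · rw [radL_capPhi_eq hs hpole ha]
    have hx0 : 0 ≤ x - 1 := by linarith [hx.1]
    have t1 : ‖(x : ℂ) * (x - 1) * capD2 s n a x‖ ≤ 2 * D * (1 / (a - 1) ^ 2) := by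
      have : (x : ℂ) * (x - 1) = ((x * (x - 1) : ℝ) : ℂ) := by push_cast; ring
      rw [norm_mul, this, nr _ (mul_nonneg (by linarith) hx0)]
      calc x * (x - 1) * ‖capD2 s n a x‖ ≤ 2 * (a - 1) * (D / (a - 1) ^ 3) := by
            gcongr
            · linarith [hx.2]
            · exact hx.2
            · exact c2 x hx
        _ = _ := by field_simp
    have t2 : ‖(3 * (x : ℂ) - 1) * capD s n a x‖ ≤ 5 * (2 + D) * (1 / (a - 1) ^ 2) := by
      rw [norm_mul]
      calc _ ≤ 5 * ((2 + D) / (a - 1) ^ 2) := by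
            gcongr
            · exact n3 x hx.1 hx.2
            · exact c1 x hx
        _ = _ := by ring
    have t3 : ‖(n : ℂ) ^ 2 / 4 / x * capPhi s n a x‖ ≤ N * (4 + D) * (1 / (a - 1) ^ 2) := by
      rw [norm_mul]
      calc _ ≤ N * ((4 + D) / (a - 1)) := by
            gcongr
            · exact nN x hx.1
            · exact c0 x hx
        _ = N * (4 + D) * (1 / (a - 1)) := by ring
        _ ≤ _ := by gcongr
    have t4 : ‖s * (s - 2) * capPhi s n a x‖ ≤ L * (4 + D) * (1 / (a - 1) ^ 2) := by
      rw [norm_mul]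
      calc _ ≤ L * ((4 + D) / (a - 1)) := by
            gcongr
            exact c0 x hx
        _ = L * (4 + D) * (1 / (a - 1)) := by ring
        _ ≤ _ := by gcongr
    calc _ ≤ L * (4 + D) * (1 / (a - 1) ^ 2) + (2 * D * (1 / (a - 1) ^ 2)
          + 5 * (2 + D) * (1 / (a - 1) ^ 2) + N * (4 + D) * (1 / (a - 1) ^ 2)) :=
          (norm_sub_le _ _).trans (add_le_add t4 ((norm_add_le _ _).trans
            (add_le_add ((norm_add_le _ _).trans (add_le_add t1 t2)) t3)))
      _ = ((L + N) * (4 + D) + 2 * D + 5 * (2 + D)) / (a - 1) ^ 2 := by ring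
      _ ≤ _ := div_le_div_of_nonneg_right (by linarith) (by positivity)

end Cap

end

section

/-! ### The Green function inverts `s(s-2) - Δ_k` on bounded functions -/

open ComplexConjugate ENNReal

section Representation

variable {s : ℂ} {n : ℤ} {a B : ℝ} {u : Siegel → ℂ}

/-- The defect of `capPhi` from being an eigenfunction of the radial operator; it is supported in
`[1, a]` and approximates a point mass as `a → 1`. -/
def defect (s : ℂ) (n : ℤ) (a x : ℝ) : ℂ := s * (s - 2) * capPhi s n a x - radL n (capPhi s n a) x

theorem continuousOn_defect (hs : 2 < s.re) (hpole : ∀ j : ℕ, s ≠ absWeight n - j) (ha : 1 < a) :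
    ContinuousOn (defect s n a) (Set.Ioi 0) :=
  (continuousOn_const.mul (contDiff_capPhi hs hpole ha).continuous.continuousOn).sub
    (continuousOn_radL (contDiff_capPhi hs hpole ha))

theorem defect_eq_zero (hs : 2 < s.re) (hpole : ∀ j : ℕ, s ≠ absWeight n - j) (ha : 1 < a) {x : ℝ}
    (hx : a ≤ x) : defect s n a x = 0 := by
  rw [defect, radL_capPhi hs hpole ha hx, capPhi_eq hs hpole ha hx, sub_self]

/-- The mass of the defect tends to `4π²`. Up to a term that tends to zero, the defect times the
radial density `4π² (σ - 1)` is the derivative of `-4π² σ (σ - 1)² h'`, where `h` is the capped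
function; at `σ = a` this is `-4π² a (a - 1)² φ'(a) → 4π²`. -/
theorem tendsto_integral_defect (hs : 2 < s.re) (hpole : ∀ j : ℕ, s ≠ absWeight n - j) :
    Tendsto (fun a => ∫ σ, defect s n a σ ∂radial) (𝓝[>] 1) (𝓝 (4 * (Real.pi : ℂ) ^ 2)) := by
  obtain ⟨C, hC, hbound⟩ := exists_capPhi_le hs hpole
  have hev : ∀ᶠ a : ℝ in 𝓝[>] 1, ∫ σ, defect s n a σ ∂radial = 4 * (Real.pi : ℂ) ^ 2 *
      ((∫ x in (1 : ℝ)..a, ((x : ℂ) - 1) * (s * (s - 2) - (n : ℂ) ^ 2 / 4 / x) * capPhi s n a x)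
        - a * (((a - 1 : ℝ) : ℂ) ^ 2 * phiDeriv s n a)) := by
    filter_upwards [self_mem_nhdsWithin] with a ha
    have ha : 1 < a := ha
    have e1 : ∫ σ, defect s n a σ ∂radial
        = ∫ x in (1 : ℝ)..a, (4 * Real.pi ^ 2 * (x - 1)) • defect s n a x := by
      rw [integral_radial, intervalIntegral.integral_of_le ha.le]
      refine setIntegral_eq_of_subset_of_forall_sdiff_eq_zero measurableSet_Ioi
        (fun x hx => hx.1) fun x hx => ?_
      have : a < x := by
        by_contra hcon
        exact hx.2 ⟨hx.1, not_lt.1 hcon⟩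
      rw [defect_eq_zero hs hpole ha this.le, smul_zero]
    have hc0 := (contDiff_capPhi hs hpole ha).continuous
    have hc1 := continuous_capD hs hpole ha
    have hc2 := continuous_capD2 hs hpole ha
    -- the second and first order terms of the radial operator, times `x - 1`, are a derivative
    have hE : ∀ x : ℝ, HasDerivAt (fun x : ℝ => (x : ℂ) * ((x : ℂ) - 1) ^ 2 * capD s n a x)
        (((x : ℂ) - 1) * (x * (x - 1) * capD2 s n a x + (3 * x - 1) * capD s n a x)) x := by
      intro x
      have hx : HasDerivAt (fun x : ℝ => (x : ℂ)) 1 x := by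
        simpa using (hasDerivAt_id x).ofReal_comp
      have := (hx.fun_mul ((hx.sub_const 1).fun_pow 2)).fun_mul (hasDerivAt_capD hs hpole ha x)
      refine this.congr_deriv ?_
      push_cast
      ring
    have e2 : ∫ x in (1 : ℝ)..a,
        ((x : ℂ) - 1) * (x * (x - 1) * capD2 s n a x + (3 * x - 1) * capD s n a x)
        = a * (((a - 1 : ℝ) : ℂ) ^ 2 * phiDeriv s n a) := by
      rw [intervalIntegral.integral_eq_sub_of_hasDerivAt (fun x _ => hE x)
        (Continuous.intervalIntegrable (by fun_prop) _ _), capD_eq hs hpole ha le_rfl]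
      push_cast
      ring
    have hc3 : ContinuousOn (fun x : ℝ => ((x : ℂ) - 1) * (s * (s - 2) - (n : ℂ) ^ 2 / 4 / x)
        * capPhi s n a x) (Set.uIcc 1 a) := by
      have hd : ContinuousOn (fun x : ℝ => (n : ℂ) ^ 2 / 4 / (x : ℂ)) (Set.uIcc 1 a) := by
        refine ContinuousOn.div (by fun_prop) (by fun_prop) fun x hx => ?_
        rw [Set.uIcc_of_le ha.le] at hx
        have : (0 : ℝ) < x := by linarith [hx.1]
        exact_mod_cast this.ne'
      exact ((by fun_prop : Continuous fun x : ℝ => ((x : ℂ) - 1)).continuousOn.mul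
        (continuousOn_const.sub hd)).mul hc0.continuousOn
    rw [e1, ← e2, ← intervalIntegral.integral_sub hc3.intervalIntegrable
      (Continuous.intervalIntegrable (by fun_prop) _ _), ← intervalIntegral.integral_const_mul]
    refine intervalIntegral.integral_congr fun x _ => ?_
    simp only [defect, radL_capPhi_eq hs hpole ha, Complex.real_smul]
    push_cast
    ring
  have l1 : Tendsto (fun a : ℝ => ∫ x in (1 : ℝ)..a,
      ((x : ℂ) - 1) * (s * (s - 2) - (n : ℂ) ^ 2 / 4 / x) * capPhi s n a x) (𝓝[>] 1) (𝓝 0) := by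
    set M := ‖s * (s - 2)‖ + ‖(n : ℂ) ^ 2 / 4‖
    refine squeeze_zero_norm' (a := fun a : ℝ => M * C * (a - 1)) ?_ ?_
    · filter_upwards [hbound, self_mem_nhdsWithin] with a hb ha
      have ha : 1 < a := ha
      have hd : 0 < a - 1 := by linarith
      have := intervalIntegral.norm_integral_le_of_norm_le_const (a := (1 : ℝ)) (b := a)
        (C := M * C) (f := fun x : ℝ =>
          ((x : ℂ) - 1) * (s * (s - 2) - (n : ℂ) ^ 2 / 4 / x) * capPhi s n a x) fun x hx => by
        rw [Set.uIoc_of_le ha.le] at hx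
        have hx1 : 0 ≤ x - 1 := by linarith [hx.1]
        have h1 : ‖(x : ℂ) - 1‖ ≤ a - 1 := by
          rw [← Complex.ofReal_one, ← Complex.ofReal_sub, Complex.norm_real, Real.norm_eq_abs,
            abs_of_nonneg hx1]
          linarith [hx.2]
        have h2 : ‖s * (s - 2) - (n : ℂ) ^ 2 / 4 / x‖ ≤ M := by
          refine (norm_sub_le _ _).trans (add_le_add le_rfl ?_)
          rw [norm_div _ (x : ℂ), Complex.norm_real, Real.norm_eq_abs, abs_of_pos (by linarith)]
          exact div_le_self (norm_nonneg _) (by linarith)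
        calc _ ≤ (a - 1) * M * (C / (a - 1)) := by
              rw [norm_mul, norm_mul]
              gcongr
              exact (hb x ⟨hx.1.le, hx.2⟩).1
          _ = M * C := by field_simp
      rwa [abs_of_pos hd] at this
    · have : Tendsto (fun a : ℝ => M * C * (a - 1)) (𝓝 1) (𝓝 (M * C * (1 - 1))) :=
        (tendsto_id.sub_const 1).const_mul _
      rw [sub_self, mul_zero] at this
      exact this.mono_left nhdsWithin_le_nhds
  have l2 : Tendsto (fun a : ℝ => (a : ℂ)) (𝓝[>] 1) (𝓝 1) := by
    have : Tendsto (fun a : ℝ => (a : ℂ)) (𝓝 1) (𝓝 ((1 : ℝ) : ℂ)) :=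
      Complex.continuous_ofReal.tendsto 1
    simpa using this.mono_left nhdsWithin_le_nhds
  have l3 := (l1.sub (l2.mul (tendsto_phiDeriv hs hpole))).const_mul (4 * (Real.pi : ℂ) ^ 2)
  rw [one_mul, zero_sub, neg_neg, mul_one] at l3
  refine l3.congr' ?_
  filter_upwards [hev] with a ha using ha.symm

/-- The kernels with radial part `defect` approximate `4π²` times the point mass at `Z`. -/
theorem tendsto_kint_defect (hs : 2 < s.re) (hpole : ∀ j : ℕ, s ≠ absWeight n - j)
    (hu : Continuous u) (Z : Siegel) :
    Tendsto (fun a => kint n (defect s n a) u Z) (𝓝[>] 1) (𝓝 (4 * (Real.pi : ℂ) ^ 2 * u Z)) := by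
  obtain ⟨C, hC, hbound⟩ := exists_capPhi_le hs hpole
  have key : Tendsto (fun a => kint n (defect s n a) u Z - (∫ σ, defect s n a σ ∂radial) * u Z)
      (𝓝[>] 1) (𝓝 0) := by
    rw [Metric.tendsto_nhds]
    intro ε hε
    set M := C * (4 * Real.pi ^ 2) + 1
    have hM : 0 < M := by positivity
    have hcont : Continuous fun ξ : Siegel => Hfactor n Z ξ * u ξ :=
      (Continuous.comp (g := fun p : Siegel × Siegel => Hfactor n p.1 p.2) (f := fun W => (Z, W))
        (continuous_Hfactor n) (continuous_const.prodMk continuous_id)).mul hu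
    -- the defect has bounded mass concentrated where `H_k(Z, ξ) u(ξ)` is close to `u(Z)`
    have hnb : {ξ : Siegel | ‖Hfactor n Z ξ * u ξ - u Z‖ < ε / M} ∈ 𝓝 Z := by
      have h1 : Tendsto (fun ξ : Siegel => ‖Hfactor n Z ξ * u ξ - u Z‖) (𝓝 Z) (𝓝 0) := by
        have := ((hcont.tendsto Z).sub_const (u Z)).norm
        simpa [Hfactor_self] using this
      exact h1.eventually_lt_const (by positivity)
    obtain ⟨δ, hδ, hδU⟩ := exists_sigma_lt_imp hnb
    have hev : ∀ᶠ a : ℝ in 𝓝[>] 1, a < 1 + δ :=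
      mem_nhdsWithin_of_mem_nhds (gt_mem_nhds (by linarith))
    filter_upwards [hbound, hev, self_mem_nhdsWithin] with a hb haδ ha
    have ha : 1 < a := ha
    have hd : 0 < a - 1 := by linarith
    have hq := continuousOn_defect hs hpole ha
    have hz : ∀ σ > a, defect s n a σ = 0 := fun σ hσ => defect_eq_zero hs hpole ha (le_of_lt hσ)
    have i1 := integrable_ker_mul (n := n) hq hz hu.locallyIntegrable_dm Z
    have i2 : Integrable (fun ξ => defect s n a (sigma Z ξ) * u Z) dm := by
      have : Integrable (defect s n a) radial := by
        refine integrable_radial_of_le (a := 3) (K := C / (a - 1) ^ 2 * a ^ (3 : ℝ)) (by norm_num)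
          (aesm_radial_of_continuousOn hq) fun σ hσ => ?_
        have hd' := rpow_neg_le_decay (a := 3) hσ
        rcases le_or_gt σ a with h | h
        · have h2 : 1 ≤ a ^ (3 : ℝ) * σ ^ (-(3 : ℝ)) := by
            rw [Real.rpow_neg (by linarith), ← div_eq_mul_inv, one_le_div (by positivity)]
            exact Real.rpow_le_rpow (by linarith) h (by norm_num)
          calc ‖defect s n a σ‖ ≤ C / (a - 1) ^ 2 := (hb σ ⟨hσ.le, h⟩).2
            _ ≤ C / (a - 1) ^ 2 * (a ^ (3 : ℝ) * σ ^ (-(3 : ℝ))) :=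
              le_mul_of_one_le_right (by positivity) h2
            _ ≤ C / (a - 1) ^ 2 * (a ^ (3 : ℝ) * decay 3 σ) := by gcongr
            _ = _ := by ring
        · rw [hz σ h, norm_zero]
          have := decay_nonneg (a := 3) hσ
          positivity
      exact (integrable_comp_sigma this Z).mul_const _
    rw [dist_zero_right, ← integral_comp_sigma (aesm_radial_of_continuousOn hq) Z,
      ← integral_mul_const, kint, ← integral_sub i1 i2]
    have hpt : ∀ ξ, ‖ker n (defect s n a) Z ξ * u ξ - defect s n a (sigma Z ξ) * u Z‖
        ≤ {ξ | sigma Z ξ ≤ a}.indicator (fun _ => C / (a - 1) ^ 2 * (ε / M)) ξ := by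
      intro ξ
      have e : ker n (defect s n a) Z ξ * u ξ - defect s n a (sigma Z ξ) * u Z
          = defect s n a (sigma Z ξ) * (Hfactor n Z ξ * u ξ - u Z) := by rw [ker]; ring
      rw [e]
      by_cases h : sigma Z ξ ≤ a
      · rw [Set.indicator_of_mem (by exact h), norm_mul]
        have h1 : ‖Hfactor n Z ξ * u ξ - u Z‖ < ε / M := hδU ξ (h.trans_lt haδ)
        gcongr
        exact (hb _ ⟨one_le_sigma Z ξ, h⟩).2
      · rw [Set.indicator_of_notMem (by exact h), hz _ (not_le.1 h)]
        simp
    have hms : MeasurableSet {ξ | sigma Z ξ ≤ a} := measurable_sigma Z measurableSet_Iic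
    calc _ ≤ ∫ ξ, {ξ | sigma Z ξ ≤ a}.indicator (fun _ => C / (a - 1) ^ 2 * (ε / M)) ξ ∂dm :=
          norm_integral_le_of_norm_le ((integrable_indicator_iff hms).2
            (integrableOn_const (dm_sigma_le_lt_top Z a).ne)) (Eventually.of_forall hpt)
      _ = dm.real {ξ | sigma Z ξ ≤ a} * (C / (a - 1) ^ 2 * (ε / M)) := by
          rw [integral_indicator hms, setIntegral_const, smul_eq_mul]
      _ ≤ 4 * Real.pi ^ 2 * (a - 1) ^ 2 * (C / (a - 1) ^ 2 * (ε / M)) := by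
          gcongr
          exact ENNReal.toReal_le_of_le_ofReal (by positivity) (dm_sigma_le_le Z ha.le)
      _ = (C * (4 * Real.pi ^ 2)) * (ε / M) := by field_simp
      _ < M * (ε / M) := by gcongr; simp [M]
      _ = ε := by field_simp
  have h2 := key.add ((tendsto_integral_defect hs hpole).mul_const (u Z))
  rw [zero_add] at h2
  exact h2.congr fun a => by ring

/-- The radial Green function, set to zero at `σ = 1`; this makes it globally measurable. -/
def phi0 (s : ℂ) (n : ℤ) : ℝ → ℂ := (Set.Ioi 1).indicator (phi s n)

theorem phi0_eq {σ : ℝ} (hσ : 1 < σ) : phi0 s n σ = phi s n σ := Set.indicator_of_mem hσ _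

theorem continuousOn_phi (hs : 2 < s.re) (hpole : ∀ j : ℕ, s ≠ absWeight n - j) :
    ContinuousOn (phi s n) (Set.Ioi 1) := fun _ hσ =>
  (hasDerivAt_phi hs hpole hσ).continuousAt.continuousWithinAt

theorem measurable_phi0 (hs : 2 < s.re) (hpole : ∀ j : ℕ, s ≠ absWeight n - j) :
    Measurable (phi0 s n) := by
  classical
  have := (continuousOn_phi hs hpole).measurable_piecewise (g := (0 : ℝ → ℂ))
    continuousOn_const measurableSet_Ioi
  rwa [Set.piecewise_eq_indicator] at this

theorem exists_phi0_le (hs : 2 < s.re) (hpole : ∀ j : ℕ, s ≠ absWeight n - j) :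
    ∃ K : ℝ, 0 ≤ K ∧ ∀ σ : ℝ, 1 < σ → ‖phi0 s n σ‖ ≤ K * decay s.re σ := by
  obtain ⟨K, hK, h⟩ := exists_phi_le_decay hs hpole
  exact ⟨K, hK, fun σ hσ => by rw [phi0_eq hσ]; exact h σ hσ⟩

theorem integrable_phi0 (hs : 2 < s.re) (hpole : ∀ j : ℕ, s ≠ absWeight n - j) :
    Integrable (phi0 s n) radial := by
  obtain ⟨K, hK, h⟩ := exists_phi0_le hs hpole
  exact integrable_radial_of_le hs (measurable_phi0 hs hpole).aestronglyMeasurable h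

/-- The capped functions are uniformly dominated. -/
theorem exists_capPhi_le_decay (hs : 2 < s.re) (hpole : ∀ j : ℕ, s ≠ absWeight n - j) :
    ∃ K : ℝ, 0 ≤ K ∧ ∀ᶠ a : ℝ in 𝓝[>] 1, ∀ σ : ℝ, 1 < σ → ‖capPhi s n a σ‖ ≤ K * decay s.re σ := by
  obtain ⟨K, hK, h⟩ := exists_phi_le_decay hs hpole
  obtain ⟨C, hC, hbound⟩ := exists_capPhi_le hs hpole
  refine ⟨K + C * 2 ^ (s.re - 1), by positivity, ?_⟩
  have e3 : ∀ᶠ a : ℝ in 𝓝[>] 1, a < 2 :=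
    mem_nhdsWithin_of_mem_nhds (gt_mem_nhds (by norm_num))
  filter_upwards [hbound, e3, self_mem_nhdsWithin] with a hb ha2 ha σ hσ
  have ha : 1 < a := ha
  have hd := decay_nonneg (a := s.re) hσ
  have hσ' : 0 < σ - 1 := by linarith
  rw [add_mul]
  rcases le_or_gt a σ with h2 | h2
  · rw [capPhi_eq hs hpole ha h2]
    exact (h σ hσ).trans (le_add_of_nonneg_right (by positivity))
  · calc ‖capPhi s n a σ‖ ≤ C / (a - 1) := (hb σ ⟨hσ.le, h2.le⟩).1
      _ ≤ C * (σ - 1)⁻¹ := by rw [← div_eq_mul_inv]; gcongr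
      _ ≤ C * (2 ^ (s.re - 1) * decay s.re σ) := by
        gcongr; exact inv_le_decay (by linarith) hσ (by linarith)
      _ = C * 2 ^ (s.re - 1) * decay s.re σ := by ring
      _ ≤ _ := le_add_of_nonneg_left (by positivity)

/-- For fixed `a` the capped function satisfies the decay conditions under which point-pair
operators commute with `Δ_k`. -/
theorem exists_capPhi_le_rpow (hs : 2 < s.re) (hpole : ∀ j : ℕ, s ≠ absWeight n - j) (ha : 1 < a)
    (ha2 : a < 2) : ∃ K : ℝ, ∀ σ : ℝ, 1 ≤ σ → ‖capPhi s n a σ‖ ≤ K * σ ^ (-s.re) ∧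
      σ * ‖deriv (capPhi s n a) σ‖ ≤ K * σ ^ (-s.re) ∧
      ‖radL n (capPhi s n a) σ‖ ≤ K * σ ^ (-s.re) := by
  obtain ⟨K0, hK0, h0⟩ := phi_bound_atTop hs hpole
  have c0 := contDiff_capPhi hs hpole ha
  have c1 := continuous_capD hs hpole ha
  have c2 : ContinuousOn (radL n (capPhi s n a)) (Set.Icc 1 2) :=
    (continuousOn_radL c0).mono fun x hx => show (0 : ℝ) < x by linarith [hx.1]
  obtain ⟨M0, hM0⟩ := isCompact_Icc.exists_bound_of_continuousOn
    (c0.continuous.continuousOn (s := Set.Icc (1 : ℝ) 2))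
  obtain ⟨M1, hM1⟩ := isCompact_Icc.exists_bound_of_continuousOn
    (c1.continuousOn (s := Set.Icc (1 : ℝ) 2))
  obtain ⟨M2, hM2⟩ := isCompact_Icc.exists_bound_of_continuousOn c2
  have p0 := (norm_nonneg _).trans (hM0 1 (by simp))
  have p1 := (norm_nonneg _).trans (hM1 1 (by simp))
  have p2 := (norm_nonneg _).trans (hM2 1 (by simp))
  set L := ‖s * (s - 2)‖
  refine ⟨(M0 + 2 * M1 + M2) * 2 ^ s.re + (1 + L) * K0, fun σ hσ => ?_⟩
  have hσ0 : 0 < σ := by linarith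
  have hp : 0 ≤ σ ^ (-s.re) := by positivity
  rw [deriv_capPhi hs hpole ha, add_mul]
  rcases le_or_gt 2 σ with h2 | h2
  · have haσ : a ≤ σ := by linarith
    rw [capPhi_eq hs hpole ha haσ, capD_eq hs hpole ha haσ, radL_capPhi hs hpole ha haσ, norm_mul]
    have t : (1 + L) * K0 * σ ^ (-s.re) ≤ (M0 + 2 * M1 + M2) * 2 ^ s.re * σ ^ (-s.re)
        + (1 + L) * K0 * σ ^ (-s.re) := le_add_of_nonneg_left (by positivity)
    have q : 0 ≤ L * (K0 * σ ^ (-s.re)) := by positivity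
    have q' : 0 ≤ K0 * σ ^ (-s.re) := by positivity
    refine ⟨?_, ?_, ?_⟩
    · linarith [(h0 σ h2).1]
    · linarith [(h0 σ h2).2]
    · have : L * ‖phi s n σ‖ ≤ L * (K0 * σ ^ (-s.re)) := by gcongr; exact (h0 σ h2).1
      linarith
  · have hσm : σ ∈ Set.Icc (1 : ℝ) 2 := ⟨hσ, h2.le⟩
    have h3 : 1 ≤ 2 ^ s.re * σ ^ (-s.re) := by
      rw [Real.rpow_neg hσ0.le, ← div_eq_mul_inv, one_le_div (by positivity)]
      exact Real.rpow_le_rpow hσ0.le h2.le (by linarith)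
    have t : M0 + 2 * M1 + M2 ≤ (M0 + 2 * M1 + M2) * 2 ^ s.re * σ ^ (-s.re)
        + (1 + L) * K0 * σ ^ (-s.re) := by
      have := le_mul_of_one_le_right (show 0 ≤ M0 + 2 * M1 + M2 by positivity) h3
      have q : 0 ≤ (1 + L) * K0 * σ ^ (-s.re) := by positivity
      linarith
    have m1 : σ * ‖capD s n a σ‖ ≤ 2 * M1 := by gcongr; exact hM1 σ hσm
    exact ⟨by linarith [hM0 σ hσm], by linarith, by linarith [hM2 σ hσm]⟩

/-- The Green function inverts `s(s-2) - Δ_k` on bounded functions. -/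
theorem kint_phi0_sub_lapl (hs : 2 < s.re) (hpole : ∀ j : ℕ, s ≠ absWeight n - j)
    (hu : ContDiffOn ℝ 2 (extendZero u) siegelSet) (hB : ∀ ξ, ‖u ξ‖ ≤ B)
    (hB' : ∀ ξ, ‖lapl n u ξ‖ ≤ B) (Z : Siegel) :
    kint n (phi0 s n) (fun ξ => s * (s - 2) * u ξ - lapl n u ξ) Z
      = 4 * (Real.pi : ℂ) ^ 2 * u Z := by
  obtain ⟨K, hK, hbound⟩ := exists_capPhi_le_decay hs hpole
  have cu := continuous_of_contDiffOn hu
  have cl := continuous_lapl (n := n) hu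
  have hB0 : 0 ≤ B := (norm_nonneg _).trans (hB base)
  set v : Siegel → ℂ := fun ξ => s * (s - 2) * u ξ - lapl n u ξ
  have cv : Continuous v := (continuous_const.mul cu).sub cl
  have hv : ∀ ξ, ‖v ξ‖ ≤ ‖s * (s - 2)‖ * B + B := fun ξ =>
    (norm_sub_le _ _).trans (add_le_add (by rw [norm_mul]; gcongr; exact hB ξ) (hB' ξ))
  have e3 : ∀ᶠ a : ℝ in 𝓝[>] 1, a < 2 :=
    mem_nhdsWithin_of_mem_nhds (gt_mem_nhds (by norm_num))
  have l1 : Tendsto (fun a => kint n (capPhi s n a) v Z) (𝓝[>] 1)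
      (𝓝 (kint n (phi0 s n) v Z)) := by
    refine tendsto_integral_filter_of_dominated_convergence
      (fun ξ => K * decay s.re (sigma Z ξ) * (‖s * (s - 2)‖ * B + B)) ?_ ?_ ?_ ?_
    · filter_upwards [self_mem_nhdsWithin] with a ha
      exact (aestronglyMeasurable_ker n (contDiff_capPhi hs hpole
        ha).continuous.measurable.aestronglyMeasurable Z).mul cv.aestronglyMeasurable
    · filter_upwards [hbound] with a hb
      filter_upwards [ae_one_lt_sigma Z] with ξ hξ
      have := hb _ hξ
      rw [norm_mul, norm_ker]
      exact mul_le_mul this (hv ξ) (norm_nonneg _) ((norm_nonneg _).trans this)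
    · exact ((integrable_comp_sigma (integrable_decay hs) Z).const_mul K).mul_const _
    · filter_upwards [ae_one_lt_sigma Z] with ξ hξ
      refine tendsto_const_nhds.congr' ?_
      filter_upwards [mem_nhdsWithin_of_mem_nhds (gt_mem_nhds hξ), self_mem_nhdsWithin] with a h1 h2
      rw [ker, ker, phi0_eq hξ, capPhi_eq hs hpole h2 (le_of_lt h1)]
  -- for each `a`, moving `Δ_k` onto the smooth kernel turns it into the defect kernel
  refine tendsto_nhds_unique l1 ((tendsto_kint_defect hs hpole cu Z).congr' ?_)
  filter_upwards [e3, self_mem_nhdsWithin] with a ha2 ha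
  have ha : 1 < a := ha
  obtain ⟨K', hK'⟩ := exists_capPhi_le_rpow hs hpole ha ha2
  have c0 := contDiff_capPhi hs hpole ha
  have comm := kint_lapl_of_decay hs c0 (fun σ hσ => (hK' σ hσ).1) (fun σ hσ => (hK' σ hσ).2.1)
    (fun σ hσ => (hK' σ hσ).2.2) hu hB hB' Z
  have int : ∀ (q : ℝ → ℂ) (w : Siegel → ℂ), ContinuousOn q (Set.Ioi 0) →
      (∀ σ, 1 ≤ σ → ‖q σ‖ ≤ K' * σ ^ (-s.re)) → Continuous w → (∀ ξ, ‖w ξ‖ ≤ B) →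
      Integrable (fun ξ => ker n q Z ξ * w ξ) dm := by
    intro q w hq hqb hw hwB
    refine ((integrable_comp_sigma (integrable_rpow_neg hs) Z).const_mul K' |>.mul_const B).mono'
      ((aestronglyMeasurable_ker n (aesm_radial_of_continuousOn hq) Z).mul hw.aestronglyMeasurable)
      (Eventually.of_forall fun ξ => ?_)
    rw [norm_mul, norm_ker]
    have := hqb _ (one_le_sigma Z ξ)
    exact mul_le_mul this (hwB ξ) (norm_nonneg _) ((norm_nonneg _).trans this)
  have i1 := int _ u c0.continuous.continuousOn (fun σ hσ => (hK' σ hσ).1) cu hB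
  have i2 := int _ u (continuousOn_radL (n := n) c0) (fun σ hσ => (hK' σ hσ).2.2) cu hB
  have i3 := int _ _ c0.continuous.continuousOn (fun σ hσ => (hK' σ hσ).1) cl hB'
  have e1 : kint n (capPhi s n a) v Z = s * (s - 2) * kint n (capPhi s n a) u Z
      - kint n (capPhi s n a) (lapl n u) Z := by
    rw [kint, kint, kint, ← integral_const_mul, ← integral_sub (i1.const_mul _) i3]
    refine integral_congr_ae (Eventually.of_forall fun ξ => ?_)
    simp only [v]; ring
  have e2 : kint n (defect s n a) u Z = s * (s - 2) * kint n (capPhi s n a) u Z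
      - kint n (radL n (capPhi s n a)) u Z := by
    rw [kint, kint, kint, ← integral_const_mul, ← integral_sub (i1.const_mul _) i2]
    refine integral_congr_ae (Eventually.of_forall fun ξ => ?_)
    simp only [ker, defect]; ring
  rw [e1, e2, comm]

end Representation

end

section

/-! ### Schur's test and Hilbert–Schmidt operators -/

universe u

section KernelOperator

open scoped ENNReal NNReal

variable {X : Type*} [MeasurableSpace X] {μ : Measure X}

theorem eLpNorm_two_sq (f : X → ℂ) : eLpNorm f 2 μ ^ 2 = ∫⁻ x, ‖f x‖ₑ ^ 2 ∂μ := by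
  have h := eLpNorm_nnreal_pow_eq_lintegral (μ := μ) (f := f) (p := 2) two_ne_zero
  simpa using h

theorem sq_enorm_toLp (F : Lp ℂ 2 μ) : ‖F‖ₑ ^ 2 = ∫⁻ x, ‖F x‖ₑ ^ 2 ∂μ := by
  rw [Lp.enorm_def, eLpNorm_two_sq]

theorem sq_norm_Lp (F : Lp ℂ 2 μ) : ‖F‖ ^ 2 = ∫ x, ‖F x‖ ^ 2 ∂μ := by
  have h := inner_self_eq_norm_sq_to_K (𝕜 := ℂ) F
  rw [L2.inner_def] at h
  simp only [inner_self_eq_norm_sq_to_K] at h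
  norm_cast at h
  exact h.symm

theorem memLp_two_of_lintegral_lt_top {f : X → ℂ} (hf : AEStronglyMeasurable f μ)
    (h : ∫⁻ x, ‖f x‖ₑ ^ 2 ∂μ < ∞) : MemLp f 2 μ := by
  refine ⟨hf, ?_⟩
  rw [← eLpNorm_two_sq] at h
  simpa using h

/-- Cauchy–Schwarz for the measure with density `a`. -/
theorem sq_lintegral_mul_le {a b : X → ℝ≥0∞} (ha : AEMeasurable a μ) (hb : AEMeasurable b μ) :
    (∫⁻ y, a y * b y ∂μ) ^ 2 ≤ (∫⁻ y, a y ∂μ) * ∫⁻ y, a y * b y ^ 2 ∂μ := by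
  have h := ENNReal.lintegral_mul_le_Lp_mul_Lq μ (p := 2) (q := 2)
    (by norm_num [Real.holderConjugate_iff]) (f := fun y => a y ^ (1 / 2 : ℝ))
    (g := fun y => a y ^ (1 / 2 : ℝ) * b y) (ha.pow_const _) ((ha.pow_const _).mul hb)
  have e0 : ∀ y, a y ^ (1 / 2 : ℝ) * a y ^ (1 / 2 : ℝ) = a y := fun y => by
    rw [← ENNReal.rpow_add_of_nonneg _ _ (by norm_num) (by norm_num)]; norm_num
  have e1 : ∀ y, (a y ^ (1 / 2 : ℝ)) ^ (2 : ℝ) = a y := fun y => by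
    rw [← ENNReal.rpow_mul]; norm_num
  have e2 : ∀ y, (a y ^ (1 / 2 : ℝ) * b y) ^ (2 : ℝ) = a y * b y ^ 2 := fun y => by
    rw [ENNReal.mul_rpow_of_nonneg _ _ (by norm_num), e1]; norm_num
  have e3 : ∀ y, ((fun y => a y ^ (1 / 2 : ℝ)) * fun y => a y ^ (1 / 2 : ℝ) * b y) y = a y * b y :=
    fun y => by rw [Pi.mul_apply, ← mul_assoc, e0]
  simp only [e1, e2] at h
  rw [lintegral_congr e3] at h
  refine (pow_le_pow_left₀ (by simp) h 2).trans_eq ?_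
  rw [mul_pow]
  simp only [← ENNReal.rpow_natCast, ← ENNReal.rpow_mul]
  norm_num

variable [SFinite μ]

/-- Schur's test. -/
theorem lintegral_sq_lintegral_mul_le {k : X → X → ℝ≥0∞} (hk : Measurable (Function.uncurry k))
    {C : ℝ≥0∞} (hrow : ∀ x, ∫⁻ y, k x y ∂μ ≤ C) (hcol : ∀ y, ∫⁻ x, k x y ∂μ ≤ C)
    {b : X → ℝ≥0∞} (hb : AEMeasurable b μ) :
    ∫⁻ x, (∫⁻ y, k x y * b y ∂μ) ^ 2 ∂μ ≤ C ^ 2 * ∫⁻ y, b y ^ 2 ∂μ := by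
  calc ∫⁻ x, (∫⁻ y, k x y * b y ∂μ) ^ 2 ∂μ
      ≤ ∫⁻ x, C * ∫⁻ y, k x y * b y ^ 2 ∂μ ∂μ := by
        refine lintegral_mono fun x => ?_
        refine (sq_lintegral_mul_le (hk.comp measurable_prodMk_left).aemeasurable hb).trans ?_
        exact mul_le_mul_left (hrow x) _
    _ ≤ C * ∫⁻ x, ∫⁻ y, k x y * b y ^ 2 ∂μ ∂μ := by
        have hm : AEMeasurable (fun p : X × X => k p.1 p.2 * b p.2 ^ 2) (μ.prod μ) :=
          hk.aemeasurable.mul ((hb.pow_const 2).comp_snd)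
        rw [lintegral_const_mul'' _ hm.lintegral_prod_right']
    _ = C * ∫⁻ y, (∫⁻ x, k x y ∂μ) * b y ^ 2 ∂μ := by
        have hm : AEMeasurable (fun p : X × X => k p.1 p.2 * b p.2 ^ 2) (μ.prod μ) :=
          hk.aemeasurable.mul ((hb.pow_const 2).comp_snd)
        rw [lintegral_lintegral_swap hm]
        congr 1
        refine lintegral_congr fun y => ?_
        exact lintegral_mul_const (b y ^ 2) (hk.comp measurable_prodMk_right)
    _ ≤ C * ∫⁻ y, C * b y ^ 2 ∂μ := by
        gcongr with y
        exact hcol y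
    _ = C ^ 2 * ∫⁻ y, b y ^ 2 ∂μ := by
        rw [lintegral_const_mul'' _ (hb.pow_const 2), ← mul_assoc, sq]

/-- A jointly measurable kernel whose rows and columns have `L¹`-norms at most `C`. -/
structure IsSchurKernel (μ : Measure X) (C : ℝ≥0) (k : X → X → ℂ) : Prop where
  measurable : Measurable (Function.uncurry k)
  row : ∀ x, ∫⁻ y, ‖k x y‖ₑ ∂μ ≤ C
  col : ∀ y, ∫⁻ x, ‖k x y‖ₑ ∂μ ≤ C

namespace IsSchurKernel

variable {C : ℝ≥0} {k : X → X → ℂ}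

theorem lintegral_sq_le (hk : IsSchurKernel μ C k) {f : X → ℂ} (hf : AEStronglyMeasurable f μ) :
    ∫⁻ x, (∫⁻ y, ‖k x y * f y‖ₑ ∂μ) ^ 2 ∂μ ≤ C ^ 2 * ∫⁻ y, ‖f y‖ₑ ^ 2 ∂μ := by
  simp only [enorm_mul]
  exact lintegral_sq_lintegral_mul_le (k := fun x y => ‖k x y‖ₑ) hk.measurable.enorm hk.row hk.col
    hf.enorm

theorem lintegral_sq_lt_top (hk : IsSchurKernel μ C k) {f : X → ℂ} (hf : MemLp f 2 μ) :
    ∫⁻ x, (∫⁻ y, ‖k x y * f y‖ₑ ∂μ) ^ 2 ∂μ < ∞ := by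
  refine (hk.lintegral_sq_le hf.1).trans_lt ?_
  rw [← eLpNorm_two_sq]
  exact ENNReal.mul_lt_top (by simp) (by simpa using hf.2)

theorem aestronglyMeasurable_mul (hk : IsSchurKernel μ C k) {f : X → ℂ}
    (hf : AEStronglyMeasurable f μ) :
    AEStronglyMeasurable (fun p : X × X => k p.1 p.2 * f p.2) (μ.prod μ) :=
  hk.measurable.aestronglyMeasurable.mul hf.comp_snd

theorem ae_integrable (hk : IsSchurKernel μ C k) {f : X → ℂ} (hf : MemLp f 2 μ) :
    ∀ᵐ x ∂μ, Integrable (fun y => k x y * f y) μ := by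
  have hm := (hk.aestronglyMeasurable_mul hf.1).enorm.lintegral_prod_right'
  filter_upwards [ae_lt_top' (hm.pow_const 2) (hk.lintegral_sq_lt_top hf).ne] with x hx
  exact ⟨((hk.measurable.comp measurable_prodMk_left).aestronglyMeasurable).mul hf.1,
    by simpa [HasFiniteIntegral] using hx⟩

theorem memLp (hk : IsSchurKernel μ C k) {f : X → ℂ} (hf : MemLp f 2 μ) :
    MemLp (fun x => ∫ y, k x y * f y ∂μ) 2 μ := by
  refine memLp_two_of_lintegral_lt_top (hk.aestronglyMeasurable_mul hf.1).integral_prod_right' ?_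
  refine lt_of_le_of_lt (lintegral_mono fun x => ?_) (hk.lintegral_sq_lt_top hf)
  exact pow_le_pow_left₀ (by simp) (enorm_integral_le_lintegral_enorm _) 2

/-- The bounded operator on `L²` with a Schur kernel. -/
def op (hk : IsSchurKernel μ C k) : Lp ℂ 2 μ →L[ℂ] Lp ℂ 2 μ :=
  LinearMap.mkContinuous
    { toFun := fun F => (hk.memLp (Lp.memLp F)).toLp _
      map_add' := fun F G => by
        rw [← MemLp.toLp_add]
        refine MemLp.toLp_congr _ _ ?_
        filter_upwards [hk.ae_integrable (Lp.memLp F), hk.ae_integrable (Lp.memLp G)] with x h1 h2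
        rw [Pi.add_apply, ← integral_add h1 h2]
        refine integral_congr_ae ?_
        filter_upwards [Lp.coeFn_add F G] with y hy
        rw [hy, Pi.add_apply, mul_add]
      map_smul' := fun c F => by
        rw [RingHom.id_apply, ← MemLp.toLp_const_smul]
        refine MemLp.toLp_congr _ _ (Eventually.of_forall fun x => ?_)
        rw [Pi.smul_apply, smul_eq_mul, ← integral_const_mul]
        refine integral_congr_ae ?_
        filter_upwards [Lp.coeFn_smul c F] with y hy
        rw [hy, Pi.smul_apply, smul_eq_mul, mul_left_comm] }
    C fun F => by
      have h : ‖(hk.memLp (Lp.memLp F)).toLp _‖ₑ ^ 2 ≤ (C * ‖F‖ₑ) ^ 2 := by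
        rw [Lp.enorm_toLp, eLpNorm_two_sq, mul_pow, sq_enorm_toLp]
        refine le_trans (lintegral_mono fun x => ?_) (hk.lintegral_sq_le (Lp.aestronglyMeasurable F))
        exact pow_le_pow_left₀ (by simp) (enorm_integral_le_lintegral_enorm _) 2
      have h' := (ENNReal.pow_le_pow_left_iff two_ne_zero).1 h
      have h2 := ENNReal.toReal_mono (by finiteness) h'
      simpa using h2

theorem op_apply_ae (hk : IsSchurKernel μ C k) (F : Lp ℂ 2 μ) :
    hk.op F =ᵐ[μ] fun x => ∫ y, k x y * F y ∂μ := MemLp.coeFn_toLp (hk.memLp (Lp.memLp F))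

theorem norm_op_le (hk : IsSchurKernel μ C k) : ‖hk.op‖ ≤ C :=
  LinearMap.mkContinuous_norm_le _ C.2 _

theorem op_toLp (hk : IsSchurKernel μ C k) {f : X → ℂ} (hf : MemLp f 2 μ) :
    hk.op (hf.toLp f) =ᵐ[μ] fun x => ∫ y, k x y * f y ∂μ := by
  filter_upwards [hk.op_apply_ae (hf.toLp f)] with x hx
  rw [hx]
  refine integral_congr_ae ?_
  filter_upwards [hf.coeFn_toLp] with y hy
  rw [hy]

theorem op_sub {C' C'' : ℝ≥0} {k' : X → X → ℂ} (hk : IsSchurKernel μ C k)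
    (hk' : IsSchurKernel μ C' k') (hs : IsSchurKernel μ C'' (fun x y => k x y - k' x y)) :
    hk.op - hk'.op = hs.op := by
  ext1 F
  refine Lp.ext ?_
  rw [_root_.sub_apply]
  filter_upwards [Lp.coeFn_sub (hk.op F) (hk'.op F), hk.op_apply_ae F, hk'.op_apply_ae F,
    hs.op_apply_ae F, hk.ae_integrable (Lp.memLp F), hk'.ae_integrable (Lp.memLp F)]
    with x h1 h2 h3 h4 h5 h6
  rw [h1, Pi.sub_apply, h2, h3, h4, ← integral_sub h5 h6]
  simp only [sub_mul]

/-- The operator with a Hermitian Schur kernel is symmetric. -/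
theorem isSymmetric_op (hk : IsSchurKernel μ C k)
    (hsymm : ∀ x y, (starRingEnd ℂ) (k x y) = k y x) :
    (hk.op : Lp ℂ 2 μ →ₗ[ℂ] Lp ℂ 2 μ).IsSymmetric := by
  intro F G
  have hF := Lp.memLp F
  have hG := Lp.memLp G
  rw [ContinuousLinearMap.coe_coe, L2.inner_def, L2.inner_def]
  have e1 : ∫ x, inner ℂ (hk.op F x) (G x) ∂μ =
      ∫ x, ∫ y, G x * (starRingEnd ℂ) (k x y * F y) ∂μ ∂μ := by
    refine integral_congr_ae ?_
    filter_upwards [hk.op_apply_ae F] with x hx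
    rw [hx, RCLike.inner_apply, ← integral_conj, integral_const_mul]
  have e2 : ∫ y, inner ℂ (F y) (hk.op G y) ∂μ =
      ∫ y, ∫ x, G x * (starRingEnd ℂ) (k x y * F y) ∂μ ∂μ := by
    refine integral_congr_ae ?_
    filter_upwards [hk.op_apply_ae G] with y hy
    rw [hy, RCLike.inner_apply, ← integral_mul_const]
    refine integral_congr_ae (Eventually.of_forall fun x => ?_)
    dsimp only
    rw [map_mul, hsymm]
    ring
  rw [e1, e2]
  refine integral_integral_swap ?_
  have hm : AEStronglyMeasurable (fun p : X × X => G p.1 * (starRingEnd ℂ) (k p.1 p.2 * F p.2))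
      (μ.prod μ) :=
    hG.1.comp_fst.mul (continuous_star.comp_aestronglyMeasurable (hk.aestronglyMeasurable_mul hF.1))
  refine ⟨hm, ?_⟩
  rw [HasFiniteIntegral]
  erw [lintegral_prod _ hm.enorm]
  simp only [enorm_mul, RCLike.enorm_conj]
  have hm2 : AEMeasurable (fun x => ∫⁻ y, ‖k x y‖ₑ * ‖F y‖ₑ ∂μ) μ := by
    have := (hk.aestronglyMeasurable_mul hF.1).enorm.lintegral_prod_right'
    simpa only [enorm_mul] using this
  calc ∫⁻ x, ∫⁻ y, ‖G x‖ₑ * (‖k x y‖ₑ * ‖F y‖ₑ) ∂μ ∂μ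
      = ∫⁻ x, ‖G x‖ₑ * ∫⁻ y, ‖k x y‖ₑ * ‖F y‖ₑ ∂μ ∂μ := by
        refine lintegral_congr fun x => ?_
        have hm3 : AEMeasurable (fun y => ‖k x y‖ₑ) μ :=
          (hk.measurable.comp measurable_prodMk_left).enorm.aemeasurable
        exact lintegral_const_mul'' _ (hm3.mul hF.1.enorm)
    _ ≤ (∫⁻ x, ‖G x‖ₑ ^ (2:ℝ) ∂μ) ^ (1 / 2 : ℝ) *
        (∫⁻ x, (∫⁻ y, ‖k x y‖ₑ * ‖F y‖ₑ ∂μ) ^ (2:ℝ) ∂μ) ^ (1 / 2 : ℝ) :=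
        ENNReal.lintegral_mul_le_Lp_mul_Lq μ (by norm_num [Real.holderConjugate_iff])
          hG.1.enorm hm2
    _ < ∞ := by
        refine ENNReal.mul_lt_top ?_ ?_ <;> refine ENNReal.rpow_lt_top_of_nonneg (by norm_num) ?_
        · have h := hG.2
          simp only [ENNReal.rpow_ofNat, ← eLpNorm_two_sq]
          finiteness
        · have h := hk.lintegral_sq_lt_top hF
          simp only [ENNReal.rpow_ofNat]
          simp only [enorm_mul] at h
          exact h.ne

end IsSchurKernel

end KernelOperator

/-- Hilbert–Schmidt operators are compact. -/
theorem isCompactOperator_of_sum_norm_sq_le {H : Type u} [NormedAddCommGroup H]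
    [InnerProductSpace ℂ H] [CompleteSpace H] (T : H →L[ℂ] H) (B : ℝ)
    (h : ∀ (ι : Type u) (v : ι → H) (s : Finset ι), Orthonormal ℂ v → ∑ i ∈ s, ‖T (v i)‖ ^ 2 ≤ B) :
    IsCompactOperator T := by
  classical
  obtain ⟨w, b, hb⟩ := exists_hilbertBasis ℂ H
  have hsum : Summable fun i => ‖T (b i)‖ ^ 2 :=
    summable_of_sum_le (fun _ => by positivity) fun u => h _ b u b.orthonormal
  let F : Finset w → H →L[ℂ] H := fun u =>
    ∑ i ∈ u, (ContinuousLinearMap.toSpanSingleton ℂ (T (b i))).comp (innerSL ℂ (b i))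
  have hF : ∀ u f, F u f = ∑ i ∈ u, inner ℂ (b i) f • T (b i) := by
    intro u f
    simp [F]
  have hFc : ∀ u, IsCompactOperator (F u) := by
    intro u
    refine Finset.sum_induction _ (fun S : H →L[ℂ] H => IsCompactOperator S)
      (fun a c ha hc => ha.add hc) isCompactOperator_zero fun i _ => ?_
    exact (isCompactOperator_of_locallyCompactSpace_rng
      (ContinuousLinearMap.toSpanSingleton ℂ (T (b i)))).comp_clm _
  refine isCompactOperator_of_tendsto (l := atTop) (F := F) ?_ (Eventually.of_forall hFc)
  rw [Metric.tendsto_atTop]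
  intro ε hε
  -- the truncations `F u` to finitely many basis vectors have finite rank and converge in norm
  obtain ⟨u, hu⟩ := summable_iff_vanishing_norm.1 hsum ((ε / 2) ^ 2) (by positivity)
  refine ⟨u, fun v hv => ?_⟩
  rw [dist_comm, dist_eq_norm]
  refine lt_of_le_of_lt (ContinuousLinearMap.opNorm_le_bound _ (by positivity : 0 ≤ ε / 2)
    fun f => ?_) (half_lt_self hε)
  have hs : HasSum (fun i => inner ℂ (b i) f • T (b i)) (T f) := by
    have := (b.hasSum_repr f).mapL T
    simpa only [map_smul, b.repr_apply_apply] using this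
  have hlim : Tendsto (fun t : Finset w => ‖∑ i ∈ t, inner ℂ (b i) f • T (b i) - F v f‖) atTop
      (𝓝 ‖(T - F v) f‖) := by
    rw [_root_.sub_apply]
    exact (hs.sub_const _).norm
  refine le_of_tendsto hlim ?_
  filter_upwards [eventually_ge_atTop v] with t ht
  rw [hF, ← Finset.sum_sdiff ht, add_sub_cancel_right]
  have h1 : ∑ i ∈ t \ v, ‖T (b i)‖ ^ 2 ≤ (ε / 2) ^ 2 := by
    have h2 := hu (t \ v) (Disjoint.mono_right hv Finset.sdiff_disjoint)
    exact (le_abs_self _).trans h2.le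
  have h3 : ∑ i ∈ t \ v, ‖inner ℂ (b i) f‖ ^ 2 ≤ ‖f‖ ^ 2 := b.orthonormal.sum_inner_products_le f
  have h4 : (∑ i ∈ t \ v, ‖inner ℂ (b i) f‖ * ‖T (b i)‖) ^ 2 ≤ (ε / 2 * ‖f‖) ^ 2 := by
    refine (Finset.sum_mul_sq_le_sq_mul_sq _ _ _).trans ?_
    rw [mul_pow, mul_comm]
    exact mul_le_mul h1 h3 (by positivity) (by positivity)
  calc ‖∑ i ∈ t \ v, inner ℂ (b i) f • T (b i)‖
      ≤ ∑ i ∈ t \ v, ‖inner ℂ (b i) f‖ * ‖T (b i)‖ := by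
        refine (norm_sum_le _ _).trans_eq ?_
        simp only [norm_smul]
    _ ≤ ε / 2 * ‖f‖ := (pow_le_pow_iff_left₀ (by positivity) (by positivity) two_ne_zero).1 h4

/-- An integral operator with bounded kernel on a finite measure space is Hilbert–Schmidt. -/
theorem IsSchurKernel.isCompactOperator_of_bounded {X : Type*} [MeasurableSpace X] {μ : Measure X}
    [IsFiniteMeasure μ] {C : NNReal} {k : X → X → ℂ} (hk : IsSchurKernel μ C k) {B : ℝ}
    (hB : ∀ x y, ‖k x y‖ ≤ B) : IsCompactOperator hk.op := by
  refine isCompactOperator_of_sum_norm_sq_le _ (B ^ 2 * μ.real Set.univ ^ 2) fun ι v s hv => ?_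
  have hrow : ∀ x, MemLp (fun y => (starRingEnd ℂ) (k x y)) 2 μ := fun x =>
    MemLp.of_bound (continuous_star.measurable.comp
      (hk.measurable.comp measurable_prodMk_left)).aestronglyMeasurable B
      (Eventually.of_forall fun y => by
        change ‖(starRingEnd ℂ) (k x y)‖ ≤ B
        rw [RCLike.norm_conj]; exact hB x y)
  -- Bessel's inequality for the row `conj (k x ·)`
  have key : ∀ x, ∑ i ∈ s, ‖∫ y, k x y * v i y ∂μ‖ ^ 2 ≤ B ^ 2 * μ.real Set.univ := by
    intro x
    have e1 : ∀ i, ∫ y, k x y * v i y ∂μ = inner ℂ ((hrow x).toLp _) (v i) := by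
      intro i
      rw [L2.inner_def]
      refine integral_congr_ae ?_
      filter_upwards [(hrow x).coeFn_toLp] with y hy
      rw [hy, RCLike.inner_apply, RCLike.conj_conj, mul_comm]
    have e2 : ∑ i ∈ s, ‖∫ y, k x y * v i y ∂μ‖ ^ 2 ≤ ‖(hrow x).toLp _‖ ^ 2 := by
      simp_rw [e1, ← norm_inner_symm (v _)]
      exact hv.sum_inner_products_le _
    refine e2.trans ?_
    rw [sq_norm_Lp]
    have e3 : ∫ y, ‖(hrow x).toLp _ y‖ ^ 2 ∂μ ≤ ∫ _, B ^ 2 ∂μ := by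
      refine integral_mono_ae ((Lp.memLp _).integrable_norm_pow two_ne_zero)
        (integrable_const _) ?_
      filter_upwards [(hrow x).coeFn_toLp] with y hy
      rw [hy, RCLike.norm_conj]
      exact pow_le_pow_left₀ (norm_nonneg _) (hB x y) 2
    refine e3.trans_eq ?_
    simp [mul_comm]
  have e4 : ∀ i, ‖hk.op (v i)‖ ^ 2 = ∫ x, ‖∫ y, k x y * v i y ∂μ‖ ^ 2 ∂μ := by
    intro i
    rw [sq_norm_Lp]
    refine integral_congr_ae ?_
    filter_upwards [hk.op_apply_ae (v i)] with x hx
    rw [hx]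
  have hint : ∀ i ∈ s, Integrable (fun x => ‖∫ y, k x y * v i y ∂μ‖ ^ 2) μ := fun i _ =>
    (hk.memLp (Lp.memLp (v i))).integrable_norm_pow two_ne_zero
  simp_rw [e4]
  rw [← integral_finsetSum _ hint]
  refine (integral_mono (integrable_finsetSum _ hint) (integrable_const _) key).trans_eq ?_
  simp
  ring

end

section

/-! ### Properly discontinuous cocompact subgroups -/

theorem radial_Iic_ne_zero : radial (Set.Iic 2) ≠ 0 := by
  rw [radial, withDensity_apply _ measurableSet_Iic]
  refine (setLIntegral_pos_iff measurable_radial_density).2 ?_ |>.ne'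
  refine lt_of_lt_of_le ?_ (measure_mono (s := Set.Ioo 1 2) fun σ hσ => ⟨?_, hσ.2.le⟩)
  · rw [Measure.restrict_apply measurableSet_Ioo,
      Set.inter_eq_left.2 (fun σ hσ => hσ.1), Real.volume_Ioo]
    norm_num
  · have : 0 < 4 * Real.pi ^ 2 * (σ - 1) := mul_pos (by positivity) (by linarith [hσ.1])
    simpa using this

section DiscreteGroup

open scoped ENNReal NNReal Pointwise

variable (Γ : Subgroup SU21)

instance : ContinuousConstSMul Γ Siegel := ⟨fun γ => continuous_const_smul (γ : SU21)⟩

section ProperlyDiscontinuous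

variable [ProperlyDiscontinuousSMul Γ Siegel]

theorem finite_sigma_smul_le (Z W : Siegel) (R : ℝ) : {γ : Γ | sigma Z (γ • W) ≤ R}.Finite := by
  refine (ProperlyDiscontinuousSMul.finite_disjoint_inter_image (Γ := Γ)
    (isCompact_singleton (x := W)) (isCompact_sigma_le Z R)).subset fun γ hγ => ?_
  exact ⟨γ • W, ⟨W, rfl, rfl⟩, hγ⟩

/-- A properly discontinuous group of isometries of `𝔖₂` is countable. -/
theorem countable_of_properlyDiscontinuous : Countable Γ := by
  rw [← Set.countable_univ_iff]
  have h : (Set.univ : Set Γ) ⊆ ⋃ N : ℕ, {γ : Γ | sigma base (γ • base) ≤ N} := fun γ _ => by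
    obtain ⟨N, hN⟩ := exists_nat_ge (sigma base (γ • base))
    exact Set.mem_iUnion.2 ⟨N, hN⟩
  exact (Set.countable_iUnion fun N : ℕ => (finite_sigma_smul_le Γ base base N).countable).mono h

end ProperlyDiscontinuous

section Cocompact

variable [CompactSpace (Quotient (MulAction.orbitRel Γ Siegel))]

/-- By compactness of the quotient, every orbit meets a fixed ball about the base point. -/
theorem exists_sigma_smul_le : ∃ R, 1 ≤ R ∧ ∀ Z : Siegel, ∃ γ : Γ, sigma base (γ • Z) ≤ R := by
  let U : ℕ → Set (Quotient (MulAction.orbitRel Γ Siegel)) := fun N =>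
    Quotient.mk'' '' {Z : Siegel | sigma base Z < N}
  have hU : ∀ N, IsOpen (U N) := fun N =>
    isOpenMap_quotient_mk'_mul _ (isOpen_lt (continuous_sigma_right base) continuous_const)
  have hcov : Set.univ ⊆ ⋃ N, U N := fun q _ => by
    induction q using Quotient.inductionOn' with
    | h Z =>
      obtain ⟨N, hN⟩ := exists_nat_gt (sigma base Z)
      exact Set.mem_iUnion.2 ⟨N, Z, hN, rfl⟩
  have hdir : Directed (fun x1 x2 => x1 ⊆ x2) U := by
    refine Monotone.directed_le fun a b hab => Set.image_mono fun Z hZ => ?_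
    exact lt_of_lt_of_le (b := (a : ℝ)) hZ (by exact_mod_cast hab)
  obtain ⟨N, hN⟩ := isCompact_univ.elim_directed_cover U hU hcov hdir
  refine ⟨max N 1, le_max_right _ _, fun Z => ?_⟩
  obtain ⟨W, hW, hWZ⟩ := hN (Set.mem_univ (Quotient.mk'' Z))
  obtain ⟨γ, hγ⟩ := Quotient.eq''.1 hWZ
  refine ⟨γ, ?_⟩
  have e : γ • Z = W := hγ
  rw [e]
  exact (le_of_lt hW).trans (le_max_left _ _)

variable [ProperlyDiscontinuousSMul Γ Siegel]

/-- The number of points of an orbit in a ball of given radius is bounded, uniformly in the orbit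
and in the centre. -/
theorem exists_encard_sigma_smul_le (R : ℝ) :
    ∃ N : ℕ, ∀ Z W : Siegel, {γ : Γ | sigma Z (γ • W) ≤ R}.encard ≤ N := by
  obtain ⟨R₀, hR₀, hcov⟩ := exists_sigma_smul_le Γ
  have hfin := finite_sigma_smul_le Γ base base (4 * R₀ * (4 * R * R₀))
  refine ⟨hfin.toFinset.card, fun Z W => ?_⟩
  obtain ⟨β, hβ⟩ := hcov Z
  obtain ⟨α, hα⟩ := hcov W
  rw [← Set.encard_coe_eq_coe_finsetCard, hfin.coe_toFinset]
  -- move `Z` and `W` into the ball of radius `R₀` about the base point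
  refine Set.encard_le_encard_of_injOn (f := fun γ => β * γ * α⁻¹) (fun γ hγ => ?_)
    (fun a _ b _ hab => by simpa using hab)
  have hγ' : sigma Z (γ • W) ≤ R := hγ
  have e1 : sigma (β • Z) ((β * γ * α⁻¹) • (α • W)) ≤ R := by
    rw [smul_smul, inv_mul_cancel_right, mul_smul]
    exact (sigma_smul (β : SU21) Z (γ • W)).trans_le hγ'
  have e2 : sigma ((β * γ * α⁻¹) • (α • W)) ((β * γ * α⁻¹) • base) ≤ R₀ := by
    refine (sigma_smul ((β * γ * α⁻¹ : Γ) : SU21) (α • W) base).trans_le ?_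
    rw [sigma_comm]
    exact hα
  have hR : 0 ≤ R := le_trans (sigma_pos _ _).le hγ'
  change sigma base ((β * γ * α⁻¹) • base) ≤ 4 * R₀ * (4 * R * R₀)
  refine (sigma_le base (β • Z) _).trans ?_
  have e3 : sigma (β • Z) ((β * γ * α⁻¹) • base) ≤ 4 * R * R₀ := by
    refine (sigma_le _ ((β * γ * α⁻¹) • (α • W)) _).trans ?_
    exact mul_le_mul (by linarith) e2 (sigma_pos _ _).le (by linarith)
  exact mul_le_mul (by linarith) e3 (sigma_pos _ _).le (by linarith)

/-- The series `∑_γ σ(Z, γ W)⁻ᵃ` is bounded, uniformly in `Z` and `W`, when `a > 2`: up to a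
constant each term is at most the integral of `σ(Z, ·)⁻ᵃ` over a ball around `γ W`, and these balls
overlap a bounded number of times. -/
theorem exists_tsum_sigma_rpow_le {a : ℝ} (ha : 2 < a) : ∃ M : ℝ≥0, ∀ Z W : Siegel,
    ∑' γ : Γ, ENNReal.ofReal (sigma Z (γ • W) ^ (-a)) ≤ M := by
  have hcount := countable_of_properlyDiscontinuous Γ
  obtain ⟨N, hN⟩ := exists_encard_sigma_smul_le Γ 2
  set I : ℝ≥0∞ := ∫⁻ σ, ENNReal.ofReal (σ ^ (-a)) ∂radial with hI
  have hItop : I < ∞ := (integrable_rpow_neg ha).lintegral_lt_top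
  set c : ℝ≥0∞ := radial (Set.Iic 2) with hc
  have hc0 : c ≠ 0 := radial_Iic_ne_zero
  have hball : ∀ W : Siegel, dm {X | sigma W X ≤ 2} = c := fun W => by
    rw [hc, ← map_sigma W, Measure.map_apply (continuous_sigma_right W).measurable
      measurableSet_Iic]
    rfl
  have hctop : c ≠ ∞ := by rw [← hball base]; exact (dm_sigma_le_lt_top base 2).ne
  have hpow : ∀ (Z W X : Siegel), sigma W X ≤ 2 → ENNReal.ofReal (sigma Z W ^ (-a)) ≤
      ENNReal.ofReal (8 ^ a) * ENNReal.ofReal (sigma Z X ^ (-a)) := by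
    intro Z W X h
    rw [← ENNReal.ofReal_mul (by positivity)]
    refine ENNReal.ofReal_le_ofReal ?_
    have h1 : sigma Z X ≤ 8 * sigma Z W := by
      have := sigma_le Z W X
      nlinarith [sigma_pos Z W]
    have h2 := Real.rpow_le_rpow (sigma_pos Z X).le h1 (by linarith : 0 ≤ a)
    rw [Real.mul_rpow (by norm_num) (sigma_pos _ _).le] at h2
    rw [Real.rpow_neg (sigma_pos _ _).le, Real.rpow_neg (sigma_pos _ _).le, ← div_eq_mul_inv,
      le_div_iff₀ (Real.rpow_pos_of_pos (sigma_pos _ _) _), inv_mul_le_iff₀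
      (Real.rpow_pos_of_pos (sigma_pos _ _) _), mul_comm]
    exact h2
  have hmain : ∀ Z W : Siegel, c * ∑' γ : Γ, ENNReal.ofReal (sigma Z (γ • W) ^ (-a)) ≤
      ENNReal.ofReal (8 ^ a) * (N * I) := by
    intro Z W
    have hq : Measurable fun X : Siegel => ENNReal.ofReal (sigma Z X ^ (-a)) :=
      ((continuous_sigma_right Z).measurable.pow_const _).ennreal_ofReal
    have hS : ∀ γ : Γ, MeasurableSet {X : Siegel | sigma (γ • W) X ≤ 2} := fun γ =>
      measurableSet_le (continuous_sigma_right _).measurable measurable_const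
    calc c * ∑' γ : Γ, ENNReal.ofReal (sigma Z (γ • W) ^ (-a))
        = ∑' γ : Γ, ∫⁻ X in {X | sigma (γ • W) X ≤ 2},
            ENNReal.ofReal (sigma Z (γ • W) ^ (-a)) ∂dm := by
          rw [← ENNReal.tsum_mul_left]
          refine tsum_congr fun γ => ?_
          rw [setLIntegral_const, hball, mul_comm]
      _ ≤ ∑' γ : Γ, ∫⁻ X in {X | sigma (γ • W) X ≤ 2},
            ENNReal.ofReal (8 ^ a) * ENNReal.ofReal (sigma Z X ^ (-a)) ∂dm := by
          refine ENNReal.tsum_le_tsum fun γ => ?_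
          exact setLIntegral_mono (hq.const_mul _) fun X hX => hpow _ _ _ hX
      _ = ENNReal.ofReal (8 ^ a) * ∫⁻ X, ∑' γ : Γ, {X | sigma (γ • W) X ≤ 2}.indicator
            (fun X => ENNReal.ofReal (sigma Z X ^ (-a))) X ∂dm := by
          rw [lintegral_tsum fun γ => (hq.indicator (hS γ)).aemeasurable, ← ENNReal.tsum_mul_left]
          refine tsum_congr fun γ => ?_
          rw [lintegral_const_mul _ hq, lintegral_indicator (hS γ)]
      _ ≤ ENNReal.ofReal (8 ^ a) * ∫⁻ X, N * ENNReal.ofReal (sigma Z X ^ (-a)) ∂dm := by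
          refine mul_le_mul_right (lintegral_mono fun X => ?_) _
          have e : ∀ γ : Γ, {X | sigma (γ • W) X ≤ 2}.indicator
              (fun X => ENNReal.ofReal (sigma Z X ^ (-a))) X =
              {γ : Γ | sigma X (γ • W) ≤ 2}.indicator 1 γ * ENNReal.ofReal (sigma Z X ^ (-a)) := by
            intro γ
            by_cases h : sigma (γ • W) X ≤ 2
            · rw [Set.indicator_of_mem (by exact h), Set.indicator_of_mem (by
                rw [Set.mem_ofPred_eq, sigma_comm]; exact h), Pi.one_apply, one_mul]
            · rw [Set.indicator_of_notMem (by exact h), Set.indicator_of_notMem (by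
                rw [Set.mem_ofPred_eq, sigma_comm]; exact h), zero_mul]
          simp_rw [e]
          rw [ENNReal.tsum_mul_right]
          refine mul_le_mul_left ?_ _
          rw [← tsum_subtype]
          simp only [Pi.one_apply, ENNReal.tsum_set_one]
          exact_mod_cast hN X W
      _ = ENNReal.ofReal (8 ^ a) * (N * I) := by
          rw [lintegral_const_mul _ hq, hI, ← map_sigma Z, lintegral_map
            (f := fun σ : ℝ => ENNReal.ofReal (σ ^ (-a)))
            (measurable_id.pow_const _).ennreal_ofReal (continuous_sigma_right Z).measurable]
  refine ⟨(ENNReal.ofReal (8 ^ a) * (N * I) / c).toNNReal, fun Z W => ?_⟩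
  rw [ENNReal.coe_toNNReal (ENNReal.div_ne_top (by finiteness) hc0),
    ENNReal.le_div_iff_mul_le (Or.inl hc0) (Or.inl hctop), mul_comm]
  exact hmain Z W

theorem summable_sigma_rpow {a : ℝ} (ha : 2 < a) (Z W : Siegel) :
    Summable fun γ : Γ => sigma Z (γ • W) ^ (-a) := by
  obtain ⟨M, hM⟩ := exists_tsum_sigma_rpow_le Γ ha
  have h := ENNReal.summable_toReal (ne_top_of_le_ne_top ENNReal.coe_ne_top (hM Z W))
  refine h.congr fun γ => ?_
  rw [ENNReal.toReal_ofReal (Real.rpow_nonneg (sigma_pos _ _).le _)]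

/-- A fundamental domain has finite measure, as the translates of a ball cover the Siegel domain. -/
theorem dm_fundamentalDomain_lt_top {D : Set Siegel} (hD : IsFundamentalDomain Γ D dm) :
    dm D < ∞ := by
  have hcount := countable_of_properlyDiscontinuous Γ
  obtain ⟨R, -, hcov⟩ := exists_sigma_smul_le Γ
  set B : Set Siegel := {Z | sigma base Z ≤ R}
  refine lt_of_le_of_lt ?_ (dm_sigma_le_lt_top base R)
  rw [hD.measure_eq_tsum B]
  refine (measure_mono fun Z hZ => ?_).trans (measure_iUnion_le fun γ : Γ => γ • B ∩ D)
  obtain ⟨γ, hγ⟩ := hcov Z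
  exact Set.mem_iUnion.2 ⟨γ⁻¹, Set.mem_smul_set.2 ⟨γ • Z, hγ, by simp⟩, hZ⟩

end Cocompact

end DiscreteGroup

end

section

/-! ### Unfolding and automorphic forms -/

section Unfolding

open scoped ENNReal NNReal Pointwise

variable {n : ℤ} {Γ : Subgroup SU21} {D : Set Siegel}

theorem ae_smul (γ : Γ) {p : Siegel → Prop} (h : ∀ᵐ Z ∂dm, p Z) : ∀ᵐ Z ∂dm, p (γ • Z) :=
  (measurePreserving_smul γ dm).quasiMeasurePreserving.ae h

variable [ProperlyDiscontinuousSMul Γ Siegel]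

/-- A property that holds almost everywhere on a fundamental domain holds at some point of almost
every orbit. -/
theorem ae_exists_smul (hD : IsFundamentalDomain Γ D dm) {p : Siegel → Prop}
    (h : ∀ᵐ Z ∂dm.restrict D, p Z) : ∀ᵐ Z ∂dm, ∃ γ : Γ, p (γ • Z) := by
  have hcount := countable_of_properlyDiscontinuous Γ
  rw [ae_restrict_iff'₀ hD.nullMeasurableSet] at h
  have h' : ∀ᵐ Z ∂dm, ∀ γ : Γ, γ • Z ∈ D → p (γ • Z) := ae_all_iff.2 fun γ => ae_smul γ h
  filter_upwards [h', hD.ae_covers] with Z h1 h2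
  obtain ⟨γ, hγ⟩ := h2
  exact ⟨γ, h1 γ hγ⟩

theorem lintegral_eq_lintegral_tsum (hD : IsFundamentalDomain Γ D dm) {F : Siegel → ℝ≥0∞}
    (hF : AEMeasurable F dm) : ∫⁻ Z, F Z ∂dm = ∫⁻ Z in D, ∑' γ : Γ, F (γ • Z) ∂dm := by
  have hcount := countable_of_properlyDiscontinuous Γ
  rw [hD.lintegral_eq_tsum'', lintegral_tsum]
  exact fun γ => (hF.comp_quasiMeasurePreserving
    (measurePreserving_smul γ dm).quasiMeasurePreserving).restrict

/-- Unfolding: an integral over `𝔖₂` is the integral over a fundamental domain of the sum over the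
orbits. -/
theorem integral_eq_integral_tsum (hD : IsFundamentalDomain Γ D dm) {F : Siegel → ℂ}
    (hF : Integrable F dm) : ∫ Z, F Z ∂dm = ∫ Z in D, ∑' γ : Γ, F (γ • Z) ∂dm := by
  have hcount := countable_of_properlyDiscontinuous Γ
  rw [hD.integral_eq_tsum'' F hF, integral_tsum]
  · exact fun γ => (hF.1.comp_quasiMeasurePreserving
      (measurePreserving_smul γ dm).quasiMeasurePreserving).restrict
  · rw [← hD.lintegral_eq_tsum'' fun Z => ‖F Z‖ₑ]
    exact hF.2.ne

/-- A `Γ`-invariant function is integrated over a bounded set at most a bounded number of times its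
integral over a fundamental domain. -/
theorem exists_setLIntegral_le [CompactSpace (Quotient (MulAction.orbitRel Γ Siegel))]
    (hD : IsFundamentalDomain Γ D dm) (R : ℝ) :
    ∃ N : ℕ, ∀ (Z : Siegel) (b : Siegel → ℝ≥0∞), AEMeasurable b dm →
      (∀ γ : Γ, ∀ᵐ W ∂dm, b (γ • W) = b W) →
      ∫⁻ W in {W | sigma Z W ≤ R}, b W ∂dm ≤ N * ∫⁻ W in D, b W ∂dm := by
  have hcount := countable_of_properlyDiscontinuous Γ
  obtain ⟨N, hN⟩ := exists_encard_sigma_smul_le Γ R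
  refine ⟨N, fun Z b hb hinv => ?_⟩
  have hS : MeasurableSet {W : Siegel | sigma Z W ≤ R} :=
    measurableSet_le (continuous_sigma_right _).measurable measurable_const
  rw [← lintegral_indicator hS, lintegral_eq_lintegral_tsum hD (hb.indicator hS),
    ← lintegral_const_mul' _ _ (by simp)]
  refine lintegral_mono_ae ?_
  filter_upwards [ae_restrict_of_ae (ae_all_iff.2 hinv)] with W hW
  have e : ∀ γ : Γ, {W : Siegel | sigma Z W ≤ R}.indicator b (γ • W) =
      {γ : Γ | sigma Z (γ • W) ≤ R}.indicator 1 γ * b W := by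
    intro γ
    by_cases h : sigma Z (γ • W) ≤ R
    · rw [Set.indicator_of_mem (by exact h), Set.indicator_of_mem (by exact h), Pi.one_apply,
        one_mul, hW]
    · rw [Set.indicator_of_notMem (by exact h), Set.indicator_of_notMem (by exact h), zero_mul]
  simp_rw [e]
  rw [ENNReal.tsum_mul_right]
  refine mul_le_mul_left ?_ _
  rw [← tsum_subtype]
  simp only [Pi.one_apply, ENNReal.tsum_set_one]
  exact_mod_cast hN Z W

theorem lintegral_fundamentalDomain_sigma (hD : IsFundamentalDomain Γ D dm) {a : ℝ → ℝ≥0∞}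
    (ha : Measurable a) (W : Siegel) :
    ∑' γ : Γ, ∫⁻ Z in D, a (sigma (γ⁻¹ • Z) W) ∂dm = ∫⁻ σ, a σ ∂radial := by
  have hcount := countable_of_properlyDiscontinuous Γ
  rw [← hD.lintegral_eq_tsum' fun Z => a (sigma Z W), ← map_sigma W,
    lintegral_map ha (continuous_sigma_right W).measurable]
  simp_rw [sigma_comm W]

/-- Convolution with a radial function is bounded on `Γ`-invariant functions in the `L¹`-norm of a
fundamental domain. -/
theorem lintegral_lintegral_sigma_mul (hD : IsFundamentalDomain Γ D dm) {a : ℝ → ℝ≥0∞}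
    (ha : Measurable a) {b : Siegel → ℝ≥0∞} (hb : AEMeasurable b dm)
    (hinv : ∀ γ : Γ, ∀ᵐ W ∂dm, b (γ • W) = b W) :
    ∫⁻ Z in D, ∫⁻ W, a (sigma Z W) * b W ∂dm ∂dm =
      (∫⁻ σ, a σ ∂radial) * ∫⁻ W in D, b W ∂dm := by
  have hcount := countable_of_properlyDiscontinuous Γ
  have hmeas : ∀ γ : Γ, Measurable fun p : Siegel × Siegel => a (sigma (γ⁻¹ • p.1) p.2) := fun γ =>
    ha.comp (continuous_sigma.comp (f := fun p : Siegel × Siegel => (γ⁻¹ • p.1, p.2))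
      ((continuous_fst.const_smul γ⁻¹).prodMk continuous_snd)).measurable
  have hm : ∀ γ : Γ, AEMeasurable (fun p : Siegel × Siegel => a (sigma (γ⁻¹ • p.1) p.2) * b p.2)
      ((dm.restrict D).prod (dm.restrict D)) := fun γ =>
    (hmeas γ).aemeasurable.mul hb.restrict.comp_snd
  have e1 : ∀ Z, ∫⁻ W, a (sigma Z W) * b W ∂dm =
      ∑' γ : Γ, ∫⁻ W in D, a (sigma (γ⁻¹ • Z) W) * b W ∂dm := by
    intro Z
    rw [hD.lintegral_eq_tsum'' fun W => a (sigma Z W) * b W]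
    refine tsum_congr fun γ => lintegral_congr_ae ?_
    filter_upwards [ae_restrict_of_ae (hinv γ)] with W hW
    rw [hW]
    congr 2
    have := sigma_smul (γ : SU21) (γ⁻¹ • Z) W
    rw [← this]
    congr 1
    exact (smul_inv_smul γ Z).symm
  simp_rw [e1]
  rw [lintegral_tsum fun γ => (hm γ).lintegral_prod_right']
  have e2 : ∀ γ : Γ, ∫⁻ Z in D, ∫⁻ W in D, a (sigma (γ⁻¹ • Z) W) * b W ∂dm ∂dm =
      ∫⁻ W in D, (∫⁻ Z in D, a (sigma (γ⁻¹ • Z) W) ∂dm) * b W ∂dm := by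
    intro γ
    rw [lintegral_lintegral_swap (hm γ)]
    refine lintegral_congr fun W => ?_
    have hW : Measurable fun Z : Siegel => a (sigma (γ⁻¹ • Z) W) := by
      simp_rw [sigma_comm _ W]
      exact ha.comp ((continuous_sigma_right W).comp (continuous_const_smul γ⁻¹)).measurable
    exact lintegral_mul_const (b W) hW
  simp_rw [e2]
  have hm' : ∀ γ : Γ, AEMeasurable (fun W => (∫⁻ Z in D, a (sigma (γ⁻¹ • Z) W) ∂dm) * b W)
      (dm.restrict D) := fun γ =>
    ((hmeas γ).lintegral_prod_left' (μ := dm.restrict D)).aemeasurable.mul hb.restrict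
  rw [← lintegral_tsum hm']
  simp_rw [ENNReal.tsum_mul_right, lintegral_fundamentalDomain_sigma hD ha]
  rw [lintegral_const_mul'' _ hb.restrict]

end Unfolding

section Forms

open scoped ENNReal NNReal Pointwise

variable {n : ℤ} {Γ : Subgroup SU21} {D : Set Siegel} {f : Siegel → ℂ}

theorem IsL2Form.ae_automorphic [ProperlyDiscontinuousSMul Γ Siegel] (hf : IsL2Form n Γ D f) :
    ∀ᵐ Z ∂dm, ∀ γ : Γ, f (γ • Z) = unitFactor γ.1 Z ^ n * f Z := by
  have hcount := countable_of_properlyDiscontinuous Γ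
  exact ae_all_iff.2 hf.automorphic

theorem IsL2Form.ae_enorm_smul (hf : IsL2Form n Γ D f) (γ : Γ) :
    ∀ᵐ Z ∂dm, ‖f (γ • Z)‖ₑ = ‖f Z‖ₑ := by
  filter_upwards [hf.automorphic γ] with Z hZ
  rw [hZ, enorm_mul, ← ofReal_norm, norm_zpow, norm_unitFactor, _root_.one_zpow,
    ENNReal.ofReal_one, one_mul]

theorem IsC2Form.norm_smul {u : Siegel → ℂ} (hu : IsC2Form n Γ u) (γ : Γ) (Z : Siegel) :
    ‖u (γ • Z)‖ = ‖u Z‖ := by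
  rw [hu.automorphic, norm_mul, norm_zpow, norm_unitFactor, _root_.one_zpow, one_mul]

theorem IsC2Form.continuous {u : Siegel → ℂ} (hu : IsC2Form n Γ u) : Continuous u :=
  continuous_of_contDiffOn hu.contDiffOn

/-- A continuous function with `Γ`-invariant absolute value is bounded. -/
theorem exists_norm_le_of_automorphic [CompactSpace (Quotient (MulAction.orbitRel Γ Siegel))]
    {u : Siegel → ℂ} (hu : Continuous u) (hinv : ∀ (γ : Γ) Z, ‖u (γ • Z)‖ = ‖u Z‖) :
    ∃ B, ∀ Z, ‖u Z‖ ≤ B := by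
  obtain ⟨R, -, hcov⟩ := exists_sigma_smul_le Γ
  obtain ⟨B, hB⟩ := (isCompact_sigma_le base R).exists_bound_of_continuousOn hu.continuousOn
  refine ⟨B, fun Z => ?_⟩
  obtain ⟨γ, hγ⟩ := hcov Z
  rw [← hinv γ]
  exact hB _ hγ

variable [ProperlyDiscontinuousSMul Γ Siegel]

theorem IsL2Form.aestronglyMeasurable (hD : IsFundamentalDomain Γ D dm) (hf : IsL2Form n Γ D f) :
    AEStronglyMeasurable f dm := by
  have hcount := countable_of_properlyDiscontinuous Γ
  rw [← hD.sum_restrict, aestronglyMeasurable_sum_measure_iff]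
  intro γ
  have hmp : MeasurePreserving (fun Z : Siegel => γ⁻¹ • Z) (dm.restrict (γ • D))
      (dm.restrict D) := by
    have := (measurePreserving_smul γ⁻¹ dm).restrict_preimage_emb
      (measurableEmbedding_const_smul γ⁻¹) D
    rwa [Set.preimage_smul_inv] at this
  have h1 := hf.memLp.1.comp_measurePreserving hmp
  have h2 : Continuous fun Z : Siegel => unitFactor γ.1 (γ⁻¹ • Z) ^ n :=
    ((continuous_unitFactor γ.1).comp (continuous_const_smul γ⁻¹)).zpow₀ n
      fun Z => Or.inl (unitFactor_ne_zero _ _)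
  refine (h2.aestronglyMeasurable.mul h1).congr ?_
  filter_upwards [ae_restrict_of_ae (ae_smul γ⁻¹ (hf.automorphic γ))] with Z hZ
  rw [smul_inv_smul] at hZ
  exact hZ.symm

theorem IsL2Form.ae_eq (hD : IsFundamentalDomain Γ D dm) (hf : IsL2Form n Γ D f) {g : Siegel → ℂ}
    (hg : IsL2Form n Γ D g) (h : f =ᵐ[dm.restrict D] g) : f =ᵐ[dm] g := by
  filter_upwards [ae_exists_smul hD h, hf.ae_automorphic, hg.ae_automorphic] with Z h1 h2 h3
  obtain ⟨γ, hγ⟩ := h1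
  rw [h2, h3] at hγ
  exact mul_left_cancel₀ (zpow_ne_zero _ (unitFactor_ne_zero _ _)) hγ

/-- Every square-integrable function on a fundamental domain extends to an automorphic function. -/
theorem exists_isL2Form (hD : IsFundamentalDomain Γ D dm) {F : Siegel → ℂ}
    (hF : MemLp F 2 (dm.restrict D)) : ∃ f, IsL2Form n Γ D f ∧ f =ᵐ[dm.restrict D] F := by
  have hcount := countable_of_properlyDiscontinuous Γ
  set f : Siegel → ℂ := fun Z => ∑' γ : Γ, (unitFactor γ.1 Z ^ n)⁻¹ * D.indicator F (γ • Z) with hf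
  have hfF : f =ᵐ[dm.restrict D] F := by
    have h1 : ∀ γ : Γ, ∀ᵐ Z ∂dm, γ ≠ 1 → Z ∈ D → γ • Z ∉ D := by
      intro γ
      by_cases hγ : γ = 1
      · exact Eventually.of_forall fun Z h => absurd hγ h
      have h2 : dm ((γ⁻¹ • D) ∩ ((1 : Γ) • D)) = 0 :=
        hD.aedisjoint (show γ⁻¹ ≠ 1 by simpa using hγ)
      filter_upwards [measure_eq_zero_iff_ae_notMem.1 h2] with Z hZ _ hZD hγZ
      refine hZ ⟨Set.mem_smul_set.2 ⟨γ • Z, hγZ, inv_smul_smul γ Z⟩, ?_⟩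
      rwa [one_smul]
    filter_upwards [ae_restrict_of_ae (ae_all_iff.2 h1), ae_restrict_mem₀ hD.nullMeasurableSet]
      with Z hZ hZD
    rw [hf]
    dsimp only
    rw [tsum_eq_single 1]
    · rw [one_smul, Set.indicator_of_mem hZD, Subgroup.coe_one, unitFactor_one, _root_.one_zpow,
        inv_one, one_mul]
    · intro γ hγ
      rw [Set.indicator_of_notMem (hZ γ hγ hZD), mul_zero]
  refine ⟨f, ⟨(memLp_congr_ae hfF).2 hF, fun β => Eventually.of_forall fun Z => ?_⟩, hfF⟩
  rw [hf]
  dsimp only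
  rw [← tsum_mul_left, ← (Equiv.mulRight β).tsum_eq
    fun γ : Γ => unitFactor β.1 Z ^ n * ((unitFactor γ.1 Z ^ n)⁻¹ * D.indicator F (γ • Z))]
  refine tsum_congr fun γ => ?_
  rw [Equiv.coe_mulRight, Subgroup.coe_mul, unitFactor_mul, mul_zpow, mul_smul]
  have h1 := unitFactor_ne_zero β.1 Z
  have h2 := unitFactor_ne_zero γ.1 (β • Z)
  have h3 : unitFactor γ.1 (β.1 • Z) = unitFactor γ.1 (β • Z) := rfl
  rw [h3]
  field_simp

variable [CompactSpace (Quotient (MulAction.orbitRel Γ Siegel))]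

theorem IsL2Form.integrable_restrict (hD : IsFundamentalDomain Γ D dm) (hf : IsL2Form n Γ D f) :
    Integrable f (dm.restrict D) := by
  have : IsFiniteMeasure (dm.restrict D) :=
    isFiniteMeasure_restrict.2 (dm_fundamentalDomain_lt_top Γ hD).ne
  exact hf.memLp.integrable (by norm_num)

/-- An automorphic form is locally integrable on the whole Siegel domain, as a compact set meets
each orbit in a bounded number of points. -/
theorem IsL2Form.locallyIntegrable (hD : IsFundamentalDomain Γ D dm) (hf : IsL2Form n Γ D f) :
    LocallyIntegrable f dm := by
  rw [locallyIntegrable_iff]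
  intro K hK
  obtain ⟨R, hR⟩ := exists_subset_sigma_le base hK
  obtain ⟨N, hN⟩ := exists_setLIntegral_le hD R
  have hm := hf.aestronglyMeasurable hD
  refine ⟨hm.restrict, lt_of_le_of_lt (lintegral_mono_set (t := {W | sigma base W ≤ R}) hR) ?_⟩
  refine (hN base (fun Z => ‖f Z‖ₑ) hm.enorm hf.ae_enorm_smul).trans_lt ?_
  exact ENNReal.mul_lt_top (by simp) (hf.integrable_restrict hD).2

theorem IsC2Form.isL2Form (hD : IsFundamentalDomain Γ D dm) {u : Siegel → ℂ}
    (hu : IsC2Form n Γ u) : IsL2Form n Γ D u := by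
  have : IsFiniteMeasure (dm.restrict D) :=
    isFiniteMeasure_restrict.2 (dm_fundamentalDomain_lt_top Γ hD).ne
  obtain ⟨B, hB⟩ := exists_norm_le_of_automorphic hu.continuous hu.norm_smul
  exact ⟨MemLp.of_bound hu.continuous.aestronglyMeasurable B (Eventually.of_forall hB),
    fun γ => Eventually.of_forall (hu.automorphic γ)⟩

end Forms

end

section

/-! ### Automorphic kernels -/

section AutomorphicKernel

open scoped ENNReal NNReal Pointwise

/-- Radial profiles `h` for which the kernels `H_k(Z, W) h(σ(Z, W))` can be averaged over a
cocompact group: integrable, and of order `σ⁻ᵃ` with `a > 2` away from the diagonal `σ = 1`. -/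
structure IsRadialKernel (h : ℝ → ℂ) : Prop where
  measurable : Measurable h
  integrable : Integrable h radial
  exists_norm_le : ∃ a : ℝ, 2 < a ∧ ∃ K : ℝ, ∀ σ, 2 ≤ σ → ‖h σ‖ ≤ K * σ ^ (-a)

theorem IsRadialKernel.sub {h h' : ℝ → ℂ} (hh : IsRadialKernel h) (hh' : IsRadialKernel h') :
    IsRadialKernel (fun σ => h σ - h' σ) := by
  obtain ⟨a, ha, K, hK⟩ := hh.exists_norm_le
  obtain ⟨a', ha', K', hK'⟩ := hh'.exists_norm_le
  refine ⟨hh.measurable.sub hh'.measurable, hh.integrable.sub hh'.integrable, min a a',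
    lt_min ha ha', K + K', fun σ hσ => ?_⟩
  have hσ0 : 0 < σ := by linarith
  have pos : ∀ {k : ℝ → ℂ} {L b : ℝ}, (∀ σ, 2 ≤ σ → ‖k σ‖ ≤ L * σ ^ (-b)) → 0 ≤ L := by
    intro k L b h
    exact nonneg_of_mul_nonneg_left ((norm_nonneg _).trans (h 2 le_rfl)) (by positivity)
  refine (norm_sub_le _ _).trans ?_
  rw [add_mul]
  refine add_le_add ((hK σ hσ).trans ?_) ((hK' σ hσ).trans ?_)
  · exact mul_le_mul_of_nonneg_left (Real.rpow_le_rpow_of_exponent_le (by linarith)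
      (by linarith [min_le_left a a'])) (pos hK)
  · exact mul_le_mul_of_nonneg_left (Real.rpow_le_rpow_of_exponent_le (by linarith)
      (by linarith [min_le_right a a'])) (pos hK')

/-- The average `∑_γ H_k(Z, γ W) h(σ(Z, γ W)) J(γ, W)^{2k}` over `Γ` of a point-pair kernel. -/
def autoKer (n : ℤ) (Γ : Subgroup SU21) (h : ℝ → ℂ) (Z W : Siegel) : ℂ :=
  ∑' γ : Γ, ker n h Z (γ • W) * unitFactor γ.1 W ^ n

variable {n : ℤ} {Γ : Subgroup SU21} {D : Set Siegel} {h : ℝ → ℂ} {f : Siegel → ℂ}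

theorem norm_ker_mul_unitFactor (n : ℤ) (h : ℝ → ℂ) (Z W : Siegel) (γ : Γ) :
    ‖ker n h Z (γ • W) * unitFactor γ.1 W ^ n‖ = ‖h (sigma Z (γ • W))‖ := by
  rw [norm_mul, norm_ker, norm_zpow, norm_unitFactor, _root_.one_zpow, mul_one]

theorem enorm_ker (n : ℤ) (h : ℝ → ℂ) (Z W : Siegel) : ‖ker n h Z W‖ₑ = ‖h (sigma Z W)‖ₑ := by
  rw [← ofReal_norm, norm_ker, ofReal_norm]

theorem enorm_ker_mul_unitFactor (n : ℤ) (h : ℝ → ℂ) (Z W : Siegel) (γ : Γ) :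
    ‖ker n h Z (γ • W) * unitFactor γ.1 W ^ n‖ₑ = ‖h (sigma Z (γ • W))‖ₑ := by
  rw [← ofReal_norm, norm_ker_mul_unitFactor, ofReal_norm]

/-- The averaged kernel is automorphic in the first variable. -/
theorem autoKer_smul_left (n : ℤ) (h : ℝ → ℂ) (β : Γ) (Z W : Siegel) :
    autoKer n Γ h (β • Z) W = unitFactor β.1 Z ^ n * autoKer n Γ h Z W := by
  rw [autoKer, autoKer, ← tsum_mul_left, ← (Equiv.mulLeft β).tsum_eq
    fun γ : Γ => ker n h (β • Z) (γ • W) * unitFactor γ.1 W ^ n]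
  refine tsum_congr fun γ => ?_
  rw [Equiv.coe_mulLeft, Subgroup.coe_mul, unitFactor_mul, mul_zpow, mul_smul, ← mul_assoc,
    ← mul_assoc, ← ker_smul n h β.1 Z (γ • W)]
  rfl

/-- The averaged kernel with the conjugate profile is the adjoint kernel. -/
theorem conj_autoKer (n : ℤ) (h : ℝ → ℂ) (Z W : Siegel) :
    (starRingEnd ℂ) (autoKer n Γ h Z W) =
      autoKer n Γ (fun σ => (starRingEnd ℂ) (h σ)) W Z := by
  rw [autoKer, autoKer, Complex.conj_tsum, ← (Equiv.inv Γ).tsum_eq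
    fun γ : Γ => ker n (fun σ => (starRingEnd ℂ) (h σ)) W (γ • Z) * unitFactor γ.1 Z ^ n]
  refine tsum_congr fun γ => ?_
  have h1 := ker_smul n (fun σ => (starRingEnd ℂ) (h σ)) γ.1 W (γ⁻¹ • Z)
  have h2 : γ.1 • γ⁻¹ • Z = Z := smul_inv_smul γ Z
  have h3 : unitFactor γ⁻¹.1 Z = (unitFactor γ.1 (γ⁻¹ • Z))⁻¹ := unitFactor_inv γ.1 Z
  have h4 := zpow_ne_zero n (unitFactor_ne_zero γ.1 (γ⁻¹ • Z))
  have h5 := zpow_ne_zero n (unitFactor_ne_zero γ.1 W)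
  rw [h2] at h1
  rw [Equiv.inv_apply, h3, map_mul, conj_ker, map_zpow₀, conj_unitFactor, _root_.inv_zpow,
    _root_.inv_zpow, mul_inv_eq_iff_eq_mul₀ h5, mul_right_comm, eq_mul_inv_iff_mul_eq₀ h4,
    mul_comm _ (unitFactor γ.1 W ^ n)]
  exact h1

theorem enorm_autoKer_le (n : ℤ) (h : ℝ → ℂ) (Z W : Siegel) :
    ‖autoKer n Γ h Z W‖ₑ ≤ ∑' γ : Γ, ‖h (sigma Z (γ • W))‖ₑ := by
  refine (enorm_tsum_le_tsum_enorm).trans_eq ?_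
  simp_rw [enorm_ker_mul_unitFactor]

theorem lintegral_enorm_ker_mul_smul (hf : IsL2Form n Γ D f) (h : ℝ → ℂ) (γ : Γ) (Z : Siegel) :
    ∫⁻ W, ‖ker n h (γ • Z) W * f W‖ₑ ∂dm = ∫⁻ W, ‖ker n h Z W * f W‖ₑ ∂dm := by
  rw [← (measurePreserving_smul γ dm).lintegral_comp_emb
    (measurableEmbedding_const_smul γ) fun W => ‖ker n h (γ • Z) W * f W‖ₑ]
  refine lintegral_congr_ae ?_
  filter_upwards [hf.ae_enorm_smul γ] with W hW
  rw [enorm_mul, enorm_mul, hW, enorm_ker, enorm_ker]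
  congr 3
  exact sigma_smul γ.1 Z W

/-- Point-pair operators preserve automorphy. -/
theorem kint_smul (hf : IsL2Form n Γ D f) (h : ℝ → ℂ) (γ : Γ) (Z : Siegel) :
    kint n h f (γ • Z) = unitFactor γ.1 Z ^ n * kint n h f Z := by
  rw [kint, kint, ← integral_smul_eq_self (μ := dm) (g := γ) fun W => ker n h (γ • Z) W * f W,
    ← integral_const_mul]
  refine integral_congr_ae ?_
  filter_upwards [hf.automorphic γ] with W hW
  rw [hW, ← mul_assoc, ← mul_assoc, ← ker_smul n h γ.1 Z W]
  rfl

section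

variable [ProperlyDiscontinuousSMul Γ Siegel]

theorem lintegral_tsum_ker_right (hD : IsFundamentalDomain Γ D dm) (hh : Measurable h)
    (Z : Siegel) :
    ∫⁻ W in D, ∑' γ : Γ, ‖h (sigma Z (γ • W))‖ₑ ∂dm = ∫⁻ σ, ‖h σ‖ₑ ∂radial := by
  rw [← lintegral_eq_lintegral_tsum hD (F := fun W => ‖h (sigma Z W)‖ₑ)
    (hh.comp (continuous_sigma_right Z).measurable).enorm.aemeasurable, ← map_sigma Z,
    lintegral_map hh.enorm (continuous_sigma_right Z).measurable]

theorem lintegral_tsum_ker_left (hD : IsFundamentalDomain Γ D dm) (hh : Measurable h)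
    (W : Siegel) :
    ∫⁻ Z in D, ∑' γ : Γ, ‖h (sigma Z (γ • W))‖ₑ ∂dm = ∫⁻ σ, ‖h σ‖ₑ ∂radial := by
  have e : ∀ Z : Siegel, ∑' γ : Γ, ‖h (sigma Z (γ • W))‖ₑ = ∑' γ : Γ, ‖h (sigma W (γ • Z))‖ₑ := by
    intro Z
    rw [← (Equiv.inv Γ).tsum_eq]
    refine tsum_congr fun γ => ?_
    have h1 := sigma_smul γ.1 Z (γ⁻¹ • W)
    have h2 : γ.1 • γ⁻¹ • W = W := smul_inv_smul γ W
    rw [h2] at h1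
    rw [Equiv.inv_apply, ← h1, sigma_comm]
    rfl
  simp_rw [e]
  exact lintegral_tsum_ker_right hD hh W

theorem measurable_autoKer (n : ℤ) (hh : Measurable h) :
    Measurable (Function.uncurry (autoKer n Γ h)) := by
  have hcount := countable_of_properlyDiscontinuous Γ
  refine Measurable.tsum (L := .unconditional Γ)
    (f := fun γ (p : Siegel × Siegel) => ker n h p.1 (γ • p.2) * unitFactor γ.1 p.2 ^ n)
    fun γ => ?_
  have h1 : Measurable fun p : Siegel × Siegel => (p.1, γ • p.2) :=
    measurable_fst.prodMk (measurable_snd.const_smul γ)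
  exact ((measurable_ker n hh).comp h1).mul
    (((continuous_unitFactor γ.1).measurable.comp measurable_snd).pow_const n)

/-- Unfolding of a convolution with an automorphic function. -/
theorem kint_eq_setIntegral (hD : IsFundamentalDomain Γ D dm)
    (hf : IsL2Form n Γ D f) {Z : Siegel} (hint : Integrable (fun W => ker n h Z W * f W) dm) :
    kint n h f Z = ∫ W in D, autoKer n Γ h Z W * f W ∂dm := by
  rw [kint, integral_eq_integral_tsum hD hint]
  refine integral_congr_ae ?_
  filter_upwards [ae_restrict_of_ae hf.ae_automorphic] with W hW
  rw [autoKer, ← tsum_mul_right]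
  refine tsum_congr fun γ => ?_
  rw [hW]
  ring

theorem lintegral_lintegral_ker_mul (hD : IsFundamentalDomain Γ D dm) (hh : Measurable h)
    (hf : IsL2Form n Γ D f) :
    ∫⁻ Z in D, ∫⁻ W, ‖ker n h Z W * f W‖ₑ ∂dm ∂dm =
      (∫⁻ σ, ‖h σ‖ₑ ∂radial) * ∫⁻ W in D, ‖f W‖ₑ ∂dm := by
  simp_rw [enorm_mul, enorm_ker]
  exact lintegral_lintegral_sigma_mul hD hh.enorm (hf.aestronglyMeasurable hD).enorm
    hf.ae_enorm_smul

theorem aestronglyMeasurable_ker_mul (hD : IsFundamentalDomain Γ D dm) (hh : Measurable h)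
    (hf : IsL2Form n Γ D f) :
    AEStronglyMeasurable (fun p : Siegel × Siegel => ker n h p.1 p.2 * f p.2) (dm.prod dm) :=
  (measurable_ker n hh).aestronglyMeasurable.mul (hf.aestronglyMeasurable hD).comp_snd

theorem IsRadialKernel.isSchurKernel (hD : IsFundamentalDomain Γ D dm) (hh : IsRadialKernel h)
    (n : ℤ) :
    IsSchurKernel (dm.restrict D) (∫⁻ σ, ‖h σ‖ₑ ∂radial).toNNReal (autoKer n Γ h) := by
  refine ⟨measurable_autoKer n hh.measurable, fun Z => ?_, fun W => ?_⟩
  all_goals rw [ENNReal.coe_toNNReal hh.integrable.2.ne]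
  · rw [← lintegral_tsum_ker_right hD hh.measurable Z]
    exact lintegral_mono fun W => enorm_autoKer_le n h Z W
  · rw [← lintegral_tsum_ker_left hD hh.measurable W]
    exact lintegral_mono fun Z => enorm_autoKer_le n h Z W

end

variable [CompactSpace (Quotient (MulAction.orbitRel Γ Siegel))]
  [ProperlyDiscontinuousSMul Γ Siegel]

theorem IsRadialKernel.summable_norm (hh : IsRadialKernel h) (Z W : Siegel) :
    Summable fun γ : Γ => ‖h (sigma Z (γ • W))‖ := by
  obtain ⟨a, ha, K, hK⟩ := hh.exists_norm_le
  refine Summable.of_norm_bounded_eventually ((summable_sigma_rpow Γ ha Z W).mul_left K) ?_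
  filter_upwards [(finite_sigma_smul_le Γ Z W 2).compl_mem_cofinite] with γ hγ
  rw [norm_norm]
  exact hK _ (le_of_not_ge hγ)

theorem IsRadialKernel.summable (hh : IsRadialKernel h) (n : ℤ) (Z W : Siegel) :
    Summable fun γ : Γ => ker n h Z (γ • W) * unitFactor γ.1 W ^ n := by
  refine Summable.of_norm ?_
  simp_rw [norm_ker_mul_unitFactor]
  exact hh.summable_norm Z W

theorem IsRadialKernel.autoKer_sub {h' : ℝ → ℂ} (hh : IsRadialKernel h) (hh' : IsRadialKernel h')
    (n : ℤ) (Z W : Siegel) :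
    autoKer n Γ (fun σ => h σ - h' σ) Z W = autoKer n Γ h Z W - autoKer n Γ h' Z W := by
  rw [autoKer, autoKer, autoKer, ← (hh.summable n Z W).tsum_sub (hh'.summable n Z W)]
  refine tsum_congr fun γ => ?_
  rw [ker, ker, ker]
  ring

/-- The operator on `L²(Γ \ 𝔖₂, k)`, realized as `L²(D)`, with the automorphic kernel attached to
the radial profile `h`. -/
def autoOp (hD : IsFundamentalDomain Γ D dm) (n : ℤ) (hh : IsRadialKernel h) :
    Lp ℂ 2 (dm.restrict D) →L[ℂ] Lp ℂ 2 (dm.restrict D) := (hh.isSchurKernel hD n).op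

/-- Schur's bound: the rows and columns of the averaged kernel unfold to the `L¹`-norm of the
profile. -/
theorem norm_autoOp_le (hD : IsFundamentalDomain Γ D dm) (n : ℤ) (hh : IsRadialKernel h) :
    ‖autoOp hD n hh‖ ≤ ∫ σ, ‖h σ‖ ∂radial := by
  refine (hh.isSchurKernel hD n).norm_op_le.trans_eq ?_
  rw [integral_norm_eq_lintegral_enorm hh.integrable.1]
  rfl

theorem norm_autoOp_sub_le (hD : IsFundamentalDomain Γ D dm) (n : ℤ) (hh : IsRadialKernel h)
    {h' : ℝ → ℂ} (hh' : IsRadialKernel h') :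
    ‖autoOp hD n hh - autoOp hD n hh'‖ ≤ ∫ σ, ‖h σ - h' σ‖ ∂radial := by
  have hS := (hh.sub hh').isSchurKernel hD n
  have e : autoKer n Γ (fun σ => h σ - h' σ) = fun Z W => autoKer n Γ h Z W - autoKer n Γ h' Z W :=
    funext fun Z => funext fun W => hh.autoKer_sub hh' n Z W
  have h1 := norm_autoOp_le hD n (hh.sub hh')
  rw [e] at hS
  rw [autoOp, autoOp, (hh.isSchurKernel hD n).op_sub (hh'.isSchurKernel hD n) hS]
  refine le_trans (le_of_eq ?_) h1
  rw [autoOp]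
  congr 1
  simp only [e]

theorem isSymmetric_autoOp (hD : IsFundamentalDomain Γ D dm) (n : ℤ) (hh : IsRadialKernel h)
    (hreal : ∀ σ, (starRingEnd ℂ) (h σ) = h σ) :
    (autoOp hD n hh : Lp ℂ 2 (dm.restrict D) →ₗ[ℂ] Lp ℂ 2 (dm.restrict D)).IsSymmetric := by
  refine (hh.isSchurKernel hD n).isSymmetric_op fun Z W => ?_
  rw [conj_autoKer]
  simp_rw [hreal]

/-- If the profile is `O(σ⁻ᵃ)` also near the diagonal, then the averaged kernel is bounded. -/
theorem isCompactOperator_autoOp_of_le (hD : IsFundamentalDomain Γ D dm) (n : ℤ)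
    (hh : IsRadialKernel h) {a K : ℝ} (ha : 2 < a) (hK : ∀ σ, 1 ≤ σ → ‖h σ‖ ≤ K * σ ^ (-a)) :
    IsCompactOperator (autoOp hD n hh) := by
  have : IsFiniteMeasure (dm.restrict D) :=
    isFiniteMeasure_restrict.2 (dm_fundamentalDomain_lt_top Γ hD).ne
  obtain ⟨M, hM⟩ := exists_tsum_sigma_rpow_le Γ ha
  refine (hh.isSchurKernel hD n).isCompactOperator_of_bounded
    (B := (ENNReal.ofReal K * M).toReal) fun Z W => ?_
  rw [← toReal_enorm]
  refine ENNReal.toReal_mono (by finiteness) ((enorm_autoKer_le n h Z W).trans ?_)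
  refine le_trans ?_ (mul_le_mul_right (hM Z W) _)
  rw [← ENNReal.tsum_mul_left]
  refine ENNReal.tsum_le_tsum fun γ => ?_
  rw [← ENNReal.ofReal_mul' (Real.rpow_nonneg (sigma_pos _ _).le _), ← ofReal_norm]
  exact ENNReal.ofReal_le_ofReal (hK _ (one_le_sigma _ _))

theorem ae_integrable_ker_mul (hD : IsFundamentalDomain Γ D dm) (hh : IsRadialKernel h)
    (hf : IsL2Form n Γ D f) : ∀ᵐ Z ∂dm, Integrable (fun W => ker n h Z W * f W) dm := by
  have hm : AEMeasurable (fun Z => ∫⁻ W, ‖ker n h Z W * f W‖ₑ ∂dm) dm :=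
    (aestronglyMeasurable_ker_mul hD hh.measurable hf).enorm.lintegral_prod_right'
  have hfin : ∫⁻ Z in D, ∫⁻ W, ‖ker n h Z W * f W‖ₑ ∂dm ∂dm ≠ ∞ := by
    rw [lintegral_lintegral_ker_mul hD hh.measurable hf]
    exact ENNReal.mul_ne_top hh.integrable.2.ne (hf.integrable_restrict hD).2.ne
  have h1 : ∀ᵐ Z ∂dm.restrict D, ∫⁻ W, ‖ker n h Z W * f W‖ₑ ∂dm < ∞ :=
    ae_lt_top' hm.restrict hfin
  filter_upwards [ae_exists_smul hD h1] with Z hZ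
  obtain ⟨γ, hγ⟩ := hZ
  rw [lintegral_enorm_ker_mul_smul hf] at hγ
  have h2 : Measurable fun W => ker n h Z W :=
    (measurable_ker n hh.measurable).comp (g := fun p : Siegel × Siegel => ker n h p.1 p.2)
      (f := fun W => (Z, W)) measurable_prodMk_left
  have h3 : AEStronglyMeasurable (fun W => ker n h Z W * f W) dm :=
    h2.aestronglyMeasurable.mul (hf.aestronglyMeasurable hD)
  exact ⟨h3, hγ⟩

theorem ae_kint_eq_setIntegral (hD : IsFundamentalDomain Γ D dm) (hh : IsRadialKernel h)
    (hf : IsL2Form n Γ D f) :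
    ∀ᵐ Z ∂dm, kint n h f Z = ∫ W in D, autoKer n Γ h Z W * f W ∂dm := by
  filter_upwards [ae_integrable_ker_mul hD hh hf] with Z hZ
  exact kint_eq_setIntegral hD hf hZ

/-- On automorphic forms, the operator with the averaged kernel is convolution with the point-pair
kernel. -/
theorem autoOp_toLp (hD : IsFundamentalDomain Γ D dm) (hh : IsRadialKernel h)
    (hf : IsL2Form n Γ D f) :
    autoOp hD n hh (hf.memLp.toLp f) =ᵐ[dm.restrict D] kint n h f := by
  filter_upwards [(hh.isSchurKernel hD n).op_toLp hf.memLp,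
    ae_restrict_of_ae (ae_kint_eq_setIntegral hD hh hf)] with Z h1 h2
  rw [h2, ← h1, autoOp]

theorem ae_integrable_autoKer_mul (hD : IsFundamentalDomain Γ D dm) (hh : IsRadialKernel h)
    (hf : IsL2Form n Γ D f) :
    ∀ᵐ Z ∂dm, Integrable (fun W => autoKer n Γ h Z W * f W) (dm.restrict D) := by
  filter_upwards [ae_exists_smul hD ((hh.isSchurKernel hD n).ae_integrable hf.memLp)] with Z hZ
  obtain ⟨γ, hγ⟩ := hZ
  simp_rw [autoKer_smul_left, mul_assoc] at hγ
  rwa [integrable_const_mul_iff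
    (zpow_ne_zero n (unitFactor_ne_zero γ.1 Z)).isUnit] at hγ

end AutomorphicKernel

end

section

/-! ### The automorphic Green function -/

section GreenFunction

open scoped ENNReal NNReal

variable {n : ℤ} {s : ℂ} {Γ : Subgroup SU21} {D : Set Siegel}

theorem isRadialKernel_phi0 (hs : 2 < s.re) (hpole : ∀ j : ℕ, s ≠ absWeight n - j) :
    IsRadialKernel (phi0 s n) := by
  obtain ⟨K, -, hK⟩ := phi_bound_atTop hs hpole
  refine ⟨measurable_phi0 hs hpole, integrable_phi0 hs hpole, s.re, hs, K, fun σ hσ => ?_⟩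
  rw [phi0_eq (by linarith)]
  exact (hK σ hσ).1

/-- A profile continuous on `(0, ∞)` and vanishing for large `σ` is bounded by a multiple of `σ⁻³`
on the range `[1, ∞)` of `σ(Z, W)`. -/
theorem exists_norm_le_rpow_of_eq_zero {h : ℝ → ℂ} (hh : ContinuousOn h (Set.Ioi 0)) {R : ℝ}
    (hR : ∀ σ > R, h σ = 0) : ∃ K, ∀ σ, 1 ≤ σ → ‖h σ‖ ≤ K * σ ^ (-3 : ℝ) := by
  have hc : ContinuousOn (fun σ : ℝ => ‖h σ‖ * σ ^ (3 : ℝ)) (Set.Icc 1 R) := by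
    have h1 : ContinuousOn (fun σ : ℝ => σ ^ (3 : ℝ)) (Set.Icc 1 R) :=
      (Real.continuous_rpow_const (by norm_num)).continuousOn
    exact (hh.mono fun σ hσ => lt_of_lt_of_le one_pos hσ.1).norm.mul h1
  obtain ⟨K, hK⟩ := isCompact_Icc.exists_bound_of_continuousOn hc
  refine ⟨max K 0, fun σ hσ => ?_⟩
  have hσ0 : 0 < σ := by linarith
  have hpos : 0 < σ ^ (3 : ℝ) := Real.rpow_pos_of_pos hσ0 _
  rw [Real.rpow_neg hσ0.le, ← div_eq_mul_inv, le_div_iff₀ hpos]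
  by_cases h1 : σ ≤ R
  · refine le_trans ?_ (le_max_left _ _)
    exact (le_abs_self _).trans (hK σ ⟨hσ, h1⟩)
  · rw [hR σ (not_le.1 h1), norm_zero, zero_mul]
    exact le_max_right _ _

theorem isRadialKernel_of_contDiff {h : ℝ → ℂ} (hh : ContDiff ℝ 2 h) {R : ℝ}
    (hR : ∀ σ > R, h σ = 0) : IsRadialKernel h := by
  obtain ⟨K, hK⟩ := exists_norm_le_rpow_of_eq_zero hh.continuous.continuousOn hR
  refine ⟨hh.continuous.measurable, ?_, 3, by norm_num, K, fun σ hσ => hK σ (by linarith)⟩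
  refine (((integrable_rpow_neg (a := 3) (by norm_num)).const_mul K).mono'
    hh.continuous.aestronglyMeasurable ?_)
  filter_upwards [ae_radial] with σ hσ
  exact hK σ hσ.le

/-- The radial Green function is a limit in `L¹` of smooth profiles of bounded support. -/
theorem exists_tendsto_phi0 (hs : 2 < s.re) (hpole : ∀ j : ℕ, s ≠ absWeight n - j) :
    ∃ h : ℕ → ℝ → ℂ, (∀ j, ContDiff ℝ 2 (h j)) ∧ (∀ j, ∃ R, ∀ σ > R, h j σ = 0) ∧
      Tendsto (fun j => ∫ σ, ‖phi0 s n σ - h j σ‖ ∂radial) atTop (𝓝 0) := by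
  have hlim : Tendsto (fun j : ℕ => 1 + 1 / ((j : ℝ) + 1)) atTop (𝓝[>] 1) := by
    refine tendsto_nhdsWithin_iff.2 ⟨?_, Eventually.of_forall fun j => ?_⟩
    · simpa using tendsto_one_div_add_atTop_nhds_zero_nat.const_add (1 : ℝ)
    · have : 0 < 1 / ((j : ℝ) + 1) := by positivity
      rw [Set.mem_Ioi]
      linarith
  have ha : ∀ j : ℕ, 1 < 1 + 1 / ((j : ℝ) + 1) := fun j => by
    have : 0 < 1 / ((j : ℝ) + 1) := by positivity
    linarith
  have hj0 : ∀ j : ℕ, 0 < (j : ℝ) + 1 := fun j => by positivity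
  -- cap the singularity at `1 + 1 / (j + 1)` and cut off beyond `j + 1`
  set h : ℕ → ℝ → ℂ := fun j => cutMul (capPhi s n (1 + 1 / ((j : ℝ) + 1))) ((j : ℝ) + 1) with hh
  have hC : ∀ j, ContDiff ℝ 2 (h j) := fun j => contDiff_cutMul (contDiff_capPhi hs hpole (ha j))
  refine ⟨h, hC, fun j => ⟨_, cutMul_eq_zero (hj0 j)⟩, ?_⟩
  obtain ⟨K, -, hK⟩ := exists_phi0_le hs hpole
  obtain ⟨K', -, hK'⟩ := exists_capPhi_le_decay hs hpole
  have key : Tendsto (fun j => ∫ σ, ‖phi0 s n σ - h j σ‖ ∂radial) atTop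
      (𝓝 (∫ _, (0 : ℝ) ∂radial)) := by
    refine tendsto_integral_filter_of_dominated_convergence
      (fun σ => K * decay s.re σ + K' * decay s.re σ) ?_ ?_ ?_ ?_
    · exact Eventually.of_forall fun j =>
        ((measurable_phi0 hs hpole).sub (hC j).continuous.measurable).norm.aestronglyMeasurable
    · filter_upwards [hlim.eventually hK'] with j hj
      filter_upwards [ae_radial] with σ hσ
      rw [norm_norm]
      refine (norm_sub_le _ _).trans (add_le_add (hK σ hσ) ?_)
      exact (norm_cutMul_le σ).trans (hj σ hσ)
    · exact ((integrable_decay hs).const_mul K).add ((integrable_decay hs).const_mul K')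
    · filter_upwards [ae_radial] with σ hσ
      refine tendsto_const_nhds.congr' ?_
      have h1 : ∀ᶠ j : ℕ in atTop, 1 + 1 / ((j : ℝ) + 1) < σ :=
        (tendsto_nhdsWithin_iff.1 hlim).1.eventually_lt_const hσ
      have h2 : ∀ᶠ j : ℕ in atTop, σ ≤ (j : ℝ) :=
        tendsto_natCast_atTop_atTop.eventually_ge_atTop σ
      filter_upwards [h1, h2] with j hj1 hj2
      rw [hh]
      dsimp only
      rw [cutMul_eq (hj0 j) (by linarith), capPhi_eq hs hpole (ha j) hj1.le, phi0_eq hσ, sub_self,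
        norm_zero]
  simpa using key

theorem one_lt_sigma_of_ne {Z W : Siegel} (h : W ≠ Z) : 1 < sigma Z W :=
  lt_of_le_of_ne (one_le_sigma Z W) fun h1 => h (eq_of_sigma_eq_one h1.symm).symm

theorem greenTerm_eq {Z W : Siegel} (hZW : ∀ γ : Γ, 1 < sigma Z (γ • W)) (γ : Γ) :
    greenTerm s n Γ Z W γ = ker n (phi0 s n) Z (γ • W) * unitFactor γ.1 W ^ n := by
  rw [greenTerm, freeGreen_eq_ker, ker, ker, phi0_eq (hZW γ)]

/-- An eigenfunction of `Δ_k` is an eigenfunction of convolution with the Green function. -/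
theorem kint_phi0_of_lapl_eq
    [CompactSpace (Quotient (MulAction.orbitRel Γ Siegel))] (hs : 2 < s.re) (hpole : ∀ j : ℕ, s ≠ absWeight n - j)
    {u : Siegel → ℂ} (hu : IsC2Form n Γ u) {μ : ℂ} (hμ : ∀ Z, lapl n u Z = μ * u Z) (Z : Siegel) :
    (s * (s - 2) - μ) * kint n (phi0 s n) u Z = 4 * (Real.pi : ℂ) ^ 2 * u Z := by
  obtain ⟨B, hB⟩ := exists_norm_le_of_automorphic hu.continuous hu.norm_smul
  rw [← kint_phi0_sub_lapl hs hpole (B := max B (‖μ‖ * B)) hu.contDiffOn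
    (fun ξ => (hB ξ).trans (le_max_left _ _)) (fun ξ => ?_) Z]
  · rw [kint, kint, ← integral_const_mul]
    refine integral_congr_ae (Eventually.of_forall fun ξ => ?_)
    dsimp only
    rw [hμ]
    ring
  · rw [hμ, norm_mul]
    exact (mul_le_mul_of_nonneg_left (hB ξ) (norm_nonneg _)).trans (le_max_right _ _)

variable [ProperlyDiscontinuousSMul Γ Siegel]

/-- The automorphic Green function is the averaged kernel with profile `phi0`, off the orbit of `Z`,
which has measure zero. -/
theorem ae_green_eq (s : ℂ) (n : ℤ) (Z : Siegel) :
    ∀ᵐ W ∂dm, green s n Γ Z W = autoKer n Γ (phi0 s n) Z W := by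
  have hcount := countable_of_properlyDiscontinuous Γ
  have h : ∀ᵐ W ∂dm, ∀ γ : Γ, 1 < sigma Z (γ • W) :=
    ae_all_iff.2 fun γ => ae_smul γ (p := fun W => 1 < sigma Z W) (ae_one_lt_sigma Z)
  filter_upwards [h] with W hW
  have h2 : greenTerm s n Γ Z W =
      fun γ : Γ => ker n (phi0 s n) Z (γ • W) * unitFactor γ.1 W ^ n := funext (greenTerm_eq hW)
  rw [green, autoKer, h2]

variable [CompactSpace (Quotient (MulAction.orbitRel Γ Siegel))]

/-- Absolute convergence of the series of the automorphic Green function. -/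
theorem summable_greenTerm (hs : 2 < s.re) (hpole : ∀ j : ℕ, s ≠ absWeight n - j) {Z W : Siegel}
    (hZW : ∀ γ : Γ, γ • W ≠ Z) : Summable (greenTerm s n Γ Z W) := by
  have h1 : ∀ γ : Γ, 1 < sigma Z (γ • W) := fun γ => one_lt_sigma_of_ne (hZW γ)
  have h2 : greenTerm s n Γ Z W =
      fun γ : Γ => ker n (phi0 s n) Z (γ • W) * unitFactor γ.1 W ^ n := funext (greenTerm_eq h1)
  rw [h2]
  exact (isRadialKernel_phi0 hs hpole).summable n Z W

/-- The operator with the automorphic Green function as kernel is a norm limit of operators with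
bounded kernels. -/
theorem isCompactOperator_autoOp_phi0 (hD : IsFundamentalDomain Γ D dm) (hs : 2 < s.re)
    (hpole : ∀ j : ℕ, s ≠ absWeight n - j) :
    IsCompactOperator (autoOp hD n (isRadialKernel_phi0 hs hpole)) := by
  obtain ⟨h, hC, hR, hlim⟩ := exists_tendsto_phi0 hs hpole
  choose R hR using hR
  refine isCompactOperator_of_tendsto (l := atTop)
    (F := fun j => autoOp hD n (isRadialKernel_of_contDiff (hC j) (hR j))) ?_
    (Eventually.of_forall fun j => ?_)
  · rw [tendsto_iff_norm_sub_tendsto_zero]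
    refine squeeze_zero (fun _ => norm_nonneg _) (fun j => ?_) hlim
    rw [norm_sub_rev]
    exact norm_autoOp_sub_le hD n _ _
  · obtain ⟨K, hK⟩ := exists_norm_le_rpow_of_eq_zero (hC j).continuous.continuousOn (hR j)
    exact isCompactOperator_autoOp_of_le hD n _ (by norm_num) hK

/-- An eigenfunction of `Δ_k` satisfies the integral equation, by unfolding. -/
theorem IsDeltaEigen.isGreenEigen (hD : IsFundamentalDomain Γ D dm) (hs : 2 < s.re)
    (hpole : ∀ j : ℕ, s ≠ absWeight n - j) {μ : ℂ} {f : Siegel → ℂ}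
    (hf : IsDeltaEigen n Γ D μ f) : IsGreenEigen s n Γ D μ f := by
  have hK := isRadialKernel_phi0 hs hpole
  obtain ⟨u, huf, hu, hμ⟩ := hf.eigen
  have hu2 := hu.isL2Form hD
  refine ⟨hf.isL2Form, hf.ne_zero, ?_, ?_⟩
  · filter_upwards [ae_integrable_autoKer_mul hD hK hf.isL2Form] with Z hZ
    refine hZ.congr ?_
    filter_upwards [ae_restrict_of_ae (ae_green_eq (Γ := Γ) s n Z)] with W hW
    rw [hW]
  · filter_upwards [huf, ae_kint_eq_setIntegral hD hK hu2] with Z h1 h2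
    have e : ∫ ξ in D, green s n Γ Z ξ * f ξ ∂dm = kint n (phi0 s n) u Z := by
      rw [h2]
      refine integral_congr_ae ?_
      filter_upwards [ae_restrict_of_ae (ae_green_eq (Γ := Γ) s n Z), ae_restrict_of_ae huf]
        with W hW hW2
      rw [hW, hW2]
    have hpi : (Real.pi : ℂ) ≠ 0 := by exact_mod_cast Real.pi_ne_zero
    rw [e, mul_assoc, kint_phi0_of_lapl_eq hs hpole hu hμ, h1]
    field_simp

theorem IsGreenEigen.kint_eq (hD : IsFundamentalDomain Γ D dm) (hs : 2 < s.re)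
    (hpole : ∀ j : ℕ, s ≠ absWeight n - j) {μ : ℂ} {f : Siegel → ℂ}
    (hf : IsGreenEigen s n Γ D μ f) :
    ∀ᵐ Z ∂dm, (s * (s - 2) - μ) * kint n (phi0 s n) f Z = 4 * (Real.pi : ℂ) ^ 2 * f Z := by
  filter_upwards [hf.eigen, ae_kint_eq_setIntegral hD (isRadialKernel_phi0 hs hpole) hf.isL2Form]
    with Z h1 h2
  have e : ∫ ξ in D, green s n Γ Z ξ * f ξ ∂dm = kint n (phi0 s n) f Z := by
    rw [h2]
    refine integral_congr_ae ?_
    filter_upwards [ae_restrict_of_ae (ae_green_eq (Γ := Γ) s n Z)] with W hW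
    rw [hW]
  have hpi : (Real.pi : ℂ) ≠ 0 := by exact_mod_cast Real.pi_ne_zero
  rw [h1, e]
  field_simp

end GreenFunction

end

section

/-! ### The weak equation and regularity -/

section Linearity

variable {n : ℤ} {u v : Siegel → ℂ}

theorem wd_mul_add {e p : ℂ × ℂ} {ε : ℂ} {F G : ℂ × ℂ → ℂ} (c : ℂ)
    (hF : DifferentiableAt ℝ F p) (hG : DifferentiableAt ℝ G p) :
    wd e ε (fun q => c * F q + G q) p = c * wd e ε F p + wd e ε G p := by
  rw [wd_add (hF.const_mul c) hG, wd_const_mul c hF]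

theorem lapC_mul_add (n : ℤ) (c : ℂ) {F G : ℂ × ℂ → ℂ} (hF : ContDiffOn ℝ 2 F siegelSet)
    (hG : ContDiffOn ℝ 2 G siegelSet) {p : ℂ × ℂ} (hp : p ∈ siegelSet) :
    lapC n (fun q => c * F q + G q) p = c * lapC n F p + lapC n G p := by
  have d : ∀ {H : ℂ × ℂ → ℂ}, ContDiffOn ℝ 2 H siegelSet → ∀ q ∈ siegelSet,
      DifferentiableAt ℝ H q := fun hH q hq =>
    (hH.contDiffAt (isOpen_siegelSet.mem_nhds hq)).differentiableAt (by norm_num)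
  have d' : ∀ {H : ℂ × ℂ → ℂ}, ContDiffOn ℝ 2 H siegelSet → ∀ (e : ℂ × ℂ) (ε : ℂ),
      DifferentiableAt ℝ (wd e ε H) p := fun hH e ε =>
    ((contDiffOn_wd (m := 1) hH isOpen_siegelSet (by norm_num)).contDiffAt
      (isOpen_siegelSet.mem_nhds hp)).differentiableAt (by norm_num)
  have h1 : ∀ (e : ℂ × ℂ) (ε : ℂ), wd e ε (fun q => c * F q + G q) p =
      c * wd e ε F p + wd e ε G p := fun e ε => wd_mul_add c (d hF p hp) (d hG p hp)
  have h2 : ∀ (e f : ℂ × ℂ) (ε η : ℂ), wd f η (wd e ε fun q => c * F q + G q) p =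
      c * wd f η (wd e ε F) p + wd f η (wd e ε G) p := by
    intro e f ε η
    rw [← wd_mul_add c (d' hF e ε) (d' hG e ε)]
    refine wd_congr ?_
    filter_upwards [isOpen_siegelSet.mem_nhds hp] with q hq
    exact wd_mul_add c (d hF q hq) (d hG q hq)
  simp only [lapC, h1, h2]
  ring

theorem contDiffOn_mul_add (c : ℂ) (hu : ContDiffOn ℝ 2 (extendZero u) siegelSet)
    (hv : ContDiffOn ℝ 2 (extendZero v) siegelSet) :
    ContDiffOn ℝ 2 (extendZero fun Z => c * u Z + v Z) siegelSet :=
  contDiffOn_of_eq (F := fun p => c * extendZero u p + extendZero v p)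
    ((contDiffOn_const.mul hu).add hv) fun Z => by simp only [extendZero_apply]

theorem lapl_mul_add (c : ℂ) (hu : ContDiffOn ℝ 2 (extendZero u) siegelSet)
    (hv : ContDiffOn ℝ 2 (extendZero v) siegelSet) (Z : Siegel) :
    lapl n (fun Z => c * u Z + v Z) Z = c * lapl n u Z + lapl n v Z := by
  rw [lapl_eq_of_eq (F := fun q => c * extendZero u q + extendZero v q)
    fun Z => by simp only [extendZero_apply], lapC_mul_add n c hu hv Z.2, lapl_eq_lapC,
    lapl_eq_lapC]

theorem lapl_zero (Z : Siegel) : lapl n (fun _ => 0) Z = 0 := by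
  rw [lapl_eq_of_eq (F := fun _ => 0) fun _ => rfl]
  have h : ∀ (e : ℂ × ℂ) (ε : ℂ), wd e ε (fun _ : ℂ × ℂ => (0 : ℂ)) = fun _ => 0 :=
    fun e ε => funext fun p => wd_const 0
  simp [lapC, h]

theorem lapl_eq_zero_of_eventually {Z : Siegel} (h : ∀ᶠ W in 𝓝 Z, u W = 0) : lapl n u Z = 0 := by
  rw [← lapl_zero (n := n) Z, lapl_eq_lapC, lapl_eq_lapC]
  refine lapC_congr ?_
  have h1 : ∀ᶠ p in 𝓝 Z.1, ∀ hp : p ∈ siegelSet, u ⟨p, hp⟩ = 0 := by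
    rw [nhds_subtype_eq_comap, eventually_comap] at h
    filter_upwards [h] with p hp hpS
    exact hp ⟨p, hpS⟩ rfl
  filter_upwards [h1, isOpen_siegelSet.mem_nhds Z.2] with p hp hpS
  rw [extendZero_apply u ⟨p, hpS⟩, extendZero_apply (fun _ => 0) ⟨p, hpS⟩, hp hpS]

end Linearity

theorem four_mul_pi_sq_ne_zero : 4 * (Real.pi : ℂ) ^ 2 ≠ 0 :=
  mul_ne_zero (by norm_num) (pow_ne_zero 2 (by exact_mod_cast Real.pi_ne_zero))

section WeakEquation

open scoped ENNReal NNReal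

variable {n : ℤ} {s : ℂ} {Γ : Subgroup SU21} {D : Set Siegel}

theorem phi0_neg (s : ℂ) (n : ℤ) : phi0 s (-n) = phi0 s n := by
  have h : absWeight (-n) = absWeight n := by simp [absWeight]
  have h2 : phi s (-n) = phi s n := by
    funext σ
    simp only [phi, normConst, h]
  rw [phi0, phi0, h2]

theorem exists_norm_le_of_eq_zero {g : Siegel → ℂ} (hg : Continuous g) {Z₀ : Siegel} {R : ℝ}
    (hR : ∀ Z, R < sigma Z₀ Z → g Z = 0) : ∃ B, 0 ≤ B ∧ ∀ Z, ‖g Z‖ ≤ B := by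
  obtain ⟨B, hB⟩ := (isCompact_sigma_le Z₀ R).exists_bound_of_continuousOn hg.continuousOn
  refine ⟨max B 0, le_max_right _ _, fun Z => ?_⟩
  by_cases h : sigma Z₀ Z ≤ R
  · exact (hB Z h).trans (le_max_left _ _)
  · rw [hR Z (not_le.1 h), norm_zero]
    exact le_max_right _ _

variable [ProperlyDiscontinuousSMul Γ Siegel]
  [CompactSpace (Quotient (MulAction.orbitRel Γ Siegel))]

/-- The integrability needed to exchange the order of integration in the weak equation. -/
theorem integrable_ker_mul_mul (hD : IsFundamentalDomain Γ D dm) {h : ℝ → ℂ}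
    (hh : IsRadialKernel h) {f : Siegel → ℂ} (hf : IsL2Form n Γ D f) {ψ : Siegel → ℂ}
    (hψ : Continuous ψ) {Z₀ : Siegel} {R : ℝ} (hR : ∀ Z, R < sigma Z₀ Z → ψ Z = 0) :
    Integrable (fun p : Siegel × Siegel => ker n h p.1 p.2 * f p.2 * ψ p.1) (dm.prod dm) := by
  obtain ⟨B, hB0, hB⟩ := exists_norm_le_of_eq_zero hψ hR
  have hm0 := aestronglyMeasurable_ker_mul hD hh.measurable hf
  have hm : AEStronglyMeasurable (fun p : Siegel × Siegel => ker n h p.1 p.2 * f p.2 * ψ p.1)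
      (dm.prod dm) := hm0.mul (hψ.comp continuous_fst).aestronglyMeasurable
  have hΦ : AEMeasurable (fun Z => ∫⁻ W, ‖ker n h Z W * f W‖ₑ ∂dm) dm :=
    hm0.enorm.lintegral_prod_right'
  obtain ⟨N, hN⟩ := exists_setLIntegral_le hD R
  refine ⟨hm, ?_⟩
  rw [HasFiniteIntegral, lintegral_prod _ hm.enorm]
  have hS : MeasurableSet {Z : Siegel | sigma Z₀ Z ≤ R} :=
    measurableSet_le (continuous_sigma_right _).measurable measurable_const
  calc ∫⁻ Z, ∫⁻ W, ‖ker n h Z W * f W * ψ Z‖ₑ ∂dm ∂dm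
      ≤ ∫⁻ Z in {Z | sigma Z₀ Z ≤ R},
          ENNReal.ofReal B * ∫⁻ W, ‖ker n h Z W * f W‖ₑ ∂dm ∂dm := by
        rw [← lintegral_indicator hS]
        refine lintegral_mono fun Z => ?_
        by_cases hZ : sigma Z₀ Z ≤ R
        · rw [Set.indicator_of_mem (by exact hZ), ← lintegral_const_mul' _ _ ENNReal.ofReal_ne_top]
          refine lintegral_mono fun W => ?_
          rw [enorm_mul, mul_comm]
          refine mul_le_mul_left ?_ _
          rw [← ofReal_norm]
          exact ENNReal.ofReal_le_ofReal (hB Z)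
        · rw [hR Z (not_le.1 hZ)]
          simp
    _ = ENNReal.ofReal B * ∫⁻ Z in {Z | sigma Z₀ Z ≤ R},
          ∫⁻ W, ‖ker n h Z W * f W‖ₑ ∂dm ∂dm :=
        lintegral_const_mul' _ _ ENNReal.ofReal_ne_top
    _ ≤ ENNReal.ofReal B * (N * ∫⁻ Z in D, ∫⁻ W, ‖ker n h Z W * f W‖ₑ ∂dm ∂dm) :=
        mul_le_mul_right (hN Z₀ _ hΦ fun γ => Eventually.of_forall fun Z =>
          lintegral_enorm_ker_mul_smul hf h γ Z) _
    _ < ∞ := by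
        rw [lintegral_lintegral_ker_mul hD hh.measurable hf]
        refine ENNReal.mul_lt_top ENNReal.ofReal_lt_top (ENNReal.mul_lt_top (by simp) ?_)
        exact ENNReal.mul_lt_top hh.integrable.2 (hf.integrable_restrict hD).2

/-- Convolution with the Green function inverts `s(s-2) - Δ_k` in the weak sense: integrated against
`(s(s-2) - Δ_{-k}) g`, it has the same value as `4π² f` against `g`. -/
theorem integral_kint_phi0_mul (hD : IsFundamentalDomain Γ D dm) (hs : 2 < s.re)
    (hpole : ∀ j : ℕ, s ≠ absWeight n - j) {f : Siegel → ℂ} (hf : IsL2Form n Γ D f)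
    {g : Siegel → ℂ} (hg : ContDiffOn ℝ 2 (extendZero g) siegelSet) {Z₀ : Siegel} {R : ℝ}
    (hR : ∀ Z, R < sigma Z₀ Z → g Z = 0) :
    ∫ Z, kint n (phi0 s n) f Z * (s * (s - 2) * g Z - lapl (-n) g Z) ∂dm =
      4 * (Real.pi : ℂ) ^ 2 * ∫ Z, f Z * g Z ∂dm := by
  have hpole' : ∀ j : ℕ, s ≠ absWeight (-n) - j := by
    have h : absWeight (-n) = absWeight n := by simp [absWeight]
    rwa [h]
  have hcg := continuous_of_contDiffOn hg
  have hcl : Continuous (lapl (-n) g) := continuous_lapl hg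
  have hRl : ∀ Z, R < sigma Z₀ Z → lapl (-n) g Z = 0 := by
    intro Z hZ
    refine lapl_eq_zero_of_eventually ?_
    filter_upwards [(continuous_sigma_right Z₀).continuousAt.eventually_const_lt hZ] with W hW
    exact hR W hW
  set ψ : Siegel → ℂ := fun Z => s * (s - 2) * g Z - lapl (-n) g Z with hψ
  have hψc : Continuous ψ := (continuous_const.mul hcg).sub hcl
  have hψR : ∀ Z, R < sigma Z₀ Z → ψ Z = 0 := fun Z hZ => by
    rw [hψ]; dsimp only; rw [hR Z hZ, hRl Z hZ, mul_zero, sub_zero]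
  obtain ⟨B1, -, hB1⟩ := exists_norm_le_of_eq_zero hcg hR
  obtain ⟨B2, -, hB2⟩ := exists_norm_le_of_eq_zero hcl hRl
  have hK := isRadialKernel_phi0 hs hpole
  -- the identity for bounded functions, in weight `-n`: the kernel is read in its second variable
  have hinner : ∀ ξ, ∫ Z, ker n (phi0 s n) Z ξ * ψ Z ∂dm = 4 * (Real.pi : ℂ) ^ 2 * g ξ := by
    intro ξ
    rw [← kint_phi0_sub_lapl (n := -n) (B := max B1 B2) hs hpole' hg
      (fun Z => (hB1 Z).trans (le_max_left _ _)) (fun Z => (hB2 Z).trans (le_max_right _ _)) ξ,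
      kint, phi0_neg]
    refine integral_congr_ae (Eventually.of_forall fun Z => ?_)
    dsimp only
    rw [ker_swap]
  calc ∫ Z, kint n (phi0 s n) f Z * ψ Z ∂dm
      = ∫ Z, ∫ ξ, ker n (phi0 s n) Z ξ * f ξ * ψ Z ∂dm ∂dm := by
        refine integral_congr_ae (Eventually.of_forall fun Z => ?_)
        dsimp only
        rw [kint, ← integral_mul_const]
    _ = ∫ ξ, ∫ Z, ker n (phi0 s n) Z ξ * f ξ * ψ Z ∂dm ∂dm :=
        integral_integral_swap (f := fun Z ξ => ker n (phi0 s n) Z ξ * f ξ * ψ Z)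
          (integrable_ker_mul_mul hD hK hf hψc hψR)
    _ = ∫ ξ, 4 * (Real.pi : ℂ) ^ 2 * (f ξ * g ξ) ∂dm := by
        refine integral_congr_ae (Eventually.of_forall fun ξ => ?_)
        dsimp only
        have e : ∀ Z, ker n (phi0 s n) Z ξ * f ξ * ψ Z = f ξ * (ker n (phi0 s n) Z ξ * ψ Z) :=
          fun Z => by ring
        simp_rw [e]
        rw [integral_const_mul, hinner]
        ring
    _ = _ := integral_const_mul _ _

/-- If `f` is an eigenfunction of convolution with the Green function, then its convolutions with
smooth radial profiles are eigenfunctions of `Δ_k`. -/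
theorem lapl_kint_of_kint_phi0_eq (hD : IsFundamentalDomain Γ D dm) (hs : 2 < s.re)
    (hpole : ∀ j : ℕ, s ≠ absWeight n - j) {f : Siegel → ℂ} (hf : IsL2Form n Γ D f) {μ : ℂ}
    (hμ : ∀ᵐ Z ∂dm, (s * (s - 2) - μ) * kint n (phi0 s n) f Z = 4 * (Real.pi : ℂ) ^ 2 * f Z)
    {h : ℝ → ℂ} (hh : ContDiff ℝ 2 h) {R : ℝ} (hR : ∀ σ > R, h σ = 0) (Z : Siegel) :
    lapl n (kint n h f) Z = μ * kint n h f Z := by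
  have hloc := hf.locallyIntegrable hD
  rw [lapl_kint hh hR hloc]
  obtain ⟨hd1, hd2⟩ := hasDerivAt_of_contDiff hh
  have hgC : ContDiffOn ℝ 2 (kerC (-n) h Z.1) siegelSet := by
    have : ContDiffOn ℝ 2 (kerP (-n) h) (siegelSet ×ˢ siegelSet) := contDiffOn_kerP hh
    exact this.comp (f := fun q : ℂ × ℂ => (q, Z.1)) (contDiff_id.prodMk contDiff_const).contDiffOn
      fun q hq => ⟨hq, Z.2⟩
  have hgeq : ∀ ξ : Siegel, ker n h Z ξ = kerC (-n) h Z.1 ξ.1 := fun ξ => ker_swap n h Z ξ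
  have hg : ContDiffOn ℝ 2 (extendZero fun ξ => ker n h Z ξ) siegelSet := contDiffOn_of_eq hgC hgeq
  have hlap : ∀ ξ, lapl (-n) (fun ξ => ker n h Z ξ) ξ = ker n (radL n h) Z ξ := by
    intro ξ
    rw [lapl_eq_of_eq hgeq, lapC_kerC (-n) hd1 hd2 ξ.2 Z.2, ker_swap n (radL n h), ← radL_neg]
    rfl
  have hweak := integral_kint_phi0_mul hD hs hpole hf hg (Z₀ := Z) (R := R) fun ξ hξ => by
    rw [ker, hR _ hξ, mul_zero]
  simp only [hlap] at hweak
  have i1 := integrable_ker_mul (n := n) hh.continuous.continuousOn hR hloc Z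
  have i2 := integrable_ker_mul (n := n) (continuousOn_radL (n := n) hh)
    (radL_eq_zero_of_gt hR) hloc Z
  have e1 : (s * (s - 2) - μ) * ∫ ξ, kint n (phi0 s n) f ξ *
      (s * (s - 2) * ker n h Z ξ - ker n (radL n h) Z ξ) ∂dm =
      4 * (Real.pi : ℂ) ^ 2 * (s * (s - 2) * kint n h f Z - kint n (radL n h) f Z) := by
    rw [kint, kint, ← integral_const_mul, ← integral_const_mul,
      ← integral_sub (i1.const_mul _) i2, ← integral_const_mul]
    refine integral_congr_ae ?_
    filter_upwards [hμ] with ξ hξ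
    rw [← mul_assoc, hξ]
    ring
  have e2 : ∫ ξ, f ξ * ker n h Z ξ ∂dm = kint n h f Z := by
    rw [kint]
    simp_rw [mul_comm (f _)]
  have hpi := four_mul_pi_sq_ne_zero
  rw [hweak, e2, ← mul_assoc, mul_comm (s * (s - 2) - μ), mul_assoc] at e1
  have e3 := mul_left_cancel₀ hpi e1
  linear_combination e3

end WeakEquation

section Regularity

variable {n : ℤ} {s : ℂ} {Γ : Subgroup SU21} {D : Set Siegel}

/-- The classes in `L²(D)` of the `C²` eigenfunctions of `Δ_k` with eigenvalue `μ`. -/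
def smoothEigenspace (n : ℤ) (Γ : Subgroup SU21) (D : Set Siegel) (μ : ℂ) :
    Submodule ℂ (Lp ℂ 2 (dm.restrict D)) where
  carrier := {F | ∃ u, IsC2Form n Γ u ∧ (∀ Z, lapl n u Z = μ * u Z) ∧ F =ᵐ[dm.restrict D] u}
  zero_mem' := by
    refine ⟨fun _ => 0, ⟨?_, fun γ Z => (mul_zero _).symm⟩, fun Z => ?_, Lp.coeFn_zero _ _ _⟩
    · exact contDiffOn_of_eq (F := fun _ => 0) contDiffOn_const fun _ => rfl
    · rw [lapl_zero, mul_zero]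
  add_mem' := by
    rintro F G ⟨u, hu, hμ, hF⟩ ⟨v, hv, hμ', hG⟩
    refine ⟨fun Z => 1 * u Z + v Z, ⟨contDiffOn_mul_add 1 hu.1 hv.1, fun γ Z => ?_⟩,
      fun Z => ?_, ?_⟩
    · rw [hu.2, hv.2]; ring
    · rw [lapl_mul_add 1 hu.1 hv.1, hμ, hμ']; ring
    · filter_upwards [Lp.coeFn_add F G, hF, hG] with Z h1 h2 h3
      rw [h1, Pi.add_apply, h2, h3, one_mul]
  smul_mem' := by
    rintro c F ⟨u, hu, hμ, hF⟩
    have h0 : ContDiffOn ℝ 2 (extendZero fun _ => 0) siegelSet :=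
      contDiffOn_of_eq (F := fun _ => 0) contDiffOn_const fun _ => rfl
    refine ⟨fun Z => c * u Z + 0, ⟨contDiffOn_mul_add c hu.1 h0, fun γ Z => ?_⟩,
      fun Z => ?_, ?_⟩
    · rw [hu.2]; ring
    · rw [lapl_mul_add c hu.1 h0, hμ, lapl_zero]; ring
    · filter_upwards [Lp.coeFn_smul c F, hF] with Z h1 h2
      rw [h1, Pi.smul_apply, h2, smul_eq_mul, add_zero]

variable [ProperlyDiscontinuousSMul Γ Siegel]
  [CompactSpace (Quotient (MulAction.orbitRel Γ Siegel))]

/-- Smooth eigenfunctions of `Δ_k` lie in an eigenspace of a compact operator with nonzero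
eigenvalue. -/
theorem smoothEigenspace_le (hD : IsFundamentalDomain Γ D dm) (hs : 2 < s.re)
    (hpole : ∀ j : ℕ, s ≠ absWeight n - j) {μ : ℂ} (hμ : s * (s - 2) - μ ≠ 0) :
    smoothEigenspace n Γ D μ ≤ Module.End.eigenspace
      (autoOp hD n (isRadialKernel_phi0 hs hpole)).toLinearMap
      (4 * (Real.pi : ℂ) ^ 2 / (s * (s - 2) - μ)) := by
  rintro F ⟨u, hu, hlap, hF⟩
  have hu2 := hu.isL2Form hD
  have hFu : F = hu2.memLp.toLp u := Lp.ext (hF.trans hu2.memLp.coeFn_toLp.symm)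
  rw [Module.End.mem_eigenspace_iff]
  refine Lp.ext ?_
  rw [ContinuousLinearMap.coe_coe]
  filter_upwards [autoOp_toLp hD (isRadialKernel_phi0 hs hpole) hu2, hF,
    Lp.coeFn_smul (4 * (Real.pi : ℂ) ^ 2 / (s * (s - 2) - μ)) F] with Z h1 h2 h3
  rw [h3, Pi.smul_apply, h2, hFu, h1, smul_eq_mul, div_mul_eq_mul_div, eq_div_iff hμ, mul_comm]
  exact kint_phi0_of_lapl_eq hs hpole hu hlap Z

/-- Regularity: an eigenfunction of convolution with the Green function is the limit of its
convolutions with smooth radial profiles, which stay in a finite-dimensional space of smooth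
eigenfunctions. -/
theorem exists_isC2Form_of_kint_phi0_eq (hD : IsFundamentalDomain Γ D dm) (hs : 2 < s.re)
    (hpole : ∀ j : ℕ, s ≠ absWeight n - j) {f : Siegel → ℂ} (hf : IsL2Form n Γ D f) {μ : ℂ}
    (hc : s * (s - 2) - μ ≠ 0)
    (hμ : ∀ᵐ Z ∂dm, (s * (s - 2) - μ) * kint n (phi0 s n) f Z = 4 * (Real.pi : ℂ) ^ 2 * f Z) :
    ∃ u, u =ᵐ[dm] f ∧ IsC2Form n Γ u ∧ ∀ Z, lapl n u Z = μ * u Z := by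
  have hK : IsRadialKernel (phi0 s n) := isRadialKernel_phi0 hs hpole
  have hpi := four_mul_pi_sq_ne_zero
  have : FiniteDimensional ℂ (smoothEigenspace n Γ D μ) := by
    have h1 := ContinuousLinearMap.finite_dimensional_eigenspace
      (isCompactOperator_autoOp_phi0 (n := n) hD hs hpole)
      (4 * (Real.pi : ℂ) ^ 2 / (s * (s - 2) - μ)) (div_ne_zero hpi hc)
    exact Submodule.finiteDimensional_of_le (smoothEigenspace_le hD hs hpole hc)
  have hclosed : IsClosed (smoothEigenspace n Γ D μ : Set (Lp ℂ 2 (dm.restrict D))) :=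
    Submodule.closed_of_finiteDimensional _
  obtain ⟨h, hC, hR, hlim⟩ := exists_tendsto_phi0 hs hpole
  choose R hR using hR
  set F := hf.memLp.toLp f
  have hmem : ∀ j, autoOp hD n (isRadialKernel_of_contDiff (hC j) (hR j)) F ∈
      smoothEigenspace n Γ D μ := fun j =>
    ⟨kint n (h j) f, ⟨contDiffOn_kint (hC j) (hR j) (hf.locallyIntegrable hD), kint_smul hf (h j)⟩,
      lapl_kint_of_kint_phi0_eq hD hs hpole hf hμ (hC j) (hR j), autoOp_toLp hD _ hf⟩
  have htend : Tendsto (fun j => autoOp hD n (isRadialKernel_of_contDiff (hC j) (hR j)) F) atTop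
      (𝓝 (autoOp hD n hK F)) := by
    rw [tendsto_iff_norm_sub_tendsto_zero]
    refine squeeze_zero (fun _ => norm_nonneg _) (fun j => ?_)
      (by simpa using hlim.mul_const ‖F‖)
    rw [norm_sub_rev, ← _root_.sub_apply]
    refine (ContinuousLinearMap.le_opNorm _ _).trans ?_
    exact mul_le_mul_of_nonneg_right (norm_autoOp_sub_le hD n _ _) (norm_nonneg _)
  -- so convolution with the Green function itself maps `f` to a smooth eigenfunction, and it is a
  -- multiple of `f`
  obtain ⟨u, hu, hlap, hAu⟩ := hclosed.mem_of_tendsto htend (Eventually.of_forall hmem)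
  set c : ℂ := (s * (s - 2) - μ) / (4 * (Real.pi : ℂ) ^ 2) with hcdef
  have h0 : ContDiffOn ℝ 2 (extendZero fun _ => 0) siegelSet :=
    contDiffOn_of_eq (F := fun _ => 0) contDiffOn_const fun _ => rfl
  have hv : IsC2Form n Γ fun Z => c * u Z + 0 :=
    ⟨contDiffOn_mul_add c hu.1 h0, fun γ Z => by rw [hu.2]; ring⟩
  refine ⟨fun Z => c * u Z + 0, ?_, hv, fun Z => ?_⟩
  · refine (hv.isL2Form hD).ae_eq hD hf ?_
    filter_upwards [hAu, autoOp_toLp hD hK hf, ae_restrict_of_ae hμ] with Z h1 h2 h3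
    rw [← h1, h2, add_zero, hcdef, div_mul_eq_mul_div, h3, mul_div_cancel_left₀ _ hpi]
  · rw [lapl_mul_add c hu.1 h0, hlap, lapl_zero]
    ring

/-- A solution of the integral equation is an eigenfunction of `Δ_k`. -/
theorem IsGreenEigen.isDeltaEigen (hD : IsFundamentalDomain Γ D dm) (hs : 2 < s.re)
    (hpole : ∀ j : ℕ, s ≠ absWeight n - j) {μ : ℂ} {f : Siegel → ℂ}
    (hf : IsGreenEigen s n Γ D μ f) : IsDeltaEigen n Γ D μ f := by
  refine ⟨hf.isL2Form, hf.ne_zero, ?_⟩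
  -- if `μ = s(s - 2)`, then the integral equation forces `f = 0`
  refine exists_isC2Form_of_kint_phi0_eq hD hs hpole hf.isL2Form (fun h0 => hf.ne_zero ?_)
    (hf.kint_eq hD hs hpole)
  filter_upwards [hf.eigen] with Z hZ
  rw [hZ, h0]
  simp

end Regularity

end

section

/-! ### Completeness of the eigenfunctions -/

/-- A compact symmetric injective operator on an infinite-dimensional separable Hilbert space has an
orthonormal basis of eigenvectors indexed by `ℕ`. -/
theorem exists_hilbertBasis_eigenvectors {H : Type*} [NormedAddCommGroup H] [InnerProductSpace ℂ H]
    [CompleteSpace H] [TopologicalSpace.SeparableSpace H] (hinf : ¬ FiniteDimensional ℂ H)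
    {T : H →L[ℂ] H} (hT : IsCompactOperator T) (hsymm : (T : H →ₗ[ℂ] H).IsSymmetric)
    (hinj : ∀ x, T x = 0 → x = 0) :
    ∃ b : HilbertBasis ℕ ℂ H, ∀ i, ∃ τ : ℂ, τ ≠ 0 ∧ T (b i) = τ • b i := by
  let V : ℂ → Submodule ℂ H := fun μ => Module.End.eigenspace (T : H →ₗ[ℂ] H) μ
  have hV : ∀ {μ x}, x ∈ V μ → T x = μ • x := fun h => Module.End.mem_eigenspace_iff.1 h
  have hfd : ∀ μ, FiniteDimensional ℂ (V μ) := by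
    intro μ
    by_cases hμ : μ = 0
    · have h : V μ = ⊥ := by
        rw [eq_bot_iff]
        intro x hx
        have := hV hx
        rw [hμ, zero_smul] at this
        exact hinj x this
      rw [h]
      infer_instance
    · exact ContinuousLinearMap.finite_dimensional_eigenspace hT μ hμ
  let e : ∀ μ, OrthonormalBasis (Fin (Module.finrank ℂ (V μ))) ℂ (V μ) :=
    fun μ => stdOrthonormalBasis ℂ (V μ)
  let v : (Σ μ : ℂ, Fin (Module.finrank ℂ (V μ))) → H := fun a => (e a.1 a.2 : H)
  have hv : Orthonormal ℂ v :=
    hsymm.orthogonalFamily_eigenspaces.orthonormal_sigma_orthonormal fun μ => (e μ).orthonormal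
  have hspan : (Submodule.span ℂ (Set.range v))ᗮ = ⊥ := by
    rw [eq_bot_iff, ← ContinuousLinearMap.orthogonalComplement_iSup_eigenspaces_eq_bot hT hsymm]
    refine Submodule.orthogonal_le (iSup_le fun μ x hx => ?_)
    have h1 := congrArg Subtype.val ((e μ).sum_repr ⟨x, hx⟩)
    rw [show x = ((⟨x, hx⟩ : V μ) : H) from rfl, ← h1, Submodule.coe_sum]
    refine Submodule.sum_mem _ fun i _ => ?_
    exact Submodule.smul_mem _ _ (Submodule.subset_span ⟨⟨μ, i⟩, rfl⟩)
  -- an orthonormal family in a separable space is countable, its members being at distance `√2`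
  have hcount : Countable (Σ μ : ℂ, Fin (Module.finrank ℂ (V μ))) := by
    rw [← Set.countable_univ_iff]
    refine Set.PairwiseDisjoint.countable_of_isOpen (s := fun a => Metric.ball (v a) (1 / 2))
      (fun a _ b _ hab => ?_) (fun _ _ => Metric.isOpen_ball)
      fun a _ => ⟨v a, Metric.mem_ball_self (by norm_num)⟩
    refine Metric.ball_disjoint_ball ?_
    have h1 : ‖v a - v b‖ ^ 2 = 2 := by
      rw [@norm_sub_sq ℂ, hv.1 a, hv.1 b, hv.2 hab]
      norm_num
    rw [dist_eq_norm]
    nlinarith [norm_nonneg (v a - v b)]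
  have hinfinite : Infinite (Σ μ : ℂ, Fin (Module.finrank ℂ (V μ))) := by
    by_contra hfin
    rw [not_infinite_iff_finite] at hfin
    have : FiniteDimensional ℂ (Submodule.span ℂ (Set.range v)) :=
      FiniteDimensional.span_of_finite ℂ (Set.finite_range v)
    rw [Submodule.orthogonal_eq_bot_iff] at hspan
    exact hinf (Module.finite_def.2 (hspan ▸ Submodule.fg_span (Set.finite_range v)))
  obtain ⟨hden⟩ := nonempty_denumerable (Σ μ : ℂ, Fin (Module.finrank ℂ (V μ)))
  let φ := (Denumerable.eqv (Σ μ : ℂ, Fin (Module.finrank ℂ (V μ)))).symm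
  have hrange : Set.range (v ∘ φ) = Set.range v := φ.surjective.range_comp v
  refine ⟨HilbertBasis.mkOfOrthogonalEqBot (hv.comp φ φ.injective) (by rw [hrange, hspan]),
    fun i => ⟨(φ i).1, fun h0 => ?_, ?_⟩⟩
  · have h1 : T (v (φ i)) = (φ i).1 • v (φ i) := hV (e (φ i).1 (φ i).2).2
    rw [h0, zero_smul] at h1
    have h2 := hv.1 (φ i)
    rw [hinj _ h1, norm_zero] at h2
    exact zero_ne_one h2
  · rw [HilbertBasis.coe_mkOfOrthogonalEqBot]
    exact hV (e (φ i).1 (φ i).2).2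

section Completeness

open scoped ENNReal NNReal

variable {n : ℤ} {s : ℂ} {Γ : Subgroup SU21} {D : Set Siegel}

/-- A locally integrable function that is orthogonal to all `C²` functions of compact support
vanishes almost everywhere. -/
theorem ae_eq_zero_of_integral_mul_eq_zero {f : Siegel → ℂ} (hf : LocallyIntegrable f dm)
    (h : ∀ (g : Siegel → ℂ) (R : ℝ), ContDiffOn ℝ 2 (extendZero g) siegelSet →
      (∀ Z, R < sigma base Z → g Z = 0) → ∫ Z, f Z * g Z ∂dm = 0) : f =ᵐ[dm] 0 := by
  have hemb : MeasurableEmbedding (Subtype.val : Siegel → ℂ × ℂ) :=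
    MeasurableEmbedding.subtype_coe measurableSet_siegelSet
  have hK : ∀ K ⊆ siegelSet, IsCompact K → IsCompact (Subtype.val ⁻¹' K : Set Siegel) := by
    intro K hKS hK
    rw [Subtype.isCompact_iff, Subtype.image_preimage_coe, Set.inter_eq_right.2 hKS]
    exact hK
  have hloc : LocallyIntegrableOn (extendZero f) siegelSet (dm.map Subtype.val) := by
    rw [locallyIntegrableOn_iff isOpen_siegelSet.isLocallyClosed]
    intro K hKS hKc
    rw [hemb.integrableOn_map_iff]
    have e : extendZero f ∘ Subtype.val = f := funext fun Z => extendZero_apply f Z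
    rw [e]
    exact hf.integrableOn_isCompact (hK K hKS hKc)
  have key := isOpen_siegelSet.ae_eq_zero_of_integral_contDiff_smul_eq_zero hloc fun G hG hGc hGS => by
    rw [hemb.integral_map]
    obtain ⟨R, hR⟩ := exists_subset_sigma_le base (hK _ hGS hGc)
    have hC : ContDiffOn ℝ 2 (extendZero fun Z => ((G Z.1 : ℝ) : ℂ)) siegelSet :=
      contDiffOn_of_eq (F := fun p => ((G p : ℝ) : ℂ))
        (Complex.ofRealCLM.contDiff.comp (contDiff_infty.1 hG 2)).contDiffOn
        fun Z => rfl
    rw [← h (fun Z => ((G Z.1 : ℝ) : ℂ)) R hC fun Z hZ => ?_]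
    · refine integral_congr_ae (Eventually.of_forall fun Z => ?_)
      dsimp only
      rw [extendZero_apply, Complex.real_smul, mul_comm]
    · have : Z.1 ∉ tsupport G := fun hmem => absurd (hR Z hmem) (not_le.2 hZ)
      rw [image_eq_zero_of_notMem_tsupport this, Complex.ofReal_zero]
  rw [hemb.ae_map_iff] at key
  filter_upwards [key] with Z hZ
  rw [← extendZero_apply f Z]
  exact hZ Z.2

theorem dm_ne_zero : dm ≠ 0 := by
  intro h
  have h1 := map_sigma base
  rw [h, Measure.map_zero] at h1
  exact radial_Iic_ne_zero (by rw [← h1]; rfl)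

/-- Spheres have measure zero. -/
theorem ae_sigma_ne (Z : Siegel) (r : ℝ) : ∀ᵐ W ∂dm, sigma Z W ≠ r := by
  have h : ∀ᵐ σ ∂radial, σ ≠ r := by
    refine (withDensity_absolutelyContinuous _ _).ae_le ?_
    exact ae_restrict_of_ae (Measure.ae_ne volume r)
  exact (measurePreserving_sigma Z).quasiMeasurePreserving.ae (p := fun σ => σ ≠ r) h

variable [ProperlyDiscontinuousSMul Γ Siegel]
  [CompactSpace (Quotient (MulAction.orbitRel Γ Siegel))]

/-- `L²(D)` has infinite dimension, as polynomials in `1 / σ(Z₀, ·)` embed into it. -/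
theorem not_finiteDimensional_Lp (hD : IsFundamentalDomain Γ D dm) :
    ¬ FiniteDimensional ℂ (Lp ℂ 2 (dm.restrict D)) := by
  intro hfd
  have hcount := countable_of_properlyDiscontinuous Γ
  have : IsFiniteMeasure (dm.restrict D) :=
    isFiniteMeasure_restrict.2 (dm_fundamentalDomain_lt_top Γ hD).ne
  let t : Siegel → ℂ := fun Z => (((sigma base Z)⁻¹ : ℝ) : ℂ)
  have ht : Continuous t := Complex.continuous_ofReal.comp
    ((continuous_sigma_right base).inv₀ fun Z => (sigma_pos _ _).ne')
  have ht1 : ∀ Z, t Z ∈ Metric.closedBall (0 : ℂ) 1 := fun Z => by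
    rw [mem_closedBall_zero_iff, Complex.norm_real, norm_inv, Real.norm_of_nonneg (sigma_pos _ _).le]
    exact inv_le_one_of_one_le₀ (one_le_sigma _ _)
  have hmem : ∀ p : Polynomial ℂ, MemLp (fun Z => p.eval (t Z)) 2 (dm.restrict D) := by
    intro p
    obtain ⟨B, hB⟩ := (isCompact_closedBall (0 : ℂ) 1).exists_bound_of_continuousOn
      p.continuous.continuousOn
    exact MemLp.of_bound (p.continuous.comp ht).aestronglyMeasurable B
      (Eventually.of_forall fun Z => hB _ (ht1 Z))
  let L : Polynomial ℂ →ₗ[ℂ] Lp ℂ 2 (dm.restrict D) :=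
    { toFun := fun p => (hmem p).toLp _
      map_add' := fun p q => by
        rw [← MemLp.toLp_add]
        refine MemLp.toLp_congr _ _ (Eventually.of_forall fun Z => ?_)
        simp
      map_smul' := fun c p => by
        rw [RingHom.id_apply, ← MemLp.toLp_const_smul]
        refine MemLp.toLp_congr _ _ (Eventually.of_forall fun Z => ?_)
        simp }
  refine Polynomial.not_finite (Module.Finite.of_injective L ?_)
  rw [injective_iff_map_eq_zero]
  intro p hp
  by_contra hp0
  have h1 : (fun Z => p.eval (t Z)) =ᵐ[dm.restrict D] 0 :=
    (hmem p).coeFn_toLp.symm.trans ((Lp.eq_zero_iff_ae_eq_zero).1 hp)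
  have h2 : ∀ᵐ Z ∂dm, ∀ z ∈ p.rootSet ℂ, t Z ≠ z := by
    refine (ae_ball_iff (p.rootSet_finite ℂ).countable).2 fun z _ => ?_
    filter_upwards [ae_sigma_ne base z.re⁻¹] with Z hZ heq
    refine hZ ?_
    rw [← heq, Complex.ofReal_re, inv_inv]
  -- a nonzero polynomial has finitely many roots, and spheres have measure zero
  have h3 : ∀ᵐ Z ∂dm.restrict D, False := by
    filter_upwards [h1, ae_restrict_of_ae h2] with Z hZ1 hZ2
    refine hZ2 (t Z) ?_ rfl
    rw [Polynomial.mem_rootSet]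
    exact ⟨hp0, by simpa using hZ1⟩
  rw [eventually_false_iff_eq_bot, ae_eq_bot, Measure.restrict_eq_zero] at h3
  exact hD.measure_ne_zero dm_ne_zero h3

/-- A function in the kernel of convolution with the Green function vanishes, by the weak equation.
-/
theorem autoOp_phi0_injective (hD : IsFundamentalDomain Γ D dm) (hs : 2 < s.re)
    (hpole : ∀ j : ℕ, s ≠ absWeight n - j) (F : Lp ℂ 2 (dm.restrict D))
    (hF : autoOp hD n (isRadialKernel_phi0 hs hpole) F = 0) : F = 0 := by
  obtain ⟨f, hf, hfF⟩ := exists_isL2Form (n := n) hD (Lp.memLp F)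
  have hFf : F = hf.memLp.toLp f := Lp.ext (hfF.symm.trans hf.memLp.coeFn_toLp.symm)
  have h1 : ∀ᵐ Z ∂dm.restrict D, kint n (phi0 s n) f Z = 0 := by
    filter_upwards [autoOp_toLp hD (isRadialKernel_phi0 hs hpole) hf,
      (Lp.eq_zero_iff_ae_eq_zero).1 hF] with Z h2 h3
    rw [← h2, ← hFf, h3, Pi.zero_apply]
  have h2 : ∀ᵐ Z ∂dm, kint n (phi0 s n) f Z = 0 := by
    filter_upwards [ae_exists_smul hD h1] with Z hZ
    obtain ⟨γ, hγ⟩ := hZ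
    rw [kint_smul hf] at hγ
    exact (mul_eq_zero.1 hγ).resolve_left (zpow_ne_zero _ (unitFactor_ne_zero _ _))
  have h3 : f =ᵐ[dm] 0 := by
    refine ae_eq_zero_of_integral_mul_eq_zero (hf.locallyIntegrable hD) fun g R hg hR => ?_
    have h4 := integral_kint_phi0_mul hD hs hpole hf hg hR
    have h5 : ∫ Z, kint n (phi0 s n) f Z * (s * (s - 2) * g Z - lapl (-n) g Z) ∂dm = 0 := by
      refine integral_eq_zero_of_ae ?_
      filter_upwards [h2] with Z hZ
      rw [hZ, zero_mul, Pi.zero_apply]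
    rw [h5] at h4
    exact (mul_eq_zero.1 h4.symm).resolve_left four_mul_pi_sq_ne_zero
  exact (Lp.eq_zero_iff_ae_eq_zero).2 (hfF.symm.trans (ae_restrict_of_ae h3))

/-- The eigenfunctions of `Δ_k` are complete: they are the eigenfunctions of convolution with a real
Green function, a compact symmetric injective operator. -/
theorem exists_isCompleteOrthonormal (n : ℤ) (hD : IsFundamentalDomain Γ D dm) :
    ∃ (φ : ℕ → Siegel → ℂ) (μ : ℕ → ℂ), IsCompleteOrthonormal n Γ D φ ∧
      ∀ i, IsDeltaEigen n Γ D (μ i) (φ i) := by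
  -- an admissible real parameter, for which the kernel is Hermitian
  set s₀ : ℝ := |(n : ℝ)| / 2 + 3 with hs₀
  have hs : 2 < (s₀ : ℂ).re := by
    rw [Complex.ofReal_re, hs₀]
    linarith [abs_nonneg (n : ℝ)]
  have hpole : ∀ j : ℕ, (s₀ : ℂ) ≠ absWeight n - j := by
    intro j h
    have h1 := congrArg Complex.re h
    simp only [absWeight, Complex.ofReal_re, Complex.sub_re, Complex.natCast_re] at h1
    have : (0 : ℝ) ≤ j := j.cast_nonneg
    linarith
  have hreal : ∀ σ, (starRingEnd ℂ) (phi0 s₀ n σ) = phi0 s₀ n σ := by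
    intro σ
    by_cases hσ : 1 < σ
    · rw [phi0_eq hσ, conj_phi s₀ n hσ]
    · rw [phi0, Set.indicator_of_notMem (by exact hσ), map_zero]
  have hK : IsRadialKernel (phi0 (s₀ : ℂ) n) := isRadialKernel_phi0 hs hpole
  have : Fact ((2 : ℝ≥0∞) ≠ ∞) := ⟨by simp⟩
  obtain ⟨b, hb⟩ := exists_hilbertBasis_eigenvectors (not_finiteDimensional_Lp hD)
    (isCompactOperator_autoOp_phi0 (n := n) hD hs hpole) (isSymmetric_autoOp hD n hK hreal)
    (autoOp_phi0_injective hD hs hpole)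
  choose τ hτ0 hτ using hb
  choose φ hφ hφb using fun i => exists_isL2Form (n := n) hD (Lp.memLp (b i))
  have hbφ : ∀ i, b i = (hφ i).memLp.toLp (φ i) := fun i =>
    Lp.ext ((hφb i).symm.trans (hφ i).memLp.coeFn_toLp.symm)
  have hinner : ∀ (F : Lp ℂ 2 (dm.restrict D)) (f : Siegel → ℂ) (i : ℕ), F =ᵐ[dm.restrict D] f →
      inner ℂ (b i) F = l2Inner D f (φ i) := by
    intro F f i hF
    rw [L2.inner_def, l2Inner]
    refine integral_congr_ae ?_
    filter_upwards [hF, hφb i] with Z h1 h2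
    rw [h1, h2, RCLike.inner_apply]
  refine ⟨φ, fun i => s₀ * (s₀ - 2) - 4 * (Real.pi : ℂ) ^ 2 / τ i, ⟨hφ, fun i j => ?_,
    fun f hf => ?_⟩, fun i => ⟨hφ i, fun h0 => ?_, ?_⟩⟩
  · rw [← hinner (b i) (φ i) j (hφb i).symm, orthonormal_iff_ite.1 b.orthonormal]
    simp only [eq_comm]
  · set F := hf.memLp.toLp f with hF
    have hFf : F =ᵐ[dm.restrict D] f := hf.memLp.coeFn_toLp
    have h1 := (b.hasSum_repr F).tendsto_sum_nat
    rw [tendsto_iff_norm_sub_tendsto_zero] at h1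
    have h2 := ENNReal.tendsto_ofReal h1
    rw [ENNReal.ofReal_zero] at h2
    refine h2.congr fun N => ?_
    rw [norm_sub_rev, ofReal_norm, Lp.enorm_def]
    refine eLpNorm_congr_ae ?_
    have h3 : ∀ᵐ Z ∂dm.restrict D, ∀ i, φ i Z = b i Z := ae_all_iff.2 hφb
    have h4 : ((∑ i ∈ Finset.range N, b.repr F i • b i : Lp ℂ 2 (dm.restrict D)) : Siegel → ℂ)
        =ᵐ[dm.restrict D] fun Z => ∑ i ∈ Finset.range N, l2Inner D f (φ i) * φ i Z := by
      have h5 : ∀ᵐ Z ∂dm.restrict D, ∀ i, (b.repr F i • b i : Lp ℂ 2 (dm.restrict D)) Z =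
          b.repr F i * b i Z := ae_all_iff.2 fun i => by
        filter_upwards [Lp.coeFn_smul (b.repr F i) (b i)] with Z hZ
        rw [hZ, Pi.smul_apply, smul_eq_mul]
      filter_upwards [Lp.coeFn_fun_finsetSum (Finset.range N)
        (fun i => (b.repr F i • b i : Lp ℂ 2 (dm.restrict D))), h3, h5] with Z h6 h7 h8
      rw [h6]
      refine Finset.sum_congr rfl fun i _ => ?_
      rw [h8, h7, b.repr_apply_apply, hinner F f i hFf]
    filter_upwards [Lp.coeFn_sub F (∑ i ∈ Finset.range N, b.repr F i • b i), hFf, h4]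
      with Z h5 h6 h7
    rw [h5, Pi.sub_apply, h6, h7]
  · have h1 : b i = 0 :=
      (Lp.eq_zero_iff_ae_eq_zero).2 ((hφb i).symm.trans (ae_restrict_of_ae h0))
    have h2 := b.orthonormal.1 i
    rw [h1, norm_zero] at h2
    exact zero_ne_one h2
  · have hc : (s₀ : ℂ) * (s₀ - 2) - (s₀ * (s₀ - 2) - 4 * (Real.pi : ℂ) ^ 2 / τ i) =
        4 * (Real.pi : ℂ) ^ 2 / τ i := by ring
    refine exists_isC2Form_of_kint_phi0_eq hD hs hpole (hφ i) ?_ ?_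
    · rw [hc]
      exact div_ne_zero four_mul_pi_sq_ne_zero (hτ0 i)
    have h1 : ∀ᵐ Z ∂dm.restrict D, kint n (phi0 s₀ n) (φ i) Z = τ i * φ i Z := by
      have h2 := hτ i
      filter_upwards [autoOp_toLp hD hK (hφ i), Lp.coeFn_smul (τ i) (b i), hφb i] with Z h3 h4 h5
      rw [← h3, ← hbφ, h2, h4, Pi.smul_apply, smul_eq_mul, h5]
    filter_upwards [ae_exists_smul hD h1, (hφ i).ae_automorphic] with Z h2 h3
    obtain ⟨γ, hγ⟩ := h2
    rw [kint_smul (hφ i), h3, mul_left_comm] at hγ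
    rw [hc, mul_left_cancel₀ (zpow_ne_zero _ (unitFactor_ne_zero _ _)) hγ, ← mul_assoc,
      div_mul_cancel₀ _ (hτ0 i)]

end Completeness

end

end PicardSU21

end

theorem theorem2p14 (n : ℤ) (Γ : Subgroup SU21) [DiscreteTopology Γ]
    [ProperlyDiscontinuousSMul Γ Siegel]
    [CompactSpace (Quotient (MulAction.orbitRel Γ Siegel))]
    (hfree : ∀ (γ : Γ) (Z : Siegel), γ • Z = Z → γ = 1)
    (D : Set Siegel) (hD : IsFundamentalDomain Γ D dm)
    (s : ℂ) (hs : 2 < s.re) (hpole : ∀ j : ℕ, s ≠ absWeight n - j) :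
    (∀ Z W : Siegel, (∀ γ : Γ, γ • W ≠ Z) → Summable (greenTerm s n Γ Z W)) ∧
    (∀ (μ : ℂ) (f : Siegel → ℂ), IsDeltaEigen n Γ D μ f ↔ IsGreenEigen s n Γ D μ f) ∧
    ∃ (φ : ℕ → Siegel → ℂ) (μ : ℕ → ℂ), IsCompleteOrthonormal n Γ D φ ∧
      ∀ i, IsDeltaEigen n Γ D (μ i) (φ i) ∧ IsGreenEigen s n Γ D (μ i) (φ i) := by
  refine ⟨fun Z W => summable_greenTerm hs hpole, fun μ f =>
    ⟨fun h => h.isGreenEigen hD hs hpole, fun h => h.isDeltaEigen hD hs hpole⟩, ?_⟩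
  obtain ⟨φ, μ, hφ, hμ⟩ := exists_isCompleteOrthonormal n hD
  exact ⟨φ, μ, hφ, fun i => ⟨hμ i, (hμ i).isGreenEigen hD hs hpole⟩⟩
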